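/- **Setting.** Fix an integer $a\ge 1$ and put $M=4(a+5)$. Let $\{Y_{x,i}: x\in\mathbb Z,\ 1\le i\le a\}$ be independent continuous-time symmetric nearest-neighbour random walks on $\mathbb Z$ of total jump rate $2$, with $Y_{x,i}(0)=x$. *Labelled process.* A labelled configuration is a triple $w=(r,\mathcal I,\mathcal Z)$ with $r\in\mathbb Z$, a set of labels $\mathcal I\subset\{(x,i):x\le r,\ 1\le i\le a\}$ and positions $\mathcal Z(x,i)\le r$ for $(x,i)\in\mathcal I$. For $\theta>0$, $\tilde{\mathbb S}_\theta$ is the set of those with $\sum_{(x,i)\in\mathcal I}e^{\theta(\mathcal Z(x,i)-r)}<\infty$ and $\max_{(x,i)\in\mathcal I}x=r$. Started from $w\in\tilde{\mathbb S}_\theta$, the particle with initial label $(x,i)$ has position $Z_{x,i}(t)=Y_{x,i}(t)+\mathcal Z(x,i)-x$. The first time $T_{r+k}$ ($k\ge1$) at which a particle present hits $r+k$, $a$ new particles with labels $(r+k,1),\dots,(r+k,a)$ are added at $r+k$, with positions $Z_{r+k,i}(t)=Y_{r+k,i}(t-T_{r+k})$ for $t\ge T_{r+k}$. Put $T_y=0$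 for $y\le r$. The front is $r_t=\max\{y\ge r:T_y\le t\}$ (so $r_0=r$), $\mathcal I(t)$ is the set of labels present at time $t$, and $\mathbb P_w$ is the law of the process. The configuration $a\delta_0$ has $r=0$ and exactly $a$ particles, with labels $(0,1),\dots,(0,a)$, all at $0$. *Auxiliary process.* For $r\in\mathbb Z$ let $\nu_0=0$ and, for $k\ge1$, let $\nu_k$ be the first time that one of the walks $Y_{z,i}$ with $\max(r,r+k-M)\le z\le r+k-1$, $1\le i\le a$, hits $r+k$. Let $\tilde r^r_t=r+n$ if $\sum_{k=0}^n\nu_k\le t<\sum_{k=0}^{n+1}\nu_k$. *Counts and norms.* For integers $z_1<z_2$ and $z$ let $$m_{z_1,z_2}(t)=\#\{(x,i)\in\mathcal I(t):\ z_1<x\le z_2,\ z_1<Z_{x,i}(t)\le z_2\},\qquad \phi_z(t)=\sum_{(x,i)\in\mathcal I(t),\,x\le z}e^{\theta(Z_{x,i}(t)-r_t)} .$$ *Regeneration time.* Let $L\in\mathbb N$, $L\ge 1$, and $\theta,\alpha_1,\alpha_2,p\in\mathbb R$. For $s\ge0$ (infima over $t\ge0$, $\inf\emptyset=\infty$) put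 $$U_s=\inf\{t:\ \tilde r^{\,r_s}_t-r_s<\lfloor\alpha_2t\rfloor\},\qquad V_s=\inf\{t:\ \max_{(z,i)\in\mathcal I(s+t),\ r_s-L<z<r_s}Z_{z,i}(s+t)>\lfloor\alpha_1t\rfloor+r_s\},$$ $$W_s=\inf\{t:\ \phi_{r_s-L}(s+t)\ge e^{\theta(\lfloor\alpha_1t\rfloor-(r_{s+t}-r_s))}\},\qquad \mathbf D_s=\min\{U_s,V_s,W_s\},\qquad U=U_0 .$$ For $x\ge r$ let $J_x$ be the least $j\ge1$ with $T_{x+jL}<\infty$, $\phi_{x+(j-1)L}(T_{x+jL})\le p$ and $m_{x+(j-1)L,\,x+jL}(T_{x+jL})\ge aL/2$ ($J_x=\infty$ if there is none; $T_{x+J_xL}=\infty$ if $J_x=\infty$). Put $R_0=r$ and, for $k\ge0$, $S_{k+1}=T_{R_k+J_{R_k}L}$, $D_{k+1}=S_{k+1}+\mathbf D_{S_{k+1}}$, $R_{k+1}=r_{D_{k+1}}$; if $S_{k+1}=\infty$ then $D_{k+1}=\infty$, and if $D_{k+1}=\infty$ then $S_{k+2}=\infty$. Let $K$ be the least $k\ge1$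 with $S_k<\infty$ and $D_k=\infty$; the regeneration time is $\kappa=S_K$, and $\kappa=\infty$ if there is no such $k$. **Statement.** There is a constant $\alpha\in(0,\infty)$ such that, for every $r\in\mathbb Z$, $\lim_{t\to\infty}\tilde r^r_t/t=\alpha$ almost surely. Let $\theta,\alpha_1,\alpha_2,p$ be real numbers with $$0<2\sinh 2\theta<\alpha_1<\alpha_2<\alpha,\qquad 0<pe^\theta<1 .$$ Then there is an integer $L_0$ such that for every integer $L\ge L_0$ with $aL\ge M$ and $(a-1)e^{-L\theta}<p$ the following hold. 1. For every $w\in\tilde{\mathbb S}_\theta$ with at least one particle at the rightmost visited site $r$, $\ \kappa<\infty$ $\ \mathbb P_w$-almost surely. 2. $\mathbb P_{a\delta_0}[U=\infty]>0$, and $$\mathbb E_{a\delta_0}[\kappa^2\mid U=\infty]<\infty,\qquad \mathbb E_{a\delta_0}[r_\kappa^2\mid U=\infty]<\infty .$$ 3. For every $\epsilon>0$ there is a constant $0<C<\infty$ such that for all $t\ge1$ $$\mathbb P_{a\delta_0}[\kappa>t\mid U=\infty]\le C\,t^{-(M/4-3-\epsilon)} .$$ -/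

import Mathlib

open MeasureTheory ProbabilityTheory Filter Topology
open scoped NNReal ENNReal

noncomputable section

namespace Combustion

/-! ### The driving random walks -/

/-- `X` is, under `P`, a continuous-time symmetric nearest-neighbour random walk on `ℤ` of total
jump rate `2` started at `x`: a process with independent increments whose increment over a time
interval of length `h` is the difference of two independent Poisson variables of mean `h` (jumps
`+1` and `-1`, each at rate `1`), with right-continuous step paths whose jumps have size one. -/
structure IsRateTwoWalk {Ω : Type*} [MeasurableSpace Ω] (P : Measure Ω) (x : ℤ)
    (X : ℝ≥0 → Ω → ℤ) : Prop where
  measurable : ∀ t, Measurable (X t)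
  start : ∀ ω, X 0 ω = x
  right_cont : ∀ ω t, ∀ᶠ s in 𝓝[>] t, X s ω = X t ω
  left_lim : ∀ ω t, 0 < t → ∃ n : ℤ, |X t ω - n| ≤ 1 ∧ ∀ᶠ s in 𝓝[<] t, X s ω = n
  indep_increments : HasIndepIncrements X P
  increment_law : ∀ s h : ℝ≥0, P.map (fun ω => X (s + h) ω - X s ω) =
    ((poissonMeasure h).prod (poissonMeasure h)).map (fun q : ℕ × ℕ => (q.1 : ℤ) - (q.2 : ℤ))

/-- The family of driving walks: for every site `x` and every `i` among `a` indices, a rate two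
walk started at `x`, all of them independent. -/
structure IsWalkFamily {Ω : Type*} [MeasurableSpace Ω] (P : Measure Ω) {a : ℕ}
    (Y : ℤ × Fin a → ℝ≥0 → Ω → ℤ) : Prop where
  walk : ∀ l, IsRateTwoWalk P l.1 (Y l)
  indep : iIndepFun (fun l (ω : Ω) (t : ℝ≥0) => Y l t ω) P

/-- One realization of the driving walks. -/
abbrev Paths (a : ℕ) := ℤ × Fin a → ℝ≥0 → ℤ

/-- The realization of the driving walks at the sample point `ω`. -/
def sample {Ω : Type*} {a : ℕ} (Y : ℤ × Fin a → ℝ≥0 → Ω → ℤ) (ω : Ω) : Paths a :=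
  fun l t => Y l t ω

/-- The first time at which the path `f` is at `y` (`∞` if it never is). -/
def hit (f : ℝ≥0 → ℤ) (y : ℤ) : ℝ≥0∞ := ⨅ (t : ℝ≥0) (_ : f t = y), (t : ℝ≥0∞)

/-! ### The auxiliary process -/

/-- The constant `M = 4 (a + 5)`. -/
def bigM (a : ℕ) : ℕ := 4 * (a + 5)

/-- `ν_k` for the starting site `r`: `ν_0 = 0`, and for `k ≥ 1` the first time one of the walks
`Y_{z,i}`, `max r (r + k - M) ≤ z ≤ r + k - 1`, hits `r + k`. -/
def nu {a : ℕ} (y : Paths a) (r : ℤ) (k : ℕ) : ℝ≥0∞ :=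
  if k = 0 then 0 else
    ⨅ (l : ℤ × Fin a) (_ : max r (r + k - bigM a) ≤ l.1 ∧ l.1 ≤ r + k - 1), hit (y l) (r + k)

/-- The auxiliary front at time `t`: `r + n` if `ν_0 + ⋯ + ν_n ≤ t < ν_0 + ⋯ + ν_{n+1}`. -/
def auxFront {a : ℕ} (y : Paths a) (r : ℤ) (t : ℝ≥0) : ℤ :=
  r + (sSup {n : ℕ | ∑ k ∈ Finset.range (n + 1), nu y r k ≤ t} : ℕ)

/-! ### Labelled configurations -/

/-- A triple (rightmost visited site, set of labels, positions). The label `(x, i)` records the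
birthplace `x` of a particle; `pos` only matters on `labels`. -/
structure Config (a : ℕ) where
  r : ℤ
  labels : Set (ℤ × Fin a)
  pos : ℤ × Fin a → ℤ
  label_le : ∀ l ∈ labels, l.1 ≤ r
  pos_le : ∀ l ∈ labels, pos l ≤ r

namespace Config

/-- The state space of the labelled process: the exponentially weighted number of particles is
finite and the largest birthplace is `r`. -/
def Admissible {a : ℕ} (θ : ℝ) (w : Config a) : Prop :=
  (∑' l : w.labels, ENNReal.ofReal (Real.exp (θ * ((w.pos l - w.r : ℤ) : ℝ)))) < ∞ ∧
    ∃ l ∈ w.labels, l.1 = w.r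

/-- The initial condition `a δ_0`: rightmost visited site `0`, and `a` particles at `0`, with
labels `(0, i)`, and none elsewhere. -/
def aDeltaZero (a : ℕ) : Config a where
  r := 0
  labels := {l | l.1 = 0}
  pos := fun _ => 0
  label_le := fun _ hl => le_of_eq hl
  pos_le := fun _ _ => le_rfl

/-! ### The labelled process -/

/-- `w.passage y k` is the time at which the front reaches `w.r + k`: the first time one of the
particles present before hits `w.r + k`. The particle with an initial label `(x, i)` moves as
`Y_{x,i}(t) + pos - x`, and the `a` particles born at `w.r + j` move as `Y_{w.r + j, i}`, started
at the time the front reaches `w.r + j`. -/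
def passage {a : ℕ} (w : Config a) (y : Paths a) : ℕ → ℝ≥0∞
  | 0 => 0
  | k + 1 =>
    (⨅ l ∈ w.labels, hit (fun t => y l t + w.pos l - l.1) (w.r + (k + 1 : ℕ))) ⊓
      (⨅ (j : Fin k) (i : Fin a), passage w y (j.1 + 1) +
        hit (y (w.r + (j.1 + 1 : ℕ), i)) (w.r + (k + 1 : ℕ)))
  termination_by k => k
  decreasing_by omega

/-- Erase the particles that are not within distance `n` of `w.r`. -/
def truncate {a : ℕ} (w : Config a) (n : ℕ) : Config a where
  r := w.r
  labels := {l | l ∈ w.labels ∧ w.r - n < w.pos l}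
  pos := w.pos
  label_le := fun l hl => w.label_le l hl.1
  pos_le := fun l hl => w.pos_le l hl.1

/-- The process of an infinite initial condition is the limit of the processes of its
truncations. -/
theorem passage_eq_iInf_truncate {a : ℕ} (w : Config a) (y : Paths a) (k : ℕ) :
    w.passage y k = ⨅ n : ℕ, (w.truncate n).passage y k := by
  induction k using Nat.strong_induction_on with
  | _ k ih =>
    cases k with
    | zero => simp [passage]
    | succ k =>
      have h : ∀ n : ℕ, (w.truncate n).passage y (k + 1) = _ := fun n => by rw [passage]
      rw [passage, iInf_congr h, iInf_inf_eq]
      congr 1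
      · apply le_antisymm
        · refine le_iInf fun n => le_iInf₂ fun l hl => ?_
          exact iInf₂_le l hl.1
        · refine le_iInf₂ fun l hl => ?_
          refine iInf_le_of_le (w.r - w.pos l + 1).toNat (iInf₂_le_of_le l ⟨hl, ?_⟩ le_rfl)
          have := w.pos_le l hl
          omega
      · refine Eq.trans ?_ iInf_comm
        refine iInf_congr fun j => ?_
        refine Eq.trans ?_ iInf_comm
        refine iInf_congr fun i => ?_
        rw [ih (j.1 + 1) (by omega), ENNReal.iInf_add]
        rfl

/-- `T_z`, the first time the front is at or beyond the site `z`. -/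
def T {a : ℕ} (w : Config a) (y : Paths a) (z : ℤ) : ℝ≥0∞ := w.passage y (z - w.r).toNat

/-- `r_t`, the front (rightmost visited site) at time `t`. -/
def front {a : ℕ} (w : Config a) (y : Paths a) (t : ℝ≥0) : ℤ :=
  w.r + (sSup {k : ℕ | w.passage y k ≤ t} : ℕ)

/-- The labels of the particles present at time `t`. -/
def labelsAt {a : ℕ} (w : Config a) (y : Paths a) (t : ℝ≥0) : Set (ℤ × Fin a) :=
  {l | l ∈ w.labels ∨ (w.r < l.1 ∧ w.T y l.1 ≤ t)}

/-- `Z_l(t)`, the position at time `t` of the particle labelled `l`. -/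
def posAt {a : ℕ} (w : Config a) (y : Paths a) (l : ℤ × Fin a) (t : ℝ≥0) : ℤ :=
  if l.1 ≤ w.r then y l t + w.pos l - l.1 else y l (t - (w.T y l.1).toNNReal)

/-- `m_{z₁,z₂}(t)`, the number of particles born in `(z₁, z₂]` that are in `(z₁, z₂]` at
time `t`. -/
def blockCount {a : ℕ} (w : Config a) (y : Paths a) (z₁ z₂ : ℤ) (t : ℝ≥0) : ℕ :=
  {l ∈ w.labelsAt y t | l.1 ∈ Set.Ioc z₁ z₂ ∧ w.posAt y l t ∈ Set.Ioc z₁ z₂}.ncard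

/-- `φ_z(t)`, the exponential density norm of the particles born at or to the left of `z`. -/
def expNorm {a : ℕ} (w : Config a) (y : Paths a) (θ : ℝ) (z : ℤ) (t : ℝ≥0) : ℝ≥0∞ :=
  ∑' l : {l : ℤ × Fin a // l ∈ w.labelsAt y t ∧ l.1 ≤ z},
    ENNReal.ofReal (Real.exp (θ * ((w.posAt y l t - w.front y t : ℤ) : ℝ)))

end Config

/-! ### The renewal structure -/

/-- The parameters of the renewal structure. -/
structure Params where
  L : ℕ
  θ : ℝ
  α₁ : ℝ
  α₂ : ℝ
  p : ℝ

/-- `U` for the starting site `r`. -/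
def timeU {a : ℕ} (c : Params) (y : Paths a) (r : ℤ) : ℝ≥0∞ :=
  ⨅ (t : ℝ≥0) (_ : auxFront y r t - r < ⌊c.α₂ * t⌋), (t : ℝ≥0∞)

/-- `V ∘ θ_s`. -/
def timeV {a : ℕ} (c : Params) (w : Config a) (y : Paths a) (s : ℝ≥0) : ℝ≥0∞ :=
  ⨅ (t : ℝ≥0) (_ : ∃ l ∈ w.labelsAt y (s + t), w.front y s - c.L < l.1 ∧ l.1 < w.front y s ∧
    ⌊c.α₁ * t⌋ + w.front y s < w.posAt y l (s + t)), (t : ℝ≥0∞)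

/-- `W ∘ θ_s`. -/
def timeW {a : ℕ} (c : Params) (w : Config a) (y : Paths a) (s : ℝ≥0) : ℝ≥0∞ :=
  ⨅ (t : ℝ≥0) (_ : ENNReal.ofReal
      (Real.exp (c.θ * ((⌊c.α₁ * t⌋ - (w.front y (s + t) - w.front y s) : ℤ) : ℝ))) ≤
    w.expNorm y c.θ (w.front y s - c.L) (s + t)), (t : ℝ≥0∞)

/-- `D ∘ θ_s = min (U ∘ θ_s, V ∘ θ_s, W ∘ θ_s)`. It is used at times `s` when the front has just
reached `r_s`, so that the walks `Y_{z,i}`, `z ≥ r_s`, start from time `s` on. -/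
def timeD {a : ℕ} (c : Params) (w : Config a) (y : Paths a) (s : ℝ≥0) : ℝ≥0∞ :=
  min (timeU c y (w.front y s)) (min (timeV c w y s) (timeW c w y s))

/-- The condition on `j` in the definition of `J_x`. -/
def GoodBlock {a : ℕ} (c : Params) (w : Config a) (y : Paths a) (x : ℤ) (j : ℕ) : Prop :=
  w.T y (x + j * c.L) < ∞ ∧
  w.expNorm y c.θ (x + (j - 1) * c.L) (w.T y (x + j * c.L)).toNNReal ≤ ENNReal.ofReal c.p ∧
  (a : ℝ) * c.L / 2 ≤
    w.blockCount y (x + (j - 1) * c.L) (x + j * c.L) (w.T y (x + j * c.L)).toNNReal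

/-- `J_x`. -/
def blockIndex {a : ℕ} (c : Params) (w : Config a) (y : Paths a) (x : ℤ) : ℕ∞ :=
  ⨅ (j : ℕ) (_ : 1 ≤ j ∧ GoodBlock c w y x j), (j : ℕ∞)

open Classical in
/-- `T_{x + J_x L}`, and `∞` if `J_x = ∞`. -/
def blockTime {a : ℕ} (c : Params) (w : Config a) (y : Paths a) (x : ℤ) : ℝ≥0∞ :=
  if blockIndex c w y x = ⊤ then ∞ else w.T y (x + (blockIndex c w y x).toNat * c.L)

open Classical in
/-- `s + D ∘ θ_s`, and `∞` if `s = ∞`. -/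
def breakTime {a : ℕ} (c : Params) (w : Config a) (y : Paths a) (s : ℝ≥0∞) : ℝ≥0∞ :=
  if s = ∞ then ∞ else s + timeD c w y s.toNNReal

open Classical in
/-- The times `S_k`: `S_0 = 0`, `S_1 = T_{r + J_r L}`, and `S_{k+1} = T_{R_k + J_{R_k} L}`, where
`R_k` is the front at time `D_k = S_k + D ∘ θ_{S_k}`; `S_{k+1} = ∞` if `D_k = ∞`. -/
def timeS {a : ℕ} (c : Params) (w : Config a) (y : Paths a) : ℕ → ℝ≥0∞
  | 0 => 0
  | 1 => blockTime c w y w.r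
  | k + 2 =>
    if breakTime c w y (timeS c w y (k + 1)) = ∞ then ∞
    else blockTime c w y (w.front y (breakTime c w y (timeS c w y (k + 1))).toNNReal)

/-- The indices `k ≥ 1` with `S_k < ∞` and `D_k = ∞`. -/
def regenIndices {a : ℕ} (c : Params) (w : Config a) (y : Paths a) : Set ℕ :=
  {k | 1 ≤ k ∧ timeS c w y k < ∞ ∧ breakTime c w y (timeS c w y k) = ∞}

open Classical in
/-- The regeneration time `κ = S_K`, where `K` is the first `k ≥ 1` with `S_k < ∞` and
`D_k = ∞`; `κ = ∞` if there is none. -/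
def kappa {a : ℕ} (c : Params) (w : Config a) (y : Paths a) : ℝ≥0∞ :=
  if (regenIndices c w y).Nonempty then timeS c w y (sInf (regenIndices c w y)) else ∞

/-- `r_κ`, the front at the regeneration time (relevant for `κ < ∞`). -/
def frontKappa {a : ℕ} (c : Params) (w : Config a) (y : Paths a) : ℤ :=
  w.front y (kappa c w y).toNNReal

/-- The event `{U = ∞}` for the initial condition `a δ_0`. -/
def eventU {Ω : Type*} {a : ℕ} (c : Params) (Y : ℤ × Fin a → ℝ≥0 → Ω → ℤ) : Set Ω :=
  {ω | timeU c (sample Y ω) 0 = ∞}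

end Combustion

end

open MeasureTheory ProbabilityTheory Filter Topology
open scoped NNReal ENNReal

noncomputable section

namespace Combustion

/-! ### Tools: step paths, independent walks, stopping and restarting, moments -/

section
/-! ### Step paths and the dyadic grid -/

/-! The walks are recentred and read as one random element of a space of step paths, and the process
is described site by site. The passage time `tau w v` of the front at `v` gives every label an age
at that passage. These ages are stopping times, one clock for each label, so the walks restarted at
a passage are independent walks with the original law, independent of what was seen before
(`IsMeshFamily.strongMarkov`, `IsStopping.measure_inter_le`). Whether a trial breaks is a question
about a real time, so such events are projections of measurable sets. They are universally
measurable because analytic sets are, and this is enough for conditioning.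

Speed. A walk fails to reach a given level within time `n` with probability of order `n ^ (-1/2)`
(`persistence`, `hit_tail`). At a full window many independent walks wait together, at least `M` of
them, so the waiting time has a tail of order `n ^ (-M/2)` and finite moments of order `2 (a + 4)`.
The waiting times are translates of a functional of one window, and sums of such translates deviate
linearly from their means with probability of order `n ^ (-(a + 4))` (`IsWalkLaw.window_tail_step`).
This gives the speed `α = 1 / meanWait`, a tail for the time at which the auxiliary front is first
too slow, and a positive probability that it never is (`IsWalkLaw.ahead_pos`).

A trial starts at the end `v` of a good block. Given its past it succeeds with probability bounded
below: the labels at or beyond `v` decide whether the auxiliary front is fast, those inside the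
block whether its particles stay below a line, those behind it whether the exponential sum stays
small. The three sets of labels are disjoint, hence independent. The last event has probability at
least `1 - p e ^ θ` by Doob's inequality (`IsWalkLaw.exists_broken_le`).

If a trial breaks, the next one is near (`IsWalkLaw.gap_tail`). Outside an event of probability of
order `n ^ (-(a + 2))`, the break happens by time `n`, when the front has made at most a multiple of
`n` steps, and a good block ends within another multiple of `n` sites. Here the good block serves a
second time: its `a L / 2 ≥ M / 2` particles, none far from the front, push the front over the first
window in time `n`, up to probability `n ^ (-M/4)`. To find the next good block, each site gets a
gain, which is `1 - κ` minus `α₁` times the waiting time minus ten times the excess of the particles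
born just before it. Its mean is positive because `α₁ < α`. At a block end where the partial sums of
the gains are at least as large as at all sites up to the start of the block, the front has outrun
the line of slope `α₁` since every one of those sites, so older particles are exponentially far
behind and the particles of the block have not strayed far. Such records exist because the sums grow
linearly while their mean loss inside a block of length `L` is of smaller order than `L`
(`exists_record`, `Calm.good`).

Iterating, the number of trials has a geometric tail, and the regeneration site exceeds a constant
times `n (1 + K)` with probability at most `C n ^ (-(a + 2)) + ρ ^ K` on `U = ∞`
(`measure_not_regen_le`). Taking `K` a small power of `t` gives the exponent `a + 2 - ε = M / 4 - 3
- ε` (`exists_rpow_bound`). On `U = ∞` the front reaches `v` by time `v / α₂`, so bounds for the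
site are bounds for the time. Since `a + 2 > 2`, second moments are finite. -/

/-- Right-continuous integer step paths with left limits and jumps of size at most one. -/
structure IsStep (f : ℝ≥0 → ℤ) : Prop where
  right_cont : ∀ t, ∀ᶠ s in 𝓝[>] t, f s = f t
  left_lim : ∀ t, 0 < t → ∃ n : ℤ, |f t - n| ≤ 1 ∧ ∀ᶠ s in 𝓝[<] t, f s = n

/-- The dyadic grid point `k / 2 ^ n`. -/
def grid (n k : ℕ) : ℝ≥0 := k / 2 ^ n

/-- The first point of the grid of level `n` beyond `t`. -/
def up (n : ℕ) (t : ℝ≥0) : ℝ≥0 := grid n (⌊t * 2 ^ n⌋₊ + 1)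

theorem lt_up (n : ℕ) (t : ℝ≥0) : t < up n t := by
  unfold up grid
  rw [lt_div_iff₀ (by positivity)]
  exact_mod_cast Nat.lt_floor_add_one (t * 2 ^ n)

theorem up_le (n : ℕ) (t : ℝ≥0) : up n t ≤ t + 1 / 2 ^ n := by
  unfold up grid
  rw [div_le_iff₀ (by positivity), add_mul, one_div, inv_mul_cancel₀ (by positivity)]
  push_cast
  gcongr
  exact Nat.floor_le (by positivity)

theorem tendsto_up (t : ℝ≥0) : Tendsto (fun n => up n t) atTop (𝓝[>] t) := by
  refine tendsto_nhdsWithin_iff.2 ⟨?_, Eventually.of_forall fun n => lt_up n t⟩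
  have h : Tendsto (fun n : ℕ => t + 1 / 2 ^ n) atTop (𝓝 (t + 0)) := by
    refine tendsto_const_nhds.add ?_
    have := tendsto_pow_atTop_nhds_zero_of_lt_one (r := (1 / 2 : ℝ≥0)) (by positivity)
      (by rw [div_lt_one (by positivity)]; norm_num)
    simpa [div_pow] using this
  rw [add_zero] at h
  exact tendsto_of_tendsto_of_tendsto_of_le_of_le tendsto_const_nhds h
    (fun n => (lt_up n t).le) fun n => up_le n t

/-- A property that persists to the right of `t` holds at a grid point in `(t, c)`. -/
theorem exists_grid_of_eventually {p : ℝ≥0 → Prop} {t : ℝ≥0} (h : ∀ᶠ s in 𝓝[>] t, p s)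
    {c : ℝ≥0∞} (hc : (t : ℝ≥0∞) < c) : ∃ n k, t < grid n k ∧ (grid n k : ℝ≥0∞) < c ∧ p (grid n k) := by
  have h2 : ∀ᶠ s in 𝓝[>] t, ((s : ℝ≥0) : ℝ≥0∞) < c := by
    refine Eventually.filter_mono nhdsWithin_le_nhds ?_
    exact (ENNReal.continuous_coe.tendsto t).eventually (gt_mem_nhds hc)
  obtain ⟨n, hn⟩ := ((tendsto_up t).eventually (h.and h2)).exists
  exact ⟨n, _, lt_up n t, hn.2, hn.1⟩

/-- The infimum of the times at which a right-open property holds is attained along the grid. -/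
theorem iInf_eq_iInf_grid {p : ℝ≥0 → Prop} (h : ∀ t, p t → ∀ᶠ s in 𝓝[>] t, p s) :
    (⨅ (t : ℝ≥0) (_ : p t), (t : ℝ≥0∞)) = ⨅ (q : ℕ × ℕ) (_ : p (grid q.1 q.2)),
      (grid q.1 q.2 : ℝ≥0∞) := by
  apply le_antisymm
  · exact le_iInf₂ fun q hq => iInf₂_le _ hq
  · refine le_iInf₂ fun t ht => le_of_forall_gt fun c hc => ?_
    obtain ⟨n, k, _, h2, h3⟩ := exists_grid_of_eventually (h t ht) hc
    exact (iInf₂_le (n, k) h3).trans_lt h2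

theorem iInf_lt_iff_time {p : ℝ≥0 → Prop} {c : ℝ≥0∞} :
    (⨅ (t : ℝ≥0) (_ : p t), (t : ℝ≥0∞)) < c ↔ ∃ t : ℝ≥0, (t : ℝ≥0∞) < c ∧ p t := by
  simp only [iInf_lt_iff]
  constructor
  · rintro ⟨t, h1, h2⟩; exact ⟨t, h2, h1⟩
  · rintro ⟨t, h1, h2⟩; exact ⟨t, h2, h1⟩

namespace IsStep

variable {f : ℝ≥0 → ℤ}

theorem map (hf : IsStep f) {g : ℤ → ℤ} (hg : ∀ x y, |g x - g y| ≤ |x - y|) :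
    IsStep fun t => g (f t) where
  right_cont t := (hf.right_cont t).mono fun s hs => by rw [hs]
  left_lim t ht := by
    obtain ⟨n, h1, h2⟩ := hf.left_lim t ht
    exact ⟨g n, (hg _ _).trans h1, h2.mono fun s hs => by rw [hs]⟩

theorem sub_const (hf : IsStep f) (c : ℤ) : IsStep fun t => f t - c :=
  hf.map (g := (· - c)) fun x y => by simp

theorem const (c : ℤ) : IsStep fun _ => c where
  right_cont t := Eventually.of_forall fun _ => rfl
  left_lim t _ := ⟨c, by simp, Eventually.of_forall fun _ => rfl⟩

theorem tendsto_up (hf : IsStep f) (t : ℝ≥0) : ∀ᶠ n in atTop, f (up n t) = f t :=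
  (Combustion.tendsto_up t).eventually (hf.right_cont t)

/-- A step path passes through every level between two of its values, for the first time. -/
theorem exists_first (hf : IsStep f) {s t : ℝ≥0} {m : ℤ} (hst : s ≤ t) (hs : f s < m)
    (ht : m ≤ f t) : ∃ u, s < u ∧ u ≤ t ∧ f u = m ∧ ∀ v, s ≤ v → v < u → f v < m := by
  set A : Set ℝ≥0 := {v | s ≤ v ∧ m ≤ f v} with hA
  have hne : A.Nonempty := ⟨t, hst, ht⟩
  have hbd : BddBelow A := OrderBot.bddBelow A
  set u := sInf A with hu
  have hut : u ≤ t := csInf_le hbd ⟨hst, ht⟩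
  have hsu : s ≤ u := le_csInf hne fun v hv => hv.1
  have hlt : ∀ v, s ≤ v → v < u → f v < m := fun v h1 h2 => by
    by_contra h
    exact absurd (csInf_le hbd (show v ∈ A from ⟨h1, not_lt.1 h⟩)) (not_le.2 h2)
  have hfu : m ≤ f u := by
    by_contra h
    obtain ⟨c, hc, hc2⟩ := mem_nhdsGT_iff_exists_Ioo_subset.1 (hf.right_cont u)
    obtain ⟨v, hv, hvc⟩ := exists_lt_of_csInf_lt hne (show sInf A < c from hc)
    rcases (csInf_le hbd hv).eq_or_lt with h1 | h1
    · exact h (by rw [hu, h1]; exact hv.2)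
    · exact h (by rw [← hc2 ⟨h1, hvc⟩]; exact hv.2)
  have hsu' : s < u := lt_of_le_of_ne hsu fun h => by rw [← h] at hfu; omega
  refine ⟨u, hsu', hut, ?_, hlt⟩
  -- Just before `u` the path equals `n < m`, and the jump at `u` has size at most one, so `m` is
  -- not overshot.
  obtain ⟨n, h1, h2⟩ := hf.left_lim u (lt_of_le_of_lt zero_le hsu')
  obtain ⟨c, hc, hc2⟩ := (mem_nhdsLT_iff_exists_Ioo_subset' hsu').1 h2
  obtain ⟨v, hv1, hv2⟩ := exists_between (max_lt hsu' hc)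
  have h3 : f v = n := hc2 ⟨(le_max_right _ _).trans_lt hv1, hv2⟩
  have h4 := hlt v ((le_max_left _ _).trans hv1.le) hv2
  rw [abs_le] at h1
  omega

end IsStep

/-! ### Hitting times -/

theorem hit_le {f : ℝ≥0 → ℤ} {m : ℤ} {t : ℝ≥0} (h : f t = m) : hit f m ≤ t := iInf₂_le t h

theorem hit_lt_iff {f : ℝ≥0 → ℤ} {m : ℤ} {c : ℝ≥0∞} :
    hit f m < c ↔ ∃ t : ℝ≥0, (t : ℝ≥0∞) < c ∧ f t = m := iInf_lt_iff_time

theorem hit_eq_grid {f : ℝ≥0 → ℤ} (hf : IsStep f) (m : ℤ) :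
    hit f m = ⨅ (q : ℕ × ℕ) (_ : f (grid q.1 q.2) = m), (grid q.1 q.2 : ℝ≥0∞) :=
  iInf_eq_iInf_grid (p := fun t => f t = m) fun t ht =>
    (hf.right_cont t).mono fun s hs => hs.trans ht

/-- Right-continuity makes the infimum a minimum: hits shortly after `t` have the value at `t`. -/
theorem apply_of_hit_eq {f : ℝ≥0 → ℤ} (hf : IsStep f) {m : ℤ} {t : ℝ≥0} (h : hit f m = t) :
    f t = m := by
  obtain ⟨c, hc, hc2⟩ := mem_nhdsGT_iff_exists_Ioo_subset.1 (hf.right_cont t)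
  obtain ⟨v, hv, hvm⟩ := hit_lt_iff.1 (show hit f m < c by rw [h]; exact_mod_cast hc)
  have h1 : t ≤ v := by exact_mod_cast h ▸ hit_le hvm
  rcases h1.eq_or_lt with h2 | h2
  · rw [h2]; exact hvm
  · rw [← hvm]; exact (hc2 ⟨h2, by exact_mod_cast hv⟩).symm

theorem hit_le_iff {f : ℝ≥0 → ℤ} (hf : IsStep f) {m : ℤ} {t : ℝ≥0} :
    hit f m ≤ t ↔ ∃ u ≤ t, f u = m := by
  constructor
  · intro h
    lift hit f m to ℝ≥0 using (h.trans_lt ENNReal.coe_lt_top).ne with u hu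
    exact ⟨u, by exact_mod_cast h, apply_of_hit_eq hf hu.symm⟩
  · rintro ⟨u, hu, h⟩
    exact (hit_le h).trans (by exact_mod_cast hu)

theorem hit_le_of_le {f : ℝ≥0 → ℤ} (hf : IsStep f) {m : ℤ} {t : ℝ≥0} (h0 : f 0 ≤ m)
    (h : m ≤ f t) : hit f m ≤ t := by
  rcases h0.eq_or_lt with h1 | h1
  · exact (hit_le h1).trans (by simp)
  · obtain ⟨u, _, h2, h3, _⟩ := hf.exists_first zero_le h1 h
    exact (hit_le h3).trans (by exact_mod_cast h2)

/-- Jumps have size at most one, so a path started at or below `m` meets `m` before any higher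
level. -/
theorem hit_mono {f : ℝ≥0 → ℤ} (hf : IsStep f) {m m' : ℤ} (h0 : f 0 ≤ m) (h : m ≤ m') :
    hit f m ≤ hit f m' := by
  refine le_iInf₂ fun t ht => hit_le_of_le hf h0 (by omega)

theorem hit_pos {f : ℝ≥0 → ℤ} (hf : IsStep f) {m : ℤ} (h : f 0 ≠ m) : 0 < hit f m := by
  rw [pos_iff_ne_zero]
  intro h0
  exact h (apply_of_hit_eq hf (by simpa using h0))

theorem hit_add_const (f : ℝ≥0 → ℤ) (c m : ℤ) : hit (fun t => f t + c) (m + c) = hit f m := by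
  simp [hit]

theorem lt_of_lt_hit {f : ℝ≥0 → ℤ} (hf : IsStep f) {m : ℤ} {t : ℝ≥0} (h0 : f 0 ≤ m)
    (h : (t : ℝ≥0∞) < hit f m) : f t < m := by
  by_contra h1
  exact absurd (hit_le_of_le hf h0 (not_lt.1 h1)) (not_le.2 h)

end

section
/-! ### The law of the increments -/

/-- The law of the increment of a rate two walk over a time interval of length `h`. -/
def stepLaw (h : ℝ≥0) : Measure ℤ :=
  ((poissonMeasure h).prod (poissonMeasure h)).map (fun q : ℕ × ℕ => (q.1 : ℤ) - (q.2 : ℤ))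

instance (h : ℝ≥0) : IsProbabilityMeasure (stepLaw h) :=
  Measure.isProbabilityMeasure_map (by fun_prop)

theorem stepLaw_map_neg (h : ℝ≥0) : (stepLaw h).map (fun x => -x) = stepLaw h := by
  unfold stepLaw
  rw [Measure.map_map (by fun_prop) (by fun_prop)]
  conv_rhs => rw [← Measure.prod_swap, Measure.map_map (by fun_prop) (by fun_prop)]
  congr 1
  ext q
  simp

/-- The rate of growth of the exponential moment of order `u`. -/
def psi (u : ℝ) : ℝ := 2 * (Real.cosh u - 1)

theorem psi_nonneg (u : ℝ) : 0 ≤ psi u := by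
  have := Real.one_le_cosh u
  unfold psi; linarith

theorem psi_neg (u : ℝ) : psi (-u) = psi u := by simp [psi]

theorem lintegral_exp_poisson (h : ℝ≥0) (u : ℝ) :
    ∫⁻ k : ℕ, ENNReal.ofReal (Real.exp (u * k)) ∂(poissonMeasure h) =
      ENNReal.ofReal (Real.exp (h * (Real.exp u - 1))) := by
  rw [lintegral_countable']
  simp_rw [poissonMeasure_singleton]
  have h1 : ∀ k : ℕ, ENNReal.ofReal (Real.exp (u * k)) *
      ENNReal.ofReal (Real.exp (-h) * h ^ k / (k.factorial : ℝ)) =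
      ENNReal.ofReal (Real.exp (-h) * ((h * Real.exp u) ^ k / (k.factorial : ℝ))) := by
    intro k
    rw [← ENNReal.ofReal_mul (by positivity), mul_comm u, Real.exp_nat_mul, mul_pow]
    congr 1
    ring
  simp_rw [h1]
  have hs := NormedSpace.expSeries_div_hasSum_exp (𝔸 := ℝ) ((h : ℝ) * Real.exp u)
  rw [← Real.exp_eq_exp_ℝ] at hs
  have hs2 := hs.mul_left (Real.exp (-h))
  rw [← ENNReal.ofReal_tsum_of_nonneg (fun k => by positivity) hs2.summable, hs2.tsum_eq,
    ← Real.exp_add]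
  congr 2
  ring

theorem lintegral_exp_stepLaw (h : ℝ≥0) (u : ℝ) :
    ∫⁻ x : ℤ, ENNReal.ofReal (Real.exp (u * x)) ∂(stepLaw h) =
      ENNReal.ofReal (Real.exp (psi u * h)) := by
  unfold stepLaw
  rw [lintegral_map (by fun_prop) (by fun_prop)]
  have h1 : ∀ q : ℕ × ℕ, ENNReal.ofReal (Real.exp (u * ((q.1 : ℤ) - (q.2 : ℤ) : ℤ))) =
      ENNReal.ofReal (Real.exp (u * q.1)) * ENNReal.ofReal (Real.exp (-u * q.2)) := by
    intro q
    rw [← ENNReal.ofReal_mul (by positivity), ← Real.exp_add]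
    push_cast
    congr 2
    ring
  simp_rw [h1]
  rw [lintegral_prod_mul (f := fun k : ℕ => ENNReal.ofReal (Real.exp (u * k)))
    (g := fun k : ℕ => ENNReal.ofReal (Real.exp (-u * k))) (by fun_prop) (by fun_prop),
    lintegral_exp_poisson,
    lintegral_exp_poisson, ← ENNReal.ofReal_mul (by positivity), ← Real.exp_add, psi,
    Real.cosh_eq]
  congr 2
  ring

theorem stepLaw_Ici_pos {h : ℝ≥0} (hh : 0 < h) (d : ℕ) : 0 < stepLaw h (Set.Ici (d : ℤ)) := by
  unfold stepLaw
  rw [Measure.map_apply (by fun_prop) measurableSet_Ici]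
  have h1 : ({d} ×ˢ {0} : Set (ℕ × ℕ)) ⊆
      (fun q : ℕ × ℕ => (q.1 : ℤ) - (q.2 : ℤ)) ⁻¹' Set.Ici (d : ℤ) := by
    rintro ⟨i, j⟩ ⟨h1, h2⟩
    simp only [Set.mem_singleton_iff] at h1 h2
    simp [h1, h2]
  refine lt_of_lt_of_le ?_ (measure_mono h1)
  rw [Measure.prod_prod, poissonMeasure_singleton, poissonMeasure_singleton]
  refine ENNReal.mul_pos ?_ ?_ <;>
  · simp only [ne_eq, ENNReal.ofReal_eq_zero, not_le]
    positivity

theorem stepLaw_Iic_pos {h : ℝ≥0} (hh : 0 < h) (d : ℕ) : 0 < stepLaw h (Set.Iic (-d : ℤ)) := by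
  rw [← stepLaw_map_neg, Measure.map_apply (by fun_prop) measurableSet_Iic]
  convert stepLaw_Ici_pos hh d using 2
  ext x
  simp

/-! ### Families of independent walks -/

variable {Ω : Type*} [mΩ : MeasurableSpace Ω] {P : Measure Ω} {Λ : Type*}

/-- The increment over the `k`-th interval of the grid of level `n`. -/
def incr (F : Λ → ℝ≥0 → Ω → ℤ) (n : ℕ) (q : Λ × ℕ) (ω : Ω) : ℤ :=
  F q.1 (grid n (q.2 + 1)) ω - F q.1 (grid n q.2) ω

/-- A family of independent rate two walks started at the origin, described through their
increments over dyadic intervals. -/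
structure IsMeshFamily (P : Measure Ω) (F : Λ → ℝ≥0 → Ω → ℤ) : Prop where
  measurable : ∀ l t, Measurable (F l t)
  step : ∀ l ω, IsStep fun t => F l t ω
  zero : ∀ l ω, F l 0 ω = 0
  law : ∀ n q, P.map (incr F n q) = stepLaw (1 / 2 ^ n)
  indep : ∀ n, iIndepFun (incr F n) P

theorem measurable_incr {F : Λ → ℝ≥0 → Ω → ℤ} (hF : ∀ l t, Measurable (F l t)) (n : ℕ)
    (q : Λ × ℕ) : Measurable (incr F n q) := (hF _ _).sub (hF _ _)

theorem grid_mono (n : ℕ) : Monotone (grid n) := fun i j h => by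
  unfold grid; gcongr

theorem grid_zero (n : ℕ) : grid n 0 = 0 := by simp [grid]

theorem grid_succ (n k : ℕ) : grid n (k + 1) = grid n k + 1 / 2 ^ n := by
  simp [grid, add_div]

theorem grid_refine (n d k : ℕ) : grid (n + d) (k * 2 ^ d) = grid n k := by
  unfold grid
  push_cast
  rw [pow_add, mul_div_mul_right _ _ (by positivity)]

/-- The centered version of the driving walks. -/
def cent {a : ℕ} (Y : ℤ × Fin a → ℝ≥0 → Ω → ℤ) : ℤ × Fin a → ℝ≥0 → Ω → ℤ :=
  fun l t ω => Y l t ω - l.1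

theorem IsRateTwoWalk.isStep {x : ℤ} {X : ℝ≥0 → Ω → ℤ} (h : IsRateTwoWalk P x X) (ω : Ω) :
    IsStep fun t => X t ω := ⟨h.right_cont ω, h.left_lim ω⟩

/-- Independence of the labels and independence of the increments of each walk combine into joint
independence of all increments of one level. -/
theorem IsWalkFamily.isMeshFamily [IsProbabilityMeasure P] {a : ℕ}
    {Y : ℤ × Fin a → ℝ≥0 → Ω → ℤ} (hY : IsWalkFamily P Y) : IsMeshFamily P (cent Y) where
  measurable l t := ((hY.walk l).measurable t).sub_const _
  step l ω := ((hY.walk l).isStep ω).sub_const _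
  zero l ω := by simp [cent, (hY.walk l).start]
  law n q := by
    have := (hY.walk q.1).increment_law (grid n q.2) (1 / 2 ^ n)
    rw [stepLaw, ← this, ← grid_succ]
    congr 1
    ext ω
    simp [incr, cent]
  indep n := by
    have h1 := hY.indep.comp (fun _ (f : ℝ≥0 → ℤ) (k : ℕ) => f (grid n (k + 1)) - f (grid n k))
      (fun l => by fun_prop)
    refine iIndepFun_uncurry' (X := fun l k => incr (cent Y) n (l, k)) (fun l k => ?_) ?_ fun l => ?_
    · exact measurable_incr (fun l t => ((hY.walk l).measurable t).sub_const _) _ _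
    · convert h1 using 3
      simp [incr, cent]
    · convert (hY.walk l).indep_increments.nat (grid_mono n) using 3
      simp [incr, cent]

namespace IsMeshFamily

variable {F : Λ → ℝ≥0 → Ω → ℤ}

theorem isProbabilityMeasure (hF : IsMeshFamily P F) : IsProbabilityMeasure P :=
  (hF.indep 0).isProbabilityMeasure

theorem apply_grid (hF : IsMeshFamily P F) (n k : ℕ) (l : Λ) (ω : Ω) :
    F l (grid n k) ω = ∑ i ∈ Finset.range k, incr F n (l, i) ω := by
  induction k with
  | zero => simp [grid_zero, hF.zero]
  | succ k ih => rw [Finset.sum_range_succ, ← ih]; simp [incr]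

theorem incr_refine (F : Λ → ℝ≥0 → Ω → ℤ) (n d : ℕ) (q : Λ × ℕ) (ω : Ω) :
    incr F n q ω = ∑ i ∈ Finset.range (2 ^ d), incr F (n + d) (q.1, q.2 * 2 ^ d + i) ω := by
  have h : ∀ j, ∑ i ∈ Finset.range j, incr F (n + d) (q.1, q.2 * 2 ^ d + i) ω =
      F q.1 (grid (n + d) (q.2 * 2 ^ d + j)) ω - F q.1 (grid (n + d) (q.2 * 2 ^ d)) ω := by
    intro j
    induction j with
    | zero => simp
    | succ j ih => rw [Finset.sum_range_succ, ih]; simp [incr, add_assoc]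
  rw [h, grid_refine, show q.2 * 2 ^ d + 2 ^ d = (q.2 + 1) * 2 ^ d by ring, grid_refine, incr]

/-- The subfamily indexed through an injective map. -/
theorem precomp {Λ' : Type*} (hF : IsMeshFamily P F) {g : Λ' → Λ} (hg : Function.Injective g) :
    IsMeshFamily P fun l => F (g l) where
  measurable l t := hF.measurable _ _
  step l ω := hF.step _ _
  zero l ω := hF.zero _ _
  law n q := hF.law n (g q.1, q.2)
  indep n := (hF.indep n).precomp (g := fun q : Λ' × ℕ => (g q.1, q.2)) fun p q h => by
    simp only [Prod.mk.injEq] at h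
    exact Prod.ext (hg h.1) h.2

end IsMeshFamily

/-! ### The past and the increments after it -/

/-- The information given by the walks up to the times `s l`. -/
abbrev pastSigma (F : Λ → ℝ≥0 → Ω → ℤ) (s : Λ → ℝ≥0) : MeasurableSpace Ω :=
  ⨆ (q : Λ × ℝ≥0) (_ : q.2 ≤ s q.1), MeasurableSpace.comap (F q.1 q.2) inferInstance

theorem measurable_pastSigma {F : Λ → ℝ≥0 → Ω → ℤ} {s : Λ → ℝ≥0} {l : Λ} {t : ℝ≥0}
    (h : t ≤ s l) : Measurable[pastSigma F s] (F l t) :=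
  (comap_measurable (F l t)).mono
    (le_iSup₂_of_le (f := fun (q : Λ × ℝ≥0) (_ : q.2 ≤ s q.1) =>
      MeasurableSpace.comap (F q.1 q.2) inferInstance) (l, t) h le_rfl) le_rfl

theorem pastSigma_le {F : Λ → ℝ≥0 → Ω → ℤ} (hF : ∀ l t, Measurable (F l t)) (s : Λ → ℝ≥0) :
    pastSigma F s ≤ mΩ := iSup₂_le fun _ _ => (hF _ _).comap_le

/-- The σ-algebra of the increments of level `n` with indices in `S`. -/
abbrev incrSigma (F : Λ → ℝ≥0 → Ω → ℤ) (n : ℕ) (S : Set (Λ × ℕ)) : MeasurableSpace Ω :=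
  ⨆ q ∈ S, MeasurableSpace.comap (incr F n q) inferInstance

theorem measurable_incrSigma {F : Λ → ℝ≥0 → Ω → ℤ} {n : ℕ} {S : Set (Λ × ℕ)} {q : Λ × ℕ}
    (h : q ∈ S) : Measurable[incrSigma F n S] (incr F n q) :=
  (comap_measurable (incr F n q)).mono
    (le_iSup₂_of_le (f := fun (q : Λ × ℕ) (_ : q ∈ S) =>
      MeasurableSpace.comap (incr F n q) inferInstance) q h le_rfl) le_rfl

theorem incrSigma_le {F : Λ → ℝ≥0 → Ω → ℤ} (hF : ∀ l t, Measurable (F l t)) (n : ℕ)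
    (S : Set (Λ × ℕ)) : incrSigma F n S ≤ mΩ :=
  iSup₂_le fun _ _ => (measurable_incr hF _ _).comap_le

namespace IsMeshFamily

variable {F : Λ → ℝ≥0 → Ω → ℤ}

theorem indep_incrSigma (hF : IsMeshFamily P F) (n : ℕ) {S S' : Set (Λ × ℕ)}
    (h : Disjoint S S') : Indep (incrSigma F n S) (incrSigma F n S') P :=
  indep_iSup_of_disjoint (fun q => (measurable_incr hF.measurable n q).comap_le)
    (hF.indep n).iIndep h

theorem incrSigma_refine (n d : ℕ) {S S' : Set (Λ × ℕ)}
    (h : ∀ q ∈ S, ∀ i < 2 ^ d, (q.1, q.2 * 2 ^ d + i) ∈ S') :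
    incrSigma F n S ≤ incrSigma F (n + d) S' := by
  refine iSup₂_le fun q hq => measurable_iff_comap_le.1 ?_
  rw [show incr F n q = fun ω => ∑ i ∈ Finset.range (2 ^ d),
    incr F (n + d) (q.1, q.2 * 2 ^ d + i) ω from funext fun ω => incr_refine F n d q ω]
  exact Finset.measurable_sum _ fun i hi =>
    measurable_incrSigma (h q hq i (Finset.mem_range.1 hi))

theorem apply_mem_incrSigma (hF : IsMeshFamily P F) {n k : ℕ} {l : Λ} {S : Set (Λ × ℕ)}
    (h : ∀ i < k, (l, i) ∈ S) : Measurable[incrSigma F n S] (F l (grid n k)) := by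
  rw [show F l (grid n k) = fun ω => ∑ i ∈ Finset.range k, incr F n (l, i) ω from
    funext fun ω => hF.apply_grid n k l ω]
  exact Finset.measurable_sum _ fun i hi => measurable_incrSigma (h i (Finset.mem_range.1 hi))

/-- The walks up to the grid times `s l` are independent of the increments after these times. -/
theorem indep_past (hF : IsMeshFamily P F) (n : ℕ) (k : Λ → ℕ) :
    Indep (pastSigma F fun l => grid n (k l)) (incrSigma F n {q | k q.1 ≤ q.2}) P := by
  have := hF.isProbabilityMeasure
  -- The past is exhausted by the increments of finer and finer levels before the times `grid n (k
  -- l)`; at each level these are disjoint from the later increments.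
  set G : ℕ → MeasurableSpace Ω := fun d => incrSigma F (n + d) {q | q.2 < k q.1 * 2 ^ d} with hG
  have hmono : Monotone G := by
    intro d e hde
    obtain ⟨j, rfl⟩ := Nat.exists_eq_add_of_le hde
    simp only [hG, ← add_assoc]
    refine incrSigma_refine _ _ fun q hq i hi => ?_
    simp only [Set.mem_ofPred_eq] at hq ⊢
    calc q.2 * 2 ^ j + i < (q.2 + 1) * 2 ^ j := by rw [add_mul, one_mul]; omega
      _ ≤ (k q.1 * 2 ^ d) * 2 ^ j := by gcongr; omega
      _ = k q.1 * 2 ^ (d + j) := by ring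
  have hind : Indep (⨆ d, G d) (incrSigma F n {q | k q.1 ≤ q.2}) P := by
    refine indep_iSup_of_monotone (fun d => ?_) (fun d => incrSigma_le hF.measurable _ _)
      (incrSigma_le hF.measurable _ _) hmono
    refine indep_of_indep_of_le_right (hF.indep_incrSigma (n + d)
      (S' := {q | k q.1 * 2 ^ d ≤ q.2}) ?_) (incrSigma_refine _ _ fun q hq i hi => ?_)
    · rw [Set.disjoint_left]
      intro q h1 h2
      simp only [Set.mem_ofPred_eq] at h1 h2
      omega
    · simp only [Set.mem_ofPred_eq] at hq ⊢
      calc k q.1 * 2 ^ d ≤ q.2 * 2 ^ d := by gcongr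
        _ ≤ _ := by omega
  refine indep_of_indep_of_le_left hind (iSup₂_le fun q hq => measurable_iff_comap_le.1 ?_)
  obtain ⟨l, t⟩ := q
  simp only at hq ⊢
  have hgrid : ∀ d j, j ≤ k l * 2 ^ d → Measurable[⨆ d, G d] (F l (grid (n + d) j)) := by
    intro d j hj
    refine Measurable.mono (hF.apply_mem_incrSigma (S := {q | q.2 < k q.1 * 2 ^ d}) fun i hi => ?_)
      (le_iSup G d) le_rfl
    simp only [Set.mem_ofPred_eq]
    omega
  rcases hq.eq_or_lt with h | h
  · rw [h, ← grid_refine n 0]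
    exact hgrid 0 _ le_rfl
  -- At a time strictly before the grid time the value is the limit of values at finer grid points
  -- on the right, which do not exceed the grid time.
  · refine @measurable_of_tendsto_metrizable Ω ℤ (⨆ d, G d) _ _ _ _
      (fun d => F l (up (n + d) t)) _ (fun d => ?_) ?_
    · refine hgrid d _ ?_
      have h2 : t * 2 ^ (n + d) < (k l * 2 ^ d : ℕ) := by
        rw [← grid_refine n d] at h
        unfold grid at h
        rwa [lt_div_iff₀ (by positivity)] at h
      exact (Nat.floor_lt (by positivity)).2 h2
    · rw [tendsto_pi_nhds]
      intro ω
      refine tendsto_nhds_of_eventually_eq ?_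
      exact (tendsto_add_atTop_nat n).eventually ((hF.step l ω).tendsto_up t) |>.mono
        fun d hd => by rw [add_comm n d]; exact hd

end IsMeshFamily

end

section
variable {Ω : Type*} [mΩ : MeasurableSpace Ω] {P : Measure Ω} {Λ : Type*}

/-! ### The maximal inequality -/

/-- The exponential functional of order `u` of a walk. -/
def expFun (u : ℝ) (x : ℤ) (t : ℝ≥0) : ℝ≥0∞ := ENNReal.ofReal (Real.exp (u * x - psi u * t))

theorem continuousAt_expFun (u : ℝ) (x : ℤ) : Continuous (expFun u x) := by
  unfold expFun; exact ENNReal.continuous_ofReal.comp (by fun_prop)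

theorem measurable_expFun (u : ℝ) (t : ℝ≥0) : Measurable fun x : ℤ => expFun u x t :=
  measurable_of_countable _

namespace IsMeshFamily

variable {F : Λ → ℝ≥0 → Ω → ℤ}

/-- The martingale property: the next increment is independent of `B` and of the present value, and
its exponential moment is exactly compensated by `psi u`. -/
theorem lintegral_expFun_succ [Countable Λ] (hF : IsMeshFamily P F) (c : Λ → ℝ≥0∞) (u : ℝ)
    (n k : ℕ) {B : Set Ω} (hB : MeasurableSet[incrSigma F n {q | q.2 < k}] B) :
    ∫⁻ ω in B, ∑' l, c l * expFun u (F l (grid n (k + 1)) ω) (grid n (k + 1)) ∂P =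
      ∫⁻ ω in B, ∑' l, c l * expFun u (F l (grid n k) ω) (grid n k) ∂P := by
  have hle := incrSigma_le hF.measurable n {q : Λ × ℕ | q.2 < k}
  have hm : ∀ l j, Measurable fun ω => c l * expFun u (F l (grid n j) ω) (grid n j) := fun l j =>
    ((measurable_expFun u _).comp (hF.measurable l _)).const_mul _
  rw [lintegral_tsum fun l => (hm l _).aemeasurable, lintegral_tsum fun l => (hm l _).aemeasurable]
  congr 1
  ext l
  have h1 : ∀ ω, B.indicator (fun ω => c l * expFun u (F l (grid n (k + 1)) ω) (grid n (k + 1))) ω =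
      B.indicator (fun ω => c l * expFun u (F l (grid n k) ω) (grid n k)) ω *
        expFun u (incr F n (l, k) ω) (1 / 2 ^ n) := by
    intro ω
    by_cases h : ω ∈ B
    · simp only [h, Set.indicator_of_mem, mul_assoc]
      congr 1
      unfold expFun
      rw [← ENNReal.ofReal_mul (by positivity), ← Real.exp_add, grid_succ]
      simp only [incr, grid_succ]
      push_cast
      congr 2
      ring
    · simp [h]
  rw [← lintegral_indicator (hle _ hB), ← lintegral_indicator (hle _ hB)]
  simp_rw [h1]
  rw [lintegral_mul_eq_lintegral_mul_lintegral_of_independent_measurableSpace hle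
    (incrSigma_le hF.measurable n {(l, k)}) (hF.indep_incrSigma n (by simp))]
  · have h2 : ∫⁻ ω, expFun u (incr F n (l, k) ω) (1 / 2 ^ n) ∂P = 1 := by
      rw [← lintegral_map (f := fun x => expFun u x (1 / 2 ^ n)) (measurable_expFun u _)
        (measurable_incr hF.measurable n _), hF.law]
      have h3 : ∀ x : ℤ, expFun u x (1 / 2 ^ n) = ENNReal.ofReal (Real.exp (u * x)) *
          ENNReal.ofReal (Real.exp (-(psi u * (1 / 2 ^ n : ℝ≥0)))) := by
        intro x
        rw [← ENNReal.ofReal_mul (by positivity), ← Real.exp_add]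
        rfl
      simp_rw [h3]
      rw [lintegral_mul_const _ (measurable_of_countable _), lintegral_exp_stepLaw,
        ← ENNReal.ofReal_mul (by positivity), ← Real.exp_add]
      simp
    rw [h2, mul_one]
  · refine Measurable.indicator ?_ hB
    refine Measurable.const_mul ((measurable_expFun u _).comp ?_) _
    exact hF.apply_mem_incrSigma fun i hi => hi
  · exact (measurable_expFun u _).comp (measurable_incrSigma rfl)

theorem lintegral_expFun_le [Countable Λ] (hF : IsMeshFamily P F) (c : Λ → ℝ≥0∞) (u : ℝ)
    (n k j : ℕ) {B : Set Ω} (hB : MeasurableSet[incrSigma F n {q | q.2 < k}] B) :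
    ∫⁻ ω in B, ∑' l, c l * expFun u (F l (grid n (k + j)) ω) (grid n (k + j)) ∂P =
      ∫⁻ ω in B, ∑' l, c l * expFun u (F l (grid n k) ω) (grid n k) ∂P := by
  induction j with
  | zero => rfl
  | succ j ih =>
    rw [← ih, ← add_assoc]
    refine hF.lintegral_expFun_succ c u n (k + j) ?_
    have hmono : incrSigma F n {q : Λ × ℕ | q.2 < k} ≤ incrSigma F n {q : Λ × ℕ | q.2 < k + j} :=
      biSup_mono fun q hq => Nat.lt_of_lt_of_le hq (Nat.le_add_right _ _)
    exact hmono _ hB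

/-- Doob's argument: split according to the first grid index at which the sum exceeds `ε`. On each
piece the martingale property replaces the value at that index by the value at `K`. -/
theorem maximal_grid [Countable Λ] (hF : IsMeshFamily P F) (c : Λ → ℝ≥0∞) (u : ℝ) (n K : ℕ)
    {ε : ℝ≥0∞} :
    ε * P {ω | ∃ k ≤ K, ε < ∑' l, c l * expFun u (F l (grid n k) ω) (grid n k)} ≤ ∑' l, c l := by
  have := hF.isProbabilityMeasure
  set N : ℕ → Ω → ℝ≥0∞ := fun k ω => ∑' l, c l * expFun u (F l (grid n k) ω) (grid n k) with hN
  have hmono : ∀ {i j : ℕ}, i ≤ j →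
      incrSigma F n {q : Λ × ℕ | q.2 < i} ≤ incrSigma F n {q : Λ × ℕ | q.2 < j} := fun hij =>
    biSup_mono fun q hq => Nat.lt_of_lt_of_le hq hij
  have hNm : ∀ k, Measurable[incrSigma F n {q : Λ × ℕ | q.2 < k}] (N k) := by
    intro k
    refine Measurable.ennreal_tsum fun l => Measurable.const_mul ((measurable_expFun u _).comp ?_) _
    exact hF.apply_mem_incrSigma fun i hi => hi
  set B : ℕ → Set Ω := fun k => {ω | ε < N k ω ∧ ∀ j < k, N j ω ≤ ε} with hBdef
  have hBm : ∀ k, MeasurableSet[incrSigma F n {q : Λ × ℕ | q.2 < k}] (B k) := by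
    intro k
    have h2 : B k = {ω | ε < N k ω} ∩ ⋂ j ∈ Finset.range k, {ω | N j ω ≤ ε} := by
      ext ω; simp [hBdef]
    rw [h2]
    refine MeasurableSet.inter ?_ (Finset.measurableSet_biInter _ fun j hj => ?_)
    · exact hNm k measurableSet_Ioi
    · refine hmono (Finset.mem_range.1 hj).le _ ?_
      exact hNm j measurableSet_Iic
  have hBm' : ∀ k, MeasurableSet (B k) := fun k => incrSigma_le hF.measurable _ _ _ (hBm k)
  have hdisj : Pairwise (Function.onFun Disjoint B) := by
    intro i j hij
    rw [Function.onFun, Set.disjoint_left]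
    rintro ω ⟨h1, h2⟩ ⟨h3, h4⟩
    rcases lt_or_gt_of_ne hij with h | h
    · exact absurd (h4 i h) (not_le.2 h1)
    · exact absurd (h2 j h) (not_le.2 h3)
  have hcov : {ω | ∃ k ≤ K, ε < N k ω} ⊆ ⋃ k ∈ Finset.range (K + 1), B k := by
    rintro ω ⟨k, hk, h⟩
    classical
    have hex : ∃ k, ε < N k ω := ⟨k, h⟩
    simp only [Set.mem_iUnion, Finset.mem_range]
    refine ⟨Nat.find hex, ?_, Nat.find_spec hex, fun j hj => not_lt.1 (Nat.find_min hex hj)⟩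
    have := Nat.find_min' hex h
    omega
  calc ε * P {ω | ∃ k ≤ K, ε < N k ω} ≤ ε * ∑ k ∈ Finset.range (K + 1), P (B k) := by
        gcongr
        exact (measure_mono hcov).trans (measure_biUnion_finset_le _ _)
    _ = ∑ k ∈ Finset.range (K + 1), ε * P (B k) := Finset.mul_sum _ _ _
    _ ≤ ∑ k ∈ Finset.range (K + 1), ∫⁻ ω in B k, N K ω ∂P := by
        refine Finset.sum_le_sum fun k hk => ?_
        obtain ⟨j, rfl⟩ := Nat.exists_eq_add_of_le (Nat.lt_succ_iff.1 (Finset.mem_range.1 hk))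
        rw [hF.lintegral_expFun_le c u n k j (hBm k), ← setLIntegral_const]
        exact setLIntegral_mono' (hBm' k) fun ω hω => hω.1.le
    _ = ∫⁻ ω in ⋃ k ∈ Finset.range (K + 1), B k, N K ω ∂P :=
        (lintegral_biUnion_finset (fun i _ j _ hij => hdisj hij) (fun k _ => hBm' k) _).symm
    _ ≤ ∫⁻ ω, N K ω ∂P := setLIntegral_le_lintegral _ _
    _ = ∑' l, c l := by
        have h := hF.lintegral_expFun_le c u n 0 K (B := Set.univ) MeasurableSet.univ
        simp only [zero_add, Measure.restrict_univ] at h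
        rw [hN, h]
        simp [grid_zero, hF.zero, expFun]

/-- Doob's inequality for the weighted sum of the exponential martingales of the walks. -/
theorem maximal [Countable Λ] (hF : IsMeshFamily P F) (c : Λ → ℝ≥0∞) (hc : ∀ l, c l ≠ ∞) (u : ℝ)
    {ε : ℝ≥0∞} :
    ε * P {ω | ∃ t, ε < ∑' l, c l * expFun u (F l t ω) t} ≤ ∑' l, c l := by
  -- The horizon `n` and the mesh `2 ^ (-n)` are refined together, so that the events increase.
  set E : ℕ → Set Ω := fun n =>
    {ω | ∃ k ≤ n * 2 ^ n, ε < ∑' l, c l * expFun u (F l (grid n k) ω) (grid n k)} with hE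
  have hmono : Monotone E := by
    refine monotone_nat_of_le_succ fun n => ?_
    rintro ω ⟨k, hk, h⟩
    refine ⟨k * 2 ^ 1, ?_, ?_⟩
    · calc k * 2 ^ 1 ≤ n * 2 ^ n * 2 ^ 1 := by gcongr
        _ ≤ (n + 1) * 2 ^ n * 2 ^ 1 := by gcongr; omega
        _ = (n + 1) * 2 ^ (n + 1) := by ring
    · rwa [grid_refine]
  have hsub : {ω | ∃ t, ε < ∑' l, c l * expFun u (F l t ω) t} ⊆ ⋃ n, E n := by
    rintro ω ⟨t, ht⟩
    -- A strict excess is already achieved by a finite partial sum. That sum is right-continuous in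
    -- time, so the excess is seen at a grid point.
    rw [ENNReal.tsum_eq_iSup_sum, lt_iSup_iff] at ht
    obtain ⟨s, hs⟩ := ht
    have h1 : ∀ᶠ v in 𝓝[>] t, ε < ∑ l ∈ s, c l * expFun u (F l v ω) v := by
      have h2 : Tendsto (fun v => ∑ l ∈ s, c l * expFun u (F l v ω) v) (𝓝[>] t)
          (𝓝 (∑ l ∈ s, c l * expFun u (F l t ω) t)) := by
        refine tendsto_finsetSum _ fun l _ => ?_
        refine ENNReal.Tendsto.const_mul ?_ (Or.inr (hc l))
        have h3 : Tendsto (fun v => expFun u (F l t ω) v) (𝓝[>] t) (𝓝 (expFun u (F l t ω) t)) :=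
          ((continuousAt_expFun u _).tendsto t).mono_left nhdsWithin_le_nhds
        refine h3.congr' ?_
        exact ((hF.step l ω).right_cont t).mono fun v hv => by simp only; rw [hv]
      exact h2.eventually (lt_mem_nhds hs)
    have h4 := (tendsto_up t).eventually h1
    obtain ⟨n, hn, hn2⟩ := (h4.and (eventually_ge_atTop (⌊t⌋₊ + 2))).exists
    refine Set.mem_iUnion.2 ⟨n, ⌊t * 2 ^ n⌋₊ + 1, ?_, hn.trans_le (ENNReal.sum_le_tsum s)⟩
    have h5 : ⌊t * 2 ^ n⌋₊ < (⌊t⌋₊ + 1) * 2 ^ n := by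
      rw [Nat.floor_lt (by positivity)]
      push_cast
      gcongr
      exact Nat.lt_floor_add_one t
    calc ⌊t * 2 ^ n⌋₊ + 1 ≤ (⌊t⌋₊ + 1) * 2 ^ n := h5
      _ ≤ n * 2 ^ n := by gcongr; omega
  calc ε * P {ω | ∃ t, ε < ∑' l, c l * expFun u (F l t ω) t} ≤ ε * P (⋃ n, E n) := by
        gcongr
    _ = ⨆ n, ε * P (E n) := by rw [hmono.measure_iUnion, ENNReal.mul_iSup]
    _ ≤ ∑' l, c l := iSup_le fun n => hF.maximal_grid c u n _

end IsMeshFamily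

end

section
variable {Ω : Type*} [mΩ : MeasurableSpace Ω] {P : Measure Ω} {Λ : Type*}

/-! ### Persistence of symmetric random walks -/

/-- The partial sums of `x` up to time `n` are at most `d`. -/
def StaysBelow (d : ℤ) (x : ℕ → ℤ) (n : ℕ) : Prop := ∀ j ≤ n, ∑ i ∈ Finset.range j, x i ≤ d

theorem measurableSet_staysBelow (d : ℤ) (n : ℕ) : MeasurableSet {x : ℕ → ℤ | StaysBelow d x n} := by
  have : {x : ℕ → ℤ | StaysBelow d x n} =
      ⋂ j ∈ Finset.range (n + 1), {x | ∑ i ∈ Finset.range j, x i ≤ d} := by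
    ext x; simp [StaysBelow]
  rw [this]
  refine Finset.measurableSet_biInter _ fun j _ => ?_
  exact measurableSet_le (by fun_prop) measurable_const

/-- The probability depends only on the common law of the independent steps, so the steps may be
shifted, or reversed and negated when their law is symmetric. -/
theorem prob_staysBelow [IsProbabilityMeasure P] {X : ℕ → Ω → ℤ} {μ : Measure ℤ}
    (hm : ∀ i, Measurable (X i)) (hX : iIndepFun X P) (hl : ∀ i, P.map (X i) = μ) (d : ℤ) (n : ℕ) :
    P {ω | StaysBelow d (fun i => X i ω) n} =
      Measure.infinitePi (fun _ : ℕ => μ) {x | StaysBelow d x n} := by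
  have h := (iIndepFun_iff_map_fun_eq_infinitePi_map hm).1 hX
  simp_rw [hl] at h
  rw [← h, Measure.map_apply (by fun_prop) (measurableSet_staysBelow d n)]
  rfl

theorem measurable_of_comap_le {β : Type*} [MeasurableSpace β] {ι : Type*} {X : ι → Ω → β}
    {S : Set ι} {i : ι} (h : i ∈ S) :
    Measurable[⨆ i ∈ S, MeasurableSpace.comap (X i) inferInstance] (X i) :=
  (comap_measurable (X i)).mono (le_iSup₂_of_le (f := fun i (_ : i ∈ S) =>
    MeasurableSpace.comap (X i) inferInstance) i h le_rfl) le_rfl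

theorem measure_inter_of_disjoint [IsProbabilityMeasure P] {β : Type*} [MeasurableSpace β]
    {ι : Type*} {X : ι → Ω → β} (hm : ∀ i, Measurable (X i)) (hX : iIndepFun X P) {S T : Set ι}
    (hST : Disjoint S T) {A B : Set Ω}
    (hA : MeasurableSet[⨆ i ∈ S, MeasurableSpace.comap (X i) inferInstance] A)
    (hB : MeasurableSet[⨆ i ∈ T, MeasurableSpace.comap (X i) inferInstance] B) :
    P (A ∩ B) = P A * P B :=
  (Indep_iff _ _ _).1 (indep_iSup_of_disjoint (fun i => (hm i).comap_le) hX.iIndep hST) A B hA hB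

theorem measurableSet_staysBelow_of {X : ℕ → Ω → ℤ} {m : MeasurableSpace Ω} {d : ℤ} {n : ℕ}
    (h : ∀ i < n, Measurable[m] (X i)) :
    MeasurableSet[m] {ω | StaysBelow d (fun i => X i ω) n} := by
  have : {ω | StaysBelow d (fun i => X i ω) n} =
      ⋂ j ∈ Finset.range (n + 1), {ω | ∑ i ∈ Finset.range j, X i ω ≤ d} := by
    ext x; simp [StaysBelow]
  rw [this]
  refine Finset.measurableSet_biInter _ fun j hj => ?_
  refine (Finset.measurable_sum (f := X) _ fun i hi => h i ?_) measurableSet_Iic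
  simp only [Finset.mem_range] at hi hj
  omega

/-- The probability that a symmetric random walk stays nonpositive for `n` steps is at most of
order `n ^ (-1/2)`: decompose according to the last time at which the maximum is attained. -/
theorem persistence [IsProbabilityMeasure P] {X : ℕ → Ω → ℤ} {μ : Measure ℤ}
    (hm : ∀ i, Measurable (X i)) (hX : iIndepFun X P) (hl : ∀ i, P.map (X i) = μ)
    (hμ : μ.map (fun x => -x) = μ) (n : ℕ) :
    (n + 1) * (μ (Set.Iic (-1)) * P {ω | StaysBelow 0 (fun i => X i ω) n} ^ 2) ≤ 1 := by
  set a := P {ω | StaysBelow 0 (fun i => X i ω) n} with ha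
  set S : ℕ → Ω → ℤ := fun j ω => ∑ i ∈ Finset.range j, X i ω with hS
  set A : ℕ → Set Ω := fun k => {ω | ∀ i < k, S i ω ≤ S k ω} with hA
  set B : ℕ → Set Ω := fun k => X k ⁻¹' Set.Iic (-1) with hB
  set C : ℕ → Set Ω := fun k => {ω | StaysBelow 0 (fun i => X (k + 1 + i) ω) n} with hC
  -- Reversing and negating the first `k` steps turns "the sum at `k` is at least all earlier ones"
  -- into "the reversed walk stays nonpositive", which has the same law by symmetry.
  set R : ℕ → ℕ → Ω → ℤ := fun k i ω => if i < k then -X (k - 1 - i) ω else X i ω with hR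
  have hAR : ∀ k, A k = {ω | StaysBelow 0 (fun i => R k i ω) k} := by
    intro k
    have hsum : ∀ j ≤ k, ∀ ω, ∑ i ∈ Finset.range j, R k i ω = S (k - j) ω - S k ω := by
      intro j
      induction j with
      | zero => intro _ ω; simp
      | succ j ih =>
        intro hj ω
        rw [Finset.sum_range_succ, ih (by omega)]
        have h1 : S (k - j) ω = S (k - (j + 1)) ω + X (k - 1 - j) ω := by
          rw [show k - j = (k - (j + 1)) + 1 by omega, hS]
          simp only
          rw [Finset.sum_range_succ, show k - (j + 1) = k - 1 - j by omega]
        simp only [hR, if_pos (show j < k by omega)]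
        omega
    ext ω
    simp only [hA, StaysBelow, Set.mem_ofPred_eq]
    constructor
    · intro h j hj
      rw [hsum j hj]
      rcases Nat.eq_zero_or_pos j with rfl | h0
      · simp
      · have := h (k - j) (by omega); omega
    · intro h i hi
      have := h (k - i) (by omega)
      rw [hsum _ (by omega), show k - (k - i) = i by omega] at this
      omega
  have hAm : ∀ k, MeasurableSet[⨆ i ∈ Set.Iio k, MeasurableSpace.comap (X i) inferInstance] (A k) := by
    intro k
    rw [hAR]
    refine measurableSet_staysBelow_of fun i hi => ?_
    simp only [hR, if_pos hi]
    exact (measurable_of_comap_le (S := Set.Iio k) (show k - 1 - i < k by omega)).neg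
  have hBm : ∀ k, MeasurableSet[⨆ i ∈ ({k} : Set ℕ), MeasurableSpace.comap (X i) inferInstance]
      (B k) := fun k => measurable_of_comap_le (S := {k}) rfl measurableSet_Iic
  have hCm : ∀ k, MeasurableSet[⨆ i ∈ Set.Ioi k, MeasurableSpace.comap (X i) inferInstance]
      (C k) := fun k => measurableSet_staysBelow_of fun i _ =>
    measurable_of_comap_le (S := Set.Ioi k) (show k < k + 1 + i by omega)
  have hPA : ∀ k ≤ n, a ≤ P (A k) := by
    intro k hk
    have h1 : P (A k) = P {ω | StaysBelow 0 (fun i => X i ω) k} := by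
      rw [hAR, prob_staysBelow hm hX hl]
      refine prob_staysBelow (fun i => ?_) ?_ (fun i => ?_) 0 k
      · simp only [hR]; split_ifs <;> [exact (hm _).neg; exact hm _]
      · have h2 : Function.Injective fun i : ℕ => if i < k then k - 1 - i else i := by
          intro i j hij
          simp only at hij
          split_ifs at hij <;> omega
        have h3 := (hX.precomp h2).comp (fun i x => if i < k then -x else x)
          (fun i => measurable_of_countable _)
        convert h3 using 2 with i
        ext ω
        by_cases h : i < k <;> simp [hR, h]
      · simp only [hR]
        split_ifs with h
        · rw [← hμ, ← hl (k - 1 - i), Measure.map_map (by fun_prop) (hm _)]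
          rfl
        · exact hl i
    rw [h1, ha]
    exact measure_mono fun ω hω j hj => hω j (hj.trans hk)
  have hPC : ∀ k, P (C k) = a := by
    intro k
    rw [ha, prob_staysBelow hm hX hl]
    exact prob_staysBelow (fun i => hm _) (hX.precomp (add_right_injective (k + 1)))
      (fun i => hl _) 0 n
  have hP : ∀ k ≤ n, μ (Set.Iic (-1)) * a ^ 2 ≤ P (A k ∩ (B k ∩ C k)) := by
    intro k hk
    have h1 : P (B k ∩ C k) = P (B k) * P (C k) :=
      measure_inter_of_disjoint hm hX (by simp) (hBm k) (hCm k)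
    have hle1 : (⨆ i ∈ ({k} : Set ℕ), MeasurableSpace.comap (X i) inferInstance) ≤
        ⨆ i ∈ Set.Ici k, MeasurableSpace.comap (X i) inferInstance :=
      biSup_mono fun i hi => by simp at hi; simp [hi]
    have hle2 : (⨆ i ∈ Set.Ioi k, MeasurableSpace.comap (X i) inferInstance) ≤
        ⨆ i ∈ Set.Ici k, MeasurableSpace.comap (X i) inferInstance :=
      biSup_mono fun i hi => Set.Ioi_subset_Ici_self hi
    have h2 : P (A k ∩ (B k ∩ C k)) = P (A k) * P (B k ∩ C k) :=
      measure_inter_of_disjoint hm hX (Set.Iio_disjoint_Ici le_rfl) (hAm k)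
        (MeasurableSet.inter (hle1 _ (hBm k)) (hle2 _ (hCm k)))
    rw [h2, h1, hPC, ← Measure.map_apply (hm k) measurableSet_Iic, hl]
    calc μ (Set.Iic (-1)) * a ^ 2 = a * (μ (Set.Iic (-1)) * a) := by ring
      _ ≤ P (A k) * (μ (Set.Iic (-1)) * a) := by gcongr; exact hPA k hk
  have hstep : ∀ k ω, ω ∈ B k ∩ C k → ∀ i, k < i → i ≤ n → S i ω < S k ω := by
    rintro k ω ⟨h1, h2⟩ i hki hin
    obtain ⟨j, rfl⟩ := Nat.exists_eq_add_of_lt hki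
    have h3 : ∑ i ∈ Finset.range j, X (k + 1 + i) ω ≤ 0 := h2 j (by omega)
    simp only [hB, Set.mem_preimage, Set.mem_Iic] at h1
    have h4 : S (k + j + 1) ω = S k ω + X k ω + ∑ i ∈ Finset.range j, X (k + 1 + i) ω := by
      rw [show k + j + 1 = (k + 1) + j by ring, hS]
      simp only
      rw [Finset.sum_range_add, Finset.sum_range_succ]
    omega
  -- The step down in `B k` makes `k` the last time at which the maximum is attained, and there is
  -- only one such time.
  have hdisj : Set.PairwiseDisjoint (Finset.range (n + 1) : Set ℕ) fun k => A k ∩ (B k ∩ C k) := by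
    have key : ∀ i j, i < j → j ≤ n → Disjoint (A i ∩ (B i ∩ C i)) (A j ∩ (B j ∩ C j)) := by
      intro i j hij hj
      rw [Set.disjoint_left]
      intro ω h1 h2
      have h3 := hstep i ω h1.2 j hij hj
      have h4 := h2.1 i hij
      omega
    intro i hi j hj hij
    simp only [Finset.coe_range, Set.mem_Iio] at hi hj
    rcases lt_or_gt_of_ne hij with h | h
    · exact key i j h (by omega)
    · exact (key j i h (by omega)).symm
  have hmeas : ∀ k, MeasurableSet (A k ∩ (B k ∩ C k)) := by
    intro k
    have hle : ∀ T : Set ℕ, (⨆ i ∈ T, MeasurableSpace.comap (X i) inferInstance) ≤ mΩ :=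
      fun T => iSup₂_le fun i _ => (hm i).comap_le
    exact (hle _ _ (hAm k)).inter ((hle _ _ (hBm k)).inter (hle _ _ (hCm k)))
  calc (n + 1) * (μ (Set.Iic (-1)) * a ^ 2)
      = ∑ k ∈ Finset.range (n + 1), μ (Set.Iic (-1)) * a ^ 2 := by simp
    _ ≤ ∑ k ∈ Finset.range (n + 1), P (A k ∩ (B k ∩ C k)) :=
        Finset.sum_le_sum fun k hk => hP k (by simp at hk; omega)
    _ = P (⋃ k ∈ Finset.range (n + 1), A k ∩ (B k ∩ C k)) :=
        (measure_biUnion_finset hdisj fun k _ => hmeas k).symm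
    _ ≤ 1 := prob_le_one

/-- Hitting times of the walks have tails of order `t ^ (-1/2)`. -/
theorem hit_tail (d : ℕ) : ∃ C : ℝ, 0 < C ∧ ∀ {P : Measure Ω} {F : Λ → ℝ≥0 → Ω → ℤ},
    IsMeshFamily P F → ∀ (l : Λ) (t : ℝ≥0), 0 < t →
      P {ω | (t : ℝ≥0∞) < hit (fun s => F l s ω) d} ≤ ENNReal.ofReal (C / √t) := by
  set κ := stepLaw 1 (Set.Iic (-1)) with hκ
  set κd := stepLaw 1 (Set.Iic (-d : ℤ)) with hκd
  have hκ0 : 0 < κ := stepLaw_Iic_pos one_pos 1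
  have hκd0 : 0 < κd := stepLaw_Iic_pos one_pos d
  have hκ1 : κ ≠ ∞ := measure_ne_top _ _
  have hκd1 : κd ≠ ∞ := measure_ne_top _ _
  have hr0 : 0 < κ.toReal := ENNReal.toReal_pos hκ0.ne' hκ1
  have hrd0 : 0 < κd.toReal := ENNReal.toReal_pos hκd0.ne' hκd1
  refine ⟨1 / (κd.toReal * √κ.toReal), by positivity, fun {P F} hF l t ht => ?_⟩
  have := hF.isProbabilityMeasure
  set X : ℕ → Ω → ℤ := fun i => incr F 0 (l, i) with hX
  have hm : ∀ i, Measurable (X i) := fun i => measurable_incr hF.measurable _ _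
  have hind : iIndepFun X P := (hF.indep 0).precomp (g := fun i => (l, i)) fun i j h => by
    simpa using h
  have hl : ∀ i, P.map (X i) = stepLaw 1 := fun i => by simpa using hF.law 0 (l, i)
  set n := ⌊t⌋₊ with hn
  have h1 := persistence hm hind hl (stepLaw_map_neg 1) (n + 1)
  set a := P {ω | StaysBelow 0 (fun i => X i ω) (n + 1)} with ha
  set b := P {ω | (t : ℝ≥0∞) < hit (fun s => F l s ω) d} with hb
  -- A first step of at most `-d`, independent of the rest, turns a walk that stays at or below `d`
  -- into one that stays nonpositive.
  have h2 : κd * b ≤ a := by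
    have h3 : b ≤ P {ω | StaysBelow d (fun i => X i ω) n} := by
      refine measure_mono fun ω hω j hj => ?_
      have h4 := hF.apply_grid 0 j l ω
      rw [← h4]
      refine (lt_of_lt_hit (hF.step l ω) (by simp [hF.zero]) (lt_of_le_of_lt ?_ hω)).le
      have : (grid 0 j : ℝ≥0) ≤ t := by
        simp only [grid, pow_zero, div_one]
        exact (Nat.cast_le.2 hj).trans (Nat.floor_le zero_le)
      exact_mod_cast this
    have h4 : P {ω | StaysBelow d (fun i => X i ω) n} =
        P {ω | StaysBelow d (fun i => X (1 + i) ω) n} := by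
      rw [prob_staysBelow hm hind hl]
      exact (prob_staysBelow (fun i => hm _) (hind.precomp (add_right_injective 1))
        (fun i => hl _) d n).symm
    have h5 : P (X 0 ⁻¹' Set.Iic (-d : ℤ) ∩ {ω | StaysBelow d (fun i => X (1 + i) ω) n}) =
        P (X 0 ⁻¹' Set.Iic (-d : ℤ)) * P {ω | StaysBelow d (fun i => X (1 + i) ω) n} :=
      measure_inter_of_disjoint hm hind (S := {0}) (T := Set.Ioi 0) (by simp)
        (measurable_of_comap_le (S := {0}) rfl measurableSet_Iic)
        (measurableSet_staysBelow_of fun i _ =>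
          measurable_of_comap_le (S := Set.Ioi 0) (show 0 < 1 + i by omega))
    rw [← Measure.map_apply (hm 0) measurableSet_Iic, hl, ← hκd, ← h4] at h5
    calc κd * b ≤ κd * P {ω | StaysBelow d (fun i => X i ω) n} := by gcongr
      _ = _ := h5.symm
      _ ≤ a := by
        refine measure_mono ?_
        rintro ω ⟨h6, h7⟩ j hj
        simp only [Set.mem_preimage, Set.mem_Iic] at h6
        rcases Nat.eq_zero_or_pos j with rfl | h0
        · simp
        · obtain ⟨i, rfl⟩ := Nat.exists_eq_add_of_lt h0
          have h8 : ∑ i ∈ Finset.range i, X (1 + i) ω ≤ d := h7 i (by omega)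
          rw [show 0 + i + 1 = 1 + i by ring, Finset.sum_range_add]
          simp only [Finset.range_one, Finset.sum_singleton]
          omega
  have ha1 : a ≠ ∞ := measure_ne_top _ _
  have hb1 : b ≠ ∞ := measure_ne_top _ _
  have h3 : (n + 2 : ℝ) * (κ.toReal * a.toReal ^ 2) ≤ 1 := by
    have := ENNReal.toReal_mono ENNReal.one_ne_top h1
    simpa [ENNReal.toReal_mul, ENNReal.toReal_add, add_assoc, one_add_one_eq_two] using this
  have h4 : κd.toReal * b.toReal ≤ a.toReal := by
    rw [← ENNReal.toReal_mul]
    exact ENNReal.toReal_mono ha1 h2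
  have h5 : (t : ℝ) ≤ n + 2 := by
    have := (Nat.lt_floor_add_one t).le
    have h6 : (t : ℝ) ≤ n + 1 := by exact_mod_cast this
    linarith
  rw [← ENNReal.ofReal_toReal hb1]
  refine ENNReal.ofReal_le_ofReal ?_
  have ht' : (0 : ℝ) < t := ht
  rw [div_div, le_div_iff₀ (by positivity)]
  have h6 : (b.toReal * (κd.toReal * √κ.toReal * √t)) ^ 2 ≤ 1 := by
    have h7 : (b.toReal * (κd.toReal * √κ.toReal * √t)) ^ 2 =
        t * (κ.toReal * (κd.toReal * b.toReal) ^ 2) := by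
      rw [mul_pow, mul_pow, mul_pow, Real.sq_sqrt hr0.le, Real.sq_sqrt ht'.le]; ring
    rw [h7]
    refine le_trans ?_ h3
    gcongr
  exact abs_le_one_iff_mul_self_le_one.2 (by rwa [sq] at h6) |> (le_abs_self _).trans

end

section
variable {Ω : Type*} [mΩ : MeasurableSpace Ω] {P : Measure Ω} {Λ : Type*}

/-! ### Restarting the walks -/

/-- The increments of the walks after the (random) times `σ l`. -/
def restart (F : Λ → ℝ≥0 → Ω → ℤ) (σ : Λ → Ω → ℝ≥0) : Λ → ℝ≥0 → Ω → ℤ :=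
  fun l t ω => F l (σ l ω + t) ω - F l (σ l ω) ω

theorem IsStep.shift {f : ℝ≥0 → ℤ} (hf : IsStep f) (s : ℝ≥0) : IsStep fun t => f (s + t) where
  right_cont t := by
    have h : Tendsto (fun v => s + v) (𝓝[>] t) (𝓝[>] (s + t)) := by
      refine tendsto_nhdsWithin_iff.2 ⟨?_, ?_⟩
      · exact ((continuous_const.add continuous_id).tendsto t).mono_left nhdsWithin_le_nhds
      · filter_upwards [self_mem_nhdsWithin] with v hv
        exact add_lt_add_right (show t < v from hv) s
    exact h.eventually (hf.right_cont (s + t))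
  left_lim t ht := by
    obtain ⟨n, h1, h2⟩ := hf.left_lim (s + t) (add_pos_of_nonneg_of_pos zero_le ht)
    have h : Tendsto (fun v => s + v) (𝓝[<] t) (𝓝[<] (s + t)) := by
      refine tendsto_nhdsWithin_iff.2 ⟨?_, ?_⟩
      · exact ((continuous_const.add continuous_id).tendsto t).mono_left nhdsWithin_le_nhds
      · filter_upwards [self_mem_nhdsWithin] with v hv
        exact add_lt_add_right (show v < t from hv) s
    exact ⟨n, h1, h.eventually h2⟩

theorem IsStep.restart {F : Λ → ℝ≥0 → Ω → ℤ} {l : Λ} {ω : Ω} (hf : IsStep fun t => F l t ω)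
    (σ : Λ → Ω → ℝ≥0) : IsStep fun t => restart F σ l t ω :=
  (hf.shift (σ l ω)).sub_const _

/-- A step path evaluated at a measurable time is measurable. -/
theorem measurable_apply_time {Ω' : Type*} {m : MeasurableSpace Ω'} {f : ℝ≥0 → Ω' → ℤ}
    (hf : ∀ t, Measurable (f t)) (hs : ∀ ω, IsStep fun t => f t ω) {τ : Ω' → ℝ≥0}
    (hτ : Measurable τ) : Measurable fun ω => f (τ ω) ω := by
  refine measurable_of_tendsto_metrizable (f := fun n ω => f (up n (τ ω)) ω) (fun n => ?_) ?_
  · have h1 : Measurable fun ω => ⌊τ ω * 2 ^ n⌋₊ := Nat.measurable_floor.comp (hτ.mul_const _)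
    intro s _
    have h2 : (fun ω => f (up n (τ ω)) ω) ⁻¹' s =
        ⋃ k : ℕ, (fun ω => ⌊τ ω * 2 ^ n⌋₊) ⁻¹' {k} ∩ f (grid n (k + 1)) ⁻¹' s := by
      ext ω
      simp [up]
    rw [h2]
    exact MeasurableSet.iUnion fun k => (h1 (measurableSet_singleton k)).inter
      (hf _ s.to_countable.measurableSet)
  · rw [tendsto_pi_nhds]
    intro ω
    exact tendsto_nhds_of_eventually_eq ((hs ω).tendsto_up (τ ω))

/-- Independence of variables with values in a countable space, in terms of points. -/
theorem iIndepFun_of_singleton {ι β : Type*} [Countable β] [MeasurableSpace β]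
    [MeasurableSingletonClass β] [IsProbabilityMeasure P] {X : ι → Ω → β}
    (hX : ∀ i, Measurable (X i))
    (h : ∀ (I : Finset ι) (x : ι → β), P (⋂ i ∈ I, X i ⁻¹' {x i}) = ∏ i ∈ I, P (X i ⁻¹' {x i})) :
    iIndepFun X P := by
  refine (iIndepFun_iff_iIndep _ _ _).2 (iIndepSets.iIndep (fun i => (hX i).comap_le)
    (fun i => {s | s = ∅ ∨ ∃ x, s = X i ⁻¹' {x}}) (fun i => ?_) (fun i => ?_) ?_)
  · rintro s (rfl | ⟨x, rfl⟩) t (rfl | ⟨y, rfl⟩) hst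
    · simp
    · simp
    · simp
    · right
      obtain ⟨ω, h1, h2⟩ := hst
      simp only [Set.mem_preimage, Set.mem_singleton_iff] at h1 h2
      exact ⟨x, by rw [← h2, h1, Set.inter_self]⟩
  · apply le_antisymm
    · rintro s ⟨t, _, rfl⟩
      have h2 : X i ⁻¹' t = ⋃ x ∈ t, X i ⁻¹' {x} := by ext; simp
      rw [h2]
      exact @MeasurableSet.biUnion _ _ (MeasurableSpace.generateFrom _) _ _ t.to_countable fun x _ =>
        MeasurableSpace.measurableSet_generateFrom (Or.inr ⟨x, rfl⟩)
    · refine MeasurableSpace.generateFrom_le ?_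
      rintro s (rfl | ⟨x, rfl⟩)
      · exact @MeasurableSet.empty _ (_)
      · exact ⟨{x}, measurableSet_singleton x, rfl⟩
  · refine (iIndepSets_iff _ _).2 fun I f hf => ?_
    by_cases hemp : ∃ i ∈ I, f i = ∅
    · obtain ⟨i, hi, hfi⟩ := hemp
      rw [Finset.prod_eq_zero hi (by rw [hfi, measure_empty])]
      refine measure_mono_null (Set.biInter_subset_of_mem hi) (by rw [hfi, measure_empty])
    · push Not at hemp
      have h2 : ∀ i, ∃ x, i ∈ I → f i = X i ⁻¹' {x} := by
        intro i
        by_cases hi : i ∈ I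
        · rcases hf i hi with h3 | ⟨x, hx⟩
          · exact absurd h3 (hemp i hi).ne_empty
          · exact ⟨x, fun _ => hx⟩
        · obtain ⟨ω⟩ := nonempty_of_isProbabilityMeasure P
          exact ⟨X i ω, fun h => absurd h hi⟩
      choose x hx using h2
      rw [Finset.prod_congr rfl fun i hi => by rw [hx i hi], ← h I x]
      congr 1
      exact Set.iInter₂_congr fun i hi => hx i hi

/-- A criterion for being a family of independent walks, through finite-dimensional laws. -/
theorem isMeshFamily_of_prod [IsProbabilityMeasure P] {G : Λ → ℝ≥0 → Ω → ℤ}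
    (hm : ∀ l t, Measurable (G l t)) (hs : ∀ l ω, IsStep fun t => G l t ω)
    (h0 : ∀ l ω, G l 0 ω = 0)
    (h : ∀ n (I : Finset (Λ × ℕ)) (x : Λ × ℕ → ℤ),
      P (⋂ q ∈ I, incr G n q ⁻¹' {x q}) = ∏ q ∈ I, stepLaw (1 / 2 ^ n) {x q}) :
    IsMeshFamily P G := by
  have hl : ∀ n q (y : ℤ), P (incr G n q ⁻¹' {y}) = stepLaw (1 / 2 ^ n) {y} := fun n q y => by
    simpa using h n {q} fun _ => y
  refine ⟨hm, hs, h0, fun n q => ?_, fun n => ?_⟩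
  · refine Measure.ext_of_singleton fun y => ?_
    rw [Measure.map_apply (measurable_incr hm n q) (measurableSet_singleton y), hl]
  · refine iIndepFun_of_singleton (measurable_incr hm n) fun I x => ?_
    rw [h]
    exact Finset.prod_congr rfl fun q _ => (hl n q _).symm

namespace IsMeshFamily

variable {F : Λ → ℝ≥0 → Ω → ℤ}

/-- After grid times, the walks are restarted, independently of the past. -/
theorem past_inter_restart_grid (hF : IsMeshFamily P F) (N : ℕ) (κ : Λ → ℕ) {A : Set Ω}
    (hA : MeasurableSet[pastSigma F fun l => grid N (κ l)] A) (n : ℕ) (hn : n ≤ N)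
    (I : Finset (Λ × ℕ)) (x : Λ × ℕ → ℤ) :
    P (A ∩ ⋂ q ∈ I, incr (restart F fun l _ => grid N (κ l)) n q ⁻¹' {x q}) =
      P A * ∏ q ∈ I, stepLaw (1 / 2 ^ n) {x q} := by
  have := hF.isProbabilityMeasure
  obtain ⟨d, rfl⟩ := Nat.exists_eq_add_of_le hn
  have hgrid : ∀ i j, grid (n + d) i + grid n j = grid (n + d) (i + j * 2 ^ d) := by
    intro i j
    rw [← grid_refine n d j]
    simp [grid, add_div]
  set X : Λ × ℕ → Ω → ℤ := fun q => incr F (n + d) (q.1, κ q.1 + q.2) with hX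
  have hXm : ∀ q, Measurable (X q) := fun q => measurable_incr hF.measurable _ _
  have hinj : Function.Injective fun q : Λ × ℕ => (q.1, κ q.1 + q.2) := by
    rintro ⟨l, i⟩ ⟨l', j⟩ h
    simp only [Prod.mk.injEq] at h
    obtain ⟨rfl, h⟩ := h
    simpa using h
  set G : (Λ × ℕ → ℤ) → Λ × ℕ → ℤ := fun y q => ∑ i ∈ Finset.range (2 ^ d),
    y (q.1, q.2 * 2 ^ d + i) with hG
  have hGm : Measurable G := by
    refine measurable_pi_lambda _ fun q => Finset.measurable_sum _ fun i _ => measurable_pi_apply _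
  have h1 : ∀ q ω, incr (restart F fun l _ => grid (n + d) (κ l)) n q ω = G (fun q => X q ω) q := by
    intro q ω
    have h : ∀ j, ∑ i ∈ Finset.range j, X (q.1, q.2 * 2 ^ d + i) ω =
        F q.1 (grid (n + d) (κ q.1 + q.2 * 2 ^ d + j)) ω -
          F q.1 (grid (n + d) (κ q.1 + q.2 * 2 ^ d)) ω := by
      intro j
      induction j with
      | zero => simp
      | succ j ih => rw [Finset.sum_range_succ, ih]; simp [hX, incr, add_assoc]
    simp only [hG, h, incr, restart, hgrid]
    rw [show κ q.1 + (q.2 + 1) * 2 ^ d = κ q.1 + q.2 * 2 ^ d + 2 ^ d by ring]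
    ring
  have h2 : ∀ q ω, incr F n q ω = G (fun q => incr F (n + d) q ω) q := fun q ω =>
    incr_refine F n d q ω
  have hlaw : P.map (fun ω q => X q ω) = P.map fun ω q => incr F (n + d) q ω := by
    rw [(iIndepFun_iff_map_fun_eq_infinitePi_map hXm).1 ((hF.indep (n + d)).precomp hinj),
      (iIndepFun_iff_map_fun_eq_infinitePi_map (measurable_incr hF.measurable _)).1
        (hF.indep (n + d))]
    simp only [hX, hF.law]
  set B : Set (Λ × ℕ → ℤ) := {y | ∀ q ∈ I, G y q = x q} with hB
  have hBm : MeasurableSet B := by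
    have : B = ⋂ q ∈ I, (fun y => G y q) ⁻¹' {x q} := by ext; simp [hB]
    rw [this]
    exact Finset.measurableSet_biInter _ fun q _ =>
      ((measurable_pi_apply q).comp hGm) (measurableSet_singleton _)
  have hset : (⋂ q ∈ I, incr (restart F fun l _ => grid (n + d) (κ l)) n q ⁻¹' {x q}) =
      (fun ω q => X q ω) ⁻¹' B := by
    ext ω; simp [hB, h1]
  have hset2 : (fun ω q => incr F (n + d) q ω) ⁻¹' B = ⋂ q ∈ I, incr F n q ⁻¹' {x q} := by
    ext ω; simp [hB, h2]
  have hXpi : Measurable fun ω q => X q ω := measurable_pi_lambda _ hXm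
  have hind := (Indep_iff _ _ _).1 (hF.indep_past (n + d) κ) A ((fun ω q => X q ω) ⁻¹' B) hA ?_
  · rw [hset, hind, ← Measure.map_apply hXpi hBm, hlaw,
      Measure.map_apply (measurable_pi_lambda _ (measurable_incr hF.measurable _)) hBm, hset2,
      (hF.indep n).meas_biInter (s := fun q => incr F n q ⁻¹' {x q}) fun q _ =>
        ⟨{x q}, measurableSet_singleton _, rfl⟩]
    congr 1
    refine Finset.prod_congr rfl fun q _ => ?_
    rw [← hF.law n q, Measure.map_apply (measurable_incr hF.measurable n q)
      (measurableSet_singleton _)]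
  · refine @measurable_pi_lambda _ _ _ (_) _ _ (fun q => ?_) _ hBm
    exact measurable_incrSigma (by simp)

/-- The strong Markov property: if the times `σ l`, rounded up to the grid, are determined by the
walks up to these times, then the walks restarted at `σ l` are independent of the past. -/
theorem strongMarkov [Countable Λ] (hF : IsMeshFamily P F) {σ : Λ → Ω → ℝ≥0}
    (hσ : ∀ l, Measurable (σ l)) {ι : Type*} [Countable ι] {κ : ℕ → ι → Λ → ℕ}
    (hκ : ∀ N ω, ∃ i, ∀ l, ⌊σ l ω * 2 ^ N⌋₊ + 1 = κ N i l) {A : Set Ω} (hA : MeasurableSet A)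
    (hP : P A ≠ 0)
    (hpast : ∀ N i, MeasurableSet[pastSigma F fun l => grid N (κ N i l)]
      (A ∩ {ω | ∀ l, ⌊σ l ω * 2 ^ N⌋₊ + 1 = κ N i l})) :
    IsMeshFamily P[|A] (restart F σ) := by
  have hprob := hF.isProbabilityMeasure
  have := cond_isProbabilityMeasure hP
  have hGm : ∀ l t, Measurable (restart F σ l t) := fun l t =>
    (measurable_apply_time (hF.measurable l) (hF.step l) ((hσ l).add_const t)).sub
      (measurable_apply_time (hF.measurable l) (hF.step l) (hσ l))
  refine isMeshFamily_of_prod hGm (fun l ω => (hF.step l ω).restart σ) (fun l ω => by simp [restart])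
    fun n I x => ?_
  set c := ∏ q ∈ I, stepLaw (1 / 2 ^ n) {x q} with hc
  set E : Set Ω := ⋂ q ∈ I, incr (restart F σ) n q ⁻¹' {x q} with hE
  have hEm : MeasurableSet E := Finset.measurableSet_biInter _ fun q _ =>
    measurable_incr hGm n q (measurableSet_singleton _)
  set σN : ℕ → Λ → Ω → ℝ≥0 := fun N l ω => up N (σ l ω) with hσN
  set EN : ℕ → Set Ω := fun N => ⋂ q ∈ I, incr (restart F (σN N)) n q ⁻¹' {x q} with hEN
  have hupm : ∀ N l, Measurable (σN N l) := fun N l => by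
    have h1 : Measurable fun ω => ⌊σ l ω * 2 ^ N⌋₊ := Nat.measurable_floor.comp ((hσ l).mul_const _)
    exact (measurable_of_countable fun k : ℕ => grid N (k + 1)).comp h1
  have hENm : ∀ N, MeasurableSet (EN N) := fun N => Finset.measurableSet_biInter _ fun q _ =>
    measurable_incr (fun l t => (measurable_apply_time (hF.measurable l) (hF.step l)
      ((hupm N l).add_const t)).sub (measurable_apply_time (hF.measurable l) (hF.step l)
        (hupm N l))) n q (measurableSet_singleton _)
  -- With the times rounded up to the grid there are countably many families of grid times. On each
  -- of them the restart at deterministic grid times applies, and the pieces add up to an exact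
  -- product.
  have hN : ∀ N, n ≤ N → P (A ∩ EN N) = P A * c := by
    intro N hnN
    classical
    set S : (Λ → ℕ) → Set Ω := fun k => A ∩ {ω | ∀ l, ⌊σ l ω * 2 ^ N⌋₊ + 1 = k l} with hS
    set R : Set (Λ → ℕ) := Set.range (κ N) with hR
    have hRc : R.Countable := Set.countable_range _
    have hSm : ∀ k ∈ R, MeasurableSet (S k) := by
      rintro _ ⟨i, rfl⟩
      exact pastSigma_le hF.measurable _ _ (hpast N i)
    have hdisj : R.PairwiseDisjoint S := by
      intro k _ k' _ hkk
      rw [Function.onFun, Set.disjoint_left]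
      rintro ω ⟨_, h1⟩ ⟨_, h2⟩
      exact hkk (funext fun l => (h1 l).symm.trans (h2 l))
    have hcov : A = ⋃ k ∈ R, S k := by
      ext ω
      simp only [hR, hS, Set.mem_iUnion, Set.mem_inter_iff, Set.mem_ofPred_eq, exists_prop,
        Set.mem_range]
      constructor
      · intro h
        obtain ⟨i, hi⟩ := hκ N ω
        exact ⟨_, ⟨i, rfl⟩, h, hi⟩
      · rintro ⟨_, _, h, _⟩; exact h
    have hsplit : ∀ T, MeasurableSet T → P (A ∩ T) = ∑' k : R, P (S k ∩ T) := by
      intro T hT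
      conv_lhs => rw [hcov]
      rw [Set.iUnion₂_inter, measure_biUnion hRc (fun k hk k' hk' h =>
        (hdisj hk hk' h).mono Set.inter_subset_left Set.inter_subset_left)
        fun k hk => (hSm k hk).inter hT]
    have h1 : ∀ k : R, P (S k ∩ EN N) = P (S k) * c := by
      rintro ⟨_, i, rfl⟩
      rw [hc, ← hF.past_inter_restart_grid N (κ N i) (hpast N i) n hnN I x]
      congr 1
      ext ω
      refine and_congr_right ?_
      rintro ⟨_, h2⟩
      simp only [Set.mem_ofPred_eq] at h2
      simp only [hEN, Set.mem_iInter, Set.mem_preimage, Set.mem_singleton_iff, incr, restart, hσN,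
        up, h2]
    rw [hsplit _ (hENm N), tsum_congr h1, ENNReal.tsum_mul_right]
    congr 1
    have := hsplit Set.univ MeasurableSet.univ
    simp only [Set.inter_univ] at this
    exact this.symm
  -- By right-continuity the finitely many increments concerned no longer change once the grid is
  -- fine enough.
  have hlim : Tendsto (fun N => P (A ∩ EN N)) atTop (𝓝 (P (A ∩ E))) := by
    refine tendsto_measure_of_tendsto_indicator_of_isFiniteMeasure atTop P
      (fun N => hA.inter (hENm N)) ?_
    intro ω
    have h1 : ∀ q ∈ I, ∀ᶠ N in atTop, incr (restart F (σN N)) n q ω = incr (restart F σ) n q ω := by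
      intro q _
      have h2 : ∀ t, ∀ᶠ N in atTop, F q.1 (σN N q.1 ω + t) ω = F q.1 (σ q.1 ω + t) ω := by
        intro t
        have := ((hF.step q.1 ω).shift t).tendsto_up (σ q.1 ω)
        simpa only [add_comm t] using this
      filter_upwards [h2 (grid n (q.2 + 1)), h2 (grid n q.2)] with N h3 h4
      simp only [incr, restart, h3, h4]
      ring
    filter_upwards [(Finset.eventually_all I).2 h1] with N h3
    have h4 : ω ∈ EN N ↔ ω ∈ E := by
      simp only [hEN, hE, Set.mem_iInter, Set.mem_preimage, Set.mem_singleton_iff]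
      exact forall₂_congr fun q hq => by rw [h3 q hq]
    simp only [Set.mem_inter_iff, h4]
  have hconst : Tendsto (fun N => P (A ∩ EN N)) atTop (𝓝 (P A * c)) :=
    tendsto_nhds_of_eventually_eq ((eventually_ge_atTop n).mono fun N => hN N)
  rw [cond_apply hA, tendsto_nhds_unique hlim hconst, ← mul_assoc,
    ENNReal.inv_mul_cancel hP (measure_ne_top _ _), one_mul]

end IsMeshFamily

end

section
/-! ### Analytic sets are universally measurable -/

/-- Compactness: if each box with `k` constrained coordinates left `V`, the witnesses would lie in
one larger compact box, and nested closed sets would produce a point of the full box outside `V`. -/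
theorem exists_box_subset {n : ℕ → ℕ} {V : Set (ℕ → ℕ)} (hV : IsOpen V)
    (hn : {x : ℕ → ℕ | ∀ i, x i ≤ n i} ⊆ V) : ∃ k, {x : ℕ → ℕ | ∀ i < k, x i ≤ n i} ⊆ V := by
  by_contra! h
  have h2 : ∀ k, ∃ x : ℕ → ℕ, (∀ i < k, x i ≤ n i) ∧ x ∉ V := fun k => by
    obtain ⟨x, hx, hxV⟩ := Set.not_subset.1 (h k)
    exact ⟨x, hx, hxV⟩
  choose x hx hxV using h2
  set N : ℕ → ℕ := fun i => n i + ∑ k ∈ Finset.range (i + 1), x k i with hN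
  have hbox : ∀ m : ℕ → ℕ, {y : ℕ → ℕ | ∀ i, y i ≤ m i} = Set.univ.pi fun i => Set.Iic (m i) := by
    intro m; ext; simp [Pi.le_def]
  have hQ : IsCompact {y : ℕ → ℕ | ∀ i, y i ≤ N i} := by
    rw [hbox]
    exact isCompact_univ_pi fun i => (Set.finite_Iic _).isCompact
  have hBc : ∀ k, IsClosed {y : ℕ → ℕ | ∀ i < k, y i ≤ n i} := by
    intro k
    have : {y : ℕ → ℕ | ∀ i < k, y i ≤ n i} = ⋂ i, ⋂ _ : i < k, (fun y => y i) ⁻¹' Set.Iic (n i) := by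
      ext; simp
    rw [this]
    exact isClosed_iInter fun i => isClosed_iInter fun _ => isClosed_Iic.preimage (continuous_apply i)
  have hxQ : ∀ k i, x k i ≤ N i := fun k i => by
    by_cases hi : i < k
    · exact (hx k i hi).trans (Nat.le_add_right _ _)
    · exact (Finset.single_le_sum (f := fun k => x k i) (fun _ _ => Nat.zero_le _)
        (Finset.mem_range.2 (by omega))).trans (Nat.le_add_left _ _)
  obtain ⟨y, hy⟩ := IsCompact.nonempty_iInter_of_sequence_nonempty_isCompact_isClosed
    (fun k => {y : ℕ → ℕ | ∀ i, y i ≤ N i} ∩ Vᶜ ∩ {y : ℕ → ℕ | ∀ i < k, y i ≤ n i})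
    (fun k y hy => ⟨hy.1, fun i hi => hy.2 i (by omega)⟩)
    (fun k => ⟨x k, ⟨hxQ k, hxV k⟩, hx k⟩)
    ((hQ.inter_right hV.isClosed_compl).inter_right (hBc 0))
    (fun k => (hQ.isClosed.inter hV.isClosed_compl).inter (hBc k))
  simp only [Set.mem_iInter] at hy
  exact (hy 0).1.2 (hn fun i => (hy (i + 1)).2 i (Nat.lt_succ_self i))

/-- Choquet's argument: the set is a continuous image of the Baire space. Bound the coordinates one
after another, keeping the outer measure of the image above `c`. The limit box is compact, and outer
regularity together with `exists_box_subset` carries the bound over to its image. -/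
theorem AnalyticSet.exists_compact_subset {X : Type*} [TopologicalSpace X] [PolishSpace X]
    [MeasurableSpace X] [BorelSpace X] {s : Set X} (hs : AnalyticSet s) (μ : Measure X)
    [IsFiniteMeasure μ] {c : ℝ≥0∞} (hc : c < μ s) : ∃ K ⊆ s, IsCompact K ∧ c ≤ μ K := by
  let _ := TopologicalSpace.upgradeIsCompletelyMetrizable X
  rw [AnalyticSet] at hs
  rcases hs with rfl | ⟨f, hf, rfl⟩
  · simp at hc
  have hstep : ∀ (S : Set (ℕ → ℕ)) (k : ℕ), c < μ (f '' S) → ∃ m, c < μ (f '' (S ∩ {x | x k ≤ m})) := by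
    intro S k h
    have h1 : f '' S = ⋃ m : ℕ, f '' (S ∩ {x | x k ≤ m}) := by
      rw [← Set.image_iUnion, ← Set.inter_iUnion]
      congr 1
      ext x
      simp only [Set.mem_inter_iff, Set.mem_iUnion, Set.mem_ofPred_eq, iff_self_and]
      exact fun _ => ⟨_, le_rfl⟩
    have hmono : Monotone fun m : ℕ => f '' (S ∩ {x | x k ≤ m}) := fun m m' hm =>
      Set.image_mono fun x hx => ⟨hx.1, (show x k ≤ m from hx.2).trans hm⟩
    rw [h1, hmono.measure_iUnion] at h
    exact lt_iSup_iff.1 h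
  choose! g hg using hstep
  let B : ℕ → Set (ℕ → ℕ) := fun k => Nat.rec Set.univ (fun k S => S ∩ {x | x k ≤ g S k}) k
  have hBs : ∀ k, B (k + 1) = B k ∩ {x | x k ≤ g (B k) k} := fun k => rfl
  have hB : ∀ k, c < μ (f '' B k) := by
    intro k
    induction k with
    | zero => simpa [B] using hc
    | succ k ih => exact hg _ _ ih
  have hBox : ∀ k, B k = {x : ℕ → ℕ | ∀ i < k, x i ≤ g (B i) i} := by
    intro k
    induction k with
    | zero => simp [B]
    | succ k ih =>
      rw [hBs]
      ext x
      constructor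
      · rintro ⟨h1, h2⟩ i hi
        rcases Nat.lt_succ_iff_lt_or_eq.1 hi with h | rfl
        · rw [ih] at h1; exact h1 i h
        · exact h2
      · intro h
        exact ⟨by rw [ih]; exact fun i hi => h i (by omega), h k (by omega)⟩
  have hK : IsCompact {x : ℕ → ℕ | ∀ i, x i ≤ g (B i) i} := by
    have : {x : ℕ → ℕ | ∀ i, x i ≤ g (B i) i} = Set.univ.pi fun i => Set.Iic (g (B i) i) := by
      ext; simp [Pi.le_def]
    rw [this]
    exact isCompact_univ_pi fun i => (Set.finite_Iic _).isCompact
  refine ⟨f '' {x : ℕ → ℕ | ∀ i, x i ≤ g (B i) i}, Set.image_subset_range _ _, hK.image hf, ?_⟩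
  rw [Set.measure_eq_iInf_isOpen]
  refine le_iInf₂ fun U hU => le_iInf fun hUo => ?_
  obtain ⟨k, hk⟩ := exists_box_subset (hUo.preimage hf) (Set.image_subset_iff.1 hU)
  rw [← hBox] at hk
  exact (hB k).le.trans (measure_mono (Set.image_subset_iff.2 hk))

theorem AnalyticSet.nullMeasurableSet {X : Type*} [TopologicalSpace X] [PolishSpace X]
    [MeasurableSpace X] [BorelSpace X] {s : Set X} (hs : AnalyticSet s) (μ : Measure X)
    [IsFiniteMeasure μ] : NullMeasurableSet s μ := by
  let _ := TopologicalSpace.upgradeIsCompletelyMetrizable X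
  rcases eq_or_ne (μ s) 0 with h0 | h0
  · exact NullMeasurableSet.of_null h0
  obtain ⟨c, _, hc, hlim⟩ := exists_seq_strictMono_tendsto' (pos_iff_ne_zero.2 h0)
  choose K hKs hKc hK using fun n => AnalyticSet.exists_compact_subset hs μ (hc n).2
  have hm : MeasurableSet (⋃ n, K n) := MeasurableSet.iUnion fun n => (hKc n).isClosed.measurableSet
  refine ⟨⋃ n, K n, hm, (ae_eq_of_subset_of_measure_ge (Set.iUnion_subset hKs) ?_
    hm.nullMeasurableSet (measure_ne_top _ _)).symm⟩
  exact le_of_tendsto' hlim fun n => (hK n).trans (measure_mono (Set.subset_iUnion K n))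

/-- Sets that are null measurable for all finite measures. -/
def UMeas {X : Type*} [MeasurableSpace X] (A : Set X) : Prop :=
  ∀ μ : Measure X, IsFiniteMeasure μ → NullMeasurableSet A μ

namespace UMeas

variable {X X' : Type*} [MeasurableSpace X] [MeasurableSpace X'] {A B : Set X}

theorem of_measurableSet (h : MeasurableSet A) : UMeas A := fun _ _ => h.nullMeasurableSet

theorem compl (h : UMeas A) : UMeas Aᶜ := fun μ i => (h μ i).compl

theorem inter (h : UMeas A) (h' : UMeas B) : UMeas (A ∩ B) := fun μ i => (h μ i).inter (h' μ i)

theorem union (h : UMeas A) (h' : UMeas B) : UMeas (A ∪ B) := fun μ i => (h μ i).union (h' μ i)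

theorem iUnion {ι : Sort*} [Countable ι] {A : ι → Set X} (h : ∀ i, UMeas (A i)) :
    UMeas (⋃ i, A i) := fun μ j => NullMeasurableSet.iUnion fun i => h i μ j

theorem iInter {ι : Sort*} [Countable ι] {A : ι → Set X} (h : ∀ i, UMeas (A i)) :
    UMeas (⋂ i, A i) := fun μ j => NullMeasurableSet.iInter fun i => h i μ j

theorem preimage {φ : X' → X} (h : UMeas A) (hφ : Measurable φ) : UMeas (φ ⁻¹' A) :=
  fun μ _ => (h (μ.map φ) inferInstance).preimage (hφ.quasiMeasurePreserving μ)

theorem setOf_exists {ι : Sort*} [Countable ι] {p : ι → X → Prop} (h : ∀ i, UMeas {x | p i x}) :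
    UMeas {x | ∃ i, p i x} := by
  have : {x | ∃ i, p i x} = ⋃ i, {x | p i x} := by ext; simp
  exact this ▸ iUnion h

theorem setOf_forall {ι : Sort*} [Countable ι] {p : ι → X → Prop} (h : ∀ i, UMeas {x | p i x}) :
    UMeas {x | ∀ i, p i x} := by
  have : {x | ∀ i, p i x} = ⋂ i, {x | p i x} := by ext; simp
  exact this ▸ iInter h

theorem setOf_and {p q : X → Prop} (h : UMeas {x | p x}) (h' : UMeas {x | q x}) :
    UMeas {x | p x ∧ q x} := h.inter h'

theorem setOf_not {p : X → Prop} (h : UMeas {x | p x}) : UMeas {x | ¬ p x} := h.compl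

theorem const (p : Prop) : UMeas {_x : X | p} := of_measurableSet (MeasurableSet.const p)

end UMeas

/-! ### The space of paths -/

/-- Step paths started at the origin. -/
def StepPath : Type := {f : ℝ≥0 → ℤ // IsStep f ∧ f 0 = 0}

instance : MeasurableSpace StepPath := Subtype.instMeasurableSpace

instance : CoeFun StepPath fun _ => ℝ≥0 → ℤ := ⟨Subtype.val⟩

theorem StepPath.isStep (f : StepPath) : IsStep f := f.2.1

@[simp] theorem StepPath.zero (f : StepPath) : f 0 = 0 := f.2.2

instance : Inhabited StepPath := ⟨⟨fun _ => 0, IsStep.const 0, rfl⟩⟩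

/-- Families of step paths. -/
abbrev PathSpace (Λ : Type*) : Type _ := Λ → StepPath

/-- The coordinate process on the space of paths. -/
def coord {Λ : Type*} (l : Λ) (t : ℝ≥0) (f : PathSpace Λ) : ℤ := f l t

variable {Ω : Type*} [mΩ : MeasurableSpace Ω] {P : Measure Ω} {Λ : Type*}

theorem measurable_stepPath {X : Type*} {m : MeasurableSpace X} {φ : X → StepPath}
    (h : ∀ t, Measurable fun x => φ x t) : Measurable φ :=
  Measurable.subtype_mk (f := fun x => (φ x).1) (measurable_pi_lambda _ h)

theorem measurable_pathSpace {X : Type*} {m : MeasurableSpace X} {φ : X → PathSpace Λ}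
    (h : ∀ l t, Measurable fun x => φ x l t) : Measurable φ :=
  measurable_pi_lambda _ fun l => measurable_stepPath (h l)

theorem measurable_eval (t : ℝ≥0) : Measurable fun f : StepPath => f t :=
  (measurable_pi_apply t).comp measurable_subtype_coe

theorem measurable_coord (l : Λ) (t : ℝ≥0) : Measurable (coord l t) :=
  (measurable_eval t).comp (measurable_pi_apply l)

theorem measurable_apply (l : Λ) (t : ℝ≥0) : Measurable fun f : PathSpace Λ => f l t :=
  measurable_coord l t

/-- The value of a path at a time is jointly measurable. -/
theorem measurable_eval_prod : Measurable fun q : StepPath × ℝ≥0 => q.1 q.2 :=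
  measurable_apply_time (f := fun t (q : StepPath × ℝ≥0) => q.1 t)
    (fun t => (measurable_eval t).comp measurable_fst) (fun q => q.1.isStep) measurable_snd

theorem Measurable.eval {X : Type*} {m : MeasurableSpace X} {φ : X → StepPath} {τ : X → ℝ≥0}
    (hφ : Measurable φ) (hτ : Measurable τ) : Measurable fun x => φ x (τ x) :=
  measurable_eval_prod.comp (hφ.prodMk hτ)

/-- The values of the paths at the grid points. -/
def gridValues (f : PathSpace Λ) (q : Λ × ℕ × ℕ) : ℤ := f q.1 (grid q.2.1 q.2.2)

/-- Right-continuous paths are determined by their values on the grid. For countably many labels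
this presents the space of paths as a pullback from a Polish space, although its time axis is
uncountable. -/
theorem comap_gridValues :
    MeasurableSpace.comap (gridValues (Λ := Λ)) inferInstance = MeasurableSpace.pi := by
  apply le_antisymm
  · exact (measurable_pi_lambda _ fun q => measurable_apply _ _).comap_le
  · have h : @Measurable (PathSpace Λ) (PathSpace Λ)
        (MeasurableSpace.comap (gridValues (Λ := Λ)) inferInstance) _ id := by
      refine @measurable_pathSpace Λ _ (_) _ fun l t => ?_
      refine @measurable_of_tendsto_metrizable _ _ (_) _ _ _ _ (fun n (f : PathSpace Λ) =>
        f l (up n t)) _ (fun n => ?_) ?_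
      · exact (measurable_pi_apply (l, n, ⌊t * 2 ^ n⌋₊ + 1)).comp
          (comap_measurable (gridValues (Λ := Λ)))
      · rw [tendsto_pi_nhds]
        exact fun f => tendsto_nhds_of_eventually_eq ((f l).isStep.tendsto_up t)
    intro s hs
    exact h hs

/-- Projections along the time axis of measurable sets of paths are universally measurable. -/
theorem UMeas.exists_time [Countable Λ] {C : Set (PathSpace Λ × ℝ≥0)} (hC : MeasurableSet C) :
    UMeas {f | ∃ t, (f, t) ∈ C} := by
  have h1 : (inferInstance : MeasurableSpace (PathSpace Λ × ℝ≥0)) =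
      MeasurableSpace.comap (Prod.map (gridValues (Λ := Λ)) id) inferInstance := by
    change MeasurableSpace.comap Prod.fst _ ⊔ MeasurableSpace.comap Prod.snd _ =
      MeasurableSpace.comap _ (MeasurableSpace.comap Prod.fst _ ⊔ MeasurableSpace.comap Prod.snd _)
    rw [MeasurableSpace.comap_sup, MeasurableSpace.comap_comp, MeasurableSpace.comap_comp,
      ← comap_gridValues, MeasurableSpace.comap_comp]
    rfl
  change MeasurableSet[inferInstance] C at hC
  rw [h1] at hC
  obtain ⟨C', hC', rfl⟩ := hC
  have h2 : {f : PathSpace Λ | ∃ t, (f, t) ∈ Prod.map gridValues id ⁻¹' C'} =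
      gridValues ⁻¹' (Prod.fst '' C') := by
    ext f
    constructor
    · rintro ⟨t, ht⟩
      exact ⟨_, ht, rfl⟩
    · rintro ⟨⟨x, t⟩, h, rfl⟩
      exact ⟨t, h⟩
  rw [h2]
  refine UMeas.preimage (fun μ _ => AnalyticSet.nullMeasurableSet
    (hC'.analyticSet_image measurable_fst) μ) ?_
  exact measurable_pi_lambda _ fun q => measurable_apply _ _

/-- A pair of families of paths is one family over the disjoint union of the labels. -/
theorem UMeas.exists_time_prod [Countable Λ] {C : Set ((PathSpace Λ × PathSpace Λ) × ℝ≥0)}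
    (hC : MeasurableSet C) : UMeas {q | ∃ t, (q, t) ∈ C} := by
  let φ : PathSpace (Λ ⊕ Λ) → PathSpace Λ × PathSpace Λ := fun h => (fun l => h (.inl l), fun l => h (.inr l))
  have hφ : Measurable φ := (measurable_pi_lambda _ fun l => measurable_pi_apply _).prodMk
    (measurable_pi_lambda _ fun l => measurable_pi_apply _)
  let ψ : PathSpace Λ × PathSpace Λ → PathSpace (Λ ⊕ Λ) := fun q => Sum.elim q.1 q.2
  have hψ : Measurable ψ := by
    refine measurable_pi_lambda _ fun l => ?_
    rcases l with l | l
    · exact (measurable_pi_apply l).comp measurable_fst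
    · exact (measurable_pi_apply l).comp measurable_snd
  exact (UMeas.exists_time (C := (fun x : PathSpace (Λ ⊕ Λ) × ℝ≥0 => (φ x.1, x.2)) ⁻¹' C)
    ((hφ.comp measurable_fst).prodMk measurable_snd hC)).preimage hψ

/-! ### The law of the family of walks -/

/-- The family of paths as a random variable. -/
def ofFamily (F : Λ → ℝ≥0 → Ω → ℤ) (hs : ∀ l ω, IsStep fun t => F l t ω) (h0 : ∀ l ω, F l 0 ω = 0)
    (ω : Ω) : PathSpace Λ := fun l => ⟨fun t => F l t ω, hs l ω, h0 l ω⟩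

theorem IsMeshFamily.map {F : Λ → ℝ≥0 → Ω → ℤ} (hF : IsMeshFamily P F) :
    IsMeshFamily (P.map (ofFamily F hF.step hF.zero)) coord := by
  have := hF.isProbabilityMeasure
  have hm : Measurable (ofFamily F hF.step hF.zero) := measurable_pathSpace hF.measurable
  have := Measure.isProbabilityMeasure_map (μ := P) hm.aemeasurable
  refine isMeshFamily_of_prod measurable_coord (fun l f => (f l).isStep) (fun l f => (f l).zero)
    fun n I x => ?_
  rw [Measure.map_apply hm (Finset.measurableSet_biInter _ fun q _ =>
    measurable_incr measurable_coord n q (measurableSet_singleton _))]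
  have h : ofFamily F hF.step hF.zero ⁻¹' (⋂ q ∈ I, incr coord n q ⁻¹' {x q}) =
      ⋂ q ∈ I, incr F n q ⁻¹' {x q} := by
    ext ω; simp [incr, coord, ofFamily]
  rw [h, (hF.indep n).meas_biInter (s := fun q => incr F n q ⁻¹' {x q}) fun q _ =>
        ⟨{x q}, measurableSet_singleton _, rfl⟩]
  refine Finset.prod_congr rfl fun q _ => ?_
  rw [← hF.law n q, Measure.map_apply (measurable_incr hF.measurable n q)
      (measurableSet_singleton _)]

/-- The law of a family of independent walks is unique. -/
theorem IsMeshFamily.unique {μ ν : Measure (PathSpace Λ)} (hμ : IsMeshFamily μ coord)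
    (hν : IsMeshFamily ν coord) : μ = ν := by
  have := hμ.isProbabilityMeasure
  have := hν.isProbabilityMeasure
  set X : ℕ → PathSpace Λ → Λ × ℕ → ℤ := fun n f q => incr coord n q f with hX
  have hXm : ∀ n, Measurable (X n) := fun n => measurable_pi_lambda _ (measurable_incr measurable_coord n)
  -- Events determined by the increments of one level. They form a π-system because two levels have
  -- a common refinement.
  set C : Set (Set (PathSpace Λ)) := {s | ∃ n B, MeasurableSet B ∧ X n ⁻¹' B = s} with hC
  have hrefine : ∀ n d (B : Set (Λ × ℕ → ℤ)), MeasurableSet B →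
      ∃ B', MeasurableSet B' ∧ X (n + d) ⁻¹' B' = X n ⁻¹' B := by
    intro n d B hB
    refine ⟨(fun y q => ∑ i ∈ Finset.range (2 ^ d), y (q.1, q.2 * 2 ^ d + i)) ⁻¹' B, ?_, ?_⟩
    · have h : Measurable fun (y : Λ × ℕ → ℤ) (q : Λ × ℕ) =>
          ∑ i ∈ Finset.range (2 ^ d), y (q.1, q.2 * 2 ^ d + i) :=
        measurable_pi_lambda _ fun q => Finset.measurable_sum _ fun i _ => measurable_pi_apply _
      exact h hB
    · ext f
      simp only [Set.mem_preimage]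
      have : X n f = fun q : Λ × ℕ => ∑ i ∈ Finset.range (2 ^ d), X (n + d) f (q.1, q.2 * 2 ^ d + i) :=
        funext fun q => IsMeshFamily.incr_refine coord n d q f
      rw [this]
  refine ext_of_generate_finite C ?_ ?_ ?_ (by simp)
  · apply le_antisymm
    · have h : @Measurable (PathSpace Λ) (PathSpace Λ) (MeasurableSpace.generateFrom C) _ id := by
        refine @measurable_pathSpace Λ _ (_) _ fun l t => ?_
        refine @measurable_of_tendsto_metrizable _ _ (_) _ _ _ _ (fun n (f : PathSpace Λ) =>
          f l (up n t)) _ (fun n => ?_) ?_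
        · have h1 : ∀ q, @Measurable _ _ (MeasurableSpace.generateFrom C) _ fun f => X n f q :=
            fun q s hs => MeasurableSpace.measurableSet_generateFrom
              ⟨n, (fun y => y q) ⁻¹' s, measurable_pi_apply q hs, rfl⟩
          have h2 : (fun f : PathSpace Λ => f l (up n t)) = fun f =>
              ∑ i ∈ Finset.range (⌊t * 2 ^ n⌋₊ + 1), X n f (l, i) :=
            funext fun f => hμ.apply_grid n _ l f
          rw [h2]
          exact @Finset.measurable_sum _ _ _ _ _ _ (_) _ _ fun i _ => h1 _
        · rw [tendsto_pi_nhds]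
          exact fun f => tendsto_nhds_of_eventually_eq ((f l).isStep.tendsto_up t)
      intro s hs
      exact h hs
    · refine MeasurableSpace.generateFrom_le ?_
      rintro s ⟨n, B, hB, rfl⟩
      exact hXm n hB
  · rintro s ⟨n, B, hB, rfl⟩ s' ⟨n', B', hB', rfl⟩ _
    obtain ⟨B₁, h1, h1'⟩ := hrefine n n' B hB
    obtain ⟨B₂, h2, h2'⟩ := hrefine n' n B' hB'
    rw [add_comm n' n] at h2'
    exact ⟨n + n', B₁ ∩ B₂, h1.inter h2, by rw [Set.preimage_inter, h1', h2']⟩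
  · rintro s ⟨n, B, hB, rfl⟩
    rw [← Measure.map_apply (hXm n) hB, ← Measure.map_apply (hXm n) hB]
    have h1 := (iIndepFun_iff_map_fun_eq_infinitePi_map (measurable_incr measurable_coord n)).1
      (hμ.indep n)
    have h2 := (iIndepFun_iff_map_fun_eq_infinitePi_map (measurable_incr measurable_coord n)).1
      (hν.indep n)
    simp only [hμ.law, hν.law] at h1 h2
    change μ.map (fun f q => incr coord n q f) B = ν.map (fun f q => incr coord n q f) B
    rw [h1, h2]

/-! ### Stopping and restarting -/

theorem IsStep.stopped {f : ℝ≥0 → ℤ} (hf : IsStep f) (s : ℝ≥0) : IsStep fun t => f (min t s) where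
  right_cont t := by
    rcases lt_or_ge t s with h | h
    · filter_upwards [hf.right_cont t, nhdsWithin_le_nhds (Iio_mem_nhds h)] with v h1 h2
      rw [min_eq_left (le_of_lt h2), min_eq_left h.le, h1]
    · filter_upwards [self_mem_nhdsWithin] with v hv
      rw [min_eq_right h, min_eq_right (h.trans (le_of_lt hv))]
  left_lim t ht := by
    rcases le_or_gt t s with h | h
    · obtain ⟨n, h1, h2⟩ := hf.left_lim t ht
      refine ⟨n, by rwa [min_eq_left h], ?_⟩
      filter_upwards [h2, self_mem_nhdsWithin] with v h3 h4
      rw [min_eq_left ((le_of_lt h4).trans h), h3]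
    · refine ⟨f s, by simp [min_eq_right h.le], ?_⟩
      filter_upwards [nhdsWithin_le_nhds (Ioi_mem_nhds h)] with v hv
      rw [min_eq_right (le_of_lt hv)]

/-- The path `f l` stopped at time `σ l`. -/
def stopAt (s : Λ → ℝ≥0) (f : PathSpace Λ) : PathSpace Λ := fun l =>
  ⟨fun t => f l (min t (s l)), (f l).isStep.stopped _, by simp⟩

/-- The path `f l` restarted at time `s l`. -/
def futAt (s : Λ → ℝ≥0) (f : PathSpace Λ) : PathSpace Λ := fun l =>
  ⟨fun t => f l (s l + t) - f l (s l), ((f l).isStep.shift _).sub_const _, by simp⟩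

/-- The times `σ l` are, on a set `R` of full measure, determined by the paths up to these
times. -/
structure IsStopping (μ : Measure (PathSpace Λ)) (σ : PathSpace Λ → Λ → ℝ≥0)
    (R : Set (PathSpace Λ)) : Prop where
  meas : ∀ l, Measurable fun f => σ f l
  countable : ∀ N : ℕ, (Set.range fun f l => ⌊σ f l * 2 ^ N⌋₊ + 1).Countable
  measR : MeasurableSet R
  full : ∀ᵐ f ∂μ, f ∈ R
  -- Galmarino's test in place of adaptedness: changing the paths after the times `σ f l` changes
  -- neither these times nor the membership in `R`.
  agree : ∀ f ∈ R, ∀ g : PathSpace Λ, (∀ l, ∀ t ≤ σ f l, g l t = f l t) → g ∈ R ∧ σ g = σ f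

namespace IsStopping

variable {μ : Measure (PathSpace Λ)} {σ : PathSpace Λ → Λ → ℝ≥0} {R : Set (PathSpace Λ)}

theorem measurable_stopAt (h : IsStopping μ σ R) : Measurable fun f => stopAt (σ f) f :=
  measurable_pathSpace fun l t => Measurable.eval (φ := fun f : PathSpace Λ => f l)
    (τ := fun f => min t (σ f l)) (measurable_pi_apply l) (measurable_const.min (h.meas l))

theorem measurable_fut (h : IsStopping μ σ R) : Measurable fun f => futAt (σ f) f :=
  measurable_pathSpace fun l _ =>
    (Measurable.eval (measurable_pi_apply l) ((h.meas l).add_const _)).sub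
      (Measurable.eval (measurable_pi_apply l) (h.meas l))

theorem stop_agree (f : PathSpace Λ) (l : Λ) (t : ℝ≥0) (ht : t ≤ σ f l) :
    stopAt (σ f) f l t = f l t := by
  change f l (min t (σ f l)) = _
  rw [min_eq_left ht]

/-- The stopped and the restarted paths are independent, and the law of the latter is the law of
the walks. -/
theorem map_stop_fut [Countable Λ] (h : IsStopping μ σ R) (hμ : IsMeshFamily μ coord) :
    μ.map (fun f => (stopAt (σ f) f, futAt (σ f) f)) = (μ.map fun f => stopAt (σ f) f).prod μ := by
  have := hμ.isProbabilityMeasure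
  have := Measure.isProbabilityMeasure_map (μ := μ) h.measurable_stopAt.aemeasurable
  symm
  refine Measure.prod_eq fun A B hA hB => ?_
  rw [Measure.map_apply (h.measurable_stopAt.prodMk h.measurable_fut) (hA.prod hB),
    Measure.map_apply h.measurable_stopAt hA]
  set A' : Set (PathSpace Λ) := (fun f => stopAt (σ f) f) ⁻¹' A ∩ R with hA'
  have hAm : MeasurableSet A' := (h.measurable_stopAt hA).inter h.measR
  have hAE : (fun f => stopAt (σ f) f) ⁻¹' A =ᵐ[μ] A' := by
    filter_upwards [h.full] with f hf
    exact propext ⟨fun h => ⟨h, hf⟩, fun h => h.1⟩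
  have hAB : (fun f => (stopAt (σ f) f, futAt (σ f) f)) ⁻¹' A ×ˢ B =ᵐ[μ]
      (A' ∩ (fun f => futAt (σ f) f) ⁻¹' B : Set (PathSpace Λ)) := by
    filter_upwards [h.full] with f hf
    exact propext ⟨fun h => ⟨⟨h.1, hf⟩, h.2⟩, fun h => ⟨h.1.1, h.2⟩⟩
  rw [measure_congr hAE, measure_congr hAB]
  rcases eq_or_ne (μ A') 0 with h0 | h0
  · rw [h0, zero_mul]
    exact measure_mono_null Set.inter_subset_left h0
  have := (Set.countable_iUnion h.countable).to_subtype
  have hmesh : IsMeshFamily μ[|A'] (restart coord fun l f => σ f l) := by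
    refine hμ.strongMarkov (ι := ⋃ N : ℕ, Set.range fun f l => ⌊σ f l * 2 ^ N⌋₊ + 1) h.meas
      (κ := fun _ i => i.1) ?_ hAm h0 ?_
    · intro N f
      exact ⟨⟨_, Set.mem_iUnion.2 ⟨N, f, rfl⟩⟩, fun l => rfl⟩
    rintro N ⟨κ, -⟩
    dsimp only
    set s : Λ → ℝ≥0 := fun l => grid N (κ l) with hs
    set Q : Set (PathSpace Λ) := A' ∩ {f | ∀ l, ⌊σ f l * 2 ^ N⌋₊ + 1 = κ l} with hQ
    have hQm : MeasurableSet Q := by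
      refine hAm.inter ?_
      have : {f : PathSpace Λ | ∀ l, ⌊σ f l * 2 ^ N⌋₊ + 1 = κ l} =
          ⋂ l, (fun f => ⌊σ f l * 2 ^ N⌋₊ + 1) ⁻¹' {κ l} := by ext; simp
      rw [this]
      exact MeasurableSet.iInter fun l => ((Nat.measurable_floor.comp ((h.meas l).mul_const _)).add_const
        1) (measurableSet_singleton _)
    have hlt : ∀ f : PathSpace Λ, (∀ l, ⌊σ f l * 2 ^ N⌋₊ + 1 = κ l) → ∀ l, σ f l < s l := by
      intro f hf l
      rw [hs]
      dsimp only
      rw [← hf l]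
      exact lt_up N _
    -- Galmarino's test shows that `Q` is not affected by changes after `s`. Hence `Q` is its own
    -- preimage under stopping at `s`, and belongs to the past.
    have hkey : ∀ f g : PathSpace Λ, (∀ l, ∀ t ≤ s l, g l t = f l t) → f ∈ Q → g ∈ Q := by
      rintro f g hfg ⟨⟨h1, h2⟩, h3⟩
      have h4 : ∀ l, ∀ t ≤ σ f l, g l t = f l t := fun l t ht =>
        hfg l t (ht.trans (hlt f h3 l).le)
      obtain ⟨h5, h6⟩ := h.agree f h2 g h4
      refine ⟨⟨?_, h5⟩, fun l => by rw [h6]; exact h3 l⟩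
      have : stopAt (σ g) g = stopAt (σ f) f := by
        rw [h6]
        funext l
        exact Subtype.ext (funext fun t => h4 l _ (min_le_right _ _))
      simpa only [Set.mem_preimage, this] using h1
    have hQs : Q = stopAt s ⁻¹' Q := by
      ext f
      have h1 : ∀ l, ∀ t ≤ s l, stopAt s f l t = f l t := fun l t ht => by
        change f l (min t (s l)) = _
        rw [min_eq_left ht]
      exact ⟨fun hf => hkey f _ h1 hf, fun hf => hkey _ f (fun l t ht => (h1 l t ht).symm) hf⟩
    have hst : @Measurable (PathSpace Λ) (PathSpace Λ) (pastSigma coord s) MeasurableSpace.pi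
        (stopAt s) := by
      refine @measurable_pathSpace Λ _ (pastSigma coord s) (stopAt s) fun l t => ?_
      exact measurable_pastSigma (F := coord) (l := l) (min_le_right t (s l))
    have hres := @hst Q hQm
    rwa [← hQs] at hres
  have := cond_isProbabilityMeasure h0
  have hlaw : (μ[|A']).map (fun f => futAt (σ f) f) = μ := hmesh.map.unique hμ
  have h1 : (μ[|A']) ((fun f => futAt (σ f) f) ⁻¹' B) = μ B := by
    rw [← Measure.map_apply h.measurable_fut hB, hlaw]
  rw [cond_apply hAm] at h1
  rw [← h1, ← mul_assoc, ENNReal.mul_inv_cancel h0 (measure_ne_top _ _), one_mul]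

/-- Conditioning on the past: the probability of an event given the stopped paths is computed by
averaging over independent restarted paths. -/
theorem measure_inter_le [Countable Λ] (h : IsStopping μ σ R) (hμ : IsMeshFamily μ coord)
    {A G : Set (PathSpace Λ)} (hA : UMeas A)
    (hAR : ∀ f ∈ R, ∀ g : PathSpace Λ, (∀ l, ∀ t ≤ σ f l, g l t = f l t) → f ∈ A → g ∈ A)
    (hG : MeasurableSet G) (hAG : A ⊆ G) {C : Set (PathSpace Λ × PathSpace Λ)}
    (hC : UMeas C) {ε : ℝ≥0∞} (hε : ∀ s ∈ G, μ {g | (s, g) ∈ C} ≤ ε) :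
    μ (A ∩ {f | (stopAt (σ f) f, futAt (σ f) f) ∈ C}) ≤ ε * μ A := by
  have := hμ.isProbabilityMeasure
  have hprob := Measure.isProbabilityMeasure_map (μ := μ) h.measurable_stopAt.aemeasurable
  set ν := μ.map fun f => stopAt (σ f) f with hν
  have hA1 : ∀ᵐ f ∂μ, f ∈ A ↔ stopAt (σ f) f ∈ A := by
    filter_upwards [h.full] with f hf
    have h1 := stop_agree (σ := σ) f
    obtain ⟨h2, h3⟩ := h.agree f hf _ h1
    exact ⟨hAR f hf _ h1, hAR _ h2 f fun l t ht => (h1 l t (by rwa [h3] at ht)).symm⟩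
  -- `A` is replaced by a measurable set up to a null set of the law of the stopped paths. The
  -- intersection with `G` keeps the bound `hε` available at every one of its points.
  obtain ⟨A₁, hA₁m, hA₁⟩ := hA ν inferInstance
  set A' := A₁ ∩ G with hA'
  have hA'm : MeasurableSet A' := hA₁m.inter hG
  have hAA' : A' =ᵐ[ν] A := by
    filter_upwards [hA₁] with s hs
    refine propext ⟨fun h => ?_, fun h => ⟨?_, hAG h⟩⟩
    · exact (Iff.of_eq hs).2 h.1
    · exact (Iff.of_eq hs).1 h
  have h2 : ∀ᵐ f ∂μ, stopAt (σ f) f ∈ A' ↔ f ∈ A := by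
    have := ae_of_ae_map h.measurable_stopAt.aemeasurable hAA'
    filter_upwards [this, hA1] with f h3 h4
    exact (Iff.of_eq h3).trans h4.symm
  have h3 : μ A = ν A' := by
    rw [hν, Measure.map_apply h.measurable_stopAt hA'm]
    exact measure_congr (by filter_upwards [h2] with f hf; exact propext hf.symm)
  -- A measurable subset of `C`, so that the bound on the sections of `C` is inherited by all its
  -- sections.
  obtain ⟨C₀, hC₀, hC₀m, hC₀C⟩ := (hC (ν.prod μ) inferInstance).exists_measurable_subset_ae_eq
  have h5 : ∀ᵐ f ∂μ, (stopAt (σ f) f, futAt (σ f) f) ∈ C₀ ↔ (stopAt (σ f) f, futAt (σ f) f) ∈ C := by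
    rw [hν, ← h.map_stop_fut hμ] at hC₀C
    filter_upwards [ae_of_ae_map (h.measurable_stopAt.prodMk h.measurable_fut).aemeasurable hC₀C]
      with f hf
    exact Iff.of_eq hf
  have h4 : μ (A ∩ {f | (stopAt (σ f) f, futAt (σ f) f) ∈ C}) =
      (ν.prod μ) (C₀ ∩ Prod.fst ⁻¹' A') := by
    rw [hν, ← h.map_stop_fut hμ, Measure.map_apply (h.measurable_stopAt.prodMk h.measurable_fut)
      (hC₀m.inter (measurable_fst hA'm))]
    refine measure_congr ?_
    filter_upwards [h2, h5] with f hf hf'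
    exact propext ⟨fun h => ⟨hf'.2 h.2, hf.2 h.1⟩, fun h => ⟨hf.1 h.2, hf'.1 h.1⟩⟩
  rw [h3, h4, Measure.prod_apply (hC₀m.inter (measurable_fst hA'm))]
  calc ∫⁻ s, μ (Prod.mk s ⁻¹' (C₀ ∩ Prod.fst ⁻¹' A')) ∂ν
      ≤ ∫⁻ s, A'.indicator (fun _ => ε) s ∂ν := by
        refine lintegral_mono fun s => ?_
        by_cases hs : s ∈ A'
        · rw [Set.indicator_of_mem hs]
          exact (measure_mono fun g (hg : (s, g) ∈ C₀ ∩ Prod.fst ⁻¹' A') => hC₀ hg.1).trans (hε s hs.2)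
        · rw [Set.indicator_of_notMem hs, nonpos_iff_eq_zero]
          convert measure_empty (μ := μ)
          ext g
          simp [hs]
    _ = ε * ν A' := by rw [lintegral_indicator_const hA'm]

end IsStopping

end

section
variable {Λ : Type*} {μ : Measure (PathSpace Λ)}

/-! ### Exponential bounds -/

/-- The weighted sum of the exponentials of the walks exceeds a growing exponential with small
probability. -/
theorem IsMeshFamily.exceed [Countable Λ] (hμ : IsMeshFamily μ coord) (c : Λ → ℝ≥0∞) {v q : ℝ}
    (hv : psi v ≤ q) (h : ℝ) :
    μ {f | ∃ t : ℝ≥0, ENNReal.ofReal (Real.exp (q * t + h)) ≤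
      ∑' l, c l * ENNReal.ofReal (Real.exp (v * f l t))} ≤
        ENNReal.ofReal (Real.exp (-h)) * ∑' l, c l := by
  set S := {f : PathSpace Λ | ∃ t : ℝ≥0, ENNReal.ofReal (Real.exp (q * t + h)) ≤
      ∑' l, c l * ENNReal.ofReal (Real.exp (v * f l t))} with hS
  rcases eq_or_ne (∑' l, c l) ∞ with hc | hc
  · rw [hc, ENNReal.mul_top (by simp [Real.exp_pos])]
    exact le_top
  have hcl : ∀ l, c l ≠ ∞ := ENNReal.ne_top_of_tsum_ne_top hc
  have h1 : ENNReal.ofReal (Real.exp h) * μ S ≤ ∑' l, c l := by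
    refine ENNReal.mul_le_of_forall_lt fun ε hε m hm => ?_
    refine le_trans ?_ (hμ.maximal c hcl v (ε := ε))
    refine mul_le_mul' le_rfl (hm.le.trans (measure_mono ?_))
    rintro f ⟨t, ht⟩
    refine ⟨t, hε.trans_le ?_⟩
    have h2 : ∑' l, c l * expFun v (coord l t f) t =
        ENNReal.ofReal (Real.exp (-(psi v * t))) *
          ∑' l, c l * ENNReal.ofReal (Real.exp (v * f l t)) := by
      rw [← ENNReal.tsum_mul_left]
      refine tsum_congr fun l => ?_
      rw [mul_left_comm, ← ENNReal.ofReal_mul (Real.exp_pos _).le, ← Real.exp_add, expFun, coord]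
      ring_nf
    rw [h2]
    refine le_trans ?_ (mul_le_mul' le_rfl ht)
    rw [← ENNReal.ofReal_mul (Real.exp_pos _).le, ← Real.exp_add]
    refine ENNReal.ofReal_le_ofReal (Real.exp_le_exp.2 ?_)
    have := mul_le_mul_of_nonneg_right hv t.2
    simp only [NNReal.val_eq_coe] at this
    linarith
  calc μ S = ENNReal.ofReal (Real.exp (-h)) * (ENNReal.ofReal (Real.exp h) * μ S) := by
        rw [← mul_assoc, ← ENNReal.ofReal_mul (Real.exp_pos _).le, ← Real.exp_add]; simp
    _ ≤ _ := mul_le_mul' le_rfl h1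

theorem IsMeshFamily.exceed_single [Countable Λ] (hμ : IsMeshFamily μ coord) (l : Λ) {v q : ℝ}
    (hv : psi v ≤ q) (h : ℝ) :
    μ {f | ∃ t : ℝ≥0, q * t + h ≤ v * f l t} ≤ ENNReal.ofReal (Real.exp (-h)) := by
  classical
  have h1 := hμ.exceed (Pi.single l 1) hv h
  rw [tsum_eq_single l fun l' hl => by simp [hl]] at h1
  simp only [Pi.single_eq_same, mul_one] at h1
  refine (measure_mono ?_).trans h1
  rintro f ⟨t, ht⟩
  refine ⟨t, ?_⟩
  rw [tsum_eq_single l fun l' hl => by simp [hl]]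
  simp only [Pi.single_eq_same, one_mul]
  exact ENNReal.ofReal_le_ofReal (Real.exp_le_exp.2 ht)

/-- The excess of a path over a line of slope `β`. -/
def slack (β : ℝ) (f : ℝ≥0 → ℤ) : ℝ≥0∞ := ⨆ t : ℝ≥0, ENNReal.ofReal (f t - β * t)

theorem le_slack (β : ℝ) (f : ℝ≥0 → ℤ) (t : ℝ≥0) : ENNReal.ofReal (f t - β * t) ≤ slack β f :=
  le_iSup (fun t : ℝ≥0 => ENNReal.ofReal (f t - β * t)) t

theorem le_add_slack {β : ℝ} {f : ℝ≥0 → ℤ} (hf : slack β f ≠ ∞) (t : ℝ≥0) :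
    (f t : ℝ) ≤ β * t + (slack β f).toReal := by
  have := (ENNReal.ofReal_le_iff_le_toReal hf).1 (le_slack β f t)
  linarith

theorem slack_eq_grid (β : ℝ) {f : ℝ≥0 → ℤ} (hf : IsStep f) :
    slack β f = ⨆ q : ℕ × ℕ, ENNReal.ofReal (f (grid q.1 q.2) - β * grid q.1 q.2) := by
  apply le_antisymm
  · refine iSup_le fun t => ?_
    have h1 : Tendsto (fun n => ENNReal.ofReal (f (up n t) - β * up n t)) atTop
        (𝓝 (ENNReal.ofReal (f t - β * t))) := by
      refine ENNReal.tendsto_ofReal (Tendsto.sub ?_ (Tendsto.const_mul _ ?_))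
      · exact tendsto_nhds_of_eventually_eq ((hf.tendsto_up t).mono fun n hn => by rw [hn])
      · exact (NNReal.continuous_coe.tendsto t).comp ((tendsto_up t).mono_right nhdsWithin_le_nhds)
    refine le_of_tendsto' h1 fun n => ?_
    exact le_iSup (fun q : ℕ × ℕ => ENNReal.ofReal (f (grid q.1 q.2) - β * grid q.1 q.2))
      (n, ⌊t * 2 ^ n⌋₊ + 1)
  · exact iSup_le fun q => le_slack β f _

theorem measurable_slack (β : ℝ) : Measurable fun f : StepPath => slack β f := by
  have : (fun f : StepPath => slack β f) = fun f : StepPath =>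
      ⨆ q : ℕ × ℕ, ENNReal.ofReal (f (grid q.1 q.2) - β * grid q.1 q.2) :=
    funext fun f => slack_eq_grid β f.isStep
  rw [this]
  refine Measurable.iSup fun q => ENNReal.measurable_ofReal.comp (Measurable.sub_const ?_ _)
  exact (measurable_of_countable fun x : ℤ => (x : ℝ)).comp (measurable_eval _)

/-- The reflected path. -/
def StepPath.neg (f : StepPath) : StepPath :=
  ⟨fun t => -f t, f.isStep.map (g := fun x => -x) fun x y => by rw [← abs_neg]; ring_nf; rfl, by simp⟩

theorem StepPath.neg_apply (f : StepPath) (t : ℝ≥0) : f.neg t = -f t := rfl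

theorem StepPath.measurable_neg : Measurable StepPath.neg :=
  measurable_stepPath fun t => (measurable_eval t).neg

/-- The condition `psi u ≤ u * β` makes `exp (u (f t - β t))` a supermartingale, and exceeding the
line by `n` means that it exceeds `exp (u n)`. -/
theorem IsMeshFamily.slack_tail [Countable Λ] (hμ : IsMeshFamily μ coord) (l : Λ) {u β : ℝ}
    (hu : 0 < u) (hβ : psi u ≤ u * β) (n : ℕ) :
    μ {f | n < slack β (f l)} ≤ ENNReal.ofReal (Real.exp (-(u * n))) := by
  refine (measure_mono ?_).trans (hμ.exceed_single l hβ (u * n))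
  intro f hf
  obtain ⟨t, ht⟩ := lt_iSup_iff.1 (show (n : ℝ≥0∞) < ⨆ t : ℝ≥0, _ from hf)
  refine ⟨t, ?_⟩
  rw [← ENNReal.ofReal_natCast, ENNReal.ofReal_lt_ofReal_iff_of_nonneg (Nat.cast_nonneg n)] at ht
  nlinarith

theorem IsMeshFamily.slack_neg_tail [Countable Λ] (hμ : IsMeshFamily μ coord) (l : Λ) {u β : ℝ}
    (hu : 0 < u) (hβ : psi u ≤ u * β) (n : ℕ) :
    μ {f | n < slack β (f l).neg} ≤ ENNReal.ofReal (Real.exp (-(u * n))) := by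
  refine (measure_mono ?_).trans (hμ.exceed_single l (v := -u) (q := u * β) (by rwa [psi_neg]) (u * n))
  intro f hf
  obtain ⟨t, ht⟩ := lt_iSup_iff.1 (show (n : ℝ≥0∞) < ⨆ t : ℝ≥0, _ from hf)
  refine ⟨t, ?_⟩
  rw [← ENNReal.ofReal_natCast, ENNReal.ofReal_lt_ofReal_iff_of_nonneg (Nat.cast_nonneg n)] at ht
  rw [StepPath.neg_apply] at ht
  push_cast at ht ⊢
  nlinarith

/-! ### Moments from tails -/

/-- If `n < X ≤ n + 1`, then `X ^ k` is at most the term of index `n` alone; if `X = ∞`, the sum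
diverges. -/
theorem lintegral_pow_lt_top_of_tail {Ω : Type*} [MeasurableSpace Ω] {P : Measure Ω}
    {X : Ω → ℝ≥0∞} (hX : Measurable X) (k : ℕ) {b : ℕ → ℝ}
    (hb : ∀ n : ℕ, P {ω | n < X ω} ≤ ENNReal.ofReal (b n))
    (hs : Summable fun n : ℕ => ((n : ℝ) + 1) ^ k * b n) (hk : k ≠ 0) :
    ∫⁻ ω, X ω ^ k ∂P < ∞ := by
  have h1 : ∀ ω, X ω ^ k ≤ ∑' n : ℕ, ((n : ℝ≥0∞) + 1) ^ k * {ω | (n : ℝ≥0∞) < X ω}.indicator 1 ω := by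
    intro ω
    rcases eq_or_ne (X ω) ∞ with hω | hω
    · have : ∑' n : ℕ, ((n : ℝ≥0∞) + 1) ^ k * {ω | (n : ℝ≥0∞) < X ω}.indicator 1 ω = ∞ := by
        rw [← top_le_iff, ← ENNReal.tsum_const_eq_top_of_ne_zero (α := ℕ) (one_ne_zero)]
        refine ENNReal.tsum_le_tsum fun n => ?_
        rw [Set.indicator_of_mem (by simp [hω])]
        simpa using one_le_pow₀ (M₀ := ℝ≥0∞) (a := (n : ℝ≥0∞) + 1) le_add_self
      rw [this]; exact le_top
    · rcases eq_or_ne (X ω) 0 with h0 | h0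
      · simp [h0, hk]
      obtain ⟨n, hn1, hn2⟩ : ∃ n : ℕ, (n : ℝ≥0∞) < X ω ∧ X ω ≤ n + 1 := by
        lift X ω to ℝ≥0 using hω with x hx
        have hx0 : 0 < x := pos_iff_ne_zero.2 (by simpa using h0)
        have h2 : 1 ≤ ⌈x⌉₊ := Nat.one_le_iff_ne_zero.2 (by simpa using hx0.ne')
        refine ⟨⌈x⌉₊ - 1, ?_, ?_⟩
        · have : ((⌈x⌉₊ - 1 : ℕ) : ℝ≥0) < x := by
            apply Nat.lt_ceil.1; omega
          exact_mod_cast this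
        · have : x ≤ ((⌈x⌉₊ - 1 : ℕ) : ℝ≥0) + 1 := by
            have h3 := Nat.le_ceil x
            have h4 : ((⌈x⌉₊ - 1 : ℕ) : ℝ≥0) + 1 = (⌈x⌉₊ : ℝ≥0) := by
              exact_mod_cast Nat.sub_add_cancel h2
            rw [h4]; exact h3
          exact_mod_cast this
      refine le_trans ?_ (ENNReal.le_tsum n)
      rw [Set.indicator_of_mem (by exact hn1)]
      simpa using pow_le_pow_left' hn2 k
  have hm : ∀ n : ℕ, MeasurableSet {ω | (n : ℝ≥0∞) < X ω} := fun n => measurableSet_lt measurable_const hX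
  calc ∫⁻ ω, X ω ^ k ∂P ≤ ∫⁻ ω, ∑' n : ℕ, ((n : ℝ≥0∞) + 1) ^ k *
        {ω | (n : ℝ≥0∞) < X ω}.indicator 1 ω ∂P := lintegral_mono h1
    _ = ∑' n : ℕ, ((n : ℝ≥0∞) + 1) ^ k * P {ω | (n : ℝ≥0∞) < X ω} := by
      rw [lintegral_tsum fun n => ((measurable_one.indicator (hm n)).const_mul _).aemeasurable]
      refine tsum_congr fun n => ?_
      rw [lintegral_const_mul _ (measurable_one.indicator (hm n)), lintegral_indicator_one (hm n)]
    _ ≤ ∑' n : ℕ, ENNReal.ofReal (((n : ℝ) + 1) ^ k * b n) := by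
      refine ENNReal.tsum_le_tsum fun n => ?_
      rw [ENNReal.ofReal_mul (by positivity), ENNReal.ofReal_pow (by positivity),
        ENNReal.ofReal_add (by positivity) (by positivity)]
      simpa using mul_le_mul' le_rfl (hb n)
    _ < ∞ := hs.tsum_ofReal_lt_top

theorem ae_ne_top_of_lintegral_pow {Ω : Type*} [MeasurableSpace Ω] {P : Measure Ω}
    {X : Ω → ℝ≥0∞} (hX : Measurable X) {k : ℕ} (h : ∫⁻ ω, X ω ^ k ∂P < ∞) (hk : k ≠ 0) :
    ∀ᵐ ω ∂P, X ω ≠ ∞ := by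
  filter_upwards [ae_lt_top (hX.pow_const k) h.ne] with ω hω h2
  simp [h2, hk] at hω

theorem memLp_toReal_of_lintegral_pow {Ω : Type*} [MeasurableSpace Ω] {P : Measure Ω}
    {X : Ω → ℝ≥0∞} (hX : Measurable X) {k : ℕ} (h : ∫⁻ ω, X ω ^ k ∂P < ∞) (hk : k ≠ 0) :
    MemLp (fun ω => (X ω).toReal) k P := by
  refine ⟨hX.ennreal_toReal.aestronglyMeasurable, ?_⟩
  rw [eLpNorm_lt_top_iff_lintegral_rpow_enorm_lt_top (by simpa using hk) (by simp)]
  refine lt_of_le_of_lt (lintegral_mono fun ω => ?_) h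
  simp only [ENNReal.toReal_natCast, ENNReal.rpow_natCast]
  gcongr
  rw [Real.enorm_eq_ofReal ENNReal.toReal_nonneg]
  exact ENNReal.ofReal_toReal_le

theorem summable_pow_mul_exp (k : ℕ) {u : ℝ} (hu : 0 < u) :
    Summable fun n : ℕ => ((n : ℝ) + 1) ^ k * Real.exp (-(u * n)) := by
  have h := (summable_nat_add_iff 1).2 (Real.summable_pow_mul_exp_neg_nat_mul k hu)
  refine (h.mul_left (Real.exp u)).congr fun n => ?_
  push_cast
  rw [mul_left_comm, ← Real.exp_add]
  ring_nf

theorem IsMeshFamily.lintegral_slack_pow [Countable Λ] (hμ : IsMeshFamily μ coord) (l : Λ)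
    {u β : ℝ} (hu : 0 < u) (hβ : psi u ≤ u * β) {k : ℕ} (hk : k ≠ 0) :
    ∫⁻ f, slack β (f l) ^ k ∂μ < ∞ :=
  lintegral_pow_lt_top_of_tail ((measurable_slack β).comp (measurable_pi_apply l)) k
    (hμ.slack_tail l hu hβ) (summable_pow_mul_exp k hu) hk

theorem IsMeshFamily.lintegral_slack_neg_pow [Countable Λ] (hμ : IsMeshFamily μ coord) (l : Λ)
    {u β : ℝ} (hu : 0 < u) (hβ : psi u ≤ u * β) {k : ℕ} (hk : k ≠ 0) :
    ∫⁻ f, slack β (f l).neg ^ k ∂μ < ∞ :=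
  lintegral_pow_lt_top_of_tail ((measurable_slack β).comp
    (StepPath.measurable_neg.comp (measurable_pi_apply l))) k
    (hμ.slack_neg_tail l hu hβ) (summable_pow_mul_exp k hu) hk

/-! ### Hitting times as random variables -/

theorem measurable_hit (m : ℤ) : Measurable fun f : StepPath => hit f m := by
  have : (fun f : StepPath => hit f m) = fun f : StepPath =>
      ⨅ (q : ℕ × ℕ) (_ : f (grid q.1 q.2) = m), (grid q.1 q.2 : ℝ≥0∞) :=
    funext fun f => hit_eq_grid f.isStep m
  rw [this]
  refine Measurable.iInf fun q => ?_
  have h2 : (fun f : StepPath => ⨅ (_ : f (grid q.1 q.2) = m), (grid q.1 q.2 : ℝ≥0∞)) =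
      fun f : StepPath => if f (grid q.1 q.2) = m then (grid q.1 q.2 : ℝ≥0∞) else ∞ := by
    funext f
    split_ifs with h <;> simp [h]
  rw [h2]
  exact Measurable.ite (measurable_eval _ (measurableSet_singleton m)) measurable_const measurable_const

theorem measurable_hit_apply (l : Λ) (m : ℤ) : Measurable fun f : PathSpace Λ => hit (f l) m :=
  (measurable_hit m).comp (measurable_pi_apply l)

theorem IsMeshFamily.ae_hit_ne_top (hμ : IsMeshFamily μ coord) (l : Λ) (d : ℕ) :
    ∀ᵐ f ∂μ, hit (f l) d ≠ ∞ := by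
  have := hμ.isProbabilityMeasure
  obtain ⟨C, _, hC⟩ := hit_tail (Ω := PathSpace Λ) (Λ := Λ) d
  have h1 : Tendsto (fun n : ℕ => ENNReal.ofReal (C / √(n + 1 : ℝ≥0))) atTop (𝓝 0) := by
    rw [← ENNReal.ofReal_zero]
    refine ENNReal.tendsto_ofReal (tendsto_const_nhds.div_atTop ?_)
    push_cast
    exact Real.tendsto_sqrt_atTop.comp (tendsto_atTop_add_const_right _ _ tendsto_natCast_atTop_atTop)
  have h2 : μ {f | hit (f l) d = ∞} = 0 := by
    refine le_antisymm (ge_of_tendsto' h1 fun n => ?_) zero_le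
    refine (measure_mono fun f hf => ?_).trans (hC hμ l (n + 1) (by positivity))
    change ((n + 1 : ℝ≥0) : ℝ≥0∞) < hit (f l) d
    rw [show hit (f l) d = ∞ from hf]
    exact ENNReal.coe_lt_top
  rw [ae_iff]
  simpa using h2

/-! ### Staying below a line -/

/-- The path restarted at time `s`. -/
def StepPath.restart (s : ℝ≥0) (f : StepPath) : StepPath :=
  ⟨fun t => f (s + t) - f s, (f.isStep.shift _).sub_const _, by simp⟩

theorem StepPath.restart_apply (s : ℝ≥0) (f : StepPath) (t : ℝ≥0) :
    f.restart s t = f (s + t) - f s := rfl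

theorem StepPath.measurable_restart (s : ℝ≥0) : Measurable (StepPath.restart s) :=
  measurable_stepPath fun _ => (measurable_eval _).sub (measurable_eval _)

/-- Deterministic times are stopping times. -/
theorem IsStopping.const (s : Λ → ℝ≥0) : IsStopping μ (fun _ => s) Set.univ where
  meas l := measurable_const
  countable N := (Set.countable_singleton (fun l => ⌊s l * 2 ^ N⌋₊ + 1)).mono (by
    rintro _ ⟨f, rfl⟩; rfl)
  measR := MeasurableSet.univ
  full := Eventually.of_forall fun _ => Set.mem_univ _
  agree := fun _ _ _ _ => ⟨Set.mem_univ _, rfl⟩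

theorem IsMeshFamily.measure_stop_inter_fut [Countable Λ] (hμ : IsMeshFamily μ coord)
    (s : Λ → ℝ≥0) {A B : Set (PathSpace Λ)} (hA : MeasurableSet A) (hB : MeasurableSet B) :
    μ {f | stopAt s f ∈ A ∧ futAt s f ∈ B} = μ {f | stopAt s f ∈ A} * μ B := by
  have := hμ.isProbabilityMeasure
  have h := IsStopping.const (μ := μ) s
  have h1 := h.map_stop_fut hμ
  have h2 := congrArg (fun ν => ν (A ×ˢ B)) h1
  have := Measure.isProbabilityMeasure_map (μ := μ) h.measurable_stopAt.aemeasurable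
  rw [Measure.map_apply (h.measurable_stopAt.prodMk h.measurable_fut) (hA.prod hB),
    Measure.prod_prod, Measure.map_apply h.measurable_stopAt hA] at h2
  exact h2

theorem stopAt_apply (s : Λ → ℝ≥0) (f : PathSpace Λ) (l : Λ) (t : ℝ≥0) :
    stopAt s f l t = f l (min t (s l)) := rfl

theorem futAt_apply (s : Λ → ℝ≥0) (f : PathSpace Λ) (l : Λ) (t : ℝ≥0) :
    futAt s f l t = f l (s l + t) - f l (s l) := rfl

theorem lt_hit_iff (f : StepPath) {m : ℤ} (hm : 0 < m) {t : ℝ≥0} :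
    (t : ℝ≥0∞) < hit f m ↔ ∀ s ≤ t, f s < m := by
  constructor
  · intro h s hs
    exact lt_of_lt_hit f.isStep (by simpa using hm.le)
      (lt_of_le_of_lt (by exact_mod_cast hs) h)
  · intro h
    by_contra h1
    obtain ⟨u, hu, h2⟩ := (hit_le_iff f.isStep).1 (not_lt.1 h1)
    exact absurd (h u hu) (by omega)

/-- A path that stays below `1` until `t` is at most `0` there, and the path restarted at `t` may
again stay below `1`, independently. -/
theorem IsMeshFamily.lt_hit_add [Countable Λ] (hμ : IsMeshFamily μ coord) (l : Λ) (t η : ℝ≥0) :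
    μ {f | (t : ℝ≥0∞) < hit (f l) 1} * μ {f | (η : ℝ≥0∞) < hit (f l) 1} ≤
      μ {f | ((t + η : ℝ≥0) : ℝ≥0∞) < hit (f l) 1} := by
  have hm : ∀ s : ℝ≥0, MeasurableSet {f : PathSpace Λ | (s : ℝ≥0∞) < hit (f l) 1} := fun s =>
    measurableSet_lt measurable_const (measurable_hit_apply l 1)
  have h_agree : {f : PathSpace Λ | stopAt (fun _ => t) f ∈ {f : PathSpace Λ | (t : ℝ≥0∞) < hit (f l) 1}} =
      {f : PathSpace Λ | (t : ℝ≥0∞) < hit (f l) 1} := by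
    ext f
    simp only [Set.mem_ofPred_eq, lt_hit_iff _ one_pos, stopAt_apply]
    exact forall₂_congr fun s hs => by rw [min_eq_left hs]
  have h1 := hμ.measure_stop_inter_fut (fun _ => t) (hm t) (hm η)
  rw [h_agree] at h1
  rw [← h1]
  refine measure_mono ?_
  rintro f ⟨h2, h3⟩
  simp only [Set.mem_ofPred_eq, lt_hit_iff _ one_pos, stopAt_apply, futAt_apply] at h2 h3 ⊢
  intro s hs
  have h4 := h2 t le_rfl
  rw [min_self] at h4
  rcases le_total s t with h | h
  · have := h2 s h
    rwa [min_eq_left h] at this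
  · have := h3 (s - t) (tsub_le_iff_left.2 hs)
    rw [add_tsub_cancel_of_le h] at this
    omega

/-- For a short time `η` the exponential bound makes a visit to `1` unlikely;
`IsMeshFamily.lt_hit_add` multiplies such stretches until they cover `t`. -/
theorem IsMeshFamily.exists_pos_lt_hit [Countable Λ] (hμ : IsMeshFamily μ coord) (t : ℝ≥0) :
    ∃ q : ℝ≥0∞, 0 < q ∧ ∀ l : Λ, q ≤ μ {f | (t : ℝ≥0∞) < hit (f l) 1} := by
  have := hμ.isProbabilityMeasure
  obtain ⟨η, hη0, hη⟩ : ∃ η : ℝ≥0, 0 < η ∧ psi 1 * η ≤ 1 / 4 := by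
    have hp := psi_nonneg 1
    refine ⟨(1 / (4 * (psi 1 + 1))).toNNReal, Real.toNNReal_pos.2 (by positivity), ?_⟩
    · rw [Real.coe_toNNReal _ (by positivity)]
      rw [mul_one_div, div_le_div_iff₀ (by positivity) (by positivity)]
      linarith
  have hm : ∀ (l : Λ) (s : ℝ≥0), MeasurableSet {f : PathSpace Λ | (s : ℝ≥0∞) < hit (f l) 1} :=
    fun l s => measurableSet_lt measurable_const (measurable_hit_apply l 1)
  have h1 : ∀ l : Λ, ENNReal.ofReal (1 - Real.exp (-(3 / 4))) ≤ μ {f | (η : ℝ≥0∞) < hit (f l) 1} := by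
    intro l
    have h2 : μ {f : PathSpace Λ | (η : ℝ≥0∞) < hit (f l) 1}ᶜ ≤ ENNReal.ofReal (Real.exp (-(3 / 4))) := by
      refine (measure_mono ?_).trans (hμ.exceed_single l (v := 1) le_rfl (3 / 4))
      intro f hf
      obtain ⟨u, hu, h2⟩ := (hit_le_iff (f l).isStep).1 (not_lt.1 hf)
      refine ⟨u, ?_⟩
      rw [h2]
      have : psi 1 * u ≤ psi 1 * η := mul_le_mul_of_nonneg_left (by exact_mod_cast hu) (psi_nonneg 1)
      push_cast
      linarith
    rw [prob_compl_eq_one_sub (hm l η), tsub_le_iff_left] at h2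
    rw [ENNReal.ofReal_sub _ (Real.exp_pos _).le, ENNReal.ofReal_one]
    exact tsub_le_iff_right.2 h2
  have hpos : 0 < ENNReal.ofReal (1 - Real.exp (-(3 / 4))) := by
    rw [ENNReal.ofReal_pos]
    have := Real.exp_lt_exp.2 (show -(3 / 4 : ℝ) < 0 by norm_num)
    rw [Real.exp_zero] at this
    linarith
  have h2 : ∀ (k : ℕ) (l : Λ), ENNReal.ofReal (1 - Real.exp (-(3 / 4))) ^ k ≤
      μ {f | ((k * η : ℝ≥0) : ℝ≥0∞) < hit (f l) 1} := by
    intro k l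
    induction k with
    | zero =>
      have : {f : PathSpace Λ | (((0 : ℕ) * η : ℝ≥0) : ℝ≥0∞) < hit (f l) 1} = Set.univ := by
        ext f
        simp only [Nat.cast_zero, zero_mul, ENNReal.coe_zero, Set.mem_ofPred_eq, Set.mem_univ, iff_true]
        exact hit_pos (f l).isStep (by simp)
      rw [this]; simp
    | succ k ih =>
      rw [pow_succ]
      refine (mul_le_mul' ih (h1 l)).trans ((hμ.lt_hit_add l _ _).trans (le_of_eq ?_))
      congr! 4
      push_cast; ring
  obtain ⟨k, hk⟩ := Archimedean.arch t hη0
  refine ⟨_, ENNReal.pow_pos hpos k, fun l => (h2 k l).trans (measure_mono fun f hf => ?_)⟩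
  refine lt_of_le_of_lt ?_ (show ((k * η : ℝ≥0) : ℝ≥0∞) < hit (f l) 1 from hf)
  rw [nsmul_eq_mul] at hk
  exact_mod_cast hk

/-- A walk stays below a line of positive slope with positive probability. -/
theorem IsMeshFamily.exists_pos_le_floor [Countable Λ] (hμ : IsMeshFamily μ coord) {u α : ℝ}
    (hu : 0 < u) (hα : psi u ≤ u * α) (hα0 : 0 < α) :
    ∃ q : ℝ≥0∞, 0 < q ∧ ∀ l : Λ, ∃ S : Set StepPath, MeasurableSet S ∧
      (∀ f ∈ S, ∀ t : ℝ≥0, f t ≤ ⌊α * t⌋) ∧ q ≤ μ {f | f l ∈ S} := by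
  have := hμ.isProbabilityMeasure
  obtain ⟨n, hn⟩ := exists_nat_gt (1 / u)
  have hn0 : (0 : ℝ) < n := lt_trans (by positivity) hn
  have hun : 1 < u * n := by
    have := mul_lt_mul_of_pos_left hn hu
    rwa [mul_one_div_cancel hu.ne'] at this
  -- During `t₀` the path stays nonpositive while the line climbs to `n + 1`. This leaves room for a
  -- later slack of at most `n`, which has positive probability.
  obtain ⟨t₀, hαt⟩ : ∃ t₀ : ℝ≥0, α * t₀ = n + 1 :=
    ⟨((n + 1) / α).toNNReal, by rw [Real.coe_toNNReal _ (by positivity)]; field_simp⟩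
  obtain ⟨q, hq0, hq⟩ := hμ.exists_pos_lt_hit t₀
  have hexp : 0 < ENNReal.ofReal (1 - Real.exp (-1)) := by
    rw [ENNReal.ofReal_pos]
    have := Real.exp_lt_exp.2 (show -(1 : ℝ) < 0 by norm_num)
    rw [Real.exp_zero] at this
    linarith
  refine ⟨q * ENNReal.ofReal (1 - Real.exp (-1)), ENNReal.mul_pos hq0.ne' hexp.ne', fun l => ?_⟩
  have hslm : Measurable fun f : StepPath => slack α (f.restart t₀) :=
    (measurable_slack α).comp (StepPath.measurable_restart t₀)
  refine ⟨{f | (t₀ : ℝ≥0∞) < hit f 1} ∩ {f | slack α (f.restart t₀) ≤ n},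
    (measurableSet_lt measurable_const (measurable_hit 1)).inter
    (measurableSet_le hslm measurable_const), ?_, ?_⟩
  · rintro f ⟨h1, h2⟩ t
    simp only [Set.mem_ofPred_eq, lt_hit_iff f one_pos] at h1
    rw [Int.le_floor]
    rcases le_total t t₀ with h | h
    · have h3 : f t ≤ 0 := by have := h1 t h; omega
      calc (f t : ℝ) ≤ 0 := by exact_mod_cast h3
        _ ≤ α * t := by positivity
    · have h3 : f t₀ ≤ 0 := by have := h1 t₀ le_rfl; omega
      have hne : slack α (f.restart t₀) ≠ ∞ := ne_top_of_le_ne_top (by simp) h2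
      have h4 := le_add_slack hne (t - t₀)
      rw [StepPath.restart_apply, add_tsub_cancel_of_le h, NNReal.coe_sub h] at h4
      have h5 := ENNReal.toReal_mono (by simp) h2
      simp only [ENNReal.toReal_natCast] at h5
      have h6 : ((f t₀ : ℤ) : ℝ) ≤ 0 := by exact_mod_cast h3
      push_cast at h4
      linarith
  · have hA : MeasurableSet {f : PathSpace Λ | (t₀ : ℝ≥0∞) < hit (f l) 1} :=
      measurableSet_lt measurable_const (measurable_hit_apply l 1)
    have hBm : Measurable fun f : PathSpace Λ => slack α (f l) :=
      (measurable_slack α).comp (measurable_pi_apply l)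
    have hB : MeasurableSet {f : PathSpace Λ | slack α (f l) ≤ n} :=
      measurableSet_le hBm measurable_const
    have h1 := hμ.measure_stop_inter_fut (fun _ => t₀) hA hB
    have h_agree : ∀ f : PathSpace Λ, stopAt (fun _ => t₀) f ∈ {f : PathSpace Λ | (t₀ : ℝ≥0∞) < hit (f l) 1} ↔
        (t₀ : ℝ≥0∞) < hit (f l) 1 := by
      intro f
      simp only [Set.mem_ofPred_eq, lt_hit_iff _ one_pos, stopAt_apply]
      exact forall₂_congr fun s hs => by rw [min_eq_left hs]
    simp only [h_agree] at h1
    have h2 : ENNReal.ofReal (1 - Real.exp (-1)) ≤ μ {f : PathSpace Λ | slack α (f l) ≤ n} := by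
      have h3 : μ {f : PathSpace Λ | slack α (f l) ≤ n}ᶜ ≤ ENNReal.ofReal (Real.exp (-1)) := by
        refine (measure_mono fun f hf => ?_).trans ((hμ.slack_tail l hu hα n).trans
          (ENNReal.ofReal_le_ofReal (Real.exp_le_exp.2 (by linarith))))
        exact lt_of_not_ge (by simpa using hf)
      rw [prob_compl_eq_one_sub hB, tsub_le_iff_left] at h3
      rw [ENNReal.ofReal_sub _ (Real.exp_pos _).le, ENNReal.ofReal_one]
      exact tsub_le_iff_right.2 h3
    have h4 : q * ENNReal.ofReal (1 - Real.exp (-1)) ≤ μ {f : PathSpace Λ |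
        (t₀ : ℝ≥0∞) < hit (f l) 1 ∧ futAt (fun _ => t₀) f ∈ {f : PathSpace Λ | slack α (f l) ≤ n}} := by
      rw [h1]
      exact mul_le_mul' (hq l) h2
    refine h4.trans (measure_mono ?_)
    rintro f ⟨h5, h6⟩
    exact ⟨h5, h6⟩

end

section
/-! ### Moments of sums of independent variables -/

section Moments

variable {Ω : Type*} [mΩ : MeasurableSpace Ω] {P : Measure Ω}

theorem integrable_pow_of_memLp [IsFiniteMeasure P] {X : Ω → ℝ} {p j : ℕ} (hX : MemLp X p P)
    (hj : j ≤ p) : Integrable (fun ω => X ω ^ j) P := by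
  have h1 : MemLp X j P := hX.mono_exponent (by exact_mod_cast hj)
  refine Integrable.mono' h1.integrable_norm_pow' (h1.aestronglyMeasurable.pow j) ?_
  exact Eventually.of_forall fun ω => by simp

theorem abs_pow_le_one_add (x : ℝ) {j q : ℕ} (hj : j ≤ 2 * q) : |x| ^ j ≤ 1 + x ^ (2 * q) := by
  have h0 : 0 ≤ x ^ (2 * q) := by rw [pow_mul]; positivity
  have h2 : |x| ^ (2 * q) = x ^ (2 * q) := by rw [pow_mul, pow_mul, sq_abs]
  rcases le_total |x| 1 with h | h
  · exact (pow_le_one₀ (abs_nonneg x) h).trans (by linarith)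
  · rw [← h2] at h0 ⊢
    exact (pow_le_pow_right₀ h hj).trans (by linarith)

theorem abs_integral_pow_le [IsProbabilityMeasure P] {X : Ω → ℝ} {j q : ℕ}
    (hX : MemLp X (2 * q : ℕ) P) (hj : j ≤ 2 * q) :
    |∫ ω, X ω ^ j ∂P| ≤ 1 + ∫ ω, X ω ^ (2 * q) ∂P := by
  have hi := integrable_pow_of_memLp hX (le_refl (2 * q))
  calc |∫ ω, X ω ^ j ∂P| ≤ ∫ ω, |X ω ^ j| ∂P := abs_integral_le_integral_abs
    _ ≤ ∫ ω, (1 + X ω ^ (2 * q)) ∂P := by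
      refine integral_mono (integrable_pow_of_memLp hX hj).abs ((integrable_const 1).add hi) fun ω => ?_
      simp only [abs_pow]
      exact abs_pow_le_one_add _ hj
    _ = _ := by rw [integral_add (integrable_const 1) hi]; simp

/-- Even moments of sums of independent centered variables. -/
theorem exists_moment_bound [IsProbabilityMeasure P] (p : ℕ) (K : ℝ) (hK : 0 ≤ K) :
    ∀ q ≤ p, ∃ C : ℝ, 0 ≤ C ∧ ∀ X : ℕ → Ω → ℝ, (∀ n, MemLp (X n) (2 * p : ℕ) P) →
      (∀ n, ∫ ω, X n ω ∂P = 0) → (∀ n, ∫ ω, X n ω ^ (2 * p) ∂P ≤ K) →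
      (∀ n, IndepFun (fun ω => ∑ i ∈ Finset.range n, X i ω) (X n) P) →
      ∀ n : ℕ, ∫ ω, (∑ i ∈ Finset.range n, X i ω) ^ (2 * q) ∂P ≤ C * n ^ q := by
  intro q
  induction q with
  | zero => exact fun _ => ⟨1, zero_le_one, fun X _ _ _ _ n => by simp⟩
  | succ q ih =>
    intro hq
    obtain ⟨C, hC, h⟩ := ih (by omega)
    refine ⟨2 ^ (2 * (q + 1)) * ((1 + C) * (1 + K)), by positivity, fun X hX h0 hXK hind n => ?_⟩
    have h1 := h X hX h0 hXK hind
    have hS : ∀ n, MemLp (fun ω => ∑ i ∈ Finset.range n, X i ω) (2 * p : ℕ) P := fun n =>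
      memLp_finsetSum _ fun i _ => hX i
    induction n with
    | zero => simp
    | succ n ihn =>
      set S : Ω → ℝ := fun ω => ∑ i ∈ Finset.range n, X i ω with hSdef
      have hexp : ∀ ω, (∑ i ∈ Finset.range (n + 1), X i ω) ^ (2 * (q + 1)) =
          ∑ k ∈ Finset.range (2 * (q + 1) + 1), X n ω ^ k * S ω ^ (2 * (q + 1) - k) *
            ((2 * (q + 1)).choose k : ℝ) := fun ω => by
        rw [Finset.sum_range_succ, add_comm, add_pow]
      have hpk : ∀ k ≤ 2 * (q + 1), IndepFun (fun ω => X n ω ^ k) (fun ω => S ω ^ (2 * (q + 1) - k)) P :=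
        fun k _ => (hind n).symm.comp (φ := fun x => x ^ k) (ψ := fun x => x ^ (2 * (q + 1) - k))
          (measurable_id.pow_const _) (measurable_id.pow_const _)
      have hiX : ∀ k ≤ 2 * (q + 1), Integrable (fun ω => X n ω ^ k) P := fun k hk =>
        integrable_pow_of_memLp (hX n) (by omega)
      have hiS : ∀ k ≤ 2 * (q + 1), Integrable (fun ω => S ω ^ k) P := fun k hk =>
        integrable_pow_of_memLp (hS n) (by omega)
      have hint : ∀ k ≤ 2 * (q + 1), Integrable (fun ω => X n ω ^ k * S ω ^ (2 * (q + 1) - k)) P :=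
        fun k hk => (hpk k hk).integrable_mul (hiX k hk) (hiS _ (by omega))
      have hval : ∀ k ≤ 2 * (q + 1), ∫ ω, X n ω ^ k * S ω ^ (2 * (q + 1) - k) ∂P =
          (∫ ω, X n ω ^ k ∂P) * ∫ ω, S ω ^ (2 * (q + 1) - k) ∂P := fun k hk =>
        (hpk k hk).integral_fun_mul_eq_mul_integral (hiX k hk).aestronglyMeasurable
          (hiS _ (by omega)).aestronglyMeasurable
      -- In the binomial expansion the power `0` of the new variable reproduces the previous moment
      -- and the power `1` vanishes by centering. All higher powers leave a power of `S` of at most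
      -- `2 * q`, of order `n ^ q` by induction.
      have hbd : ∀ k ∈ Finset.range (2 * q + 1),
          (∫ ω, X n ω ^ (k + 2) ∂P) * (∫ ω, S ω ^ (2 * (q + 1) - (k + 2)) ∂P) *
            ((2 * (q + 1)).choose (k + 2) : ℝ) ≤
          ((1 + K) * ((1 + C) * (n + 1) ^ q)) * ((2 * (q + 1)).choose (k + 2) : ℝ) := by
        intro k hk
        refine mul_le_mul_of_nonneg_right ?_ (Nat.cast_nonneg _)
        have hk' := Finset.mem_range.1 hk
        have hj : 2 * (q + 1) - (k + 2) ≤ 2 * q := by omega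
        have a1 : |∫ ω, X n ω ^ (k + 2) ∂P| ≤ 1 + K :=
          (abs_integral_pow_le (hX n) (by omega)).trans (by linarith [hXK n])
        have a2 : |∫ ω, S ω ^ (2 * (q + 1) - (k + 2)) ∂P| ≤ (1 + C) * (n + 1) ^ q := by
          refine (abs_integral_pow_le ((hS n).mono_exponent (by exact_mod_cast by omega)) hj).trans ?_
          have b1 := h1 n
          have b2 : C * (n : ℝ) ^ q ≤ C * (n + 1) ^ q := by gcongr; linarith
          have b3 : (1 : ℝ) ≤ (n + 1) ^ q := one_le_pow₀ (by linarith [(Nat.cast_nonneg n : (0:ℝ) ≤ n)])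
          linarith
        calc _ ≤ |(∫ ω, X n ω ^ (k + 2) ∂P) * ∫ ω, S ω ^ (2 * (q + 1) - (k + 2)) ∂P| := le_abs_self _
          _ = _ := abs_mul _ _
          _ ≤ _ := mul_le_mul a1 a2 (abs_nonneg _) (by linarith)
      have hchoose : ∑ k ∈ Finset.range (2 * q + 1), ((2 * (q + 1)).choose (k + 2) : ℝ) ≤
          2 ^ (2 * (q + 1)) := by
        have b1 := Nat.sum_range_choose (2 * (q + 1))
        have h2 : ∀ (N : ℕ) (f : ℕ → ℕ), ∑ k ∈ Finset.range N, f (k + 2) ≤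
            ∑ k ∈ Finset.range (N + 2), f k := fun N f => by
          rw [Finset.sum_range_succ', Finset.sum_range_succ']
          exact (Nat.le_add_right _ _).trans (Nat.le_add_right _ _)
        have b2 : ∑ k ∈ Finset.range (2 * q + 1), (2 * (q + 1)).choose (k + 2) ≤ 2 ^ (2 * (q + 1)) := by
          rw [← b1]
          exact h2 (2 * q + 1) _
        exact_mod_cast b2
      simp only [hexp]
      rw [integral_finsetSum _ fun k hk => (hint k (by have := Finset.mem_range.1 hk; omega)).mul_const _]
      have hterm : ∀ k ∈ Finset.range (2 * (q + 1) + 1),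
          ∫ ω, X n ω ^ k * S ω ^ (2 * (q + 1) - k) * ((2 * (q + 1)).choose k : ℝ) ∂P =
          (∫ ω, X n ω ^ k ∂P) * (∫ ω, S ω ^ (2 * (q + 1) - k) ∂P) * ((2 * (q + 1)).choose k : ℝ) := by
        intro k hk
        rw [integral_mul_const, hval k (by have := Finset.mem_range.1 hk; omega)]
      rw [Finset.sum_congr rfl hterm, show 2 * (q + 1) + 1 = (2 * q + 1) + 1 + 1 by ring,
        Finset.sum_range_succ', Finset.sum_range_succ']
      have hsum := Finset.sum_le_sum hbd
      rw [← Finset.mul_sum] at hsum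
      have hsum2 := hsum.trans (mul_le_mul_of_nonneg_left hchoose (by positivity))
      have hz : (∫ ω, X n ω ^ (0 + 1) ∂P) = 0 := by simpa using h0 n
      rw [hz]
      simp only [add_assoc, one_add_one_eq_two] at hsum2 ⊢
      simp only [pow_zero, integral_const, probReal_univ, smul_eq_mul, zero_mul, zero_add, one_mul,
        Nat.sub_zero, Nat.choose_zero_right, Nat.cast_one, mul_one]
      have e1 : (n : ℝ) ^ (q + 1) + (n + 1) ^ q ≤ (n + 1) ^ (q + 1) := by
        have : (n : ℝ) ^ q ≤ (n + 1) ^ q := by gcongr; linarith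
        have hn0 : (0 : ℝ) ≤ n := Nat.cast_nonneg n
        rw [pow_succ, pow_succ]
        nlinarith
      have e2 := mul_le_mul_of_nonneg_left e1
        (show 0 ≤ (2 : ℝ) ^ (2 * (q + 1)) * ((1 + C) * (1 + K)) by positivity)
      push_cast
      have e3 : ∫ ω, S ω ^ (2 * (q + 1)) ∂P ≤ _ := ihn
      linarith

/-- Markov's inequality for the moment of order `2 * p`, which is of order `n ^ p` and not `n ^ (2 *
p)`. -/
theorem exists_tail_bound [IsProbabilityMeasure P] (p : ℕ) (K : ℝ) (hK : 0 ≤ K) :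
    ∃ C : ℝ, 0 ≤ C ∧ ∀ X : ℕ → Ω → ℝ, (∀ n, MemLp (X n) (2 * p : ℕ) P) →
      (∀ n, ∫ ω, X n ω ∂P = 0) → (∀ n, ∫ ω, X n ω ^ (2 * p) ∂P ≤ K) →
      (∀ n, IndepFun (fun ω => ∑ i ∈ Finset.range n, X i ω) (X n) P) →
      ∀ n : ℕ, 1 ≤ n → ∀ ε : ℝ, 0 < ε →
        P {ω | ε * n ≤ |∑ i ∈ Finset.range n, X i ω|} ≤
          ENNReal.ofReal (C / ε ^ (2 * p) / n ^ p) := by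
  obtain ⟨C, hC, h⟩ := exists_moment_bound (P := P) p K hK p le_rfl
  refine ⟨C, hC, fun X hX h0 hXK hind n hn ε hε => ?_⟩
  have h1 := h X hX h0 hXK hind n
  have hS : MemLp (fun ω => ∑ i ∈ Finset.range n, X i ω) (2 * p : ℕ) P :=
    memLp_finsetSum _ fun i _ => hX i
  have hn0 : (0 : ℝ) < n := by exact_mod_cast hn
  have h2 := mul_meas_ge_le_integral_of_nonneg (μ := P)
    (f := fun ω => (∑ i ∈ Finset.range n, X i ω) ^ (2 * p))
    (Eventually.of_forall fun ω => by simp only [pow_mul]; positivity)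
    (integrable_pow_of_memLp hS le_rfl) ((ε * n) ^ (2 * p))
  have hpos : 0 < (ε * n) ^ (2 * p) := by positivity
  have h3 : P.real {ω | (ε * n) ^ (2 * p) ≤ (∑ i ∈ Finset.range n, X i ω) ^ (2 * p)} ≤
      C / ε ^ (2 * p) / n ^ p := by
    rw [div_div, le_div_iff₀ (by positivity)]
    have h4 := h2.trans h1
    have h5 : (ε * n) ^ (2 * p) = (ε ^ (2 * p) * n ^ p) * n ^ p := by rw [mul_pow]; ring
    rw [h5] at h4 ⊢
    have hnp : (0 : ℝ) < n ^ p := by positivity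
    nlinarith
  refine (measure_mono fun ω hω => ?_).trans ((ENNReal.le_ofReal_iff_toReal_le (measure_ne_top _ _)
    (by positivity)).2 h3)
  change (ε * n) ^ (2 * p) ≤ (∑ i ∈ Finset.range n, X i ω) ^ (2 * p)
  calc (ε * n) ^ (2 * p) ≤ |∑ i ∈ Finset.range n, X i ω| ^ (2 * p) :=
        pow_le_pow_left₀ (by positivity) hω _
    _ = _ := by rw [pow_mul, sq_abs, ← pow_mul]

end Moments

/-! ### Functionals of the labels in a window -/

variable {a : ℕ} {μ : Measure (PathSpace (ℤ × Fin a))}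

/-- The law of the walks: independent paths. -/
structure IsWalkLaw (μ : Measure (PathSpace (ℤ × Fin a))) : Prop where
  mesh : IsMeshFamily μ coord
  indep : iIndepFun (fun l (f : PathSpace (ℤ × Fin a)) => f l) μ

/-- The information given by the paths with labels in `S`. -/
abbrev labSigma {Λ : Type*} (S : Set Λ) : MeasurableSpace (PathSpace Λ) :=
  ⨆ l ∈ S, MeasurableSpace.comap (fun f => f l) inferInstance

theorem measurable_labSigma {Λ : Type*} {S : Set Λ} {l : Λ} (h : l ∈ S) :
    Measurable[labSigma S] fun f : PathSpace Λ => f l :=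
  (comap_measurable _).mono (le_iSup₂_of_le (f := fun l (_ : l ∈ S) =>
    MeasurableSpace.comap (fun f : PathSpace Λ => f l) inferInstance) l h le_rfl) le_rfl

theorem labSigma_le {Λ : Type*} (S : Set Λ) : labSigma S ≤ MeasurableSpace.pi :=
  iSup₂_le fun l _ => (measurable_pi_apply l).comap_le

theorem labSigma_mono {Λ : Type*} {S T : Set Λ} (h : S ⊆ T) : labSigma S ≤ labSigma T :=
  biSup_mono h

theorem IsWalkLaw.indep_labSigma (hμ : IsWalkLaw μ) {S T : Set (ℤ × Fin a)} (h : Disjoint S T) :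
    Indep (labSigma S) (labSigma T) μ :=
  indep_iSup_of_disjoint (fun l => (measurable_pi_apply l).comap_le) hμ.indep h

/-- Translation of the labels. -/
def shift (j : ℤ) (f : PathSpace (ℤ × Fin a)) : PathSpace (ℤ × Fin a) := fun l => f (l.1 + j, l.2)

theorem measurable_shift (j : ℤ) : Measurable (shift (a := a) j) :=
  measurable_pi_lambda _ fun _ => measurable_pi_apply _

theorem IsWalkLaw.map_shift (hμ : IsWalkLaw μ) (j : ℤ) : μ.map (shift j) = μ := by
  have hinj : Function.Injective fun l : ℤ × Fin a => (l.1 + j, l.2) := by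
    rintro ⟨x, i⟩ ⟨y, k⟩ h
    simp only [Prod.mk.injEq] at h
    ext <;> simp [h.2]
    omega
  exact (hμ.mesh.precomp hinj).map.unique hμ.mesh

theorem IsWalkLaw.measure_shift (hμ : IsWalkLaw μ) (j : ℤ) {s : Set (PathSpace (ℤ × Fin a))}
    (hs : MeasurableSet s) : μ {f | shift j f ∈ s} = μ s := by
  conv_rhs => rw [← hμ.map_shift j, Measure.map_apply (measurable_shift j) hs]
  rfl

/-- The labels in the window `[x, x + m)`. -/
def window (a : ℕ) (x : ℤ) (m : ℕ) : Set (ℤ × Fin a) := {l | x ≤ l.1 ∧ l.1 < x + m}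

theorem measurable_shift_window (S : Set (ℤ × Fin a)) (j : ℤ) :
    Measurable[labSigma {l | (l.1 - j, l.2) ∈ S}, labSigma S] (shift (a := a) j) := by
  rw [measurable_iff_comap_le, labSigma]
  simp only [MeasurableSpace.comap_iSup, MeasurableSpace.comap_comp]
  refine iSup₂_le fun l hl => ?_
  have h : ((l.1 + j, l.2) : ℤ × Fin a) ∈ {l : ℤ × Fin a | (l.1 - j, l.2) ∈ S} := by simpa using hl
  exact (measurable_labSigma h).comap_le

theorem measurable_comp_shift {g : PathSpace (ℤ × Fin a) → ℝ} {m : ℕ} {x : ℤ}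
    (hg : Measurable[labSigma (window a x m)] g) (j : ℤ) :
    Measurable[labSigma (window a (x + j) m)] fun f => g (shift j f) := by
  refine Measurable.mono (hg.comp (measurable_shift_window _ j)) (labSigma_mono ?_) le_rfl
  rintro l ⟨h1, h2⟩
  simp only [window, Set.mem_ofPred_eq] at h1 h2 ⊢
  constructor <;> omega

/-- The law of large numbers, with a rate, for translates of a functional of finitely many
labels. -/
theorem IsWalkLaw.window_tail_step (hμ : IsWalkLaw μ) {g : PathSpace (ℤ × Fin a) → ℝ} {m : ℕ}
    (hm : 0 < m) {x : ℤ} (hg : Measurable[labSigma (window a x m)] g) {p : ℕ}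
    (hgp : MemLp g (2 * p : ℕ) μ) (hp : 1 ≤ p) {ε : ℝ} (hε : 0 < ε)
    {d : ℕ} (hd1 : 1 ≤ d) :
    ∃ C : ℝ, 0 ≤ C ∧ ∀ (u : ℤ) (n : ℕ), 1 ≤ n →
      μ {f | ε * n ≤ |∑ j ∈ Finset.range n, (g (shift (u + (d * j : ℕ)) f) - ∫ f, g f ∂μ)|} ≤
        ENNReal.ofReal (C / n ^ p) := by
  have := hμ.mesh.isProbabilityMeasure
  set e := ∫ f, g f ∂μ with he
  set Y : ℤ → PathSpace (ℤ × Fin a) → ℝ := fun j f => g (shift j f) - e with hY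
  have hgm : Measurable g := hg.mono (labSigma_le _) le_rfl
  have hYm : ∀ j, Measurable[labSigma (window a (x + j) m)] (Y j) := fun j =>
    (measurable_comp_shift hg j).sub_const _
  have hYm' : ∀ j, Measurable (Y j) := fun j => (hYm j).mono (labSigma_le _) le_rfl
  have hpres : ∀ j, MeasurePreserving (shift (a := a) j) μ μ := fun j =>
    ⟨measurable_shift j, hμ.map_shift j⟩
  have hYp : ∀ j, MemLp (Y j) (2 * p : ℕ) μ := fun j =>
    (hgp.comp_measurePreserving (hpres j)).sub (memLp_const e)
  have hgi : Integrable g μ := by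
    simpa using integrable_pow_of_memLp (j := 1) hgp (by omega)
  have hY0 : ∀ j, ∫ f, Y j f ∂μ = 0 := fun j => by
    have h1 : Integrable (fun f => g (shift j f)) μ := (hpres j).integrable_comp_of_integrable hgi
    rw [hY]
    simp only
    rw [integral_sub h1 (integrable_const e)]
    have h2 : ∫ f, g (shift j f) ∂μ = e := by
      rw [he]
      conv_rhs => rw [← hμ.map_shift j]
      rw [integral_map (measurable_shift j).aemeasurable hgm.aestronglyMeasurable]
    rw [h2]; simp
  set K := ∫ f, (g f - e) ^ (2 * p) ∂μ with hK
  have hYK : ∀ j, ∫ f, Y j f ^ (2 * p) ∂μ = K := fun j => by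
    rw [hK]
    conv_rhs => rw [← hμ.map_shift j]
    rw [integral_map (measurable_shift j).aemeasurable
      ((hgm.sub_const e).pow_const _).aestronglyMeasurable]
  have hK0 : 0 ≤ K := integral_nonneg fun f => by rw [pow_mul]; positivity
  obtain ⟨C, hC, h⟩ := exists_tail_bound (P := μ) p K hK0
  refine ⟨m * (C / (ε / m) ^ (2 * p)), by positivity, fun u n hn => ?_⟩
  -- The terms are split into residue classes modulo `m`. Inside a class the windows are disjoint,
  -- since `1 ≤ d`, so each term is independent of the sum of the previous ones. Indices from `n` on
  -- are padded with zeros.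
  set X : ℕ → ℕ → PathSpace (ℤ × Fin a) → ℝ := fun s i f =>
    if s + i * m < n then Y (u + (d * (s + i * m) : ℕ)) f else 0 with hX
  have hXm : ∀ s i, Measurable[labSigma (window a (x + (u + (d * (s + i * m) : ℕ))) m)] (X s i) := by
    intro s i
    simp only [hX]
    split_ifs with h1
    · exact hYm _
    · exact measurable_const
  have hsum : ∀ f, ∑ j ∈ Finset.range n, Y (u + (d * j : ℕ)) f =
      ∑ s ∈ Finset.range m, ∑ i ∈ Finset.range n, X s i f := by
    intro f
    rw [← Finset.sum_product']
    simp only [hX]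
    rw [← Finset.sum_filter]
    refine Finset.sum_nbij' (fun j => (j % m, j / m)) (fun q => q.1 + q.2 * m) ?_ ?_ ?_ ?_ ?_
    · intro j hj
      have hj' := Finset.mem_range.1 hj
      simp only [Finset.mem_filter, Finset.mem_product, Finset.mem_range]
      have h2 := Nat.mod_add_div' j m
      exact ⟨⟨Nat.mod_lt _ hm, (Nat.div_le_self _ _).trans_lt hj'⟩, by omega⟩
    · intro q hq
      simp only [Finset.mem_filter, Finset.mem_product, Finset.mem_range] at hq
      exact Finset.mem_range.2 hq.2
    · intro j _
      exact Nat.mod_add_div' j m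
    · rintro ⟨s, i⟩ hq
      simp only [Finset.mem_filter, Finset.mem_product, Finset.mem_range] at hq
      ext
      · simp [Nat.add_mul_mod_self_right, Nat.mod_eq_of_lt hq.1.1]
      · simp [Nat.add_mul_div_right _ _ hm, Nat.div_eq_of_lt hq.1.1]
    · intro j _
      simp only [Nat.mod_add_div']
  have hbound : ∀ s, μ {f | ε / m * n ≤ |∑ i ∈ Finset.range n, X s i f|} ≤
      ENNReal.ofReal (C / (ε / m) ^ (2 * p) / n ^ p) := by
    intro s
    refine h (X s) (fun i => ?_) (fun i => ?_) (fun i => ?_) (fun i => ?_) n hn (ε / m) (by positivity)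
    · simp only [hX]; split_ifs
      · exact hYp _
      · exact MemLp.zero
    · simp only [hX]; split_ifs
      · exact hY0 _
      · simp
    · simp only [hX]; split_ifs
      · exact (hYK _).le
      · simp only [integral_const, probReal_univ, smul_eq_mul, one_mul]
        rw [zero_pow (by omega)]; exact hK0
    · have hd := hμ.indep_labSigma (S := {l | l.1 < x + (u + (d * (s + i * m) : ℕ))})
        (T := window a (x + (u + (d * (s + i * m) : ℕ))) m) (by
          rw [Set.disjoint_left]
          rintro l h1 ⟨h2, _⟩
          simp only [Set.mem_ofPred_eq] at h1
          omega)
      refine (IndepFun_iff_Indep _ _ _).2 (indep_of_indep_of_le_left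
        (indep_of_indep_of_le_right hd (hXm s i).comap_le) ?_)
      refine Measurable.comap_le ?_
      refine Finset.measurable_sum _ fun k hk => (hXm s k).mono (labSigma_mono ?_) le_rfl
      rintro l ⟨_, h2⟩
      have hk' := Finset.mem_range.1 hk
      have h3 : d * (s + k * m) + m ≤ d * (s + i * m) := by
        have h5 : s + k * m + m ≤ s + i * m := by nlinarith
        calc d * (s + k * m) + m ≤ d * (s + k * m) + d * m := by nlinarith
          _ = d * (s + k * m + m) := by ring
          _ ≤ _ := Nat.mul_le_mul_left _ h5
      simp only [Set.mem_ofPred_eq]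
      push_cast at h2 ⊢
      have h4 : (d : ℤ) * (s + k * m) + m ≤ d * (s + i * m) := by exact_mod_cast h3
      omega
  calc μ {f | ε * n ≤ |∑ j ∈ Finset.range n, (g (shift (u + (d * j : ℕ)) f) - e)|}
      ≤ μ (⋃ s ∈ Finset.range m, {f | ε / m * n ≤ |∑ i ∈ Finset.range n, X s i f|}) := by
        refine measure_mono fun f hf => ?_
        by_contra hcon
        simp only [Set.mem_iUnion, Set.mem_ofPred_eq, exists_prop, not_exists, not_and, not_le] at hcon
        have h1 : |∑ j ∈ Finset.range n, Y (u + (d * j : ℕ)) f| < ε * n := by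
          rw [hsum]
          refine (Finset.abs_sum_le_sum_abs _ _).trans_lt ?_
          refine (Finset.sum_lt_sum_of_nonempty (Finset.nonempty_range_iff.2 hm.ne') hcon).trans_eq ?_
          rw [Finset.sum_const, Finset.card_range, nsmul_eq_mul]
          have : (m : ℝ) ≠ 0 := by exact_mod_cast hm.ne'
          field_simp
        exact absurd (show ε * n ≤ |∑ j ∈ Finset.range n, Y (u + (d * j : ℕ)) f| from hf) (not_le.2 h1)
    _ ≤ ∑ s ∈ Finset.range m, μ {f | ε / m * n ≤ |∑ i ∈ Finset.range n, X s i f|} :=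
        measure_biUnion_finset_le _ _
    _ ≤ ∑ s ∈ Finset.range m, ENNReal.ofReal (C / (ε / m) ^ (2 * p) / n ^ p) :=
        Finset.sum_le_sum fun s _ => hbound s
    _ = ENNReal.ofReal (m * (C / (ε / m) ^ (2 * p)) / n ^ p) := by
        rw [Finset.sum_const, Finset.card_range, nsmul_eq_mul, ← ENNReal.ofReal_natCast,
          ← ENNReal.ofReal_mul (Nat.cast_nonneg m)]
        ring_nf

theorem IsWalkLaw.window_tail (hμ : IsWalkLaw μ) {g : PathSpace (ℤ × Fin a) → ℝ} {m : ℕ}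
    (hm : 0 < m) {x : ℤ} (hg : Measurable[labSigma (window a x m)] g) {p : ℕ}
    (hgp : MemLp g (2 * p : ℕ) μ) (hp : 1 ≤ p) {ε : ℝ} (hε : 0 < ε) :
    ∃ C : ℝ, 0 ≤ C ∧ ∀ (u : ℤ) (n : ℕ), 1 ≤ n →
      μ {f | ε * n ≤ |∑ j ∈ Finset.range n, (g (shift (u + j) f) - ∫ f, g f ∂μ)|} ≤
        ENNReal.ofReal (C / n ^ p) := by
  simpa only [one_mul] using hμ.window_tail_step hm hg hgp hp hε le_rfl

end

/-! ### The front and the trials, described site by site -/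

section
variable {a : ℕ}

/-- The space of realizations of the centered walks. -/
abbrev Real₀ (a : ℕ) : Type := PathSpace (ℤ × Fin a)

/-- The driving walks with given centered paths. -/
def walks (f : Real₀ a) : Paths a := fun l t => l.1 + f l t

/-! ### Passage times -/

/-- The starting point of the particle labelled `l`. -/
def start (w : Config a) (l : ℤ × Fin a) : ℤ := if l.1 ≤ w.r then w.pos l else l.1

/-- The labels of the particles born at or to the left of `z`. -/
def alive (w : Config a) (z : ℤ) : Set (ℤ × Fin a) := {l | l.1 ≤ z ∧ (l ∈ w.labels ∨ w.r < l.1)}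

/-- The passage time of the front at `v`. -/
def tau (w : Config a) (v : ℤ) (f : Real₀ a) : ℝ≥0∞ := w.T (walks f) v

theorem tau_of_le (w : Config a) {v : ℤ} (h : v ≤ w.r) (f : Real₀ a) : tau w v f = 0 := by
  have : (v - w.r).toNat = 0 := by omega
  rw [tau, Config.T, this, Config.passage]

theorem start_le {w : Config a} {v : ℤ} {l : ℤ × Fin a} (hl : l ∈ alive w v) (hv : w.r ≤ v) :
    start w l ≤ v := by
  obtain ⟨h1, h2⟩ := hl
  unfold start
  split_ifs with h
  · rcases h2 with h2 | h2
    · exact (w.pos_le l h2).trans hv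
    · omega
  · exact h1

theorem alive_mono (w : Config a) {v v' : ℤ} (h : v ≤ v') : alive w v ⊆ alive w v' :=
  fun _ hl => ⟨hl.1.trans h, hl.2⟩

theorem hit_shift (f : StepPath) (c m : ℤ) : hit (fun t => f t + c) m = hit f (m - c) := by
  rw [← hit_add_const f c (m - c), sub_add_cancel]

/-- Initial and later particles obey one formula: labels at or to the left of `w.r` have birth time
`0`, and `start` accounts for their initial positions. -/
theorem tau_eq (w : Config a) {v : ℤ} (hv : w.r < v) (f : Real₀ a) :
    tau w v f = ⨅ l ∈ alive w (v - 1), tau w l.1 f + hit (f l) (v - start w l) := by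
  obtain ⟨k, hk⟩ : ∃ k : ℕ, v = w.r + (k + 1 : ℕ) := ⟨(v - w.r - 1).toNat, by omega⟩
  have hk' : (v - w.r).toNat = k + 1 := by omega
  rw [tau, Config.T, hk', Config.passage]
  have hinit : ∀ l ∈ w.labels, hit (fun t => walks f l t + w.pos l - l.1) (w.r + (k + 1 : ℕ)) =
      tau w l.1 f + hit (f l) (v - start w l) := by
    intro l hl
    have h1 := w.label_le l hl
    rw [tau_of_le w h1, zero_add, start, if_pos h1, ← hit_shift, ← hk]
    congr 1
    funext t
    simp only [walks]; ring
  have hfresh : ∀ (j : Fin k) (i : Fin a), w.passage (walks f) (j.1 + 1) +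
      hit (walks f (w.r + (j.1 + 1 : ℕ), i)) (w.r + (k + 1 : ℕ)) =
      tau w (w.r + (j.1 + 1 : ℕ)) f + hit (f (w.r + (j.1 + 1 : ℕ), i))
        (v - start w (w.r + (j.1 + 1 : ℕ), i)) := by
    intro j i
    have h1 : (w.r + (j.1 + 1 : ℕ) - w.r).toNat = j.1 + 1 := by omega
    rw [tau, Config.T, h1, start, if_neg (by simp only; omega), ← hit_shift, ← hk]
    congr 2
    funext t
    simp only [walks]; ring
  apply le_antisymm
  · refine le_iInf₂ fun l hl => ?_
    obtain ⟨h1, h2⟩ := hl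
    by_cases h3 : l ∈ w.labels
    · exact inf_le_left.trans ((iInf₂_le l h3).trans (hinit l h3).le)
    · have h4 : w.r < l.1 := h2.resolve_left h3
      obtain ⟨x, i⟩ := l
      simp only at h1 h4
      obtain ⟨j, hj⟩ : ∃ j : ℕ, x = w.r + (j + 1 : ℕ) := ⟨(x - w.r - 1).toNat, by omega⟩
      subst hj
      have h5 := hfresh ⟨j, by omega⟩ i
      exact inf_le_right.trans (iInf_le_of_le ⟨j, by omega⟩ (iInf_le_of_le i h5.le))
  · refine le_inf ?_ ?_
    · refine le_iInf₂ fun l hl => ?_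
      rw [hinit l hl]
      have := w.label_le l hl
      exact iInf₂_le l ⟨by omega, Or.inl hl⟩
    · refine le_iInf₂ fun j i => ?_
      rw [hfresh j i]
      have h6 : ((w.r + (j.1 + 1 : ℕ), i) : ℤ × Fin a) ∈ alive w (v - 1) := by
        have := j.2
        exact ⟨by simp only; omega, Or.inr (by simp only; omega)⟩
      exact iInf_le_of_le _ (iInf_le_of_le h6 le_rfl)

theorem tau_le (w : Config a) {v : ℤ} (hv : w.r < v) (f : Real₀ a) {l : ℤ × Fin a}
    (hl : l ∈ alive w (v - 1)) : tau w v f ≤ tau w l.1 f + hit (f l) (v - start w l) := by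
  rw [tau_eq w hv]
  exact iInf₂_le l hl

theorem tau_mono_succ (w : Config a) (v : ℤ) (f : Real₀ a) : tau w v f ≤ tau w (v + 1) f := by
  rcases le_or_gt v w.r with hv | hv
  · rw [tau_of_le w hv]; exact zero_le
  rw [tau_eq w (by omega : w.r < v + 1)]
  refine le_iInf₂ fun l hl => ?_
  rcases eq_or_ne l.1 v with h | h
  · rw [h]; exact le_self_add
  · have hl' : l ∈ alive w (v - 1) := ⟨by have := hl.1; omega, hl.2⟩
    have := start_le hl' (by omega)
    exact (tau_le w hv f hl').trans (add_le_add le_rfl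
      (hit_mono (f l).isStep (by rw [StepPath.zero]; omega) (by omega)))

theorem tau_mono (w : Config a) (f : Real₀ a) : Monotone fun v => tau w v f :=
  monotone_int_of_le_succ fun v => tau_mono_succ w v f

theorem measurable_tau (w : Config a) (v : ℤ) : Measurable (tau w v) := by
  rcases le_or_gt v w.r with hv | hv
  · have : tau w v = fun _ => 0 := funext fun f => tau_of_le w hv f
    rw [this]; exact measurable_const
  obtain ⟨k, hk⟩ : ∃ k : ℕ, v = w.r + k := ⟨(v - w.r).toNat, by omega⟩
  subst hk
  clear hv
  induction k using Nat.strong_induction_on with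
  | _ k ih =>
    rcases Nat.eq_zero_or_pos k with h0 | h0
    · have : tau w (w.r + k) = fun _ => 0 := funext fun f => tau_of_le w (by omega) f
      rw [this]; exact measurable_const
    have : tau w (w.r + k) = fun f => ⨅ l ∈ alive w (w.r + k - 1), tau w l.1 f +
        hit (f l) (w.r + k - start w l) := funext fun f => tau_eq w (by omega) f
    rw [this]
    refine Measurable.iInf fun l => Measurable.iInf fun hl => ?_
    refine Measurable.add ?_ (measurable_hit_apply l _)
    rcases le_or_gt l.1 w.r with h | h
    · have : tau w l.1 = fun _ => 0 := funext fun f => tau_of_le w h f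
      rw [this]; exact measurable_const
    · have h1 := hl.1
      have := ih (l.1 - w.r).toNat (by omega)
      rwa [show w.r + ((l.1 - w.r).toNat : ℤ) = l.1 by omega] at this

/-- The passage times up to `v` are finite and attained. -/
def Reg (w : Config a) (v : ℤ) : Set (Real₀ a) :=
  {f | ∀ x : ℤ, w.r < x → x ≤ v → tau w x f < ∞ ∧
    ∃ l ∈ alive w (x - 1), tau w x f = tau w l.1 f + hit (f l) (x - start w l)}

theorem measurableSet_reg (w : Config a) (v : ℤ) : MeasurableSet (Reg w v) := by
  have h : Reg w v = ⋂ x : ℤ, ⋂ _ : w.r < x, ⋂ _ : x ≤ v, {f | tau w x f < ∞} ∩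
      ⋃ l : ℤ × Fin a, ⋃ _ : l ∈ alive w (x - 1),
        {f | tau w x f = tau w l.1 f + hit (f l) (x - start w l)} := by
    ext f
    simp [Reg]
  rw [h]
  refine MeasurableSet.iInter fun x => MeasurableSet.iInter fun _ => MeasurableSet.iInter fun _ =>
    (measurableSet_lt (measurable_tau w x) measurable_const).inter ?_
  exact MeasurableSet.iUnion fun l => MeasurableSet.iUnion fun _ => measurableSet_eq_fun
    (measurable_tau w x) ((measurable_tau w l.1).add (measurable_hit_apply l _))

theorem Reg.mono {w : Config a} {v v' : ℤ} (h : v ≤ v') {f : Real₀ a} (hf : f ∈ Reg w v') :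
    f ∈ Reg w v := fun x h1 h2 => hf x h1 (h2.trans h)

theorem Reg.tau_lt_top {w : Config a} {v : ℤ} {f : Real₀ a} (hf : f ∈ Reg w v) {x : ℤ} (hx : x ≤ v) :
    tau w x f < ∞ := by
  rcases le_or_gt x w.r with h | h
  · rw [tau_of_le w h]; exact ENNReal.zero_lt_top
  · exact (hf x h hx).1

theorem hit_lt_hit_succ (f : StepPath) {m : ℤ} (hm : 0 ≤ m) (h : hit f (m + 1) < ∞) :
    hit f m < hit f (m + 1) := by
  refine lt_of_le_of_ne (hit_mono f.isStep (by simpa using hm) (by omega)) fun he => ?_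
  lift hit f (m + 1) to ℝ≥0 using h.ne with u hu
  have h1 := apply_of_hit_eq f.isStep he
  have h2 := apply_of_hit_eq f.isStep hu.symm
  omega

/-- The particle that attains the passage at `x + 1` was at `x` strictly earlier, or was born at `x`
and needs a positive time to move. So the front visits the sites one at a time. -/
theorem Reg.tau_lt_succ {w : Config a} {v : ℤ} {f : Real₀ a} (hf : f ∈ Reg w v) {x : ℤ}
    (hx : w.r ≤ x) (hxv : x < v) : tau w x f < tau w (x + 1) f := by
  obtain ⟨h1, l, hl, h2⟩ := hf (x + 1) (by omega) (by omega)
  have hx1 := Reg.tau_lt_top hf (x := x) hxv.le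
  rw [add_sub_cancel_right] at hl
  have hsl := start_le hl hx
  rw [h2] at h1 ⊢
  have hfin : hit (f l) (x + 1 - start w l) < ∞ := lt_of_le_of_lt le_add_self h1
  have hfin' : tau w l.1 f < ∞ := lt_of_le_of_lt le_self_add h1
  rcases hx.eq_or_lt with hxr | hxr
  · rw [← hxr, tau_of_le w le_rfl, hxr]
    have : 0 < hit (f l) (x + 1 - start w l) := hit_pos (f l).isStep (by rw [StepPath.zero]; omega)
    exact lt_of_lt_of_le this le_add_self
  rcases eq_or_ne l.1 x with h3 | h3
  · rw [h3]
    refine ENNReal.lt_add_right hx1.ne (ne_of_gt (hit_pos (f l).isStep ?_))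
    rw [StepPath.zero]; omega
  · have hl' : l ∈ alive w (x - 1) := ⟨by have := hl.1; omega, hl.2⟩
    refine (tau_le w hxr f hl').trans_lt (ENNReal.add_lt_add_left hfin'.ne ?_)
    have := hit_lt_hit_succ (f l) (m := x - start w l) (by omega)
      (by rwa [show x - start w l + 1 = x + 1 - start w l by ring])
    rwa [show x - start w l + 1 = x + 1 - start w l by ring] at this

/-- The age of the particle labelled `l` when the front reaches `v`. -/
def age (w : Config a) (v : ℤ) (f : Real₀ a) (l : ℤ × Fin a) : ℝ≥0 :=
  (tau w v f - tau w l.1 f).toNNReal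

theorem measurable_age (w : Config a) (v : ℤ) (l : ℤ × Fin a) : Measurable fun f => age w v f l :=
  ((measurable_tau w v).sub (measurable_tau w l.1)).ennreal_toNNReal

theorem age_of_ge (w : Config a) {v : ℤ} (f : Real₀ a) {l : ℤ × Fin a} (h : v ≤ l.1) :
    age w v f l = 0 := by
  rw [age, tsub_eq_zero_of_le (tau_mono w f h)]; rfl

theorem coe_age {w : Config a} {v : ℤ} {f : Real₀ a} (h : tau w v f < ∞) (l : ℤ × Fin a) :
    (age w v f l : ℝ≥0∞) = tau w v f - tau w l.1 f :=
  ENNReal.coe_toNNReal (ne_top_of_le_ne_top h.ne tsub_le_self)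

/-- The paths `f` and `g` agree up to the ages at the passage at `v`. -/
def Agree (w : Config a) (v : ℤ) (f g : Real₀ a) : Prop := ∀ l, ∀ t ≤ age w v f l, g l t = f l t

theorem Agree.mono {w : Config a} {v v' : ℤ} {f g : Real₀ a} (h : Agree w v' f g) (hv : v ≤ v')
    (hf : f ∈ Reg w v') : Agree w v f g := by
  intro l t ht
  refine h l t (ht.trans ?_)
  rw [← ENNReal.coe_le_coe, coe_age (Reg.tau_lt_top hf hv), coe_age (Reg.tau_lt_top hf le_rfl)]
  exact tsub_le_tsub_right (tau_mono w f hv) _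

/-- Induction over the sites. Every hit that could produce the passage at `x` by that time uses a
path only up to its age at `v`, where `f` and `g` coincide: the particle attaining it for `f` bounds
the passage for `g`, and an earlier hit for `g` would also be one for `f`. -/
theorem Agree.tau_eq_and {w : Config a} {v : ℤ} {f g : Real₀ a} (h : Agree w v f g)
    (hf : f ∈ Reg w v) : ∀ x ≤ v, tau w x g = tau w x f ∧ (w.r < x →
      ∃ l ∈ alive w (x - 1), tau w x g = tau w l.1 g + hit (g l) (x - start w l)) := by
  have key : ∀ k : ℕ, w.r + k ≤ v → tau w (w.r + k) g = tau w (w.r + k) f ∧ (w.r < w.r + k →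
      ∃ l ∈ alive w (w.r + k - 1), tau w (w.r + k) g = tau w l.1 g + hit (g l) (w.r + k - start w l)) := by
    intro k
    induction k using Nat.strong_induction_on with
    | _ k ih =>
      intro hk
      rcases Nat.eq_zero_or_pos k with h0 | h0
      · subst h0
        exact ⟨by rw [tau_of_le w (by simp), tau_of_le w (by simp)], fun h => by simp at h⟩
      set x := w.r + (k : ℤ) with hx
      have hxr : w.r < x := by omega
      have hih : ∀ l ∈ alive w (x - 1), tau w l.1 g = tau w l.1 f := by
        intro l hl
        rcases le_or_gt l.1 w.r with h1 | h1
        · rw [tau_of_le w h1, tau_of_le w h1]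
        · have h2 := hl.1
          have := (ih (l.1 - w.r).toNat (by omega) (by omega)).1
          rwa [show w.r + ((l.1 - w.r).toNat : ℤ) = l.1 by omega] at this
      obtain ⟨hfin, l, hl, hatt⟩ := hf x hxr hk
      have hvfin := Reg.tau_lt_top hf le_rfl
      have hage : ∀ l ∈ alive w (x - 1), ∀ u : ℝ≥0, tau w l.1 f + u ≤ tau w x f → g l u = f l u := by
        intro l _ u hu
        refine h l u ?_
        rw [← ENNReal.coe_le_coe, coe_age hvfin]
        refine ENNReal.le_sub_of_add_le_left (ne_top_of_le_ne_top hfin.ne (le_self_add.trans hu)) ?_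
        exact hu.trans (tau_mono w f hk)
      have h1 : hit (f l) (x - start w l) ≠ ∞ := ne_top_of_le_ne_top hfin.ne (by rw [hatt]; exact le_add_self)
      have h2 : hit (g l) (x - start w l) ≤ hit (f l) (x - start w l) := by
        obtain ⟨u, hu⟩ : ∃ u : ℝ≥0, (u : ℝ≥0∞) = hit (f l) (x - start w l) :=
          ⟨_, ENNReal.coe_toNNReal h1⟩
        rw [← hu]
        refine hit_le ?_
        rw [hage l hl u (by rw [hatt, hu])]
        exact apply_of_hit_eq (f l).isStep hu.symm
      have h3 : tau w x f ≤ tau w x g := by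
        rw [tau_eq w hxr g]
        refine le_iInf₂ fun l' hl' => ?_
        by_contra hcon
        rw [not_le, hih l' hl'] at hcon
        have h4 : hit (g l') (x - start w l') ≠ ∞ := ne_top_of_le_ne_top hcon.ne_top le_add_self
        obtain ⟨u, hu⟩ : ∃ u : ℝ≥0, (u : ℝ≥0∞) = hit (g l') (x - start w l') :=
          ⟨_, ENNReal.coe_toNNReal h4⟩
        rw [← hu] at hcon
        have h5 := hage l' hl' u hcon.le
        have h6 : hit (f l') (x - start w l') ≤ u :=
          hit_le (by rw [← h5]; exact apply_of_hit_eq (g l').isStep hu.symm)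
        exact absurd ((tau_le w hxr f hl').trans (add_le_add le_rfl h6)) (not_le.2 hcon)
      have h4 : tau w x g ≤ tau w l.1 g + hit (g l) (x - start w l) := tau_le w hxr g hl
      have h5 : tau w l.1 g + hit (g l) (x - start w l) ≤ tau w x f := by
        rw [hih l hl, hatt]; exact add_le_add le_rfl h2
      exact ⟨le_antisymm (h4.trans h5) h3, fun _ => ⟨l, hl, le_antisymm h4 (h5.trans h3)⟩⟩
  intro x hx
  rcases le_or_gt x w.r with h1 | h1
  · exact ⟨by rw [tau_of_le w h1, tau_of_le w h1], fun h => by omega⟩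
  · have := key (x - w.r).toNat (by omega)
    rwa [show w.r + ((x - w.r).toNat : ℤ) = x by omega] at this

theorem Agree.tau_eq {w : Config a} {v : ℤ} {f g : Real₀ a} (h : Agree w v f g)
    (hf : f ∈ Reg w v) {x : ℤ} (hx : x ≤ v) : tau w x g = tau w x f := (h.tau_eq_and hf x hx).1

theorem Agree.reg {w : Config a} {v : ℤ} {f g : Real₀ a} (h : Agree w v f g)
    (hf : f ∈ Reg w v) : g ∈ Reg w v := fun x h1 h2 =>
  ⟨by rw [h.tau_eq hf h2]; exact Reg.tau_lt_top hf h2, (h.tau_eq_and hf x h2).2 h1⟩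

theorem Agree.age_eq {w : Config a} {v : ℤ} {f g : Real₀ a} (h : Agree w v f g)
    (hf : f ∈ Reg w v) {x : ℤ} (hx : x ≤ v) : age w x g = age w x f := by
  funext l
  rcases le_or_gt x l.1 with h1 | h1
  · rw [age_of_ge w f h1, age_of_ge w g h1]
  · rw [age, age, h.tau_eq hf hx, h.tau_eq hf (h1.le.trans hx)]

theorem Agree.symm {w : Config a} {v : ℤ} {f g : Real₀ a} (h : Agree w v f g)
    (hf : f ∈ Reg w v) : Agree w v g f := fun l t ht => by
  rw [h.age_eq hf le_rfl] at ht
  exact (h l t ht).symm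

/-- The ages at a passage time are determined by the paths up to these ages. -/
theorem isStopping_age (w : Config a) (v : ℤ) {μ : Measure (Real₀ a)} (h : ∀ᵐ f ∂μ, f ∈ Reg w v) :
    IsStopping μ (age w v) (Reg w v) where
  meas := measurable_age w v
  countable N := by
    -- The ages at `v` depend on the label only through its birthplace clipped to `[w.r, v]`, so
    -- finitely many numbers encode the rounded ages of all labels.
    refine (Set.countable_range (fun (c : List ℕ) (l : ℤ × Fin a) =>
      c.getD (min (l.1 - w.r).toNat (v - w.r).toNat) 0)).mono ?_
    rintro _ ⟨f, rfl⟩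
    refine ⟨(List.range ((v - w.r).toNat + 1)).map fun k : ℕ =>
      ⌊(tau w (max v w.r) f - tau w (w.r + k) f).toNNReal * 2 ^ N⌋₊ + 1, funext fun l => ?_⟩
    have hlt : min (l.1 - w.r).toNat (v - w.r).toNat < (v - w.r).toNat + 1 := by omega
    simp only [List.getD_eq_getElem?_getD, List.getElem?_map, List.getElem?_range hlt, Option.map_some,
      Option.getD_some, age]
    congr 4
    rcases le_or_gt v w.r with hv | hv
    · rw [max_eq_right hv, tau_of_le w hv, tau_of_le w le_rfl, zero_tsub, zero_tsub]
    · rw [max_eq_left hv.le]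
      rcases le_or_gt l.1 w.r with h1 | h1
      · have e : w.r + ((min (l.1 - w.r).toNat (v - w.r).toNat : ℕ) : ℤ) ≤ w.r := by omega
        rw [tau_of_le w h1, tau_of_le w e]
      · rcases le_or_gt l.1 v with h2 | h2
        · congr 2; omega
        · rw [tsub_eq_zero_of_le (tau_mono w f h2.le), tsub_eq_zero_of_le (tau_mono w f (by omega))]
  measR := measurableSet_reg w v
  full := h
  agree f hf g hg := ⟨Agree.reg hg hf, Agree.age_eq hg hf le_rfl⟩

end

section
variable {a : ℕ}

/-! ### The renewal structure indexed by sites -/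

/-- The paths after the passage at `v`. -/
def futV (w : Config a) (v : ℤ) (f : Real₀ a) : Real₀ a := futAt (age w v f) f

/-- The position of the particle labelled `l` at the passage at `v`. -/
def place (w : Config a) (v : ℤ) (f : Real₀ a) (l : ℤ × Fin a) : ℤ := start w l + f l (age w v f l)

open Classical in
/-- The weights, at the passage at `v`, of the particles born at or to the left of `z`. -/
def weight (θ : ℝ) (w : Config a) (z v : ℤ) (f : Real₀ a) (l : ℤ × Fin a) : ℝ≥0∞ :=
  if l ∈ alive w z then ENNReal.ofReal (Real.exp (θ * ((place w v f l - v : ℤ) : ℝ))) else 0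

/-- The condition on the site at the end of a good block. -/
def Good (c : Params) (w : Config a) (v : ℤ) (f : Real₀ a) : Prop :=
  ∑' l, weight c.θ w (v - c.L) v f l ≤ ENNReal.ofReal c.p ∧
  ∃ S : Finset (ℤ × Fin a), (a : ℝ) * c.L / 2 ≤ S.card ∧ ∀ l ∈ S, l ∈ alive w v ∧ v - c.L < l.1 ∧
    v - c.L < place w v f l ∧ place w v f l ≤ v

/-- The time at which the auxiliary front reaches `u + n`. -/
def auxTime (f : Real₀ a) (u : ℤ) (n : ℕ) : ℝ≥0∞ := ∑ k ∈ Finset.range (n + 1), nu (walks f) u k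

/-- The auxiliary front started at `u` is too slow at time `t`. -/
def SlowAux (c : Params) (u : ℤ) (g : Real₀ a) (t : ℝ≥0) : Prop := (t : ℝ≥0∞) < auxTime g u ⌊c.α₂ * t⌋₊

/-- A particle of the block behind `u` is too fast at time `t` after the passage at `u`. -/
def FastBlock (c : Params) (w : Config a) (u : ℤ) (s g : Real₀ a) (t : ℝ≥0) : Prop :=
  ∃ l ∈ alive w u, u - c.L < l.1 ∧ l.1 < u ∧ ⌊c.α₁ * t⌋ + u < place w u s l + g l t

/-- The particles behind the block are too fast at time `t` after the passage at `u`. -/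
def FastBack (c : Params) (w : Config a) (u : ℤ) (s g : Real₀ a) (t : ℝ≥0) : Prop :=
  ENNReal.ofReal (Real.exp (c.θ * ⌊c.α₁ * t⌋)) ≤
    ∑' l, weight c.θ w (u - c.L) u s l * ENNReal.ofReal (Real.exp (c.θ * g l t))

/-- The trial at `u` is broken at time `t` after the passage at `u`. -/
def Broken (c : Params) (w : Config a) (u : ℤ) (f : Real₀ a) (t : ℝ≥0) : Prop :=
  SlowAux c u f t ∨ FastBlock c w u f (futV w u f) t ∨ FastBack c w u f (futV w u f) t

/-- `v` is the end of the first good block after `x`. -/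
def First (c : Params) (w : Config a) (x v : ℤ) (f : Real₀ a) : Prop :=
  ∃ j : ℕ, 1 ≤ j ∧ v = x + j * c.L ∧ Good c w v f ∧ ∀ i : ℕ, 1 ≤ i → i < j → ¬ Good c w (x + i * c.L) f

/-- The trial at `u` is broken when the front is at a site `x`, and `v` is the end of the first good
block after `x`. -/
def Next (c : Params) (w : Config a) (u v : ℤ) (f : Real₀ a) : Prop :=
  ∃ x, u ≤ x ∧ (∃ t : ℝ≥0, Broken c w u f t ∧ tau w u f + t < tau w (x + 1) f) ∧
    (¬ ∃ t : ℝ≥0, Broken c w u f t ∧ tau w u f + t < tau w x f) ∧ First c w x v f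

/-- The trial number `k` takes place at `v`. -/
def Trial (c : Params) (w : Config a) : ℕ → ℤ → Real₀ a → Prop
  | 0, v, f => First c w w.r v f
  | k + 1, v, f => ∃ u, Trial c w k u f ∧ Next c w u v f

theorem First.lt {c : Params} (hL : 1 ≤ c.L) {w : Config a} {x v : ℤ} {f : Real₀ a}
    (h : First c w x v f) : x < v := by
  obtain ⟨j, h1, rfl, -⟩ := h
  have : 1 ≤ j * c.L := Nat.mul_pos h1 hL
  have h2 : (1 : ℤ) ≤ j * c.L := by exact_mod_cast this
  omega

theorem First.good {c : Params} {w : Config a} {x v : ℤ} {f : Real₀ a}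
    (h : First c w x v f) : Good c w v f := by
  obtain ⟨j, h1, rfl, h2, -⟩ := h
  exact h2

theorem Next.lt {c : Params} (hL : 1 ≤ c.L) {w : Config a} {u v : ℤ} {f : Real₀ a}
    (h : Next c w u v f) : u < v := by
  obtain ⟨x, h1, -, -, h2⟩ := h
  exact h1.trans_lt (h2.lt hL)

theorem Trial.good {c : Params} {w : Config a} {k : ℕ} {v : ℤ} {f : Real₀ a}
    (h : Trial c w k v f) : Good c w v f := by
  cases k with
  | zero => exact First.good h
  | succ k =>
    obtain ⟨u, -, x, -, -, -, h2⟩ := h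
    exact h2.good

theorem Trial.lt {c : Params} (hL : 1 ≤ c.L) {w : Config a} {k : ℕ} {v : ℤ} {f : Real₀ a}
    (h : Trial c w k v f) : w.r < v := by
  induction k generalizing v with
  | zero => exact First.lt hL h
  | succ k ih =>
    obtain ⟨u, h1, h2⟩ := h
    exact (ih h1).trans (h2.lt hL)

/-! ### Measurability -/

theorem measurable_place (w : Config a) (v : ℤ) (l : ℤ × Fin a) :
    Measurable fun f => place w v f l :=
  (Measurable.eval (φ := fun f : Real₀ a => f l) (measurable_pi_apply l) (measurable_age w v l)).const_add _

theorem measurable_expInt (θ : ℝ) : Measurable fun x : ℤ => ENNReal.ofReal (Real.exp (θ * x)) :=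
  measurable_of_countable _

theorem measurable_weight (θ : ℝ) (w : Config a) (z v : ℤ) (l : ℤ × Fin a) :
    Measurable fun f => weight θ w z v f l := by
  unfold weight
  split_ifs
  · exact (measurable_expInt θ).comp ((measurable_place w v l).sub_const v)
  · exact measurable_const

theorem measurableSet_good (c : Params) (w : Config a) (v : ℤ) : MeasurableSet {f | Good c w v f} := by
  refine MeasurableSet.inter (measurableSet_le
    (Measurable.tsum fun l => measurable_weight _ _ _ _ l) measurable_const) ?_
  have h : {f : Real₀ a | ∃ S : Finset (ℤ × Fin a), (a : ℝ) * c.L / 2 ≤ S.card ∧ ∀ l ∈ S,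
      l ∈ alive w v ∧ v - c.L < l.1 ∧ v - c.L < place w v f l ∧ place w v f l ≤ v} =
      ⋃ S : Finset (ℤ × Fin a), ⋃ _ : (a : ℝ) * c.L / 2 ≤ S.card, ⋂ l ∈ S,
        ⋂ _ : l ∈ alive w v ∧ v - c.L < l.1 → True, {f | l ∈ alive w v ∧ v - c.L < l.1 ∧
          v - c.L < place w v f l ∧ place w v f l ≤ v} := by
    ext f; simp
  change MeasurableSet {f : Real₀ a | ∃ S : Finset (ℤ × Fin a), (a : ℝ) * c.L / 2 ≤ S.card ∧ ∀ l ∈ S,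
      l ∈ alive w v ∧ v - c.L < l.1 ∧ v - c.L < place w v f l ∧ place w v f l ≤ v}
  rw [h]
  refine MeasurableSet.iUnion fun S => MeasurableSet.iUnion fun _ => Finset.measurableSet_biInter _
    fun l _ => MeasurableSet.iInter fun _ => ?_
  refine (MeasurableSet.const _).inter ((MeasurableSet.const _).inter (MeasurableSet.inter ?_ ?_))
  · exact measurableSet_lt measurable_const (measurable_place w v l)
  · exact measurableSet_le (measurable_place w v l) measurable_const

theorem measurable_nu (u : ℤ) (k : ℕ) : Measurable fun f : Real₀ a => nu (walks f) u k := by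
  unfold nu
  split_ifs
  · exact measurable_const
  · refine Measurable.iInf fun l => Measurable.iInf fun _ => ?_
    have : (fun f : Real₀ a => hit (walks f l) (u + k)) = fun f => hit (f l) (u + k - l.1) := by
      funext f
      rw [← hit_shift]
      congr 1
      funext t
      simp only [walks]; ring
    rw [this]
    exact measurable_hit_apply l _

theorem measurable_auxTime (u : ℤ) (n : ℕ) : Measurable fun f : Real₀ a => auxTime f u n :=
  Finset.measurable_sum _ fun k _ => measurable_nu u k

theorem measurable_futV (w : Config a) (v : ℤ) : Measurable (futV w v) :=
  measurable_pathSpace fun l t =>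
    (Measurable.eval (φ := fun f : Real₀ a => f l) (measurable_pi_apply l)
      ((measurable_age w v l).add_const t)).sub
      (Measurable.eval (φ := fun f : Real₀ a => f l) (measurable_pi_apply l) (measurable_age w v l))

section Joint

variable {X : Type*} [MeasurableSpace X] {s g : X → Real₀ a} {t : X → ℝ≥0}

theorem measurable_eval_of (hg : Measurable g) (ht : Measurable t) (l : ℤ × Fin a) :
    Measurable fun x => g x l (t x) :=
  Measurable.eval (φ := fun x => g x l) ((measurable_pi_apply l).comp hg) ht

theorem measurable_floor_mul (ht : Measurable t) (α : ℝ) : Measurable fun x => ⌊α * t x⌋ :=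
  Int.measurable_floor.comp (ht.coe_nnreal_real.const_mul α)

theorem measurableSet_slowAux (c : Params) (u : ℤ) (hg : Measurable g) (ht : Measurable t) :
    MeasurableSet {x | SlowAux c u (g x) (t x)} := by
  have h : {x | SlowAux c u (g x) (t x)} = ⋃ n : ℕ, {x | ⌊c.α₂ * t x⌋₊ = n} ∩
      {x | (t x : ℝ≥0∞) < auxTime (g x) u n} := by
    ext x; simp [SlowAux]
  rw [h]
  refine MeasurableSet.iUnion fun n => MeasurableSet.inter ?_ ?_
  · exact (Nat.measurable_floor.comp (ht.coe_nnreal_real.const_mul c.α₂)) (measurableSet_singleton n)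
  · exact measurableSet_lt ht.coe_nnreal_ennreal ((measurable_auxTime u n).comp hg)

theorem measurableSet_fastBlock (c : Params) (w : Config a) (u : ℤ) (hs : Measurable s)
    (hg : Measurable g) (ht : Measurable t) :
    MeasurableSet {x | FastBlock c w u (s x) (g x) (t x)} := by
  have h : {x | FastBlock c w u (s x) (g x) (t x)} = ⋃ l : ℤ × Fin a, ⋃ _ : l ∈ alive w u,
      ⋃ _ : u - c.L < l.1, ⋃ _ : l.1 < u,
        {x | ⌊c.α₁ * t x⌋ + u < place w u (s x) l + g x l (t x)} := by
    ext x; simp only [Set.mem_iUnion, Set.mem_ofPred_eq, FastBlock, exists_prop]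
  rw [h]
  refine MeasurableSet.iUnion fun l => MeasurableSet.iUnion fun _ => MeasurableSet.iUnion fun _ =>
    MeasurableSet.iUnion fun _ => measurableSet_lt ((measurable_floor_mul ht _).add_const u) ?_
  exact ((measurable_place w u l).comp hs).add (measurable_eval_of hg ht l)

theorem measurableSet_fastBack (c : Params) (w : Config a) (u : ℤ) (hs : Measurable s)
    (hg : Measurable g) (ht : Measurable t) :
    MeasurableSet {x | FastBack c w u (s x) (g x) (t x)} := by
  refine measurableSet_le ((measurable_expInt c.θ).comp (measurable_floor_mul ht c.α₁)) ?_
  refine Measurable.tsum fun l => ((measurable_weight _ _ _ _ l).comp hs).mul ?_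
  exact (measurable_expInt c.θ).comp (measurable_eval_of hg ht l)

end Joint

theorem measurableSet_broken (c : Params) (w : Config a) (u : ℤ) :
    MeasurableSet {q : Real₀ a × ℝ≥0 | Broken c w u q.1 q.2} :=
  (measurableSet_slowAux c u measurable_fst measurable_snd).union
    ((measurableSet_fastBlock c w u measurable_fst ((measurable_futV w u).comp measurable_fst)
      measurable_snd).union (measurableSet_fastBack c w u measurable_fst
        ((measurable_futV w u).comp measurable_fst) measurable_snd))

/-- The time ranges over a continuum, so the event is a projection and only universal measurability
is claimed. -/
theorem uMeas_broken_before (c : Params) (w : Config a) (u x : ℤ) :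
    UMeas {f : Real₀ a | ∃ t : ℝ≥0, Broken c w u f t ∧ tau w u f + t < tau w x f} := by
  refine UMeas.exists_time (C := {q : Real₀ a × ℝ≥0 | Broken c w u q.1 q.2 ∧
    tau w u q.1 + q.2 < tau w x q.1}) ((measurableSet_broken c w u).inter ?_)
  have h1 : Measurable fun q : Real₀ a × ℝ≥0 => tau w u q.1 + q.2 :=
    ((measurable_tau w u).comp measurable_fst).add measurable_snd.coe_nnreal_ennreal
  exact measurableSet_lt h1 ((measurable_tau w x).comp measurable_fst)

theorem uMeas_broken (c : Params) (w : Config a) (u : ℤ) :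
    UMeas {f : Real₀ a | ∃ t : ℝ≥0, Broken c w u f t} :=
  UMeas.exists_time (C := {q : Real₀ a × ℝ≥0 | Broken c w u q.1 q.2}) (measurableSet_broken c w u)

theorem uMeas_first (c : Params) (w : Config a) (x v : ℤ) : UMeas {f | First c w x v f} := by
  refine UMeas.setOf_exists fun j => UMeas.setOf_and (UMeas.const _) (UMeas.setOf_and (UMeas.const _)
    (UMeas.setOf_and (UMeas.of_measurableSet (measurableSet_good c w v)) ?_))
  refine UMeas.setOf_forall fun i => UMeas.setOf_forall fun _ => UMeas.setOf_forall fun _ => ?_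
  exact UMeas.setOf_not (UMeas.of_measurableSet (measurableSet_good c w _))

theorem uMeas_next (c : Params) (w : Config a) (u v : ℤ) : UMeas {f | Next c w u v f} :=
  UMeas.setOf_exists fun x => UMeas.setOf_and (UMeas.const _) (UMeas.setOf_and
    (uMeas_broken_before c w u _) (UMeas.setOf_and (UMeas.setOf_not (uMeas_broken_before c w u _))
      (uMeas_first c w x v)))

theorem uMeas_trial (c : Params) (w : Config a) (k : ℕ) (v : ℤ) : UMeas {f | Trial c w k v f} := by
  induction k generalizing v with
  | zero => exact uMeas_first c w w.r v
  | succ k ih => exact UMeas.setOf_exists fun u => UMeas.setOf_and (ih u) (uMeas_next c w u v)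

/-! ### The trials are determined by the past -/

theorem Agree.place_eq {w : Config a} {v : ℤ} {f g : Real₀ a} (h : Agree w v f g)
    (hf : f ∈ Reg w v) {x : ℤ} (hx : x ≤ v) (l : ℤ × Fin a) : place w x g l = place w x f l := by
  rw [place, place, h.age_eq hf hx, (h.mono hx hf) l _ le_rfl]

theorem Agree.weight_eq {w : Config a} {v : ℤ} {f g : Real₀ a} (h : Agree w v f g)
    (hf : f ∈ Reg w v) {x : ℤ} (hx : x ≤ v) (θ : ℝ) (z : ℤ) (l : ℤ × Fin a) :
    weight θ w z x g l = weight θ w z x f l := by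
  rw [weight, weight, h.place_eq hf hx]

theorem Agree.good_iff {c : Params} {w : Config a} {v : ℤ} {f g : Real₀ a} (h : Agree w v f g)
    (hf : f ∈ Reg w v) {x : ℤ} (hx : x ≤ v) : Good c w x g ↔ Good c w x f := by
  simp only [Good, h.weight_eq hf hx, h.place_eq hf hx]

theorem Agree.first_iff {c : Params} {w : Config a} {v : ℤ} {f g : Real₀ a}
    (h : Agree w v f g) (hf : f ∈ Reg w v) (x : ℤ) : First c w x v g ↔ First c w x v f := by
  refine exists_congr fun j => and_congr_right fun _ => and_congr_right fun hv =>
    and_congr (h.good_iff hf le_rfl) ?_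
  refine forall_congr' fun i => forall_congr' fun _ => forall_congr' fun hi => not_congr (h.good_iff hf ?_)
  rw [hv]
  have : (i : ℤ) * c.L ≤ j * c.L := by exact_mod_cast Nat.mul_le_mul_right _ hi.le
  omega

theorem iInf_attained {ι : Type*} {S : Set ι} (hS : S.Finite) (h : ι → ℝ≥0∞)
    (hlt : ⨅ l ∈ S, h l < ∞) : ∃ l ∈ S, ⨅ l ∈ S, h l = h l := by
  have hne : (h '' S).Nonempty := by
    rw [Set.image_nonempty]
    by_contra hcon
    rw [Set.not_nonempty_iff_eq_empty] at hcon
    simp [hcon] at hlt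
  obtain ⟨l, hl, hlS⟩ := hne.csInf_mem (hS.image h)
  exact ⟨l, hl, by rw [hlS, sInf_image]⟩

theorem hit_walks (f : Real₀ a) (l : ℤ × Fin a) (m : ℤ) : hit (walks f l) m = hit (f l) (m - l.1) := by
  rw [← hit_shift]
  congr 1
  funext t
  simp only [walks]; ring

theorem nu_succ (f : Real₀ a) (u : ℤ) (k : ℕ) : nu (walks f) u (k + 1) =
    ⨅ l ∈ {l : ℤ × Fin a | max u (u + (k + 1 : ℕ) - bigM a) ≤ l.1 ∧ l.1 ≤ u + (k + 1 : ℕ) - 1},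
      hit (f l) (u + (k + 1 : ℕ) - l.1) := by
  rw [nu, if_neg (Nat.succ_ne_zero k)]
  refine iInf_congr fun l => ?_
  rw [hit_walks]
  rfl

theorem finite_window (x y : ℤ) : {l : ℤ × Fin a | x ≤ l.1 ∧ l.1 ≤ y}.Finite := by
  refine ((Set.finite_Icc x y).prod (Set.finite_univ (α := Fin a))).subset ?_
  rintro l ⟨h1, h2⟩
  exact ⟨⟨h1, h2⟩, Set.mem_univ _⟩

theorem auxTime_succ (f : Real₀ a) (u : ℤ) (n : ℕ) :
    auxTime f u (n + 1) = auxTime f u n + nu (walks f) u (n + 1) := by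
  rw [auxTime, Finset.sum_range_succ]; rfl

theorem auxTime_zero (f : Real₀ a) (u : ℤ) : auxTime f u 0 = 0 := by simp [auxTime, nu]

theorem auxTime_mono (f : Real₀ a) (u : ℤ) : Monotone (auxTime f u) :=
  monotone_nat_of_le_succ fun n => by rw [auxTime_succ]; exact le_self_add

/-- All labels at or to the right of `u` belong to particles that start at their birthplaces. -/
def Fresh (w : Config a) (u : ℤ) : Prop :=
  w.r ≤ u ∧ ∀ l : ℤ × Fin a, u ≤ l.1 → (l ∈ w.labels ∨ w.r < l.1) ∧ start w l = l.1

theorem fresh_of_lt {w : Config a} {u : ℤ} (h : w.r < u) : Fresh w u :=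
  ⟨h.le, fun l hl => ⟨Or.inr (by omega), by rw [start, if_neg (by omega)]⟩⟩

/-- The auxiliary front is behind the front. -/
theorem tau_le_auxTime {w : Config a} {u : ℤ} (hu : Fresh w u) (f : Real₀ a) (n : ℕ) :
    tau w (u + n) f ≤ tau w u f + auxTime f u n := by
  induction n with
  | zero => simp [auxTime_zero]
  | succ n ih =>
    rw [auxTime_succ, ← add_assoc, nu_succ]
    simp only [ENNReal.add_iInf]
    refine le_iInf₂ fun l hl => ?_
    obtain ⟨h1, h2⟩ := hl
    have hul : u ≤ l.1 := (le_max_left _ _).trans h1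
    obtain ⟨h3, h4⟩ := hu.2 l hul
    have hur := hu.1
    push_cast at h2 ⊢
    refine (tau_le w (v := u + (n + 1)) (by omega) f (l := l) ⟨by omega, h3⟩).trans ?_
    rw [h4]
    exact add_le_add ((tau_mono w f (by omega : l.1 ≤ u + n)).trans ih) le_rfl

/-- A walk that attains a waiting time is restarted in the auxiliary process no earlier than its
particle is born in the process, by `tau_le_auxTime`. So the part of its path used before time `t`
lies within its age at `v`. -/
theorem Agree.auxTime_le {w : Config a} {v u : ℤ} {f g : Real₀ a} (h : Agree w v f g)
    (hf : f ∈ Reg w v) (hu : Fresh w u) {t : ℝ≥0} (ht : tau w u f + t ≤ tau w v f) {n : ℕ}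
    (hn : auxTime f u n ≤ t) : auxTime g u n ≤ auxTime f u n := by
  induction n with
  | zero => simp [auxTime_zero]
  | succ n ih =>
    rw [auxTime_succ] at hn ⊢
    rw [auxTime_succ]
    refine add_le_add (ih (le_self_add.trans hn)) ?_
    have hfin : nu (walks f) u (n + 1) < ∞ :=
      lt_of_le_of_lt (le_add_self.trans hn) ENNReal.coe_lt_top
    rw [nu_succ] at hfin hn
    rw [nu_succ, nu_succ]
    obtain ⟨l, hl, hatt⟩ := iInf_attained (finite_window _ _) _ hfin
    rw [hatt] at hfin hn ⊢
    refine (iInf₂_le l hl).trans ?_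
    obtain ⟨h1, h2⟩ := hl
    have hul : u ≤ l.1 := (le_max_left _ _).trans h1
    obtain ⟨e, he⟩ : ∃ e : ℝ≥0, (e : ℝ≥0∞) = hit (f l) (u + (n + 1 : ℕ) - l.1) :=
      ⟨_, ENNReal.coe_toNNReal hfin.ne⟩
    rw [← he] at hn ⊢
    refine hit_le ?_
    rw [h l e ?_]
    · exact apply_of_hit_eq (f l).isStep he.symm
    · have hv := Reg.tau_lt_top hf le_rfl
      rw [← ENNReal.coe_le_coe, coe_age hv]
      have h3 : tau w l.1 f ≤ tau w u f + auxTime f u n := by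
        push_cast at h2
        refine (tau_mono w f (by omega : l.1 ≤ u + n)).trans (tau_le_auxTime hu f n)
      have h4 : tau w l.1 f + e ≤ tau w v f := by
        calc tau w l.1 f + e ≤ tau w u f + auxTime f u n + e := add_le_add h3 le_rfl
          _ = tau w u f + (auxTime f u n + e) := add_assoc _ _ _
          _ ≤ tau w u f + t := add_le_add le_rfl hn
          _ ≤ _ := ht
      exact ENNReal.le_sub_of_add_le_left (ne_top_of_le_ne_top hv.ne (le_self_add.trans h4)) h4

theorem futV_apply (w : Config a) (u : ℤ) (f : Real₀ a) (l : ℤ × Fin a) (t : ℝ≥0) :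
    futV w u f l t = f l (age w u f l + t) - f l (age w u f l) := rfl

theorem Agree.futV_eq {w : Config a} {v u : ℤ} {f g : Real₀ a} (h : Agree w v f g)
    (hf : f ∈ Reg w v) (huv : u ≤ v) {t : ℝ≥0} (ht : tau w u f + t ≤ tau w v f) {l : ℤ × Fin a}
    (hl : l.1 ≤ u) : futV w u g l t = futV w u f l t := by
  rw [futV_apply, futV_apply, h.age_eq hf huv, (h.mono huv hf) l _ le_rfl, h l]
  have hv := Reg.tau_lt_top hf le_rfl
  have hu := Reg.tau_lt_top hf huv
  rw [← ENNReal.coe_le_coe, ENNReal.coe_add, coe_age hv, coe_age hu]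
  refine ENNReal.le_sub_of_add_le_left (Reg.tau_lt_top hf (hl.trans huv)).ne ?_
  rw [← add_assoc, add_tsub_cancel_of_le (tau_mono w f hl)]
  exact ht

/-- All three ways of breaking at time `t` look at paths only up to time `t` after the passage at
`u`, hence up to the passage at `v`. One implication suffices, since `Agree` is symmetric on regular
paths. -/
theorem Agree.broken_of {c : Params} {w : Config a} {v u : ℤ} {f g : Real₀ a} (h : Agree w v f g)
    (hf : f ∈ Reg w v) (hu : w.r < u) (huv : u ≤ v) {t : ℝ≥0}
    (ht : tau w u f + t ≤ tau w v f) (hb : Broken c w u g t) : Broken c w u f t := by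
  rcases hb with h1 | ⟨l, h1, h2, h3, h4⟩ | h1
  · left
    by_contra hcon
    rw [SlowAux, not_lt] at hcon
    exact absurd ((h.auxTime_le hf (fresh_of_lt hu) ht hcon).trans hcon) (not_le.2 h1)
  · right; left
    refine ⟨l, h1, h2, h3, ?_⟩
    rwa [h.place_eq hf huv, h.futV_eq hf huv ht h1.1] at h4
  · right; right
    refine le_of_le_of_eq h1 (tsum_congr fun l => ?_)
    rw [h.weight_eq hf huv]
    by_cases hl : l ∈ alive w (u - c.L)
    · rw [h.futV_eq hf huv ht (by have := hl.1; omega)]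
    · simp [weight, hl]

theorem Agree.broken_iff {c : Params} {w : Config a} {v u : ℤ} {f g : Real₀ a} (h : Agree w v f g)
    (hf : f ∈ Reg w v) (hu : w.r < u) (huv : u ≤ v) {t : ℝ≥0}
    (ht : tau w u f + t ≤ tau w v f) : Broken c w u g t ↔ Broken c w u f t := by
  refine ⟨h.broken_of hf hu huv ht, (h.symm hf).broken_of (h.reg hf) hu huv ?_⟩
  rwa [h.tau_eq hf huv, h.tau_eq hf le_rfl]

theorem Agree.broken_before_iff {c : Params} {w : Config a} {v u x : ℤ} {f g : Real₀ a}
    (h : Agree w v f g) (hf : f ∈ Reg w v) (hu : w.r < u) (huv : u ≤ v) (hx : x ≤ v) :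
    (∃ t : ℝ≥0, Broken c w u g t ∧ tau w u g + t < tau w x g) ↔
      ∃ t : ℝ≥0, Broken c w u f t ∧ tau w u f + t < tau w x f := by
  rw [h.tau_eq hf huv, h.tau_eq hf hx]
  refine exists_congr fun t => and_congr_left fun ht => h.broken_iff hf hu huv ?_
  exact ht.le.trans (tau_mono w f hx)

/-- With blocks of positive length the break site satisfies `x < v`, so the front leaves `x` no
later than it reaches `v`, and the break is decided by the past of `v`. -/
theorem Agree.next_iff {c : Params} (hL : 1 ≤ c.L) {w : Config a} {v u : ℤ} {f g : Real₀ a}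
    (h : Agree w v f g) (hf : f ∈ Reg w v) (hu : w.r < u) : Next c w u v g ↔ Next c w u v f := by
  refine exists_congr fun x => and_congr_right fun hx => ?_
  rw [h.first_iff hf x]
  constructor
  · rintro ⟨h1, h2, h3⟩
    have hxv := h3.lt hL
    rw [h.broken_before_iff hf hu (by omega) (by omega)] at h1 h2
    exact ⟨h1, h2, h3⟩
  · rintro ⟨h1, h2, h3⟩
    have hxv := h3.lt hL
    rw [← h.broken_before_iff hf hu (by omega) (by omega)] at h1 h2
    exact ⟨h1, h2, h3⟩

theorem Agree.trial_iff {c : Params} (hL : 1 ≤ c.L) {w : Config a} {v : ℤ} {f g : Real₀ a}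
    (h : Agree w v f g) (hf : f ∈ Reg w v) (k : ℕ) : Trial c w k v g ↔ Trial c w k v f := by
  induction k generalizing v with
  | zero => exact h.first_iff hf _
  | succ k ih =>
    refine exists_congr fun u => ?_
    constructor
    · rintro ⟨h1, h2⟩
      have h3 := (h2.lt hL).le
      have h4 := (ih (h.mono h3 hf) (Reg.mono h3 hf)).1 h1
      exact ⟨h4, (h.next_iff hL hf (h4.lt hL)).1 h2⟩
    · rintro ⟨h1, h2⟩
      have h3 := (h2.lt hL).le
      exact ⟨(ih (h.mono h3 hf) (Reg.mono h3 hf)).2 h1, (h.next_iff hL hf (h1.lt hL)).2 h2⟩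

end

/-! ### Almost sure properties and the speed of the fronts -/

section
variable {a : ℕ} {μ : Measure (Real₀ a)}

/-! ### Almost sure regularity -/

theorem age_of_le (w : Config a) {v : ℤ} (hv : v ≤ w.r) (f : Real₀ a) (l : ℤ × Fin a) :
    age w v f l = 0 := by
  rw [age, tau_of_le w hv]; simp

theorem futV_of_le (w : Config a) {v : ℤ} (hv : v ≤ w.r) (f : Real₀ a) : futV w v f = f := by
  funext l
  refine Subtype.ext (funext fun t => ?_)
  change futV w v f l t = f l t
  rw [futV_apply, age_of_le w hv]; simp

theorem futV_of_ge (w : Config a) {v : ℤ} (f : Real₀ a) {l : ℤ × Fin a} (hl : v ≤ l.1) :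
    futV w v f l = f l := by
  refine Subtype.ext (funext fun t => ?_)
  change futV w v f l t = f l t
  rw [futV_apply, age_of_ge w f hl]; simp

theorem place_of_le (w : Config a) {v : ℤ} (hv : v ≤ w.r) (f : Real₀ a) (l : ℤ × Fin a) :
    place w v f l = start w l := by
  rw [place, age_of_le w hv]; simp

/-- The weights of the initial particles. -/
def rootWeight (θ : ℝ) (w : Config a) (l : ℤ × Fin a) : ℝ≥0∞ := weight θ w w.r w.r (fun _ => default) l

theorem weight_root (θ : ℝ) (w : Config a) (z : ℤ) (f g : Real₀ a) (l : ℤ × Fin a) :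
    weight θ w z w.r f l = weight θ w z w.r g l := by
  rw [weight, weight, place_of_le w le_rfl, place_of_le w le_rfl]

theorem mem_alive_root {w : Config a} {l : ℤ × Fin a} : l ∈ alive w w.r ↔ l ∈ w.labels :=
  ⟨fun h => h.2.resolve_right (by have := h.1; omega), fun h => ⟨w.label_le l h, Or.inl h⟩⟩

theorem rootWeight_of_mem (θ : ℝ) {w : Config a} {l : ℤ × Fin a} (h : l ∈ w.labels) :
    rootWeight θ w l = ENNReal.ofReal (Real.exp (θ * ((w.pos l - w.r : ℤ) : ℝ))) := by
  rw [rootWeight, weight, if_pos (mem_alive_root.2 h), place_of_le w le_rfl, start,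
    if_pos (w.label_le l h)]

theorem rootWeight_of_notMem (θ : ℝ) {w : Config a} {l : ℤ × Fin a} (h : l ∉ w.labels) :
    rootWeight θ w l = 0 := by
  rw [rootWeight, weight, if_neg (mt mem_alive_root.1 h)]

theorem Config.Admissible.tsum_rootWeight {θ : ℝ} {w : Config a} (h : w.Admissible θ) :
    ∑' l, rootWeight θ w l < ∞ := by
  refine lt_of_eq_of_lt ?_ h.1
  have h1 := tsum_subtype w.labels (fun l => ENNReal.ofReal (Real.exp (θ * ((w.pos l - w.r : ℤ) : ℝ))))
  rw [h1]
  refine tsum_congr fun l => ?_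
  by_cases hl : l ∈ w.labels
  · rw [rootWeight_of_mem θ hl, Set.indicator_of_mem hl]
  · rw [rootWeight_of_notMem θ hl, Set.indicator_of_notMem hl]

/-- A bound for the exponential weights bounds the positions. -/
theorem place_add_lt {θ : ℝ} (hθ : 0 < θ) {w : Config a} {u : ℤ} {f g : Real₀ a} {t : ℝ≥0} {y : ℝ}
    (h : ∑' l, weight θ w u u f l * ENNReal.ofReal (Real.exp (θ * g l t)) <
      ENNReal.ofReal (Real.exp (θ * y))) {l : ℤ × Fin a} (hl : l ∈ alive w u) :
    (place w u f l + g l t : ℝ) < u + y := by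
  have h1 := (ENNReal.le_tsum l).trans_lt h
  rw [weight, if_pos hl, ← ENNReal.ofReal_mul (Real.exp_pos _).le, ← Real.exp_add,
    ENNReal.ofReal_lt_ofReal_iff (Real.exp_pos _), Real.exp_lt_exp, ← mul_add] at h1
  have h2 := lt_of_mul_lt_mul_left h1 hθ.le
  push_cast at h2
  linarith

/-- Doob's inequality with the level `exp n`; the bounds tend to `0` because the initial exponential
norm is finite. -/
theorem ae_root_bound (hμ : IsMeshFamily μ coord) {θ q : ℝ} (hq : psi θ ≤ q) {w : Config a}
    (hw : ∑' l, rootWeight θ w l < ∞) : ∀ᵐ f ∂μ, ∃ n : ℕ, ∀ t : ℝ≥0,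
      ∑' l, rootWeight θ w l * ENNReal.ofReal (Real.exp (θ * f l t)) <
        ENNReal.ofReal (Real.exp (q * t + n)) := by
  have h0 : μ {f | ∀ n : ℕ, ∃ t : ℝ≥0, ENNReal.ofReal (Real.exp (q * t + n)) ≤
      ∑' l, rootWeight θ w l * ENNReal.ofReal (Real.exp (θ * f l t))} = 0 := by
    refine le_antisymm (ge_of_tendsto' (x := atTop) (f := fun n : ℕ =>
      ENNReal.ofReal (Real.exp (-n)) * ∑' l, rootWeight θ w l) ?_ fun n => ?_) bot_le
    · have h1 : Tendsto (fun n : ℕ => ENNReal.ofReal (Real.exp (-n))) atTop (𝓝 0) := by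
        rw [← ENNReal.ofReal_zero]
        refine ENNReal.tendsto_ofReal ?_
        exact Real.tendsto_exp_neg_atTop_nhds_zero.comp tendsto_natCast_atTop_atTop
      simpa using ENNReal.Tendsto.mul_const h1 (Or.inr hw.ne)
    · refine (measure_mono ?_).trans (hμ.exceed (rootWeight θ w) hq n)
      intro f hf
      exact hf n
  filter_upwards [measure_eq_zero_iff_ae_notMem.1 h0] with f hf
  by_contra hcon
  refine hf fun n => ?_
  by_contra hn
  exact hcon ⟨n, fun t => lt_of_not_ge fun ht => hn ⟨t, ht⟩⟩

theorem iInf_attained_of_finite {ι : Type*} {A : Set ι} {h : ι → ℝ≥0∞} {N : ℝ≥0∞}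
    (hS : {l | l ∈ A ∧ h l ≤ N}.Finite) (hN : ⨅ l ∈ A, h l < N) :
    ∃ l ∈ A, ⨅ l ∈ A, h l = h l := by
  simp only [iInf_lt_iff] at hN
  obtain ⟨l₁, h1, h2⟩ := hN
  obtain ⟨l₀, h3, h4⟩ := Set.exists_min_image _ h hS ⟨l₁, h1, h2.le⟩
  refine ⟨l₀, h3.1, le_antisymm (iInf₂_le l₀ h3.1) (le_iInf₂ fun l hl => ?_)⟩
  rcases le_or_gt (h l) N with h5 | h5
  · exact h4 l ⟨hl, h5⟩
  · exact h3.2.trans h5.le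

/-- Borel–Cantelli: an initial particle reaches `v ≥ w.r` by time `N` with probability at most a
constant times its exponential weight, and the weights are summable. -/
theorem ae_finite_hit_le (hμ : IsMeshFamily μ coord) {θ : ℝ} (hθ : 0 < θ) {w : Config a}
    (hw : ∑' l, rootWeight θ w l < ∞) (v : ℤ) (hv : w.r ≤ v) (N : ℕ) :
    ∀ᵐ f ∂μ, {l : ℤ × Fin a | l ∈ w.labels ∧ hit (f l) (v - start w l) ≤ N}.Finite := by
  have h1 : ∀ l, μ {f | l ∈ w.labels ∧ hit (f l) (v - start w l) ≤ N} ≤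
      ENNReal.ofReal (Real.exp (psi θ * N)) * rootWeight θ w l := by
    intro l
    by_cases hl : l ∈ w.labels
    · have h2 := hμ.exceed_single l (v := θ) le_rfl (-(psi θ * N) + θ * (w.r - w.pos l))
      rw [rootWeight_of_mem θ hl, ← ENNReal.ofReal_mul (Real.exp_pos _).le, ← Real.exp_add]
      refine (measure_mono ?_).trans (h2.trans (ENNReal.ofReal_le_ofReal (Real.exp_le_exp.2 ?_)))
      · rintro f ⟨-, hf⟩
        obtain ⟨e, he⟩ : ∃ e : ℝ≥0, (e : ℝ≥0∞) = hit (f l) (v - start w l) :=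
          ⟨_, ENNReal.coe_toNNReal (ne_top_of_le_ne_top (ENNReal.natCast_ne_top N) hf)⟩
        refine ⟨e, ?_⟩
        rw [apply_of_hit_eq (f l).isStep he.symm, start, if_pos (w.label_le l hl)]
        rw [← he] at hf
        have h3 : (e : ℝ) ≤ N := by exact_mod_cast hf
        have h4 : (w.r : ℝ) ≤ v := by exact_mod_cast hv
        push_cast
        nlinarith [psi_nonneg θ]
      · push_cast
        linarith
    · simp [hl]
  have h2 : ∑' l, μ {f | l ∈ w.labels ∧ hit (f l) (v - start w l) ≤ N} ≠ ∞ := by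
    refine ne_top_of_le_ne_top ?_ (ENNReal.tsum_le_tsum h1)
    rw [ENNReal.tsum_mul_left]
    exact ENNReal.mul_ne_top ENNReal.ofReal_ne_top hw.ne
  filter_upwards [ae_finite_setOfPred_mem h2] with f hf
  exact hf

/-- The configurations with a finite exponential norm and a particle at the front. -/
structure Proper (θ : ℝ) (w : Config a) : Prop where
  finite : ∑' l, rootWeight θ w l < ∞
  front : ∃ l ∈ w.labels, w.pos l = w.r

/-- A particle at the front reaches every level, so passage times are finite. They are attained
because only finitely many particles can compete before a finite time. -/
theorem Proper.ae_reg (hμ : IsMeshFamily μ coord) {θ : ℝ} (hθ : 0 < θ) {w : Config a}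
    (hw : Proper θ w) : ∀ᵐ f ∂μ, ∀ v, f ∈ Reg w v := by
  obtain ⟨l₀, hl₀, hpos⟩ := hw.front
  have h1 : ∀ᵐ f ∂μ, ∀ (d : ℕ) (N : ℕ),
      {l : ℤ × Fin a | l ∈ w.labels ∧ hit (f l) (w.r + d - start w l) ≤ N}.Finite :=
    ae_all_iff.2 fun d => ae_all_iff.2 fun N =>
      ae_finite_hit_le hμ hθ hw.finite (w.r + d) (by omega) N
  have h2 : ∀ᵐ f ∂μ, ∀ d : ℕ, hit (f l₀) d ≠ ∞ := ae_all_iff.2 fun d => hμ.ae_hit_ne_top l₀ d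
  filter_upwards [h1, h2] with f hf1 hf2
  intro v x hx hxv
  obtain ⟨d, rfl⟩ : ∃ d : ℕ, x = w.r + d := ⟨(x - w.r).toNat, by omega⟩
  have hfin : tau w (w.r + d) f < ∞ := by
    have h3 := w.label_le l₀ hl₀
    refine (tau_le w hx f (l := l₀) ⟨by omega, Or.inl hl₀⟩).trans_lt ?_
    rw [tau_of_le w h3, zero_add, start, if_pos h3, hpos, add_sub_cancel_left]
    exact lt_top_iff_ne_top.2 (hf2 d)
  refine ⟨hfin, ?_⟩
  obtain ⟨N, hN⟩ := ENNReal.exists_nat_gt hfin.ne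
  set h := fun l : ℤ × Fin a => tau w l.1 f + hit (f l) (w.r + d - start w l) with hh
  set S := {l | l ∈ alive w (w.r + d - 1) ∧ h l ≤ N} with hS
  have hSf : S.Finite := by
    refine ((hf1 d N).union (finite_window (w.r + 1) (w.r + d - 1))).subset ?_
    rintro l ⟨⟨h3, h4⟩, h5⟩
    rcases h4 with h4 | h4
    · exact Or.inl ⟨h4, le_add_self.trans h5⟩
    · exact Or.inr ⟨by omega, h3⟩
  rw [tau_eq w hx] at hN ⊢
  exact iInf_attained_of_finite hSf hN

end

section
variable {a : ℕ} {μ : Measure (Real₀ a)}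

/-! ### The speed of the front is bounded -/

/-- Borel–Cantelli; the moment order `2 ≤ p` makes the deviation probabilities summable. -/
theorem IsWalkLaw.ae_window_eventually (hμ : IsWalkLaw μ) {g : Real₀ a → ℝ} {m : ℕ}
    (hm : 0 < m) {x : ℤ} (hg : Measurable[labSigma (window a x m)] g) {p : ℕ}
    (hgp : MemLp g (2 * p : ℕ) μ) (hp : 2 ≤ p) {ε : ℝ} (hε : 0 < ε) (u : ℤ) :
    ∀ᵐ f ∂μ, ∀ᶠ n : ℕ in atTop,
      |∑ j ∈ Finset.range n, (g (shift (u + j) f) - ∫ f, g f ∂μ)| < ε * n := by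
  obtain ⟨C, hC, h⟩ := hμ.window_tail hm hg hgp (by omega) hε
  have := hμ.mesh.isProbabilityMeasure
  have hs : ∑' n : ℕ, μ {f | ε * (n + 1 : ℕ) ≤
      |∑ j ∈ Finset.range (n + 1), (g (shift (u + j) f) - ∫ f, g f ∂μ)|} ≠ ∞ := by
    refine ne_top_of_le_ne_top ?_ (ENNReal.tsum_le_tsum fun n => h u (n + 1) (by omega))
    have h1 : Summable fun n : ℕ => C / ((n + 1 : ℕ) : ℝ) ^ p := by
      have h2 := (summable_nat_add_iff 1).2 (Real.summable_one_div_nat_pow.2 (by omega : 1 < p))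
      simpa [div_eq_mul_inv] using h2.mul_left C
    exact h1.tsum_ofReal_ne_top
  filter_upwards [ae_eventually_notMem hs] with f hf
  obtain ⟨N, hN⟩ := eventually_atTop.1 hf
  refine eventually_atTop.2 ⟨N + 1, fun n hn => ?_⟩
  obtain ⟨k, rfl⟩ : ∃ k, n = k + 1 := ⟨n - 1, by omega⟩
  exact lt_of_not_ge (hN k (by omega))

theorem IsMeshFamily.ae_slack_ne_top (hμ : IsMeshFamily μ coord) {u β : ℝ} (hu : 0 < u)
    (hβ : psi u ≤ u * β) : ∀ᵐ f ∂μ, ∀ l, slack β (f l) ≠ ∞ :=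
  ae_all_iff.2 fun l => ae_ne_top_of_lintegral_pow
    ((measurable_slack β).comp (measurable_pi_apply l)) (hμ.lintegral_slack_pow l hu hβ one_ne_zero)
    one_ne_zero

theorem IsMeshFamily.ae_slack_neg_ne_top (hμ : IsMeshFamily μ coord) {u β : ℝ} (hu : 0 < u)
    (hβ : psi u ≤ u * β) : ∀ᵐ f ∂μ, ∀ l, slack β (f l).neg ≠ ∞ :=
  ae_all_iff.2 fun l => ae_ne_top_of_lintegral_pow
    ((measurable_slack β).comp (StepPath.measurable_neg.comp (measurable_pi_apply l)))
    (hμ.lintegral_slack_neg_pow l hu hβ one_ne_zero) one_ne_zero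

theorem slack_anti {β β' : ℝ} (h : β ≤ β') (f : ℝ≥0 → ℤ) : slack β' f ≤ slack β f := by
  refine iSup_mono fun t => ENNReal.ofReal_le_ofReal ?_
  have := mul_le_mul_of_nonneg_right h t.coe_nonneg
  linarith

theorem StepPath.eventually_zero (f : StepPath) : ∃ δ : ℝ≥0, 0 < δ ∧ ∀ t < δ, f t = 0 := by
  have h := f.isStep.right_cont 0
  obtain ⟨δ, hδ, hs⟩ := (mem_nhdsGT_iff_exists_Ioo_subset (a := (0 : ℝ≥0))).1 h
  refine ⟨δ, hδ, fun t ht => ?_⟩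
  rcases eq_or_lt_of_le (zero_le (a := t)) with h1 | h1
  · rw [← h1]; exact f.zero
  · have h2 : f t = f 0 := hs ⟨h1, ht⟩
    rw [h2]; exact f.zero

/-- The path rests at `0` for some time `δ`; a line that is steep enough is above the path from `δ`
on. -/
theorem slack_eventually_zero (f : StepPath) {β : ℝ} (hf : slack β f ≠ ∞) :
    ∀ᶠ n : ℕ in atTop, slack n f = 0 := by
  obtain ⟨δ, hδ, h⟩ := f.eventually_zero
  obtain ⟨N, hN⟩ := exists_nat_ge (max 0 (β + (slack β f).toReal / δ))
  filter_upwards [eventually_ge_atTop N] with n hn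
  refine le_antisymm (iSup_le fun t => ?_) bot_le
  rw [ENNReal.ofReal_eq_zero.2]
  have hn' : max 0 (β + (slack β f).toReal / δ) ≤ n := hN.trans (by exact_mod_cast hn)
  rcases lt_or_ge t δ with ht | ht
  · rw [h t ht]
    have := t.coe_nonneg
    have h0 := (le_max_left _ _).trans hn'
    push_cast
    nlinarith
  · have h1 := le_add_slack hf t
    have h2 := (le_max_right _ _).trans hn'
    have hδ' : (0 : ℝ) < δ := hδ
    have ht' : (δ : ℝ) ≤ t := ht
    have h3 : (slack β f).toReal / δ * δ = (slack β f).toReal := by field_simp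
    have h4 : (slack β f).toReal / δ * δ ≤ (slack β f).toReal / δ * t :=
      mul_le_mul_of_nonneg_left ht' (by positivity)
    nlinarith

/-- The total slack of the walks born at `k`. -/
def slackSum (β : ℝ) (k : ℤ) (f : Real₀ a) : ℝ := ∑ i, (slack β (f (k, i))).toReal

theorem slackSum_nonneg (β : ℝ) (k : ℤ) (f : Real₀ a) : 0 ≤ slackSum β k f :=
  Finset.sum_nonneg fun _ _ => ENNReal.toReal_nonneg

theorem slackSum_shift (β : ℝ) (k j : ℤ) (f : Real₀ a) :
    slackSum β k (shift j f) = slackSum β (k + j) f := rfl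

theorem measurable_slackSum (β : ℝ) (k : ℤ) :
    Measurable[labSigma (window a k 1)] (slackSum (a := a) β k) :=
  Finset.measurable_sum _ fun i _ => ((measurable_slack β).comp (measurable_labSigma
    (show ((k, i) : ℤ × Fin a) ∈ window a k 1 from ⟨le_rfl, by simp⟩))).ennreal_toReal

theorem IsMeshFamily.memLp_slackSum (hμ : IsMeshFamily μ coord) {u β : ℝ} (hu : 0 < u)
    (hβ : psi u ≤ u * β) (k : ℤ) {q : ℕ} (hq : q ≠ 0) : MemLp (slackSum (a := a) β k) q μ :=
  memLp_finsetSum _ fun i _ => memLp_toReal_of_lintegral_pow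
    ((measurable_slack β).comp (measurable_pi_apply (k, i))) (hμ.lintegral_slack_pow _ hu hβ hq) hq

/-- Dominated convergence as the slope tends to infinity, with the slack over `β₀` as integrable
bound. -/
theorem IsMeshFamily.exists_slackSum_le (hμ : IsMeshFamily μ coord) {u β₀ ε : ℝ} (hu : 0 < u)
    (hβ₀ : psi u ≤ u * β₀) (hε : 0 < ε) :
    ∃ β : ℝ, 0 < β ∧ β₀ ≤ β ∧ ∫ f, slackSum (a := a) β 0 f ∂μ ≤ ε := by
  have := hμ.isProbabilityMeasure
  have h1 : ∀ i : Fin a, Tendsto (fun n : ℕ => ∫⁻ f, slack (max β₀ n) (f ((0 : ℤ), i)) ∂μ) atTop (𝓝 0) := by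
    intro i
    have h2 := tendsto_lintegral_of_dominated_convergence (μ := μ)
      (F := fun (n : ℕ) (f : Real₀ a) => slack (max β₀ n) (f ((0 : ℤ), i))) (f := fun _ => 0)
      (fun f => slack β₀ (f ((0 : ℤ), i)))
      (fun n => (measurable_slack _).comp (measurable_pi_apply _))
      (fun n => ae_of_all _ fun f => slack_anti (le_max_left _ _) _)
      (by simpa using (hμ.lintegral_slack_pow ((0 : ℤ), i) hu hβ₀ one_ne_zero).ne) (by
        filter_upwards [hμ.ae_slack_ne_top hu hβ₀] with f hf
        refine tendsto_const_nhds.congr' ?_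
        filter_upwards [slack_eventually_zero (f ((0 : ℤ), i)) (hf _)] with n hn
        exact (le_antisymm ((slack_anti (le_max_right _ _) _).trans hn.le) bot_le).symm)
    simpa using h2
  have h3 : Tendsto (fun n : ℕ => ∫ f, slackSum (a := a) (max β₀ n) 0 f ∂μ) atTop (𝓝 0) := by
    have h4 : ∀ n : ℕ, ∫ f, slackSum (a := a) (max β₀ n) 0 f ∂μ =
        ∑ i : Fin a, (∫⁻ f, slack (max β₀ n) (f ((0 : ℤ), i)) ∂μ).toReal := by
      intro n
      have hβ : psi u ≤ u * max β₀ n := hβ₀.trans (mul_le_mul_of_nonneg_left (le_max_left _ _) hu.le)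
      unfold slackSum
      rw [integral_finsetSum]
      · refine Finset.sum_congr rfl fun i _ => ?_
        have hm : Measurable fun f : Real₀ a => slack (max β₀ n) (f ((0 : ℤ), i)) :=
          (measurable_slack _).comp (measurable_pi_apply ((0 : ℤ), i))
        refine integral_toReal hm.aemeasurable ?_
        filter_upwards [hμ.ae_slack_ne_top hu hβ] with f hf
        exact lt_top_iff_ne_top.2 (hf _)
      · intro i _
        have := memLp_toReal_of_lintegral_pow
          ((measurable_slack (max β₀ n)).comp (measurable_pi_apply ((0 : ℤ), i)))
          (hμ.lintegral_slack_pow _ hu hβ one_ne_zero) one_ne_zero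
        exact memLp_one_iff_integrable.1 (by simpa using this)
    simp only [h4]
    have h5 := tendsto_finsetSum (Finset.univ : Finset (Fin a))
      fun i _ => (ENNReal.tendsto_toReal ENNReal.zero_ne_top).comp (h1 i)
    simpa using h5
  obtain ⟨n, hn1, hn2⟩ := ((h3.eventually (gt_mem_nhds hε)).and (eventually_ge_atTop 1)).exists
  refine ⟨max β₀ n, ?_, le_max_left _ _, hn1.le⟩
  have : (1 : ℝ) ≤ n := by exact_mod_cast hn2
  exact lt_of_lt_of_le (by linarith) (le_max_right _ _)

/-- If the particles present at the passage at `u` stay behind a line of slope `β`, then so does the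
front, up to the slacks of the particles born later. -/
theorem le_tau_of_slack {w : Config a} {u : ℤ} {f : Real₀ a} (hreg : ∀ v, f ∈ Reg w v) (hu : w.r ≤ u)
    {β X : ℝ} (hX : 0 ≤ X)
    (hold : ∀ l ∈ alive w u, ∀ t, (place w u f l + futV w u f l t : ℝ) ≤ u + β * t + X)
    (hnew : ∀ l, u < l.1 → slack β (f l) ≠ ∞) (k : ℕ) :
    (k : ℝ) ≤ β * ((tau w (u + k) f).toReal - (tau w u f).toReal) + X +
      ∑ j ∈ Finset.range k, slackSum β (u + j) f := by
  induction k using Nat.strong_induction_on with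
  | _ k ih =>
    rcases Nat.eq_zero_or_pos k with rfl | hk
    · simpa using hX
    have hfin : ∀ v, tau w v f ≠ ∞ := fun v => (Reg.tau_lt_top (hreg v) le_rfl).ne
    obtain ⟨htop, l, ⟨hl1, hl2⟩, hatt⟩ := hreg (u + k) (u + k) (by omega) le_rfl
    have hhit : hit (f l) (u + k - start w l) ≠ ∞ :=
      fun h => htop.ne (by rw [hatt, h]; simp)
    obtain ⟨e, he⟩ : ∃ e : ℝ≥0, (e : ℝ≥0∞) = hit (f l) (u + k - start w l) :=
      ⟨_, ENNReal.coe_toNNReal hhit⟩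
    have hfe := apply_of_hit_eq (f l).isStep he.symm
    rw [← he] at hatt
    have hattR : (tau w (u + k) f).toReal = (tau w l.1 f).toReal + e := by
      rw [hatt, ENNReal.toReal_add (hfin _) ENNReal.coe_ne_top]; rfl
    have hS : ∀ j, 0 ≤ slackSum β (u + j) f := fun j => slackSum_nonneg _ _ _
    rcases le_or_gt l.1 u with hlu | hlu
    · obtain ⟨t, ht⟩ : ∃ t : ℝ≥0, tau w (u + k) f = tau w u f + t := by
        refine ⟨(tau w (u + k) f - tau w u f).toNNReal, ?_⟩
        rw [ENNReal.coe_toNNReal (ENNReal.sub_ne_top (hfin _)),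
          add_tsub_cancel_of_le (tau_mono w f (by omega))]
      have hage : e = age w u f l + t := by
        rw [← ENNReal.coe_inj, ENNReal.coe_add, coe_age (lt_top_iff_ne_top.2 (hfin u))]
        have h1 : tau w l.1 f + e = tau w l.1 f + (tau w u f - tau w l.1 f + t) := by
          rw [← hatt, ht, ← add_assoc, add_tsub_cancel_of_le (tau_mono w f hlu)]
        exact (ENNReal.add_right_inj (hfin _)).1 h1
      have h1 := hold l ⟨hlu, hl2⟩ t
      have h2 : (place w u f l + futV w u f l t : ℤ) = u + k := by
        rw [place, futV_apply, ← hage, hfe]; ring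
      have h3 : (place w u f l + futV w u f l t : ℝ) = u + k := by exact_mod_cast h2
      have h4 : (tau w (u + k) f).toReal - (tau w u f).toReal = t := by
        rw [ht, ENNReal.toReal_add (hfin _) ENNReal.coe_ne_top]; simp
      rw [h4]
      have h5 : 0 ≤ ∑ j ∈ Finset.range k, slackSum β (u + j) f := Finset.sum_nonneg fun j _ => hS j
      linarith
    -- The attaining particle was born at `u + s` with `s < k`. The induction hypothesis holds up to
    -- its birth, and its own slack is the additional term of the sum.
    · obtain ⟨s, hs⟩ : ∃ s : ℕ, l.1 = u + s := ⟨(l.1 - u).toNat, by omega⟩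
      have hsk : s < k := by omega
      have h1 := ih s hsk
      have h2 := le_add_slack (hnew l hlu) e
      rw [hfe, start, if_neg (by omega), hs] at h2
      push_cast at h2
      have h3 : (slack β (f l)).toReal ≤ slackSum β (u + s) f := by
        rw [← hs]
        exact Finset.single_le_sum (f := fun i => (slack β (f (l.1, i))).toReal)
          (fun i _ => ENNReal.toReal_nonneg) (Finset.mem_univ l.2)
      have h4 : ∑ j ∈ Finset.range s, slackSum β (u + j) f + slackSum β (u + s) f ≤
          ∑ j ∈ Finset.range k, slackSum β (u + j) f := by
        rw [← Finset.sum_range_succ]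
        exact Finset.sum_le_sum_of_subset_of_nonneg (Finset.range_mono hsk) fun j _ _ => hS j
      rw [hattR, hs]
      nlinarith

end

section
variable {a : ℕ} {μ : Measure (Real₀ a)}

/-! ### The auxiliary front in the bulk -/

theorem IsWalkLaw.exists_hit_tail_pow (hμ : IsWalkLaw μ) (d : ℕ) : ∃ C : ℝ, 0 < C ∧
    ∀ (S : Finset (ℤ × Fin a)) (n : ℕ), 1 ≤ n →
      μ {f | ∀ l ∈ S, (n : ℝ≥0∞) < hit (f l) d} ≤ ENNReal.ofReal ((C / √n) ^ S.card) := by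
  obtain ⟨C, hC, h⟩ := hit_tail (Ω := Real₀ a) (Λ := ℤ × Fin a) d
  refine ⟨C, hC, fun S n hn => ?_⟩
  have h1 : {f : Real₀ a | ∀ l ∈ S, (n : ℝ≥0∞) < hit (f l) d} =
      ⋂ l ∈ S, (fun f : Real₀ a => f l) ⁻¹' {g : StepPath | (n : ℝ≥0∞) < hit g d} := by
    ext f; simp
  rw [h1, hμ.indep.measure_inter_preimage_eq_mul S
    (fun l _ => measurableSet_lt measurable_const (measurable_hit _)),
    ENNReal.ofReal_pow (by positivity), ← Finset.prod_const]
  refine Finset.prod_le_prod' fun l _ => ?_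
  exact h hμ.mesh l n (by exact_mod_cast hn)

/-- The waiting time of the auxiliary front at a full window of sites. -/
def wait (k : ℤ) (f : Real₀ a) : ℝ≥0∞ :=
  ⨅ l ∈ {l : ℤ × Fin a | k - bigM a ≤ l.1 ∧ l.1 ≤ k - 1}, hit (f l) (k - l.1)

theorem wait_shift (k j : ℤ) (f : Real₀ a) : wait k (shift j f) = wait (k + j) f := by
  refine le_antisymm (le_iInf₂ fun l hl => ?_) (le_iInf₂ fun l hl => ?_)
  · refine (iInf₂_le ((l.1 - j, l.2) : ℤ × Fin a) ⟨by have := hl.1; simp only; omega,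
      by have := hl.2; simp only; omega⟩).trans (le_of_eq ?_)
    simp only [shift, sub_add_cancel]
    congr 1
    ring
  · refine (iInf₂_le ((l.1 + j, l.2) : ℤ × Fin a) ⟨by have := hl.1; simp only; omega,
      by have := hl.2; simp only; omega⟩).trans (le_of_eq ?_)
    simp only [shift]
    congr 1
    ring

theorem measurable_wait_labSigma (k : ℤ) :
    Measurable[labSigma (window a (k - bigM a) (bigM a))] (wait (a := a) k) :=
  Measurable.iInf fun l => Measurable.iInf fun hl =>
    (measurable_hit _).comp (measurable_labSigma (show l ∈ window a (k - bigM a) (bigM a) from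
      ⟨hl.1, by have := hl.2; omega⟩))

theorem measurable_wait (k : ℤ) : Measurable (wait (a := a) k) :=
  (measurable_wait_labSigma k).mono (labSigma_le _) le_rfl

theorem nu_eq_wait (f : Real₀ a) (u : ℤ) {k : ℕ} (hk : bigM a ≤ k) (hk0 : 0 < k) :
    nu (walks f) u k = wait (u + k) f := by
  obtain ⟨k, rfl⟩ : ∃ j, k = j + 1 := ⟨k - 1, by omega⟩
  rw [nu_succ, wait]
  rw [max_eq_right (by push_cast; omega)]

/-- An auxiliary front started later has fewer walks at its disposal, so it waits at least as long
at each site. -/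
theorem nu_add_succ_le (f : Real₀ a) (u : ℤ) (N k : ℕ) :
    nu (walks f) u (N + (k + 1)) ≤ nu (walks f) (u + N) (k + 1) := by
  rw [← add_assoc, nu_succ, nu_succ]
  refine le_iInf₂ fun l hl => ?_
  obtain ⟨h1, h2⟩ := hl
  push_cast at h1 h2 ⊢
  refine (iInf₂_le l ⟨?_, ?_⟩).trans (le_of_eq ?_)
  rotate_left
  · rw [max_le_iff] at h1 ⊢
    omega
  · omega
  · congr 1
    ring

theorem auxTime_add_le (f : Real₀ a) (u : ℤ) (N n : ℕ) :
    auxTime f u (N + n) ≤ auxTime f u N + auxTime f (u + N) n := by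
  induction n with
  | zero => simp
  | succ n ih =>
    rw [← add_assoc, auxTime_succ, auxTime_succ, ← add_assoc]
    exact add_le_add ih (nu_add_succ_le f u N n)

theorem nu_shift (f : Real₀ a) (u j : ℤ) (k : ℕ) :
    nu (walks (shift j f)) u k = nu (walks f) (u + j) k := by
  cases k with
  | zero => simp [nu]
  | succ k =>
    rw [nu_succ, nu_succ]
    refine le_antisymm (le_iInf₂ fun l hl => ?_) (le_iInf₂ fun l hl => ?_)
    · obtain ⟨h1, h2⟩ := hl
      refine (iInf₂_le ((l.1 - j, l.2) : ℤ × Fin a) ⟨?_, ?_⟩).trans (le_of_eq ?_)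
      rotate_left
      · rw [max_le_iff] at h1 ⊢; simp only; omega
      · simp only; omega
      · simp only [shift, sub_add_cancel]
        congr 1
        ring
    · obtain ⟨h1, h2⟩ := hl
      refine (iInf₂_le ((l.1 + j, l.2) : ℤ × Fin a) ⟨?_, ?_⟩).trans (le_of_eq ?_)
      rotate_left
      · rw [max_le_iff] at h1 ⊢; simp only; omega
      · simp only; omega
      · simp only [shift]
        congr 1
        ring

theorem auxTime_shift (f : Real₀ a) (u j : ℤ) (n : ℕ) :
    auxTime (shift j f) u n = auxTime f (u + j) n :=
  Finset.sum_congr rfl fun k _ => nu_shift f u j k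

theorem measurable_auxTime_labSigma (u : ℤ) (n : ℕ) :
    Measurable[labSigma {l | u ≤ l.1}] fun f : Real₀ a => auxTime f u n := by
  refine Finset.measurable_sum _ fun k _ => ?_
  cases k with
  | zero => simp only [nu, if_pos]; exact measurable_const
  | succ k =>
    simp only [nu_succ]
    exact Measurable.iInf fun l => Measurable.iInf fun hl => (measurable_hit _).comp
      (measurable_labSigma (show l ∈ {l : ℤ × Fin a | u ≤ l.1} from (le_max_left _ _).trans hl.1))

/-- The waiting times after the first full window. -/
theorem auxTime_bulk (f : Real₀ a) (u : ℤ) (n : ℕ) : auxTime f u (bigM a + n) =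
    auxTime f u (bigM a) + ∑ j ∈ Finset.range n, wait (u + bigM a + 1 + j) f := by
  induction n with
  | zero => simp
  | succ n ih =>
    rw [← add_assoc, auxTime_succ, ih, Finset.sum_range_succ, add_assoc,
      nu_eq_wait f u (by omega) (by omega)]
    congr 3
    push_cast; ring

theorem bigM_pos (a : ℕ) : 0 < bigM a := by unfold bigM; omega

/-- The number of moments that are used. -/
def mom (a : ℕ) : ℕ := a + 4

/-- A long wait means that many independent walks are all late, and each is late with probability of
order `n ^ (-1/2)`. -/
theorem IsWalkLaw.exists_wait_tail (hμ : IsWalkLaw μ) (ha : 1 ≤ a) : ∃ C : ℝ, 0 < C ∧ ∀ n : ℕ,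
    μ {f | (n : ℝ≥0∞) < wait 0 f} ≤ ENNReal.ofReal (C / ((n : ℝ) + 1) ^ (2 * mom a + 2)) := by
  have := hμ.mesh.isProbabilityMeasure
  obtain ⟨C, hC, h⟩ := hμ.exists_hit_tail_pow (bigM a)
  set q := 2 * mom a + 2 with hq
  -- Here `2 * q = 4 (a + 5) = M`. The tail is of order `n ^ (-M/2)`, two powers more than the
  -- moment of order `2 * mom a` needs for summability.
  have h2q : 2 * q ≤ bigM a * a := by
    simp only [hq, mom, bigM]; nlinarith
  obtain ⟨S, hS, hcard⟩ := Finset.exists_subset_card_eq (s := Finset.Ico (-(bigM a : ℤ)) 0 ×ˢ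
    (Finset.univ : Finset (Fin a))) (n := 2 * q) (by simpa using h2q)
  refine ⟨(C ^ 2) ^ q * 2 ^ q + 1, by positivity, fun n => ?_⟩
  rcases Nat.eq_zero_or_pos n with rfl | hn
  · refine prob_le_one.trans ?_
    rw [← ENNReal.ofReal_one]
    refine ENNReal.ofReal_le_ofReal ?_
    simp; positivity
  · refine (measure_mono ?_).trans ((h S n hn).trans (ENNReal.ofReal_le_ofReal ?_))
    · intro f hf l hl
      have h1 := hS hl
      simp only [Finset.mem_product, Finset.mem_Ico, Finset.mem_univ, and_true] at h1
      refine lt_of_lt_of_le hf ((iInf₂_le l ⟨by omega, by omega⟩).trans ?_)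
      exact hit_mono (f l).isStep (by simp; omega) (by omega)
    · have hn' : (1 : ℝ) ≤ n := by exact_mod_cast hn
      rw [hcard, pow_mul, div_pow, Real.sq_sqrt (by positivity), div_pow]
      rw [div_le_div_iff₀ (by positivity) (by positivity)]
      have h2 : ((n : ℝ) + 1) ^ q ≤ 2 ^ q * n ^ q := by
        rw [← mul_pow]; exact pow_le_pow_left₀ (by positivity) (by linarith) _
      have h3 : 0 ≤ (C ^ 2) ^ q := by positivity
      have h4 : 0 < (n : ℝ) ^ q := by positivity
      nlinarith [mul_le_mul_of_nonneg_left h2 h3]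

theorem IsWalkLaw.lintegral_wait_pow (hμ : IsWalkLaw μ) (ha : 1 ≤ a) :
    ∫⁻ f, wait 0 f ^ (2 * mom a) ∂μ < ∞ := by
  obtain ⟨C, hC, h⟩ := hμ.exists_wait_tail ha
  refine lintegral_pow_lt_top_of_tail (measurable_wait 0) _ h ?_ (by simp [mom])
  have h2 := (summable_nat_add_iff 1).2 (Real.summable_one_div_nat_pow.2 (by norm_num : 1 < 2))
  refine (h2.mul_left C).congr fun n => ?_
  rw [pow_add]
  push_cast
  have : (n : ℝ) + 1 ≠ 0 := by positivity
  field_simp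

theorem IsWalkLaw.measure_shift_ae (hμ : IsWalkLaw μ) {p : Real₀ a → Prop} (h : ∀ᵐ f ∂μ, p f) :
    ∀ᵐ f ∂μ, ∀ j, p (shift j f) := by
  refine ae_all_iff.2 fun j => ?_
  have h1 : MeasurePreserving (shift (a := a) j) μ μ := ⟨measurable_shift j, hμ.map_shift j⟩
  exact h1.quasiMeasurePreserving.ae h

theorem IsWalkLaw.ae_wait_ne_top (hμ : IsWalkLaw μ) (ha : 1 ≤ a) : ∀ᵐ f ∂μ, ∀ k, wait k f ≠ ∞ := by
  filter_upwards [hμ.measure_shift_ae (ae_ne_top_of_lintegral_pow (measurable_wait 0)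
    (hμ.lintegral_wait_pow ha) (by simp [mom]))] with f hf k
  have := hf k
  rwa [wait_shift, zero_add] at this

/-- The waiting time as a real number. -/
def waitR (k : ℤ) (f : Real₀ a) : ℝ := (wait k f).toReal

theorem waitR_nonneg (k : ℤ) (f : Real₀ a) : 0 ≤ waitR k f := ENNReal.toReal_nonneg

theorem waitR_shift (k j : ℤ) (f : Real₀ a) : waitR k (shift j f) = waitR (k + j) f := by
  rw [waitR, wait_shift, waitR]

theorem measurable_waitR (k : ℤ) :
    Measurable[labSigma (window a (k - bigM a) (bigM a))] (waitR (a := a) k) :=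
  Measurable.ennreal_toReal (measurable_wait_labSigma k)

theorem IsWalkLaw.memLp_waitR (hμ : IsWalkLaw μ) (ha : 1 ≤ a) :
    MemLp (waitR (a := a) 0) (2 * mom a : ℕ) μ :=
  memLp_toReal_of_lintegral_pow (measurable_wait 0) (hμ.lintegral_wait_pow ha) (by simp [mom])

/-- The mean waiting time. -/
def meanWait (μ : Measure (Real₀ a)) : ℝ := ∫ f, waitR 0 f ∂μ

theorem wait_pos (k : ℤ) (f : Real₀ a) : 0 < wait k f := by
  rw [pos_iff_ne_zero]
  intro h
  obtain ⟨l, hl, h1⟩ := iInf_attained (finite_window (a := a) (k - bigM a) (k - 1))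
    (fun l => hit (f l) (k - l.1)) (by
      change wait k f < ∞
      rw [h]; exact ENNReal.zero_lt_top)
  change wait k f = _ at h1
  rw [h1] at h
  refine (hit_pos (f l).isStep (m := k - l.1) ?_).ne' h
  have := hl.2
  rw [(f l).zero]; omega

theorem IsWalkLaw.meanWait_pos (hμ : IsWalkLaw μ) (ha : 1 ≤ a) : 0 < meanWait μ := by
  have := hμ.mesh.isProbabilityMeasure
  have hi : Integrable (waitR (a := a) 0) μ := by
    simpa using integrable_pow_of_memLp (j := 1) (hμ.memLp_waitR ha) (by simp [mom]; omega)
  rw [meanWait, integral_pos_iff_support_of_nonneg (fun f => waitR_nonneg 0 f) hi]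
  have h1 : ∀ᵐ f ∂μ, f ∈ Function.support (waitR (a := a) 0) := by
    filter_upwards [hμ.ae_wait_ne_top ha] with f hf
    rw [Function.mem_support, waitR]
    exact (ENNReal.toReal_pos (wait_pos 0 f).ne' (hf 0)).ne'
  have h2 : μ (Function.support (waitR (a := a) 0))ᶜ = 0 := h1
  rw [pos_iff_ne_zero]
  intro h3
  have h4 := measure_union_le (μ := μ) (Function.support (waitR (a := a) 0)) (Function.support (waitR (a := a) 0))ᶜ
  rw [Set.union_compl_self, measure_univ, h2, h3] at h4
  simp at h4

theorem IsWalkLaw.ae_auxTime_ne_top (hμ : IsWalkLaw μ) (ha : 1 ≤ a) :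
    ∀ᵐ f ∂μ, ∀ u n, auxTime f u n ≠ ∞ := by
  have h : ∀ᵐ f ∂μ, ∀ (l : ℤ × Fin a) (d : ℕ), hit (f l) d ≠ ∞ :=
    ae_all_iff.2 fun l => ae_all_iff.2 fun d => hμ.mesh.ae_hit_ne_top l d
  filter_upwards [h] with f hf u n
  refine ENNReal.sum_ne_top.2 fun k _ => ?_
  cases k with
  | zero => simp [nu]
  | succ k =>
    rw [nu_succ]
    refine ne_top_of_le_ne_top (hf (u + k, ⟨0, ha⟩) 1) ((iInf₂_le (u + k, ⟨0, ha⟩) ⟨?_, ?_⟩).trans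
      (le_of_eq ?_))
    rotate_left
    · have := bigM_pos a
      rw [max_le_iff]; simp only; push_cast; omega
    · simp only; push_cast; omega
    · congr 1
      simp

/-- After the first window the waiting times are translates of one functional, so the law of large
numbers with rate applies; the first window is a finite correction. -/
theorem IsWalkLaw.ae_auxTime_tendsto (hμ : IsWalkLaw μ) (ha : 1 ≤ a) :
    ∀ᵐ f ∂μ, ∀ u, Tendsto (fun n : ℕ => (auxTime f u n).toReal / n) atTop (𝓝 (meanWait μ)) := by
  have h1 : ∀ᵐ f ∂μ, ∀ (u : ℤ) (m : ℕ), ∀ᶠ n : ℕ in atTop,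
      |∑ j ∈ Finset.range n, (waitR 0 (shift (u + j) f) - meanWait μ)| < 1 / (m + 1 : ℝ) * n :=
    ae_all_iff.2 fun u => ae_all_iff.2 fun m => hμ.ae_window_eventually (bigM_pos a)
      (measurable_waitR 0) (hμ.memLp_waitR ha) (by simp [mom]) Nat.one_div_pos_of_nat u
  filter_upwards [h1, hμ.ae_wait_ne_top ha, hμ.ae_auxTime_ne_top ha] with f hf hw hA u
  rw [← tendsto_add_atTop_iff_nat (bigM a)]
  have h2 : Tendsto (fun n : ℕ => (∑ j ∈ Finset.range n, waitR (u + bigM a + 1 + j) f) / n) atTop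
      (𝓝 (meanWait μ)) := by
    rw [Metric.tendsto_nhds]
    intro ε hε
    obtain ⟨m, hm⟩ := exists_nat_one_div_lt hε
    filter_upwards [hf (u + bigM a + 1) m, eventually_gt_atTop 0] with n hn hn0
    have hn0' : (0 : ℝ) < n := by exact_mod_cast hn0
    simp only [waitR_shift, zero_add, Finset.sum_sub_distrib, Finset.sum_const, Finset.card_range,
      nsmul_eq_mul] at hn
    rw [Real.dist_eq, div_sub' hn0'.ne', abs_div, abs_of_pos hn0', div_lt_iff₀ hn0']
    exact hn.trans (mul_lt_mul_of_pos_right hm hn0')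
  have h3 : ∀ n : ℕ, (auxTime f u (n + bigM a)).toReal = (auxTime f u (bigM a)).toReal +
      ∑ j ∈ Finset.range n, waitR (u + bigM a + 1 + j) f := by
    intro n
    rw [add_comm n, auxTime_bulk, ENNReal.toReal_add (hA _ _)
      (ENNReal.sum_ne_top.2 fun _ _ => hw _), ENNReal.toReal_sum fun _ _ => hw _]
    rfl
  have h4 : Tendsto (fun n : ℕ => (n : ℝ) / ((n + bigM a : ℕ) : ℝ)) atTop (𝓝 1) := by
    simpa using tendsto_natCast_div_add_atTop (𝕜 := ℝ) (bigM a : ℝ)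
  have h5 : Tendsto (fun n : ℕ => (auxTime f u (bigM a)).toReal / ((n + bigM a : ℕ) : ℝ)) atTop (𝓝 0) :=
    tendsto_const_nhds.div_atTop (tendsto_natCast_atTop_atTop.comp (tendsto_add_atTop_nat _))
  have h6 := h5.add (h2.mul h4)
  rw [zero_add, mul_one] at h6
  refine h6.congr' ?_
  filter_upwards [eventually_gt_atTop 0] with n hn
  have hn0' : (n : ℝ) ≠ 0 := by exact_mod_cast hn.ne'
  rw [h3, add_div]
  congr 1
  field_simp

end

section
variable {a : ℕ} {μ : Measure (Real₀ a)}

/-! ### The speed of the auxiliary front -/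

theorem tendsto_auxTime_atTop {f : Real₀ a} {u : ℤ} {e : ℝ} (he : 0 < e)
    (h : Tendsto (fun n : ℕ => (auxTime f u n).toReal / n) atTop (𝓝 e)) :
    Tendsto (fun n : ℕ => (auxTime f u n).toReal) atTop atTop := by
  refine (h.pos_mul_atTop he tendsto_natCast_atTop_atTop).congr' ?_
  filter_upwards [eventually_gt_atTop 0] with n hn
  have : (n : ℝ) ≠ 0 := by exact_mod_cast hn.ne'
  field_simp

theorem le_sSup_auxTime_iff {f : Real₀ a} {u : ℤ} (hf : ∀ n, auxTime f u n ≠ ∞)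
    (h : Tendsto (fun n : ℕ => (auxTime f u n).toReal) atTop atTop) (t : ℝ≥0) (n : ℕ) :
    n ≤ sSup {n : ℕ | auxTime f u n ≤ t} ↔ auxTime f u n ≤ t := by
  obtain ⟨N, hN⟩ := (h.eventually_gt_atTop (t : ℝ)).exists
  have hN' : (t : ℝ≥0∞) < auxTime f u N := by
    rw [← ENNReal.ofReal_toReal (hf N), ← ENNReal.ofReal_coe_nnreal]
    exact (ENNReal.ofReal_lt_ofReal_iff_of_nonneg t.coe_nonneg).2 hN
  have hb : BddAbove {n : ℕ | auxTime f u n ≤ t} := ⟨N, fun m hm => by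
    by_contra hcon
    exact absurd (hN'.trans_le (auxTime_mono f u (not_le.1 hcon).le)) (not_lt.2 hm)⟩
  have hne : {n : ℕ | auxTime f u n ≤ t}.Nonempty := ⟨0, by simp [auxTime_zero]⟩
  exact ⟨fun hn => (auxTime_mono f u hn).trans (Nat.sSup_mem hne hb), fun hn => le_csSup hb hn⟩

theorem auxFront_eq (f : Real₀ a) (u : ℤ) (t : ℝ≥0) :
    auxFront (walks f) u t = u + (sSup {n : ℕ | auxTime f u n ≤ t} : ℕ) := rfl

theorem slowAux_iff {c : Params} {f : Real₀ a} {u : ℤ} (hα : 0 ≤ c.α₂) (hf : ∀ n, auxTime f u n ≠ ∞)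
    (h : Tendsto (fun n : ℕ => (auxTime f u n).toReal) atTop atTop) (t : ℝ≥0) :
    SlowAux c u f t ↔ auxFront (walks f) u t - u < ⌊c.α₂ * t⌋ := by
  have h1 := le_sSup_auxTime_iff hf h t ⌊c.α₂ * t⌋₊
  rw [auxFront_eq, add_sub_cancel_left, SlowAux, ← not_le, ← h1, not_le,
    ← Int.natCast_floor_eq_floor (mul_nonneg hα t.coe_nonneg)]
  norm_cast

/-- Inversion of a renewal sequence: with `N` sites gained at time `t`, `N / t` lies between `N`
over the time of `N + 1` sites and `N` over that of `N` sites. -/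
theorem tendsto_auxFront {f : Real₀ a} {u : ℤ} {e : ℝ} (he : 0 < e) (hf : ∀ n, auxTime f u n ≠ ∞)
    (h : Tendsto (fun n : ℕ => (auxTime f u n).toReal / n) atTop (𝓝 e)) :
    Tendsto (fun t : ℝ≥0 => (auxFront (walks f) u t : ℝ) / t) atTop (𝓝 e⁻¹) := by
  have htop := tendsto_auxTime_atTop he h
  have hiff := le_sSup_auxTime_iff hf htop
  set N : ℝ≥0 → ℕ := fun t => sSup {n : ℕ | auxTime f u n ≤ t} with hN
  have hNtop : Tendsto N atTop atTop := by
    refine tendsto_atTop.2 fun n => ?_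
    filter_upwards [eventually_ge_atTop (auxTime f u n).toNNReal] with t ht
    refine (hiff t n).2 ?_
    rw [← ENNReal.coe_toNNReal (hf n)]
    exact_mod_cast ht
  have h1 : Tendsto (fun n : ℕ => (n : ℝ) / (auxTime f u n).toReal) atTop (𝓝 e⁻¹) := by
    refine (h.inv₀ he.ne').congr fun n => ?_
    rw [inv_div]
  have h2 : Tendsto (fun n : ℕ => (n : ℝ) / (auxTime f u (n + 1)).toReal) atTop (𝓝 e⁻¹) := by
    have h3 := (tendsto_add_atTop_iff_nat 1).2 h1
    have h4 : Tendsto (fun n : ℕ => 1 / (auxTime f u (n + 1)).toReal) atTop (𝓝 0) :=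
      tendsto_const_nhds.div_atTop ((tendsto_add_atTop_iff_nat 1).2 htop)
    have h5 := h3.sub h4
    rw [sub_zero] at h5
    refine h5.congr fun n => ?_
    push_cast
    rw [← sub_div, add_sub_cancel_right]
  have h6 : Tendsto (fun t : ℝ≥0 => (N t : ℝ) / t) atTop (𝓝 e⁻¹) := by
    refine tendsto_of_tendsto_of_tendsto_of_le_of_le' (h2.comp hNtop) (h1.comp hNtop) ?_ ?_
    · filter_upwards [eventually_gt_atTop 0] with t ht
      have h7 : ¬ auxTime f u (N t + 1) ≤ t := fun h8 => by
        exact absurd ((hiff t _).2 h8) (Nat.not_succ_le_self _)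
      refine div_le_div_of_nonneg_left (Nat.cast_nonneg _) (by exact_mod_cast ht) ?_
      have h9 := ENNReal.toReal_mono (hf _) (not_le.1 h7).le
      simpa using h9
    · filter_upwards [hNtop.eventually (htop.eventually_gt_atTop 0)] with t ht
      refine div_le_div_of_nonneg_left (Nat.cast_nonneg _) ht ?_
      have h9 := ENNReal.toReal_mono ENNReal.coe_ne_top ((hiff t (N t)).1 le_rfl)
      simpa using h9
  have h7 : Tendsto (fun t : ℝ≥0 => (u : ℝ) / t) atTop (𝓝 0) :=
    tendsto_const_nhds.div_atTop (NNReal.tendsto_coe_atTop.2 tendsto_id)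
  have h8 := h7.add h6
  rw [zero_add] at h8
  refine h8.congr fun t => ?_
  rw [auxFront_eq, ← add_div]
  push_cast
  rfl

/-! ### The auxiliary front stays ahead of a line of small slope -/

/-- The auxiliary front started at `u` stays ahead of the line of slope `α`. -/
def Ahead (α : ℝ) (u : ℤ) (f : Real₀ a) : Prop := ∀ n : ℕ, auxTime f u n ≤ ENNReal.ofReal (n / α)

/-- Slowness is tightest at the times `n / c.α₂`. This turns a condition over all times into
countably many, and so into a measurable event of the labels from `u` on. -/
theorem not_slowAux_iff {c : Params} (hα : 0 < c.α₂) (u : ℤ) (f : Real₀ a) :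
    (¬ ∃ t, SlowAux c u f t) ↔ Ahead c.α₂ u f := by
  simp only [not_exists, SlowAux, not_lt]
  constructor
  · intro h n
    have h1 := h (Real.toNNReal (n / c.α₂))
    rw [Real.coe_toNNReal _ (by positivity), mul_div_cancel₀ _ hα.ne', Nat.floor_natCast] at h1
    exact h1
  · intro h t
    refine (h _).trans ?_
    rw [← ENNReal.ofReal_coe_nnreal]
    refine ENNReal.ofReal_le_ofReal ?_
    rw [div_le_iff₀ hα, mul_comm]
    exact Nat.floor_le (by positivity)

theorem measurableSet_ahead (α : ℝ) (u : ℤ) :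
    MeasurableSet[labSigma {l | u ≤ l.1}] {f : Real₀ a | Ahead α u f} := by
  have h : {f : Real₀ a | Ahead α u f} = ⋂ n : ℕ, {f | auxTime f u n ≤ ENNReal.ofReal (n / α)} := by
    ext f; simp [Ahead]
  rw [h]
  refine MeasurableSet.iInter fun n => ?_
  exact measurableSet_le (measurable_auxTime_labSigma u n) measurable_const

theorem IsWalkLaw.measure_ahead (hμ : IsWalkLaw μ) (α : ℝ) (u : ℤ) :
    μ {f | Ahead α u f} = μ {f | Ahead α 0 f} := by
  rw [← hμ.measure_shift u (labSigma_le _ _ (measurableSet_ahead α 0))]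
  congr 1
  ext f
  simp only [Set.mem_ofPred_eq, Ahead, auxTime_shift, zero_add]

/-- One walk from each of the first `N` sites is to the right of its start at the grid time `2 ^
(-k) < ε`; these are finitely many independent events of positive probability. -/
theorem IsWalkLaw.exists_fast (hμ : IsWalkLaw μ) (ha : 1 ≤ a) (N : ℕ) {ε : ℝ} (hε : 0 < ε) :
    ∃ A : Set (Real₀ a), MeasurableSet[labSigma {l | l.1 < (N : ℤ)}] A ∧ 0 < μ A ∧
      ∀ f ∈ A, ∀ n ≤ N, auxTime f 0 n ≤ ENNReal.ofReal (n * ε) := by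
  obtain ⟨k, hk⟩ := exists_pow_lt_of_lt_one hε (by norm_num : (1 / 2 : ℝ) < 1)
  set i₀ : Fin a := ⟨0, ha⟩
  set S : Finset (ℤ × Fin a) := (Finset.Ico (0 : ℤ) N).image fun x => (x, i₀) with hS
  have hpos : ∀ l, 0 < μ ((fun f : Real₀ a => f l) ⁻¹' {g : StepPath | 1 ≤ g (grid k 1)}) := by
    intro l
    have h1 := hμ.mesh.law k (l, 0)
    have h2 := stepLaw_Ici_pos (h := 1 / 2 ^ k) (by positivity) 1
    rw [← h1, Measure.map_apply (measurable_incr hμ.mesh.measurable k (l, 0)) measurableSet_Ici] at h2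
    refine lt_of_lt_of_eq h2 ?_
    congr 1
    ext f
    simp [incr, coord, grid]
  have hG : MeasurableSet {g : StepPath | 1 ≤ g (grid k 1)} :=
    measurableSet_le measurable_const (measurable_eval _)
  refine ⟨⋂ l ∈ S, (fun f : Real₀ a => f l) ⁻¹' {g : StepPath | 1 ≤ g (grid k 1)}, ?_, ?_, ?_⟩
  · refine Finset.measurableSet_biInter _ fun l hl => ?_
    have hl' : l ∈ {l : ℤ × Fin a | l.1 < (N : ℤ)} := by
      obtain ⟨x, hx, rfl⟩ := Finset.mem_image.1 hl
      exact (Finset.mem_Ico.1 hx).2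
    exact measurable_labSigma hl' hG
  · rw [hμ.indep.measure_inter_preimage_eq_mul S
      (fun l _ => hG)]
    exact pos_iff_ne_zero.2 (Finset.prod_ne_zero_iff.2 fun l _ => (hpos l).ne')
  · intro f hf n hn
    simp only [Set.mem_iInter] at hf
    induction n with
    | zero => simp [auxTime_zero]
    | succ n ih =>
      rw [auxTime_succ]
      push_cast
      rw [add_mul, one_mul, ENNReal.ofReal_add (by positivity) hε.le]
      refine add_le_add (ih (by omega)) ?_
      have h1 : (1 : ℤ) ≤ f ((n : ℤ), i₀) (grid k 1) := hf ((n : ℤ), i₀)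
        (Finset.mem_image.2 ⟨n, Finset.mem_Ico.2 ⟨by omega, by omega⟩, rfl⟩)
      rw [nu_succ]
      have h2 : ((n : ℤ), i₀) ∈ {l : ℤ × Fin a | max 0 (0 + ((n + 1 : ℕ) : ℤ) - bigM a) ≤ l.1 ∧
          l.1 ≤ 0 + ((n + 1 : ℕ) : ℤ) - 1} := by
        have := bigM_pos a
        refine ⟨max_le (by simp) (by simp only; push_cast; omega), by simp only; push_cast; omega⟩
      refine (iInf₂_le _ h2).trans ((hit_le_of_le (f _).isStep ?_ (t := grid k 1) ?_).trans ?_)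
      · simp
      · simpa using h1
      · rw [← ENNReal.ofReal_coe_nnreal]
        refine ENNReal.ofReal_le_ofReal ?_
        simp only [grid]
        push_cast
        rw [one_div_pow] at hk
        exact hk.le

/-- By the law of large numbers the front is at most a constant time `K` late with positive
probability. Crossing the first `N ≥ 2 * α * K` sites at speed at least `2 * α` saves the time `K`,
and the front started afresh at `N` depends on other labels. -/
theorem IsWalkLaw.ahead_pos (hμ : IsWalkLaw μ) (ha : 1 ≤ a) {α : ℝ} (hα : 0 < α)
    (hα' : α < (meanWait μ)⁻¹) : 0 < μ {f | Ahead α 0 f} := by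
  have := hμ.mesh.isProbabilityMeasure
  have hm := hμ.meanWait_pos ha
  have hm' : meanWait μ < 1 / α := by
    rw [lt_div_iff₀ hα]
    rwa [lt_inv_comm₀ hα hm, ← one_div, lt_div_iff₀ hα] at hα'
  set B : ℕ → Set (Real₀ a) := fun K => {f | ∀ n : ℕ, auxTime f 0 n ≤ ENNReal.ofReal (n / α + K)} with hB
  have hcov : ∀ᵐ f ∂μ, f ∈ ⋃ K, B K := by
    filter_upwards [hμ.ae_auxTime_tendsto ha, hμ.ae_auxTime_ne_top ha] with f hf hA
    have h1 := (hf 0).eventually (gt_mem_nhds hm')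
    obtain ⟨N, hN⟩ := eventually_atTop.1 h1
    obtain ⟨K, hK⟩ := exists_nat_ge (auxTime f 0 N).toReal
    refine Set.mem_iUnion.2 ⟨K, fun n => ?_⟩
    rw [← ENNReal.ofReal_toReal (hA 0 n)]
    refine ENNReal.ofReal_le_ofReal ?_
    rcases le_or_gt n N with h2 | h2
    · have h3 := ENNReal.toReal_mono (hA 0 N) (auxTime_mono f 0 h2)
      have : 0 ≤ (n : ℝ) / α := by positivity
      linarith
    · have h3 := hN n h2.le
      have hn : (0 : ℝ) < n := by exact_mod_cast (by omega : 0 < n)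
      rw [div_lt_iff₀ hn, one_div, inv_mul_eq_div] at h3
      have : (0 : ℝ) ≤ K := Nat.cast_nonneg K
      linarith
  obtain ⟨K, hK⟩ : ∃ K, 0 < μ (B K) := by
    by_contra hcon
    have h1 : ∀ K, μ (B K) = 0 := fun K => by
      by_contra h2
      exact hcon ⟨K, pos_iff_ne_zero.2 h2⟩
    have h2 : μ (⋃ K, B K) = 0 := measure_iUnion_null h1
    have h3 : μ (⋃ K, B K)ᶜ = 0 := hcov
    have h4 := measure_union_le (μ := μ) (⋃ K, B K) (⋃ K, B K)ᶜ
    rw [Set.union_compl_self, measure_univ, h2, h3] at h4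
    simp at h4
  obtain ⟨N, hN⟩ := exists_nat_ge (2 * α * K)
  obtain ⟨A, hA, hApos, hAf⟩ := hμ.exists_fast ha N (ε := 1 / (2 * α)) (by positivity)
  have hBm : MeasurableSet (B K) := by
    have h : B K = ⋂ n : ℕ, {f | auxTime f 0 n ≤ ENNReal.ofReal (n / α + K)} := by
      ext f; simp [hB]
    rw [h]
    exact MeasurableSet.iInter fun n => measurableSet_le (measurable_auxTime 0 n) measurable_const
  set B' : Set (Real₀ a) := {f | ∀ n : ℕ, auxTime f N n ≤ ENNReal.ofReal (n / α + K)} with hB'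
  have hB'm : MeasurableSet[labSigma {l | (N : ℤ) ≤ l.1}] B' := by
    have h : B' = ⋂ n : ℕ, {f | auxTime f N n ≤ ENNReal.ofReal (n / α + K)} := by
      ext f; simp [hB']
    rw [h]
    refine MeasurableSet.iInter fun n => ?_
    exact measurableSet_le (measurable_auxTime_labSigma _ n) measurable_const
  have hB'pos : 0 < μ B' := by
    rw [← hμ.measure_shift N hBm] at hK
    refine lt_of_lt_of_eq hK ?_
    congr 1
    ext f
    simp only [hB, hB', Set.mem_ofPred_eq, auxTime_shift, zero_add]
  have hdisj : Disjoint {l : ℤ × Fin a | l.1 < (N : ℤ)} {l | (N : ℤ) ≤ l.1} := by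
    rw [Set.disjoint_left]
    intro l (h1 : l.1 < (N : ℤ)) (h2 : (N : ℤ) ≤ l.1)
    omega
  have hind := (Indep_iff _ _ μ).1 (hμ.indep_labSigma hdisj) A B' hA hB'm
  have hpos : 0 < μ (A ∩ B') := by
    rw [hind]; exact ENNReal.mul_pos hApos.ne' hB'pos.ne'
  refine hpos.trans_le (measure_mono ?_)
  rintro f ⟨h1, h2⟩ n
  rcases le_or_gt n N with h3 | h3
  · refine (hAf f h1 n h3).trans (ENNReal.ofReal_le_ofReal ?_)
    rw [mul_one_div]
    exact div_le_div_of_nonneg_left (Nat.cast_nonneg n) hα (by linarith)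
  · obtain ⟨m, rfl⟩ : ∃ m, n = N + m := ⟨n - N, by omega⟩
    refine (auxTime_add_le f 0 N m).trans ?_
    rw [zero_add]
    refine (add_le_add (hAf f h1 N le_rfl) (h2 m)).trans ?_
    rw [← ENNReal.ofReal_add (by positivity) (by positivity)]
    refine ENNReal.ofReal_le_ofReal ?_
    push_cast
    have h4 : (K : ℝ) ≤ N * (1 / (2 * α)) := by
      rw [mul_one_div, le_div_iff₀ (by positivity)]; linarith
    have h5 : (N : ℝ) / α = N * (1 / (2 * α)) + N * (1 / (2 * α)) := by field_simp; ring
    rw [add_div, h5]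
    linarith

/-! ### Polynomial tail of the time at which the auxiliary front is first too slow -/

theorem exists_tsum_tail_le (s : ℕ) {C : ℝ} (hC : 0 ≤ C) : ∃ C' : ℝ, 0 ≤ C' ∧ ∀ m : ℕ, 1 ≤ m →
    ∑' i : ℕ, ENNReal.ofReal (C / ((m + i : ℕ) : ℝ) ^ (s + 2)) ≤ ENNReal.ofReal (C' / m ^ s) := by
  have h2 : Summable fun i : ℕ => 1 / ((i + 1 : ℕ) : ℝ) ^ 2 :=
    (summable_nat_add_iff 1).2 (Real.summable_one_div_nat_pow.2 (by norm_num : 1 < 2))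
  refine ⟨C * ∑' i : ℕ, 1 / ((i + 1 : ℕ) : ℝ) ^ 2, mul_nonneg hC (tsum_nonneg fun i => by positivity),
    fun m hm => ?_⟩
  have hm' : (1 : ℝ) ≤ m := by exact_mod_cast hm
  calc ∑' i : ℕ, ENNReal.ofReal (C / ((m + i : ℕ) : ℝ) ^ (s + 2))
      ≤ ∑' i : ℕ, ENNReal.ofReal (C / m ^ s * (1 / ((i + 1 : ℕ) : ℝ) ^ 2)) := by
        refine ENNReal.tsum_le_tsum fun i => ENNReal.ofReal_le_ofReal ?_
        rw [pow_add, div_mul_div_comm, mul_one]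
        refine div_le_div_of_nonneg_left hC (by positivity) ?_
        refine mul_le_mul (pow_le_pow_left₀ (by positivity) (by push_cast; linarith [Nat.cast_nonneg (α := ℝ) i]) _)
          (pow_le_pow_left₀ (by positivity) (by push_cast; linarith) _) (by positivity) (by positivity)
    _ = ENNReal.ofReal (∑' i : ℕ, C / m ^ s * (1 / ((i + 1 : ℕ) : ℝ) ^ 2)) :=
        (ENNReal.ofReal_tsum_of_nonneg (fun i => by positivity) (h2.mul_left _)).symm
    _ = _ := by rw [tsum_mul_left]; congr 1; ring

/-- Bounds for large `n` extend to all `n`. -/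
theorem exists_bound_of_le {ι : Type*} {X : ι → ℕ → ℝ≥0∞} (hX : ∀ i n, X i n ≤ 1) {s n₀ : ℕ} {C : ℝ}
    (h : ∀ i n, 1 ≤ n → n₀ ≤ n → X i n ≤ ENNReal.ofReal (C / n ^ s)) :
    ∃ C' : ℝ, 0 ≤ C' ∧ ∀ i n, 1 ≤ n → X i n ≤ ENNReal.ofReal (C' / n ^ s) := by
  refine ⟨max C ((n₀ : ℝ) ^ s), le_max_of_le_right (by positivity), fun i n hn => ?_⟩
  have hn' : (1 : ℝ) ≤ n := by exact_mod_cast hn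
  rcases le_or_gt n₀ n with h1 | h1
  · exact (h i n hn h1).trans (ENNReal.ofReal_le_ofReal
      (div_le_div_of_nonneg_right (le_max_left _ _) (by positivity)))
  · refine (hX i n).trans ?_
    rw [← ENNReal.ofReal_one]
    refine ENNReal.ofReal_le_ofReal ?_
    rw [le_div_iff₀ (by positivity), one_mul]
    exact (pow_le_pow_left₀ (by positivity) (by exact_mod_cast h1.le) _).trans (le_max_right _ _)

/-- It is unlikely that the auxiliary front is too slow for the first time after time `n`. -/
theorem IsWalkLaw.slowAux_tail (hμ : IsWalkLaw μ) (ha : 1 ≤ a) {c : Params} (hα : 0 < c.α₂)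
    (hα' : c.α₂ < (meanWait μ)⁻¹) : ∃ C : ℝ, 0 ≤ C ∧ ∀ (u : ℤ) (n : ℕ), 1 ≤ n →
      μ {f | (∃ t, SlowAux c u f t) ∧ ∀ t : ℝ≥0, t ≤ n → ¬ SlowAux c u f t} ≤
        ENNReal.ofReal (C / n ^ (a + 2)) := by
  have := hμ.mesh.isProbabilityMeasure
  have hm := hμ.meanWait_pos ha
  have hm' : 0 < 1 / c.α₂ - meanWait μ := by
    rw [sub_pos, lt_div_iff₀ hα]
    rwa [lt_inv_comm₀ hα hm, ← one_div, lt_div_iff₀ hα] at hα'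
  set ε := 1 / c.α₂ - meanWait μ with hε
  obtain ⟨C, hC, h⟩ := hμ.window_tail (bigM_pos a) (measurable_waitR 0) (hμ.memLp_waitR ha)
    (by simp [mom]) hm'
  -- The lateness may show up at any later site. Summing over these sites turns the order `a + 4` of
  -- the deviation bound into `a + 2`.
  obtain ⟨C', hC', h'⟩ := exists_tsum_tail_le (a + 2) hC
  obtain ⟨n₀, hn₀⟩ := exists_nat_ge (2 * (bigM a + 2) / c.α₂)
  refine exists_bound_of_le (n₀ := n₀) (C := C' * (2 / c.α₂) ^ (a + 2)) (fun _ _ => prob_le_one)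
    fun u n hn hnn => ?_
  have hnα : bigM a + 2 ≤ c.α₂ * n / 2 := by
    have h1 : 2 * (bigM a + 2) / c.α₂ ≤ (n : ℝ) := hn₀.trans (by exact_mod_cast hnn)
    rw [div_le_iff₀ hα] at h1
    linarith
  set K := ⌊c.α₂ * n⌋₊ with hK
  have hK1 : c.α₂ * n < K + 1 := Nat.lt_floor_add_one _
  have hKM : bigM a + 1 ≤ K := by
    have : (bigM a : ℝ) + 1 ≤ K := by linarith
    exact_mod_cast this
  have hm1 : 1 ≤ K - bigM a := by omega
  have hcast : ((K - bigM a : ℕ) : ℝ) = K - bigM a := by rw [Nat.cast_sub (by omega)]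
  refine (measure_mono_ae (t := ⋃ i : ℕ, {f | ε * ((K - bigM a + i : ℕ) : ℝ) ≤
    |∑ j ∈ Finset.range (K - bigM a + i),
      (waitR 0 (shift ((u + bigM a + 1) + j) f) - ∫ f, waitR 0 f ∂μ)|}) ?_).trans
    ((measure_iUnion_le _).trans ((ENNReal.tsum_le_tsum fun i => h (u + bigM a + 1) _ (by omega)).trans
      ((h' _ hm1).trans (ENNReal.ofReal_le_ofReal ?_))))
  · filter_upwards [hμ.ae_wait_ne_top ha, hμ.ae_auxTime_ne_top ha] with f hw hA
    rintro ⟨⟨t, ht⟩, hslow⟩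
    have htn : (n : ℝ) < t := by
      by_contra hcon
      exact hslow t (by exact_mod_cast not_lt.1 hcon) ht
    -- The first window has nonstationary waiting times; it is controlled because its deadline `M /
    -- c.α₂` is before `n`, when the front is not yet late.
    have h1 : (auxTime f u (bigM a)).toReal ≤ bigM a / c.α₂ := by
      have h2 : Real.toNNReal (bigM a / c.α₂) ≤ n := by
        rw [Real.toNNReal_le_iff_le_coe]
        simp only [NNReal.coe_natCast]
        rw [div_le_iff₀ hα]
        linarith
      have h3 := hslow _ h2
      rw [SlowAux, not_lt, Real.coe_toNNReal _ (by positivity), mul_div_cancel₀ _ hα.ne',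
        Nat.floor_natCast] at h3
      have h4 := ENNReal.toReal_mono ENNReal.coe_ne_top h3
      rwa [ENNReal.coe_toReal, Real.coe_toNNReal _ (by positivity)] at h4
    set k := ⌊c.α₂ * t⌋₊ with hk
    have hkK : K ≤ k := Nat.floor_le_floor (mul_le_mul_of_nonneg_left htn.le hα.le)
    obtain ⟨i, hi⟩ : ∃ i, k = bigM a + (K - bigM a + i) := ⟨k - K, by omega⟩
    refine Set.mem_iUnion.2 ⟨i, ?_⟩
    have h2 : (k : ℝ) / c.α₂ < (auxTime f u k).toReal := by
      have h3 : (t : ℝ) < (auxTime f u k).toReal := by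
        have := (ENNReal.toReal_lt_toReal ENNReal.coe_ne_top (hA u k)).2 ht
        simpa using this
      refine lt_of_le_of_lt ?_ h3
      rw [div_le_iff₀ hα, mul_comm]
      exact Nat.floor_le (by positivity)
    rw [hi, auxTime_bulk, ENNReal.toReal_add (hA _ _) (ENNReal.sum_ne_top.2 fun _ _ => hw _),
      ENNReal.toReal_sum fun _ _ => hw _, ← hi] at h2
    have h3 : (k : ℝ) = bigM a + ((K - bigM a + i : ℕ) : ℝ) := by rw [hi]; push_cast; ring
    rw [h3, add_div] at h2
    rw [Set.mem_ofPred_eq]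
    refine le_trans ?_ (le_abs_self _)
    simp only [waitR_shift, zero_add, Finset.sum_sub_distrib, Finset.sum_const, Finset.card_range,
      nsmul_eq_mul]
    change _ ≤ ∑ j ∈ Finset.range (K - bigM a + i), (wait (u + bigM a + 1 + j) f).toReal - _
    have h4 : ε * ((K - bigM a + i : ℕ) : ℝ) =
        ((K - bigM a + i : ℕ) : ℝ) / c.α₂ - ((K - bigM a + i : ℕ) : ℝ) * ∫ f, waitR 0 f ∂μ := by
      rw [hε, meanWait]; ring
    rw [h4]
    linarith
  · rw [hcast]
    have h1 : c.α₂ / 2 * n ≤ (K : ℝ) - bigM a := by linarith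
    have hn' : (1 : ℝ) ≤ n := by exact_mod_cast hn
    have h2 : 0 < c.α₂ / 2 * n := by positivity
    calc C' / ((K : ℝ) - bigM a) ^ (a + 2) ≤ C' / (c.α₂ / 2 * n) ^ (a + 2) :=
          div_le_div_of_nonneg_left hC' (by positivity) (pow_le_pow_left₀ h2.le h1 _)
      _ = _ := by
        rw [mul_pow, div_pow, div_pow]
        field_simp

end

/-! ### Gains of the front, and good blocks at the records of their sums -/

section
variable {a : ℕ} {μ : Measure (Real₀ a)}

/-! ### The gain of the front over the particles -/

/-- `psi` is quadratic at `0`, so every positive slope is admissible for a small enough exponent. -/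
theorem exists_psi_le {β : ℝ} (hβ : 0 < β) : ∃ u : ℝ, 0 < u ∧ psi u ≤ u * β := by
  refine ⟨min 1 (β / 2), by positivity, ?_⟩
  set u := min 1 (β / 2) with hu
  have hu0 : 0 < u := by positivity
  have hu1 : u ≤ 1 := min_le_left _ _
  have hu2 : u ≤ β / 2 := min_le_right _ _
  have h1 := Real.cosh_le_exp_half_sq u
  have h2 := Real.abs_exp_sub_one_le (x := u ^ 2 / 2) (by rw [abs_of_nonneg (by positivity)]; nlinarith)
  rw [abs_of_nonneg (by positivity : 0 ≤ u ^ 2 / 2)] at h2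
  have h3 := (abs_le.1 h2).2
  unfold psi
  nlinarith

/-- How far a walk strays beyond the line of slope `α` to the right and the line of slope `α / 10` to
the left. -/
def lag (α : ℝ) (l : ℤ × Fin a) (f : Real₀ a) : ℝ :=
  (slack α (f l)).toReal + (slack (α / 10) (f l).neg).toReal

theorem measurable_lag {S : Set (ℤ × Fin a)} (α : ℝ) {l : ℤ × Fin a} (hl : l ∈ S) :
    Measurable[labSigma S] (lag α l) :=
  (((measurable_slack α).comp (measurable_labSigma hl)).ennreal_toReal).add
    (((measurable_slack (α / 10)).comp
      (StepPath.measurable_neg.comp (measurable_labSigma hl))).ennreal_toReal)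

theorem IsMeshFamily.memLp_lag (hμ : IsMeshFamily μ coord) {θ α : ℝ} (hθ : 0 < θ)
    (hα : psi θ ≤ θ * α) (hα0 : 0 < α) (l : ℤ × Fin a) {q : ℕ} (hq : q ≠ 0) : MemLp (lag α l) q μ := by
  obtain ⟨u, hu, hu'⟩ := exists_psi_le (β := α / 10) (by positivity)
  exact (memLp_toReal_of_lintegral_pow ((measurable_slack α).comp (measurable_pi_apply l))
    (hμ.lintegral_slack_pow l hθ hα hq) hq).add
    (memLp_toReal_of_lintegral_pow ((measurable_slack (α / 10)).comp
      (StepPath.measurable_neg.comp (measurable_pi_apply l)))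
      (hμ.lintegral_slack_neg_pow l hu hu' hq) hq)

/-- The total lag beyond `K` of the walks born at `k`. -/
def excess (α K : ℝ) (k : ℤ) (f : Real₀ a) : ℝ := ∑ i, max 0 (lag α (k, i) f - K)

theorem excess_nonneg (α K : ℝ) (k : ℤ) (f : Real₀ a) : 0 ≤ excess α K k f :=
  Finset.sum_nonneg fun _ _ => le_max_left _ _

theorem lag_le_excess (α K : ℝ) (l : ℤ × Fin a) (f : Real₀ a) : lag α l f ≤ K + excess α K l.1 f := by
  have h := Finset.single_le_sum (f := fun i => max 0 (lag α (l.1, i) f - K))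
    (fun i _ => le_max_left _ _) (Finset.mem_univ l.2)
  have h1 := le_max_right 0 (lag α (l.1, l.2) f - K)
  change _ ≤ excess α K l.1 f at h
  change lag α (l.1, l.2) f ≤ _
  linarith

/-- The gain of the front at `k`: the mean of its sums over long intervals is positive, and where they
are positive the particles born there stay well behind the front. -/
def gain (α K c : ℝ) (k : ℤ) (f : Real₀ a) : ℝ :=
  1 - c - α * waitR k f - 10 * excess α K (k - 1) f

theorem gain_shift (α K c : ℝ) (k j : ℤ) (f : Real₀ a) :
    gain α K c k (shift j f) = gain α K c (k + j) f := by
  have h : excess α K (k - 1) (shift j f) = excess α K (k - 1 + j) f := rfl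
  rw [gain, gain, waitR_shift, h]
  congr 3
  ring

theorem gain_le {α K c : ℝ} (hα : 0 ≤ α) (hc : 0 ≤ c) (k : ℤ) (f : Real₀ a) : gain α K c k f ≤ 1 := by
  have h1 := mul_nonneg hα (waitR_nonneg k f)
  have h2 := excess_nonneg α K (k - 1) f
  unfold gain
  linarith

theorem measurable_gain (α K c : ℝ) (k : ℤ) :
    Measurable[labSigma (window a (k - bigM a) (bigM a))] (gain (a := a) α K c k) := by
  refine ((measurable_const.sub ((measurable_waitR k).const_mul α))).sub
    (Measurable.const_mul ?_ 10)
  refine Finset.measurable_sum _ fun i _ => measurable_const.max (Measurable.sub_const ?_ K)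
  exact measurable_lag α ⟨by simp only; have := bigM_pos a; omega, by simp only; omega⟩

theorem IsWalkLaw.memLp_gain (hμ : IsWalkLaw μ) (ha : 1 ≤ a) {θ α : ℝ} (hθ : 0 < θ)
    (hα : psi θ ≤ θ * α) (hα0 : 0 < α) (K c : ℝ) : MemLp (gain (a := a) α K c 0) (2 * mom a : ℕ) μ := by
  have := hμ.mesh.isProbabilityMeasure
  refine ((memLp_const (1 - c)).sub ((hμ.memLp_waitR ha).const_mul α)).sub (MemLp.const_mul ?_ 10)
  refine memLp_finsetSum _ fun i _ => ?_
  exact ((hμ.mesh.memLp_lag hθ hα hα0 (0 - 1, i) (by simp [mom])).sub (memLp_const K)).pos_part.congr_norm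
    (by
      refine ((measurable_const.max (((measurable_lag α (Set.mem_univ _)).mono (labSigma_le _)
        le_rfl).sub_const K))).aestronglyMeasurable) (ae_of_all _ fun f => by
      simp [max_comm])

/-- Without the excess the mean gain is at least `3 * c`; truncating the lag at a high level `K`
makes the mean excess at most `c / 10`. -/
theorem IsWalkLaw.exists_gain_mean (hμ : IsWalkLaw μ) (ha : 1 ≤ a) {θ α c : ℝ} (hθ : 0 < θ)
    (hα : psi θ ≤ θ * α) (hα0 : 0 < α) (hc : 0 < c) (hc' : α * meanWait μ ≤ 1 - 4 * c) :
    ∃ K : ℝ, 0 < K ∧ 2 * c ≤ ∫ f, gain (a := a) α K c 0 f ∂μ := by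
  have := hμ.mesh.isProbabilityMeasure
  set E := ∑ i : Fin a, ∫ f, lag α ((0 : ℤ) - 1, i) f ^ 2 ∂μ with hE
  have hE0 : 0 ≤ E := Finset.sum_nonneg fun i _ => integral_nonneg fun f => sq_nonneg _
  have h2 : ∀ i : Fin a, MemLp (lag α ((0 : ℤ) - 1, i)) 2 μ := fun i => by
    simpa using hμ.mesh.memLp_lag hθ hα hα0 ((0 : ℤ) - 1, i) (q := 2) two_ne_zero
  -- Since `x - K ≤ x ^ 2 / K`, the mean excess is at most `E / K`, which this `K` brings below `c /
  -- 10`.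
  set K := 10 * E / c + 1 with hK
  have hK0 : 0 < K := by positivity
  refine ⟨K, hK0, ?_⟩
  have hp : ((2 * mom a : ℕ) : ℝ≥0∞) ≥ 1 := by
    have : 1 ≤ 2 * mom a := by simp [mom]; omega
    exact_mod_cast this
  have hw : Integrable (waitR (a := a) 0) μ := (hμ.memLp_waitR ha).integrable hp
  have hx : ∀ i : Fin a, Integrable (fun f => max 0 (lag α ((0 : ℤ) - 1, i) f - K)) μ := fun i => by
    have h3 := ((h2 i).integrable (by norm_num)).sub (integrable_const K)
    simpa [max_comm] using h3.pos_part
  have he : ∫ f, excess (a := a) α K (0 - 1) f ∂μ ≤ c / 10 := by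
    unfold excess
    rw [integral_finsetSum _ fun i _ => hx i]
    calc ∑ i : Fin a, ∫ f, max 0 (lag α ((0 : ℤ) - 1, i) f - K) ∂μ
        ≤ ∑ i : Fin a, ∫ f, 1 / K * lag α ((0 : ℤ) - 1, i) f ^ 2 ∂μ := by
          refine Finset.sum_le_sum fun i _ => integral_mono (hx i) ((h2 i).integrable_sq.const_mul _)
            fun f => max_le (by positivity) ?_
          rw [one_div, inv_mul_eq_div, le_div_iff₀ hK0]
          nlinarith [sq_nonneg (lag α ((0 : ℤ) - 1, i) f - K)]
      _ = E / K := by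
          rw [hE, Finset.sum_div]
          refine Finset.sum_congr rfl fun i _ => ?_
          rw [integral_const_mul]; ring
      _ ≤ c / 10 := by
          rw [div_le_iff₀ hK0, hK]
          have : c / 10 * (10 * E / c + 1) = E + c / 10 := by field_simp
          rw [this]; linarith
  have hxi : Integrable (excess (a := a) α K (0 - 1)) μ := integrable_finsetSum _ fun i _ => hx i
  have hg : ∫ f, gain (a := a) α K c 0 f ∂μ =
      1 - c - α * meanWait μ - 10 * ∫ f, excess (a := a) α K (0 - 1) f ∂μ := by
    have hw' : Integrable (fun f => 1 - c - α * waitR 0 f) μ :=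
      (integrable_const _).sub (hw.const_mul α)
    unfold gain meanWait
    rw [integral_sub hw' (hxi.const_mul 10), integral_sub (integrable_const _) (hw.const_mul α),
      integral_const_mul, integral_const_mul]
    simp
  rw [hg]
  exact le_trans (b := 1 - c - α * meanWait μ - 10 * (c / 10)) (by linarith)
    (sub_le_sub_left (mul_le_mul_of_nonneg_left he (by norm_num)) _)

/-- The sum over `k < L` of the losses of the front over the last `k` sites before `v`. -/
def deficit (α K c : ℝ) (L : ℕ) (v : ℤ) (f : Real₀ a) : ℝ :=
  ∑ k ∈ Finset.range L, max 0 (-∑ j ∈ Finset.range k, gain α K c (v - j) f)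

theorem deficit_nonneg (α K c : ℝ) (L : ℕ) (v : ℤ) (f : Real₀ a) : 0 ≤ deficit α K c L v f :=
  Finset.sum_nonneg fun _ _ => le_max_left _ _

theorem neg_sum_le_deficit (α K c : ℝ) {L k : ℕ} (hk : k < L) (v : ℤ) (f : Real₀ a) :
    -∑ j ∈ Finset.range k, gain α K c (v - j) f ≤ deficit α K c L v f :=
  (le_max_right _ _).trans (Finset.single_le_sum
    (f := fun k => max 0 (-∑ j ∈ Finset.range k, gain α K c (v - j) f))
    (fun _ _ => le_max_left _ _) (Finset.mem_range.2 hk))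

theorem deficit_shift (α K c : ℝ) (L : ℕ) (v j : ℤ) (f : Real₀ a) :
    deficit α K c L v (shift j f) = deficit α K c L (v + j) f := by
  unfold deficit
  simp only [gain_shift]
  refine Finset.sum_congr rfl fun k _ => ?_
  congr 2
  refine Finset.sum_congr rfl fun i _ => ?_
  congr 1
  ring

theorem measurable_deficit (α K c : ℝ) (L : ℕ) (v : ℤ) :
    Measurable[labSigma (window a (v - L - bigM a) (L + bigM a))] (deficit (a := a) α K c L v) := by
  refine Finset.measurable_sum _ fun k hk => measurable_const.max
    (Finset.measurable_sum _ fun j hj => ?_).neg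
  have h1 := Finset.mem_range.1 hk
  have h2 := Finset.mem_range.1 hj
  refine (measurable_gain α K c (v - j)).mono (labSigma_mono ?_) le_rfl
  rintro l ⟨h3, h4⟩
  exact ⟨by omega, by omega⟩

theorem IsWalkLaw.memLp_gain_all (hμ : IsWalkLaw μ) (ha : 1 ≤ a) {θ α : ℝ} (hθ : 0 < θ)
    (hα : psi θ ≤ θ * α) (hα0 : 0 < α) (K c : ℝ) (k : ℤ) :
    MemLp (gain (a := a) α K c k) (2 * mom a : ℕ) μ := by
  have h := (hμ.memLp_gain ha hθ hα hα0 K c).comp_measurePreserving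
    (⟨measurable_shift k, hμ.map_shift k⟩ : MeasurePreserving (shift (a := a) k) μ μ)
  refine h.congr_norm (((measurable_gain α K c k).mono (labSigma_le _) le_rfl).aestronglyMeasurable)
    (ae_of_all _ fun f => ?_)
  simp [gain_shift]

theorem memLp_max_zero {Ω : Type*} [MeasurableSpace Ω] {P : Measure Ω} {X : Ω → ℝ} {q : ℝ≥0∞}
    (hX : MemLp X q P) : MemLp (fun ω => max 0 (X ω)) q P := by
  simpa [max_comm] using hX.pos_part

theorem IsWalkLaw.memLp_deficit (hμ : IsWalkLaw μ) (ha : 1 ≤ a) {θ α : ℝ} (hθ : 0 < θ)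
    (hα : psi θ ≤ θ * α) (hα0 : 0 < α) (K c : ℝ) (L : ℕ) :
    MemLp (deficit (a := a) α K c L 0) (2 * mom a : ℕ) μ :=
  memLp_finsetSum _ fun _ _ => memLp_max_zero
    (memLp_finsetSum _ fun _ _ => hμ.memLp_gain_all ha hθ hα hα0 K c _).neg

/-- The mean deficit is of smaller order than `L`. -/
theorem IsWalkLaw.exists_deficit_mean (hμ : IsWalkLaw μ) (ha : 1 ≤ a) {θ α K c : ℝ} (hθ : 0 < θ)
    (hα : psi θ ≤ θ * α) (hα0 : 0 < α) (hg : 0 < ∫ f, gain (a := a) α K c 0 f ∂μ) {η : ℝ}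
    (hη : 0 < η) : ∃ L₀ : ℕ, ∀ L ≥ L₀, ∫ f, deficit (a := a) α K c L 0 f ∂μ ≤ η * L := by
  have := hμ.mesh.isProbabilityMeasure
  set e := ∫ f, gain (a := a) α K c 0 f ∂μ with he
  obtain ⟨C, hC, h⟩ := hμ.window_tail (bigM_pos a) (measurable_gain α K c 0)
    (hμ.memLp_gain ha hθ hα hα0 K c) (by simp [mom]) hg
  have h2 : ∀ k, MemLp (gain (a := a) α K c k) 2 μ := fun k =>
    (hμ.memLp_gain_all ha hθ hα hα0 K c k).mono_exponent (by
      have : 2 ≤ 2 * mom a := by simp [mom]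
      exact_mod_cast this)
  set G := ∫ f, gain (a := a) α K c 0 f ^ 2 ∂μ with hG
  have hG0 : 0 ≤ G := integral_nonneg fun f => sq_nonneg _
  have hGk : ∀ k, ∫ f, gain (a := a) α K c k f ^ 2 ∂μ = G := fun k => by
    rw [hG]
    conv_rhs => rw [← hμ.map_shift k]
    rw [integral_map (measurable_shift k).aemeasurable (((measurable_gain α K c 0).mono
      (labSigma_le _) le_rfl).pow_const 2).aestronglyMeasurable]
    simp [gain_shift]
  -- The part of each term proportional to `δ` then contributes at most `η / 2` per site; the
  -- remaining parts have a finite sum, negligible against `η * L` for large `L`.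
  set δ := η / (2 * (G + 1)) with hδ
  have hδ0 : 0 < δ := by positivity
  have hS2 : Summable fun k : ℕ => 1 / (k : ℝ) ^ 2 := Real.summable_one_div_nat_pow.2 (by norm_num)
  set S₂ := ∑' k : ℕ, 1 / (k : ℝ) ^ 2 with hS₂
  obtain ⟨L₀, hL₀⟩ := exists_nat_ge (2 * (C / δ * S₂) / η)
  refine ⟨L₀, fun L hL => ?_⟩
  set S : ℕ → Real₀ a → ℝ := fun k f => ∑ j ∈ Finset.range k, gain α K c (0 - j) f with hS
  have hSm : ∀ k, MemLp (S k) 2 μ := fun k => memLp_finsetSum _ fun j _ => h2 _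
  have hmS : ∀ k, Measurable (S k) := fun k => Finset.measurable_sum _ fun j _ =>
    (measurable_gain α K c _).mono (labSigma_le _) le_rfl
  have hneg : ∀ k : ℕ, 1 ≤ k → μ.real {f | S k f < 0} ≤ C / k ^ 4 := by
    intro k hk
    have hk' : (1 : ℝ) ≤ k := by exact_mod_cast hk
    refine ENNReal.toReal_le_of_le_ofReal (by positivity) ?_
    refine (measure_mono ?_).trans ((h (1 - k) k hk).trans (ENNReal.ofReal_le_ofReal ?_))
    · intro f (hf : S k f < 0)
      rw [Set.mem_ofPred_eq]
      refine le_trans ?_ (neg_le_abs _)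
      simp only [gain_shift, Finset.sum_sub_distrib, Finset.sum_const, Finset.card_range, nsmul_eq_mul]
      have h3 : ∑ j ∈ Finset.range k, gain α K c (0 + (1 - (k : ℤ) + j)) f = S k f := by
        rw [hS, ← Finset.sum_range_reflect]
        refine Finset.sum_congr rfl fun j hj => ?_
        have := Finset.mem_range.1 hj
        congr 1
        push_cast [Nat.cast_sub (show j ≤ k - 1 by omega), Nat.cast_sub hk]
        ring
      rw [h3, ← he]
      linarith
    · exact div_le_div_of_nonneg_left hC (by positivity) (pow_le_pow_right₀ hk' (by simp [mom]))
  -- The negative part of `S k` is split by the inequality between means: its square costs at most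
  -- `δ * G` by Cauchy–Schwarz, and the event that it is nonzero has probability of order `k ^
  -- (-4)`, which beats the factor `k ^ 2 / δ`.
  have hterm : ∀ k : ℕ, ∫ f, max 0 (-S k f) ∂μ ≤ δ * G + C / δ * (1 / (k : ℝ) ^ 2) := by
    intro k
    rcases Nat.eq_zero_or_pos k with rfl | hk
    · simp [hS]; positivity
    have hk' : (0 : ℝ) < k := by exact_mod_cast hk
    have hA : MeasurableSet {f | S k f < 0} := measurableSet_lt (hmS k) measurable_const
    have hi1 : Integrable (fun f => δ / k ^ 2 * S k f ^ 2) μ := (hSm k).integrable_sq.const_mul _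
    have hi2 : Integrable (fun f => (k : ℝ) ^ 2 / δ * {f | S k f < 0}.indicator (fun _ => (1 : ℝ)) f) μ :=
      ((integrable_const _).indicator hA).const_mul _
    calc ∫ f, max 0 (-S k f) ∂μ
        ≤ ∫ f, (δ / k ^ 2 * S k f ^ 2 + (k : ℝ) ^ 2 / δ * {f | S k f < 0}.indicator (fun _ => (1 : ℝ)) f) ∂μ := by
          refine integral_mono (memLp_max_zero (hSm k).neg |>.integrable (by norm_num)) (hi1.add hi2)
            fun f => ?_
          simp only
          by_cases hf : S k f < 0
          · rw [Set.indicator_of_mem (show f ∈ {f | S k f < 0} from hf), max_eq_right (by linarith)]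
            have h5 : (k : ℝ) ^ 2 / δ * (δ / k ^ 2) = 1 := by field_simp
            have h6 : 0 < (k : ℝ) ^ 2 / δ := by positivity
            have h7 : 0 < δ / (k : ℝ) ^ 2 := by positivity
            have h8 : 0 ≤ (k : ℝ) ^ 2 / δ * (δ / k ^ 2 * (-S k f) - 1 / 2) ^ 2 := by positivity
            have h9 : (k : ℝ) ^ 2 / δ * (δ / k ^ 2 * (-S k f) - 1 / 2) ^ 2 =
                ((k : ℝ) ^ 2 / δ * (δ / k ^ 2)) * (δ / k ^ 2 * S k f ^ 2) +
                ((k : ℝ) ^ 2 / δ * (δ / k ^ 2)) * S k f + (k : ℝ) ^ 2 / δ / 4 := by ring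
            rw [h9, h5] at h8
            linarith
          · rw [Set.indicator_of_notMem (show f ∉ {f | S k f < 0} from hf),
              max_eq_left (by linarith [not_lt.1 hf])]
            positivity
      _ = δ / k ^ 2 * ∫ f, S k f ^ 2 ∂μ + (k : ℝ) ^ 2 / δ * μ.real {f | S k f < 0} := by
          rw [integral_add hi1 hi2, integral_const_mul, integral_const_mul, integral_indicator_const _ hA]
          simp
      _ ≤ δ / k ^ 2 * (k ^ 2 * G) + (k : ℝ) ^ 2 / δ * (C / k ^ 4) := by
          refine add_le_add (mul_le_mul_of_nonneg_left ?_ (by positivity))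
            (mul_le_mul_of_nonneg_left (hneg k hk) (by positivity))
          calc ∫ f, S k f ^ 2 ∂μ ≤ ∫ f, k * ∑ j ∈ Finset.range k, gain α K c (0 - j) f ^ 2 ∂μ := by
                refine integral_mono (hSm k).integrable_sq ((integrable_finsetSum _ fun j _ =>
                  (h2 _).integrable_sq).const_mul _) fun f => ?_
                have := sq_sum_le_card_mul_sum_sq (s := Finset.range k)
                  (f := fun j : ℕ => gain α K c (0 - j) f)
                rw [Finset.card_range] at this
                exact this
            _ = k ^ 2 * G := by
                rw [integral_const_mul, integral_finsetSum _ fun j _ => (h2 _).integrable_sq]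
                simp only [hGk, Finset.sum_const, Finset.card_range, nsmul_eq_mul]
                ring
      _ = _ := by field_simp
  have hi : ∀ k, Integrable (fun f => max 0 (-S k f)) μ := fun k =>
    (memLp_max_zero (hSm k).neg).integrable (by norm_num)
  change ∫ f, ∑ k ∈ Finset.range L, max 0 (-S k f) ∂μ ≤ _
  rw [integral_finsetSum _ fun k _ => hi k]
  refine (Finset.sum_le_sum fun k _ => hterm k).trans ?_
  rw [Finset.sum_add_distrib, Finset.sum_const, Finset.card_range, nsmul_eq_mul, ← Finset.mul_sum]
  have h3 : ∑ k ∈ Finset.range L, 1 / (k : ℝ) ^ 2 ≤ S₂ :=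
    hS2.sum_le_tsum _ fun k _ => by positivity
  have h4 : C / δ * ∑ k ∈ Finset.range L, 1 / (k : ℝ) ^ 2 ≤ C / δ * S₂ :=
    mul_le_mul_of_nonneg_left h3 (by positivity)
  have h5 : 2 * (C / δ * S₂) / η ≤ (L : ℝ) := hL₀.trans (by exact_mod_cast hL)
  rw [div_le_iff₀ hη] at h5
  have h6 : δ * G ≤ η / 2 := by
    rw [hδ, div_mul_eq_mul_div, div_le_div_iff₀ (by positivity) (by norm_num)]
    nlinarith
  have h7 : (L : ℝ) * (δ * G) ≤ L * (η / 2) := mul_le_mul_of_nonneg_left h6 (Nat.cast_nonneg L)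
  linarith

end

section
variable {a : ℕ} {μ : Measure (Real₀ a)}

/-! ### Polynomial bounds -/

/-- The probability of `X u n` is at most of order `n ^ (-s)`, uniformly in `u`. -/
def PolyBound (μ : Measure (Real₀ a)) (s : ℕ) (X : ℤ → ℕ → Set (Real₀ a)) : Prop :=
  ∃ C : ℝ, 0 ≤ C ∧ ∀ u n, 1 ≤ n → μ (X u n) ≤ ENNReal.ofReal (C / n ^ s)

theorem PolyBound.union {s : ℕ} {X Y : ℤ → ℕ → Set (Real₀ a)} (hX : PolyBound μ s X)
    (hY : PolyBound μ s Y) : PolyBound μ s fun u n => X u n ∪ Y u n := by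
  obtain ⟨C, hC, h⟩ := hX
  obtain ⟨C', hC', h'⟩ := hY
  refine ⟨C + C', by positivity, fun u n hn => (measure_union_le _ _).trans ?_⟩
  rw [add_div, ENNReal.ofReal_add (by positivity) (by positivity)]
  exact add_le_add (h u n hn) (h' u n hn)

theorem PolyBound.biUnion {s : ℕ} {ι : Type*} (F : Finset ι) {X : ι → ℤ → ℕ → Set (Real₀ a)}
    (hX : ∀ i ∈ F, PolyBound μ s (X i)) : PolyBound μ s fun u n => ⋃ i ∈ F, X i u n := by
  classical
  induction F using Finset.induction_on with
  | empty => exact ⟨0, le_rfl, fun u n _ => by simp⟩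
  | insert i F hi ih =>
    simp only [Finset.set_biUnion_insert]
    exact (hX i (Finset.mem_insert_self i F)).union
      (ih fun j hj => hX j (Finset.mem_insert_of_mem hj))

theorem PolyBound.of_le {s p : ℕ} {C : ℝ} (hC : 0 ≤ C) (hs : s ≤ p) {X : ℤ → ℕ → Set (Real₀ a)}
    (m : ℕ → ℕ) (hm : ∀ n, n ≤ m n) (y : ℤ → ℕ → ℤ)
    (Z : ℤ → ℕ → Set (Real₀ a)) (hXZ : ∀ u n, 1 ≤ n → X u n ⊆ Z (y u n) (m n))
    (h : ∀ u n, 1 ≤ n → μ (Z u n) ≤ ENNReal.ofReal (C / n ^ p)) : PolyBound μ s X := by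
  refine ⟨C, hC, fun u n hn => (measure_mono (hXZ u n hn)).trans
    ((h _ _ (hn.trans (hm n))).trans (ENNReal.ofReal_le_ofReal ?_))⟩
  have hn' : (1 : ℝ) ≤ n := by exact_mod_cast hn
  have hm' : (n : ℝ) ≤ m n := by exact_mod_cast hm n
  refine div_le_div_of_nonneg_left hC (by positivity) ?_
  exact (pow_le_pow_right₀ hn' hs).trans (pow_le_pow_left₀ (by positivity) hm' _)

theorem exp_neg_le_div_pow {θ : ℝ} (hθ : 0 < θ) (s : ℕ) {n : ℕ} (hn : 1 ≤ n) :
    Real.exp (-(θ * n)) ≤ s.factorial / θ ^ s / n ^ s := by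
  have hn' : (0 : ℝ) < n := by exact_mod_cast hn
  have h := Real.pow_div_factorial_le_exp (x := θ * n) (by positivity) s
  rw [Real.exp_neg, div_div, ← mul_pow, inv_le_comm₀ (Real.exp_pos _) (by positivity), inv_div]
  exact h

/-! ### Rough environments -/

/-- The ways in which the walks born after the passage at `u` may be unusual on the scale `n`. -/
def Rough (c : Params) (β K κ : ℝ) (B A : ℕ) (u : ℤ) (n : ℕ) (g : Real₀ a) : Prop :=
  (∃ l : ℤ × Fin a, u < l.1 ∧ l.1 ≤ u + bigM a ∧ (n : ℝ≥0∞) < slack c.α₁ (g l)) ∨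
  ((B * n : ℕ) / 2 : ℝ) < ∑ j ∈ Finset.range (B * n), slackSum β (u + j) g ∨
  ((∃ t, SlowAux c u g t) ∧ ∀ t : ℝ≥0, t ≤ n → ¬ SlowAux c u g t) ∨
  (∃ ρ < c.L, ∑ j ∈ Finset.range (ρ + A * n * c.L), gain c.α₁ K κ (u + bigM a + 1 + j) g <
    κ * (ρ + A * n * c.L : ℕ)) ∨
  ∃ ρ < c.L, κ / 2 * c.L * (A * n : ℕ) < ∑ j ∈ Finset.range (A * n),
    deficit c.α₁ K κ c.L (u + bigM a + ρ + c.L + (c.L * j : ℕ)) g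

/-- Large slacks near `u` are exponentially unlikely; the sums of slacks, gains and deficits deviate
with probability of order `n ^ (-(a + 4))`; the late slowness of the auxiliary front gives the
exponent `a + 2`. The residues `ρ` only multiply the constants. -/
theorem IsWalkLaw.rough_tail (hμ : IsWalkLaw μ) (ha : 1 ≤ a) {c : Params} (hL : 1 ≤ c.L) {β K κ : ℝ}
    {B A : ℕ} (hθ : 0 < c.θ) (hα₁ : psi c.θ ≤ c.θ * c.α₁) (hα₁0 : 0 < c.α₁) (hα₂ : 0 < c.α₂)
    (hα₂' : c.α₂ < (meanWait μ)⁻¹) (hβ : psi c.θ ≤ c.θ * β)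
    (hβ' : ∫ f, slackSum (a := a) β 0 f ∂μ ≤ 1 / 4) (hB : 1 ≤ B) (hA : 1 ≤ A) (hκ : 0 < κ)
    (hgain : 2 * κ ≤ ∫ f, gain (a := a) c.α₁ K κ 0 f ∂μ)
    (hdef : ∫ f, deficit (a := a) c.α₁ K κ c.L 0 f ∂μ ≤ κ / 4 * c.L) :
    PolyBound μ (a + 2) fun u n => {g | Rough c β K κ B A u n g} := by
  have hp : 1 ≤ mom a := by simp [mom]
  have hp2 : a + 2 ≤ mom a := by simp [mom]
  have h1 : PolyBound μ (a + 2) fun u n =>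
      {g | ∃ l : ℤ × Fin a, u < l.1 ∧ l.1 ≤ u + bigM a ∧ (n : ℝ≥0∞) < slack c.α₁ (g l)} := by
    have h := PolyBound.biUnion (μ := μ) (s := a + 2) (Finset.Ioc 0 (bigM a) ×ˢ (Finset.univ : Finset (Fin a)))
      (X := fun q u n => {g | (n : ℝ≥0∞) < slack c.α₁ (g (u + q.1, q.2))}) (fun q _ =>
        ⟨(a + 2).factorial / c.θ ^ (a + 2), by positivity, fun u n hn =>
          (hμ.mesh.slack_tail _ hθ hα₁ n).trans
            (ENNReal.ofReal_le_ofReal (exp_neg_le_div_pow hθ _ hn))⟩)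
    obtain ⟨C, hC, h⟩ := h
    refine ⟨C, hC, fun u n hn => (measure_mono ?_).trans (h u n hn)⟩
    rintro g ⟨l, h1, h2, h3⟩
    refine Set.mem_biUnion (x := ((l.1 - u).toNat, l.2)) ?_ ?_
    · simp only [Finset.coe_product, Set.mem_prod, Finset.mem_coe, Finset.mem_Ioc, Finset.mem_univ, and_true]
      omega
    · rw [Set.mem_ofPred_eq]
      have : u + ((l.1 - u).toNat : ℤ) = l.1 := by omega
      simp only [this]
      exact h3
  have h2 : PolyBound μ (a + 2) fun u n =>
      {g | ((B * n : ℕ) / 2 : ℝ) < ∑ j ∈ Finset.range (B * n), slackSum β (u + j) g} := by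
    obtain ⟨C, hC, h⟩ := hμ.window_tail one_pos (measurable_slackSum β 0)
      (hμ.mesh.memLp_slackSum hθ hβ 0 (q := 2 * mom a) (by simp [mom])) hp (ε := 1 / 4) (by norm_num)
    refine PolyBound.of_le hC hp2 (fun n => B * n) (fun n => Nat.le_mul_of_pos_left n hB) (fun u _ => u) _
      (fun u n hn g hg => ?_) h
    rw [Set.mem_ofPred_eq] at hg ⊢
    refine le_trans ?_ (le_abs_self _)
    simp only [slackSum_shift, zero_add, Finset.sum_sub_distrib, Finset.sum_const, Finset.card_range,
      nsmul_eq_mul]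
    have := mul_le_mul_of_nonneg_left hβ' (Nat.cast_nonneg (α := ℝ) (B * n))
    linarith
  have h3 : PolyBound μ (a + 2) fun u n =>
      {g | (∃ t, SlowAux c u g t) ∧ ∀ t : ℝ≥0, t ≤ n → ¬ SlowAux c u g t} := hμ.slowAux_tail ha hα₂ hα₂'
  have h4 : PolyBound μ (a + 2) fun u n => ⋃ ρ ∈ Finset.range c.L,
      {g | ∑ j ∈ Finset.range (ρ + A * n * c.L), gain c.α₁ K κ (u + bigM a + 1 + j) g <
        κ * (ρ + A * n * c.L : ℕ)} := by
    refine PolyBound.biUnion _ fun ρ _ => ?_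
    obtain ⟨C, hC, h⟩ := hμ.window_tail (bigM_pos a) (measurable_gain c.α₁ K κ 0)
      (hμ.memLp_gain ha hθ hα₁ hα₁0 K κ) hp hκ
    refine PolyBound.of_le hC hp2 (fun n => ρ + A * n * c.L) (fun n =>
      (Nat.le_mul_of_pos_left n hA).trans ((Nat.le_mul_of_pos_right _ hL).trans (Nat.le_add_left _ _)))
      (fun u _ => u + bigM a + 1) _ (fun u n hn g hg => ?_) h
    rw [Set.mem_ofPred_eq] at hg ⊢
    refine le_trans ?_ (neg_le_abs _)
    simp only [gain_shift, zero_add, Finset.sum_sub_distrib, Finset.sum_const, Finset.card_range,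
      nsmul_eq_mul]
    have := mul_le_mul_of_nonneg_left hgain (Nat.cast_nonneg (α := ℝ) (ρ + A * n * c.L))
    linarith
  have h5 : PolyBound μ (a + 2) fun u n => ⋃ ρ ∈ Finset.range c.L,
      {g | κ / 2 * c.L * (A * n : ℕ) < ∑ j ∈ Finset.range (A * n),
        deficit c.α₁ K κ c.L (u + bigM a + ρ + c.L + (c.L * j : ℕ)) g} := by
    refine PolyBound.biUnion _ fun ρ _ => ?_
    have hLR : (0 : ℝ) < c.L := by exact_mod_cast hL
    obtain ⟨C, hC, h⟩ := hμ.window_tail_step (m := c.L + bigM a) (by omega) (measurable_deficit c.α₁ K κ c.L 0)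
      (hμ.memLp_deficit ha hθ hα₁ hα₁0 K κ c.L) hp (ε := κ / 4 * c.L) (by positivity) hL
    refine PolyBound.of_le hC hp2 (fun n => A * n) (fun n => by nlinarith)
      (fun u _ => u + bigM a + ρ + c.L) _ (fun u n hn g hg => ?_) h
    rw [Set.mem_ofPred_eq] at hg ⊢
    refine le_trans ?_ (le_abs_self _)
    simp only [deficit_shift, zero_add, Finset.sum_sub_distrib, Finset.sum_const, Finset.card_range,
      nsmul_eq_mul]
    have := mul_le_mul_of_nonneg_left hdef (Nat.cast_nonneg (α := ℝ) (A * n))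
    linarith
  obtain ⟨C, hC, h⟩ := h1.union (h2.union (h3.union (h4.union h5)))
  refine ⟨C, hC, fun u n hn => (measure_mono ?_).trans (h u n hn)⟩
  rintro g (hg | hg | hg | ⟨ρ, hρ, hg⟩ | ⟨ρ, hρ, hg⟩)
  · exact Or.inl hg
  · exact Or.inr (Or.inl hg)
  · exact Or.inr (Or.inr (Or.inl hg))
  · exact Or.inr (Or.inr (Or.inr (Or.inl (Set.mem_biUnion (Finset.mem_coe.2 (Finset.mem_range.2 hρ)) hg))))
  · exact Or.inr (Or.inr (Or.inr (Or.inr (Set.mem_biUnion (Finset.mem_coe.2 (Finset.mem_range.2 hρ)) hg))))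

end

section
variable {a : ℕ}

/-! ### Good blocks at records of the gain -/

/-- If no block end after `N` were a record, passing a block would raise the running maximum by at
most the loss `D j` inside it. The total would stay below `ρ + N * L` plus half of the required
linear growth, a contradiction. -/
theorem exists_record {P : ℕ → ℝ} (h0 : P 0 = 0) (h1 : ∀ k, P (k + 1) ≤ P k + 1) {L ρ N J : ℕ}
    {D : ℕ → ℝ} (hD0 : ∀ j, 0 ≤ D j)
    (hD : ∀ j, ∀ k < L, P (ρ + L + L * j - k) - P (ρ + L + L * j) ≤ D j) {κ : ℝ} (hκ : 0 < κ)
    (hNJ : N ≤ J) (hJ : κ * (ρ + J * L : ℕ) ≤ P (ρ + J * L))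
    (hDJ : ∑ j ∈ Finset.range J, D j ≤ κ / 2 * L * J)
    (hN : ((ρ + N * L : ℕ) : ℝ) < κ / 2 * (ρ + J * L : ℕ)) :
    ∃ j, N < j ∧ j ≤ J ∧ ∀ x ≤ ρ + (j - 1) * L, P x ≤ P (ρ + j * L) := by
  by_contra hcon
  push Not at hcon
  have hP : ∀ k, P k ≤ k := by
    intro k
    induction k with
    | zero => simp [h0]
    | succ k ih => push_cast; linarith [h1 k]
  -- Inside block `j` the sum exceeds its value at the block end by at most `D j`, and that value is
  -- below an earlier one because the end is not a record.
  have hclaim : ∀ j, N ≤ j → j ≤ J → ∀ x ≤ ρ + j * L,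
      P x ≤ (ρ + N * L : ℕ) + ∑ i ∈ Finset.range j, D i := by
    intro j hj
    induction j, hj using Nat.le_induction with
    | base =>
      intro _ x hx
      have h2 : (x : ℝ) ≤ (ρ + N * L : ℕ) := by exact_mod_cast hx
      have h3 := Finset.sum_nonneg fun i (_ : i ∈ Finset.range N) => hD0 i
      linarith [hP x]
    | succ j hj ih =>
      intro hjJ x hx
      obtain ⟨x₀, hx₀, h2⟩ := hcon (j + 1) (by omega) hjJ
      rw [Nat.add_sub_cancel] at hx₀
      have h3 := ih (by omega)
      rw [Finset.sum_range_succ]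
      rcases le_or_gt x (ρ + j * L) with h4 | h4
      · linarith [h3 x h4, hD0 j]
      · have h5 : ρ + (j + 1) * L = ρ + L + L * j := by ring
        have h6 := hD j (ρ + L + L * j - x) (by rw [h5] at hx; nlinarith [Nat.sub_add_cancel hx])
        rw [h5] at hx h2
        rw [Nat.sub_sub_self hx] at h6
        linarith [h3 x₀ hx₀]
  have h2 := hclaim J hNJ le_rfl _ le_rfl
  have h3 : κ / 2 * L * J ≤ κ / 2 * (ρ + J * L : ℕ) := by
    rw [mul_assoc]
    refine mul_le_mul_of_nonneg_left ?_ (by positivity)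
    push_cast
    nlinarith [Nat.cast_nonneg (α := ℝ) ρ]
  linarith

theorem place_eq_add {w : Config a} {u v : ℤ} {f : Real₀ a} (hv : tau w v f < ∞) (huv : u ≤ v)
    {l : ℤ × Fin a} (hl : l.1 ≤ u) :
    place w v f l = place w u f l + futV w u f l (tau w v f - tau w u f).toNNReal := by
  have hu : tau w u f < ∞ := (tau_mono w f huv).trans_lt hv
  have hl' : tau w l.1 f < ∞ := (tau_mono w f hl).trans_lt hu
  have h : age w v f l = age w u f l + (tau w v f - tau w u f).toNNReal := by
    rw [← ENNReal.coe_inj, ENNReal.coe_add, coe_age hv, coe_age hu,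
      ENNReal.coe_toNNReal (ENNReal.sub_ne_top hv.ne), add_comm,
      tsub_add_tsub_cancel (tau_mono w f huv) (tau_mono w f hl)]
  rw [place, place, futV_apply, ← h]
  ring

theorem coe_age_real {w : Config a} {v : ℤ} {f : Real₀ a} (hv : tau w v f < ∞) {l : ℤ × Fin a}
    (hl : l.1 ≤ v) : (age w v f l : ℝ) = (tau w v f).toReal - (tau w l.1 f).toReal := by
  rw [← ENNReal.toReal_sub_of_le (tau_mono w f hl) hv.ne, ← coe_age hv]
  rfl

/-- A particle beyond `v` would already have hit `v + 1`, whereas the passage there is strictly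
later. -/
theorem place_le {w : Config a} {v : ℤ} {f : Real₀ a} (hv : w.r ≤ v) (hf : f ∈ Reg w (v + 1))
    {l : ℤ × Fin a} (hl : l ∈ alive w v) : place w v f l ≤ v := by
  by_contra hcon
  have h1 := Reg.tau_lt_succ hf hv (lt_add_one v)
  have htop := Reg.tau_lt_top hf (lt_add_one v).le
  have h2 : hit (f l) (v + 1 - start w l) ≤ age w v f l := by
    refine hit_le_of_le (f l).isStep ?_ ?_
    · have := start_le hl hv
      rw [(f l).zero]; omega
    · rw [place] at hcon; omega
  have h3 := tau_le w (v := v + 1) (by omega) f (l := l) (by simpa using hl)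
  refine absurd (h3.trans (add_le_add le_rfl h2)) (not_le.2 ?_)
  rwa [coe_age htop, add_tsub_cancel_of_le (tau_mono w f hl.1)]

/-- All walks of the window are started by the passage at `k - 1`, so they reach `k` at least as
early as if they had all been started then. -/
theorem tau_le_add_wait {w : Config a} {k : ℤ} {f : Real₀ a} (hk : w.r < k - bigM a)
    (hf : f ∈ Reg w k) (hw : wait k f ≠ ∞) :
    (tau w k f).toReal ≤ (tau w (k - 1) f).toReal + waitR k f := by
  have h : tau w k f ≤ tau w (k - 1) f + wait k f := by
    rw [wait]
    simp only [ENNReal.add_iInf]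
    refine le_iInf₂ fun l hl => ?_
    have := bigM_pos a
    obtain ⟨h1, h2⟩ := hl
    refine (tau_le w (by omega) f (l := l) ⟨h2, Or.inr (by omega)⟩).trans ?_
    rw [start, if_neg (by omega)]
    exact add_le_add (tau_mono w f h2) le_rfl
  have h1 := (Reg.tau_lt_top hf (by omega : k - 1 ≤ k)).ne
  rw [waitR, ← ENNReal.toReal_add h1 hw]
  exact ENNReal.toReal_mono (ENNReal.add_ne_top.2 ⟨h1, hw⟩) h

theorem tsum_exp_le {s : ℝ} (hs : 0 < s) (z : ℤ) :
    ∑' l : ℤ × Fin a, (if l.1 ≤ z then ENNReal.ofReal (Real.exp (-(s * ((z - l.1 : ℤ) : ℝ)))) else 0) ≤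
      ENNReal.ofReal (a / (1 - Real.exp (-s))) := by
  have h1 : Real.exp (-s) < 1 := (Real.exp_lt_exp.2 (by linarith)).trans_eq Real.exp_zero
  have h2 := tsum_subtype {l : ℤ × Fin a | l.1 ≤ z}
    (fun l => ENNReal.ofReal (Real.exp (-(s * ((z - l.1 : ℤ) : ℝ)))))
  simp only [Set.indicator, Set.mem_ofPred_eq] at h2
  rw [← h2]
  set φ : {l : ℤ × Fin a | l.1 ≤ z} → Fin a × ℕ := fun l => (l.1.2, (z - l.1.1).toNat) with hφ
  have hinj : Function.Injective φ := by
    rintro ⟨l, hl⟩ ⟨l', hl'⟩ h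
    simp only [hφ, Prod.mk.injEq] at h
    simp only [Set.mem_ofPred_eq] at hl hl'
    refine Subtype.ext (Prod.ext ?_ h.1)
    have := h.2
    simp only
    omega
  have h3 := ENNReal.tsum_comp_le_tsum_of_injective hinj
    fun q : Fin a × ℕ => ENNReal.ofReal (Real.exp (-s)) ^ q.2
  refine le_trans (le_of_eq (tsum_congr fun l => ?_)) (h3.trans (le_of_eq ?_))
  · rw [← ENNReal.ofReal_pow (Real.exp_pos _).le, ← Real.exp_nat_mul]
    congr 2
    have hl : l.1.1 ≤ z := l.2
    have : ((z - l.1.1).toNat : ℝ) = ((z - l.1.1 : ℤ) : ℝ) := by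
      exact_mod_cast Int.toNat_of_nonneg (by omega)
    rw [hφ]
    simp only
    rw [this]; ring
  · rw [ENNReal.tsum_prod (f := fun (_ : Fin a) (k : ℕ) => ENNReal.ofReal (Real.exp (-s)) ^ k)]
    simp only [ENNReal.tsum_geometric, tsum_fintype, Finset.sum_const, Finset.card_univ,
      Fintype.card_fin, nsmul_eq_mul]
    rw [ENNReal.ofReal_div_of_pos (by linarith), ENNReal.ofReal_natCast, div_eq_mul_inv,
      ENNReal.ofReal_sub _ (Real.exp_pos _).le, ENNReal.ofReal_one]

/-- What is needed of the environment after the passage at `u` for good blocks on the scale `n`. -/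
structure Calm (c : Params) (K κ : ℝ) (w : Config a) (u : ℤ) (n : ℕ) (f : Real₀ a) : Prop where
  root : w.r ≤ u
  reg : ∀ v, f ∈ Reg w v
  wait_ne : ∀ k, wait k f ≠ ∞
  slack_ne : ∀ l, slack c.α₁ (f l) ≠ ∞
  slack_neg_ne : ∀ l, slack (c.α₁ / 10) (f l).neg ≠ ∞
  first : (tau w (u + bigM a) f).toReal ≤ (tau w u f).toReal + n
  old : ∀ t, ∑' l, weight c.θ w u u f l * ENNReal.ofReal (Real.exp (c.θ * futV w u f l t)) <
    ENNReal.ofReal (Real.exp (c.θ * (c.α₁ * t + n)))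
  young : ∀ l : ℤ × Fin a, u < l.1 → l.1 ≤ u + bigM a → slack c.α₁ (f l) ≤ n

/-- The smallness conditions on the parameters. -/
structure Small (a : ℕ) (c : Params) (K κ : ℝ) : Prop where
  θ_pos : 0 < c.θ
  α₁_pos : 0 < c.α₁
  κ_pos : 0 < κ
  κ_le : κ ≤ 1
  K_pos : 0 < K
  L_pos : 1 ≤ c.L
  block : c.L / 5 + K + 1 ≤ (c.L : ℝ) / 2
  back : Real.exp (c.θ * K) * Real.exp (-(c.θ * κ * c.L)) * (a / (1 - Real.exp (-(c.θ * κ)))) ≤ c.p / 2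

/-- By `hR` the front has outrun the line of slope `α₁` from every site up to the start of the
block. For the exponential norm, particles older than `u`, or born in the first window, are `n`
behind `v`, and the others are behind in proportion to the distance to their birthplaces. For the
count, the particles of the block are too young to have left it. -/
theorem Calm.good {c : Params} {K κ : ℝ} {w : Config a} {u : ℤ} {n : ℕ} {f : Real₀ a}
    (h : Calm c K κ w u n f) (hs : Small a c K κ)
    (hn : (a * bigM a + 1) * Real.exp (-(c.θ * n)) ≤ c.p / 2) {v : ℤ} (hLv : u + bigM a ≤ v - c.L)
    (hv : (2 + c.α₁) * n ≤ κ * (v - (u + bigM a)))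
    (hR : ∀ x y : ℤ, u + bigM a ≤ x → x ≤ v - c.L → x ≤ y → y < v →
      c.α₁ * ((tau w v f).toReal - (tau w x f).toReal) + 10 * excess c.α₁ K y f ≤ (1 - κ) * (v - x)) :
    Good c w v f := by
  obtain ⟨hθ, hα, hκ, hκ1, hK, hL, hblock, hback⟩ := hs
  have hroot := h.root
  have hM := bigM_pos a
  have htop : ∀ x, tau w x f < ∞ := fun x => Reg.tau_lt_top (h.reg x) le_rfl
  have hmono : ∀ {x y : ℤ}, x ≤ y → (tau w x f).toReal ≤ (tau w y f).toReal := fun hxy =>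
    ENNReal.toReal_mono (htop _).ne (tau_mono w f hxy)
  have hfresh : ∀ l : ℤ × Fin a, u < l.1 → l.1 ≤ v → (place w v f l : ℝ) ≤
      l.1 + c.α₁ * ((tau w v f).toReal - (tau w l.1 f).toReal) + (slack c.α₁ (f l)).toReal := by
    intro l h1 h2
    have h3 := le_add_slack (h.slack_ne l) (age w v f l)
    rw [coe_age_real (htop v) h2] at h3
    rw [place, start, if_neg (by omega)]
    push_cast
    linarith
  have hex : ∀ y, 0 ≤ excess c.α₁ K y f := fun y => excess_nonneg _ _ _ _
  have hbase : c.α₁ * ((tau w v f).toReal - (tau w (u + bigM a) f).toReal) ≤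
      (1 - κ) * (v - (u + bigM a)) := by
    have h1 := hR (u + bigM a) (u + bigM a) le_rfl hLv le_rfl (by omega)
    push_cast at h1
    linarith [hex (u + bigM a)]
  constructor
  · set t : ℝ≥0 := (tau w v f - tau w u f).toNNReal with ht
    have htR : (t : ℝ) = (tau w v f).toReal - (tau w u f).toReal :=
      ENNReal.toReal_sub_of_le (tau_mono w f (by omega)) (htop v).ne
    have htα : c.α₁ * t + n + u - v ≤ -(n : ℝ) := by
      rw [htR]
      have h1 := mul_le_mul_of_nonneg_left h.first hα.le
      have h2 : (0 : ℝ) < bigM a := by exact_mod_cast hM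
      nlinarith
    -- The weights are dominated by three sums: `g₁` for the particles present at `u`, `g₂` for
    -- those born in the first window, and `g₃`, a geometric series with rate `c.θ * κ`, for those
    -- born later. The first two share one half of `c.p`, the last one has the other half.
    set g₁ : ℤ × Fin a → ℝ≥0∞ := fun l => weight c.θ w u u f l *
      ENNReal.ofReal (Real.exp (c.θ * futV w u f l t)) * ENNReal.ofReal (Real.exp (c.θ * (u - v))) with hg₁
    set F : Finset (ℤ × Fin a) := Finset.Ioc u (u + bigM a) ×ˢ Finset.univ with hF
    set g₂ : ℤ × Fin a → ℝ≥0∞ := fun l =>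
      if l ∈ F then ENNReal.ofReal (Real.exp (-(c.θ * n))) else 0 with hg₂
    set g₃ : ℤ × Fin a → ℝ≥0∞ := fun l =>
      ENNReal.ofReal (Real.exp (c.θ * K) * Real.exp (-(c.θ * κ * c.L))) *
        (if l.1 ≤ v - c.L then
          ENNReal.ofReal (Real.exp (-(c.θ * κ * ((v - c.L - l.1 : ℤ) : ℝ)))) else 0) with hg₃
    have hle : ∀ l, weight c.θ w (v - c.L) v f l ≤ g₁ l + g₂ l + g₃ l := by
      intro l
      rw [weight]
      split_ifs with hal
      swap
      · exact bot_le
      rcases le_or_gt l.1 u with hl | hl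
      · refine le_trans (le_of_eq ?_) (le_add_right le_self_add)
        rw [hg₁]
        simp only
        rw [weight, if_pos ⟨hl, hal.2⟩, ← ENNReal.ofReal_mul (Real.exp_pos _).le, ← Real.exp_add,
          ← ENNReal.ofReal_mul (Real.exp_pos _).le, ← Real.exp_add,
          place_eq_add (htop v) (by omega) hl]
        congr 2
        push_cast
        ring
      · have h1 := hfresh l hl (by have := hal.1; omega)
        rcases le_or_gt l.1 (u + bigM a) with hl2 | hl2
        · refine le_trans ?_ (le_add_right le_add_self)
          rw [hg₂]
          simp only
          rw [if_pos (by simp [hF]; omega)]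
          refine ENNReal.ofReal_le_ofReal (Real.exp_le_exp.2 ?_)
          rw [← mul_neg]
          refine mul_le_mul_of_nonneg_left ?_ hθ.le
          have h2 := ENNReal.toReal_mono (ENNReal.natCast_ne_top n) (h.young l hl hl2)
          rw [ENNReal.toReal_natCast] at h2
          have h3 := mul_le_mul_of_nonneg_left (hmono hl.le) hα.le
          have h4 := mul_le_mul_of_nonneg_left h.first hα.le
          have h5 : (l.1 : ℝ) ≤ u + bigM a := by exact_mod_cast hl2
          push_cast
          linarith
        · refine le_trans ?_ le_add_self
          rw [hg₃]
          simp only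
          rw [if_pos hal.1, ← ENNReal.ofReal_mul (by positivity), ← Real.exp_add, ← Real.exp_add]
          refine ENNReal.ofReal_le_ofReal (Real.exp_le_exp.2 ?_)
          have h2 := hR l.1 l.1 hl2.le hal.1 le_rfl (by have := hal.1; omega)
          have h3 := lag_le_excess c.α₁ K l f
          have h4 : (slack c.α₁ (f l)).toReal ≤ lag c.α₁ l f := le_add_of_nonneg_right ENNReal.toReal_nonneg
          have h5 : (place w v f l : ℝ) - v ≤ K - κ * (v - l.1) := by linarith [hex l.1]
          push_cast
          nlinarith
    have hs₁ : ∑' l, g₁ l ≤ ENNReal.ofReal (Real.exp (-(c.θ * n))) := by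
      rw [hg₁, ENNReal.tsum_mul_right]
      refine (mul_le_mul_left (h.old t).le _).trans ?_
      rw [← ENNReal.ofReal_mul (Real.exp_pos _).le, ← Real.exp_add, ← mul_add, ← mul_neg]
      refine ENNReal.ofReal_le_ofReal (Real.exp_le_exp.2 (mul_le_mul_of_nonneg_left ?_ hθ.le))
      linarith
    have hs₂ : ∑' l, g₂ l = ENNReal.ofReal (a * bigM a * Real.exp (-(c.θ * n))) := by
      rw [hg₂, tsum_eq_sum (s := F) (fun l hl => if_neg hl), Finset.sum_congr rfl fun l hl => if_pos hl,
        Finset.sum_const, hF, Finset.card_product, Int.card_Ioc, Finset.card_univ, Fintype.card_fin,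
        add_sub_cancel_left, Int.toNat_natCast, nsmul_eq_mul, ← ENNReal.ofReal_natCast,
        ← ENNReal.ofReal_mul (by positivity)]
      congr 1
      push_cast; ring
    have hs₃ : ∑' l, g₃ l ≤ ENNReal.ofReal (c.p / 2) := by
      rw [hg₃, ENNReal.tsum_mul_left]
      refine (mul_le_mul_right (tsum_exp_le (mul_pos hθ hκ) _) _).trans ?_
      rw [← ENNReal.ofReal_mul (by positivity)]
      exact ENNReal.ofReal_le_ofReal hback
    calc ∑' l, weight c.θ w (v - c.L) v f l ≤ ∑' l, (g₁ l + g₂ l + g₃ l) := ENNReal.tsum_le_tsum hle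
      _ = ∑' l, g₁ l + ∑' l, g₂ l + ∑' l, g₃ l := by rw [ENNReal.tsum_add, ENNReal.tsum_add]
      _ ≤ ENNReal.ofReal (Real.exp (-(c.θ * n))) + ENNReal.ofReal (a * bigM a * Real.exp (-(c.θ * n))) +
          ENNReal.ofReal (c.p / 2) := add_le_add (add_le_add hs₁ hs₂.le) hs₃
      _ ≤ ENNReal.ofReal (c.p / 2) + ENNReal.ofReal (c.p / 2) := by
          refine add_le_add ?_ le_rfl
          rw [← ENNReal.ofReal_add (by positivity) (by positivity)]
          exact ENNReal.ofReal_le_ofReal (by linarith)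
      _ = ENNReal.ofReal c.p := by
          have : 0 ≤ c.p / 2 := le_trans (by positivity) hn
          rw [← ENNReal.ofReal_add this this]
          congr 1; ring
  · set m := ⌊(c.L : ℝ) / 5 + K⌋₊ + 1 with hm
    have hm1 : (c.L : ℝ) / 5 + K < m := by rw [hm]; push_cast; exact Nat.lt_floor_add_one _
    have hm2 : (m : ℝ) ≤ c.L / 2 := by
      have := Nat.floor_le (by positivity : 0 ≤ (c.L : ℝ) / 5 + K)
      rw [hm]; push_cast; linarith
    refine ⟨Finset.Icc (v - c.L + m) v ×ˢ Finset.univ, ?_, ?_⟩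
    · have h1 : m ≤ c.L := by
        have : (m : ℝ) ≤ c.L := by linarith [Nat.cast_nonneg (α := ℝ) c.L]
        exact_mod_cast this
      rw [Finset.card_product, Int.card_Icc, Finset.card_univ, Fintype.card_fin]
      have h2 : (v + 1 - (v - c.L + m)).toNat = c.L + 1 - m := by omega
      rw [h2]
      push_cast [Nat.cast_sub (by omega : m ≤ c.L + 1)]
      nlinarith [Nat.cast_nonneg (α := ℝ) a]
    · intro l hl
      simp only [Finset.mem_product, Finset.mem_Icc, Finset.mem_univ, and_true] at hl
      have hlv : l.1 ≤ v := hl.2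
      have hal : l ∈ alive w v := ⟨hlv, Or.inr (by omega)⟩
      refine ⟨hal, by omega, ?_, place_le (by omega) (h.reg _) hal⟩
      have h1 := le_add_slack (f := (f l).neg) (h.slack_neg_ne l) (age w v f l)
      rw [StepPath.neg_apply, coe_age_real (htop v) hlv] at h1
      have h2 : (m : ℝ) ≤ l.1 - (v - c.L) := by
        have : (v - c.L + m : ℤ) ≤ l.1 := hl.1
        have h3 : ((v - c.L + m : ℤ) : ℝ) ≤ l.1 := by exact_mod_cast this
        push_cast at h3
        linarith
      have h3 : (v - c.L : ℝ) < place w v f l := by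
        rw [place, start, if_neg (by omega)]
        rcases eq_or_lt_of_le hlv with h4 | h4
        · rw [age_of_ge w f h4.ge, (f l).zero]
          push_cast
          have := lt_of_le_of_lt (by positivity : 0 ≤ (c.L : ℝ) / 5 + K) hm1
          linarith
        · have h5 := hR (v - c.L) l.1 hLv le_rfl (by omega) h4
          have h6 := lag_le_excess c.α₁ K l f
          have h7 : (slack (c.α₁ / 10) (f l).neg).toReal ≤ lag c.α₁ l f :=
            le_add_of_nonneg_left ENNReal.toReal_nonneg
          have h8 := mul_le_mul_of_nonneg_left (hmono (by omega : v - c.L ≤ l.1)) hα.le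
          have h9 := hex l.1
          have h10 := mul_le_mul_of_nonneg_left (hmono hlv) hα.le
          have h11 : 0 ≤ κ * (c.L : ℝ) := by positivity
          push_cast at h1 h5 ⊢
          linarith
      exact_mod_cast h3

end

section
variable {a : ℕ}

/-! ### The next trial -/

/-- The conditions on the constants that describe the scales. -/
structure Scales (a : ℕ) (c : Params) (α' ε β K κ : ℝ) (B N A : ℕ) : Prop extends Small a c K κ where
  ε_pos : 0 < ε
  ε_le : ε ≤ 1
  gap : α' + 2 * ε ≤ c.α₁
  β_ge : c.α₁ ≤ β
  B_gt : 2 * (β + 1) < B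
  B_le : B ≤ N
  N_ge : 2 + c.α₁ ≤ κ * N
  A_ge : (N : ℝ) + 1 ≤ κ / 2 * A

/-- A realization with the properties that hold almost surely. -/
structure Nice (c : Params) (w : Config a) (f : Real₀ a) : Prop where
  reg : ∀ v, f ∈ Reg w v
  wait_ne : ∀ k, wait k f ≠ ∞
  slack_ne : ∀ l, slack c.α₁ (f l) ≠ ∞
  slack_neg_ne : ∀ l, slack (c.α₁ / 10) (f l).neg ≠ ∞

/-- The particles present at the passage at `u` behave as expected on the scale `n`. -/
structure Settled (c : Params) (α' ε : ℝ) (w : Config a) (u : ℤ) (n : ℕ) (f : Real₀ a) : Prop where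
  first : (tau w (u + bigM a) f).toReal ≤ (tau w u f).toReal + n
  old : ∀ t, ∑' l, weight c.θ w u u f l * ENNReal.ofReal (Real.exp (c.θ * futV w u f l t)) <
    ENNReal.ofReal (Real.exp (c.θ * (α' * t + ε * n)))

variable {c : Params} {α' ε β K κ : ℝ} {B N A : ℕ} {w : Config a} {u : ℤ} {n : ℕ} {f : Real₀ a}

theorem sum_gain_back (α K κ : ℝ) (b : ℤ) (f : Real₀ a) (m k : ℕ) (hk : k ≤ m) :
    ∑ j ∈ Finset.range k, gain α K κ (b + m - j) f =
      ∑ i ∈ Finset.range m, gain α K κ (b + 1 + i) f -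
        ∑ i ∈ Finset.range (m - k), gain α K κ (b + 1 + i) f := by
  induction k with
  | zero => simp
  | succ k ih =>
    rw [Finset.sum_range_succ, ih (by omega)]
    obtain ⟨d, rfl⟩ : ∃ d, m = k + 1 + d := ⟨m - (k + 1), by omega⟩
    have h1 : k + 1 + d - k = d + 1 := by omega
    have h2 : k + 1 + d - (k + 1) = d := by omega
    rw [h1, h2, Finset.sum_range_succ]
    have h3 : b + (k + 1 + d : ℕ) - k = b + 1 + d := by push_cast; ring
    rw [h3]; ring

theorem Nice.tau_sub_le (h : Nice c w f) (hu : w.r ≤ u) {k m : ℕ} (hkm : k ≤ m) :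
    (tau w (u + bigM a + m) f).toReal - (tau w (u + bigM a + k) f).toReal ≤
      ∑ i ∈ Finset.Ico k m, waitR (u + bigM a + 1 + i) f := by
  induction m, hkm using Nat.le_induction with
  | base => simp
  | succ m hkm ih =>
    rw [Finset.sum_Ico_succ_top hkm]
    have h1 := tau_le_add_wait (w := w) (k := u + bigM a + 1 + m) (by omega) (h.reg _) (h.wait_ne _)
    have h2 : u + bigM a + 1 + (m : ℤ) - 1 = u + bigM a + m := by ring
    have h3 : u + bigM a + ((m + 1 : ℕ) : ℤ) = u + bigM a + 1 + m := by push_cast; ring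
    rw [h2] at h1
    rw [h3]
    linarith

/-- `exists_record` is applied to the partial sums of the gains from `b = u + M` on, at ends of
blocks aligned with `x`; a record is exactly the hypothesis of `Calm.good`. -/
theorem Nice.exists_first (h : Nice c w f) (hs : Scales a c α' ε β K κ B N A) (hu : w.r ≤ u)
    (hn : 1 ≤ n) (hnp : (a * bigM a + 1) * Real.exp (-(c.θ * n)) ≤ c.p / 2)
    (hset : Settled c α' ε w u n f) (hr : ¬ Rough c β K κ B A u n f) {x : ℤ}
    (hx : x ≤ u + bigM a + N * n) :
    ∃ v, First c w x v f ∧ v ≤ u + (bigM a + c.L + A * c.L) * n := by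
  simp only [Rough, not_or, not_exists, not_and, not_lt] at hr
  obtain ⟨hr1, -, -, hr4, hr5⟩ := hr
  have hL := hs.L_pos
  have hLR : (1 : ℝ) ≤ c.L := by exact_mod_cast hL
  have hnR : (1 : ℝ) ≤ n := by exact_mod_cast hn
  have hcalm : Calm c K κ w u n f := by
    refine ⟨hu, h.reg, h.wait_ne, h.slack_ne, h.slack_neg_ne, hset.first, fun t => ?_, fun l h1 h2 => hr1 l h1 h2⟩
    refine (hset.old t).trans_le (ENNReal.ofReal_le_ofReal (Real.exp_le_exp.2
      (mul_le_mul_of_nonneg_left ?_ hs.θ_pos.le)))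
    have h1 : α' ≤ c.α₁ := by linarith [hs.gap, hs.ε_pos]
    exact add_le_add (mul_le_mul_of_nonneg_right h1 t.coe_nonneg)
      (mul_le_of_le_one_left (by positivity) hs.ε_le)
  set b := u + (bigM a : ℤ) with hb
  have hLZ : (0 : ℤ) < c.L := by exact_mod_cast hL
  -- Blocks are counted from `x`, but the sums start at `b`. The residue `ρ` aligns them, and `q`
  -- may be negative when `x` lies to the left of `b`.
  obtain ⟨ρ, q, hρ, hxq⟩ : ∃ (ρ : ℕ) (q : ℤ), ρ < c.L ∧ x = b + ρ + q * c.L := by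
    refine ⟨((x - b) % c.L).toNat, (x - b) / c.L, ?_, ?_⟩
    · have h1 := Int.emod_lt_of_pos (x - b) hLZ
      have h2 := Int.emod_nonneg (x - b) hLZ.ne'
      omega
    · have h2 := Int.emod_nonneg (x - b) hLZ.ne'
      have h3 := Int.emod_add_mul_ediv (x - b) c.L
      rw [Int.toNat_of_nonneg h2]
      linarith
  set P : ℕ → ℝ := fun k => ∑ i ∈ Finset.range k, gain c.α₁ K κ (b + 1 + i) f with hP
  obtain ⟨j, hj1, hj2, hrec⟩ := exists_record (P := P) (by simp [hP])
    (fun k => by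
      simp only [hP, Finset.sum_range_succ]
      linarith [gain_le hs.α₁_pos.le hs.κ_pos.le (K := K) (b + 1 + k) f]) (L := c.L) (ρ := ρ) (N := N * n)
    (J := A * n) (D := fun j => deficit c.α₁ K κ c.L (b + ρ + c.L + (c.L * j : ℕ)) f)
    (fun j => deficit_nonneg _ _ _ _ _ _)
    (fun j k hk => by
      have h1 := neg_sum_le_deficit c.α₁ K κ hk (b + ρ + c.L + (c.L * j : ℕ)) f
      have h2 := sum_gain_back c.α₁ K κ b f (ρ + c.L + c.L * j) k (by omega)
      have h3 : b + (ρ + c.L + c.L * j : ℕ) = b + ρ + c.L + (c.L * j : ℕ) := by push_cast; ring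
      rw [h3] at h2
      rw [h2] at h1
      simp only [hP]
      linarith) hs.κ_pos
    (Nat.mul_le_mul_right n (by
      have h1 : (N : ℝ) ≤ A := by
        have h2 : κ / 2 * A ≤ 1 * A := mul_le_mul_of_nonneg_right (by linarith [hs.κ_le]) (Nat.cast_nonneg A)
        linarith [hs.A_ge]
      exact_mod_cast h1))
    (hr4 ρ hρ) (by exact_mod_cast hr5 ρ hρ) (by
      push_cast
      have h1 := hs.A_ge
      have h2 : (ρ : ℝ) < c.L := by exact_mod_cast hρ
      have h3 : ((N : ℝ) + 1) * (n * c.L) ≤ κ / 2 * A * (n * c.L) :=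
        mul_le_mul_of_nonneg_right h1 (by positivity)
      have h4 : (1 : ℝ) * c.L ≤ n * c.L := mul_le_mul_of_nonneg_right hnR (by positivity)
      have h5 : 0 ≤ κ / 2 * ρ := by have := hs.κ_pos; positivity
      nlinarith)
  set v := b + (ρ + j * c.L : ℕ) with hv
  have hjN : (N * n + 1) * c.L ≤ j * c.L := Nat.mul_le_mul_right _ hj1
  have hNL : N * n + 1 ≤ (N * n + 1) * c.L := Nat.le_mul_of_pos_right _ hL
  have hvb : (N * n + 1 : ℕ) ≤ v - b := by
    rw [hv, add_sub_cancel_left]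
    exact_mod_cast (hNL.trans hjN).trans (Nat.le_add_left _ _)
  have hvx : x < v := by push_cast at hvb; omega
  have hvq : v = x + (j - q) * c.L := by rw [hv, hxq]; push_cast; ring
  have hjq : 0 < (j : ℤ) - q := by
    by_contra hcon
    have := mul_nonpos_of_nonpos_of_nonneg (not_lt.1 hcon) hLZ.le
    omega
  have hgood : Good c w v f := by
    refine hcalm.good hs.toSmall hnp ?_ ?_ ?_
    · rw [hv]
      have : c.L ≤ j * c.L := Nat.le_mul_of_pos_left _ (by omega)
      push_cast
      have h1 : (c.L : ℤ) ≤ j * c.L := by exact_mod_cast this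
      omega
    · have h1 : ((N * n + 1 : ℕ) : ℝ) ≤ v - b := by exact_mod_cast hvb
      push_cast at h1
      have h2 := mul_le_mul_of_nonneg_right hs.N_ge (by positivity : (0 : ℝ) ≤ n)
      have h3 := mul_le_mul_of_nonneg_left h1 hs.κ_pos.le
      have h4 : (b : ℝ) = u + bigM a := by rw [hb]; push_cast; ring
      rw [← h4]
      nlinarith [hs.κ_pos]
    · intro x' y hx1 hx2 hy1 hy2
      obtain ⟨k, hk⟩ : ∃ k : ℕ, x' = b + k := ⟨(x' - b).toNat, by omega⟩
      obtain ⟨i, hi⟩ : ∃ i : ℕ, y = b + i := ⟨(y - b).toNat, by omega⟩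
      set m := ρ + j * c.L with hm
      have hkm : k ≤ ρ + (j - 1) * c.L := by
        have h1 : ((j - 1 : ℕ) : ℤ) * c.L = j * c.L - c.L := by
          rw [Nat.cast_sub (by omega)]; push_cast; ring
        have h2 : (k : ℤ) ≤ ρ + ((j - 1 : ℕ) : ℤ) * c.L := by
          rw [h1]; push_cast [hm] at hv; omega
        exact_mod_cast h2
      have hkm' : k ≤ m := hkm.trans (Nat.add_le_add_left (Nat.mul_le_mul_right _ (by omega)) _)
      -- A nonnegative sum of gains between `x'` and `v` says that `α₁` times the waiting times,
      -- plus ten times the excesses, is at most `(1 - κ) (v - x')`.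
      have h1 := hrec k hkm
      have h2 : P m - P k = ∑ s ∈ Finset.Ico k m, gain c.α₁ K κ (b + 1 + s) f :=
        (Finset.sum_Ico_eq_sub _ hkm').symm
      have h3 := h.tau_sub_le (u := u) hu hkm'
      have h4 : excess c.α₁ K y f ≤ ∑ s ∈ Finset.Ico k m, excess c.α₁ K (b + s) f := by
        rw [hi]
        exact Finset.single_le_sum (f := fun s : ℕ => excess c.α₁ K (b + s) f)
          (fun _ _ => excess_nonneg _ _ _ _) (Finset.mem_Ico.2 ⟨by omega, by omega⟩)
      have h5 : ∑ s ∈ Finset.Ico k m, gain c.α₁ K κ (b + 1 + s) f = (1 - κ) * (m - k) -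
          c.α₁ * ∑ s ∈ Finset.Ico k m, waitR (b + 1 + s) f -
            10 * ∑ s ∈ Finset.Ico k m, excess c.α₁ K (b + s) f := by
        simp only [gain, Finset.sum_sub_distrib, ← Finset.mul_sum, Finset.sum_const, Nat.card_Ico,
          nsmul_eq_mul, Nat.cast_sub hkm']
        have h6 : ∀ s : ℕ, b + 1 + (s : ℤ) - 1 = b + s := fun s => by ring
        simp only [h6]
        ring
      have h6 : (v : ℝ) - x' = m - k := by rw [hv, hk]; push_cast; ring
      have h7 := mul_le_mul_of_nonneg_left h3 hs.α₁_pos.le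
      rw [h6, hk]
      rw [hv]
      linarith
  have hex : ∃ i : ℕ, 1 ≤ i ∧ Good c w (x + i * c.L) f := by
    refine ⟨(j - q : ℤ).toNat, by omega, ?_⟩
    rw [Int.toNat_of_nonneg hjq.le, ← hvq]
    exact hgood
  classical
  refine ⟨x + (Nat.find hex : ℕ) * c.L, ⟨Nat.find hex, (Nat.find_spec hex).1, rfl, (Nat.find_spec hex).2,
    fun i h1 h2 h3 => Nat.find_min hex h2 ⟨h1, h3⟩⟩, ?_⟩
  have h1 : Nat.find hex ≤ (j - q : ℤ).toNat := Nat.find_min' hex ⟨by omega, by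
    rw [Int.toNat_of_nonneg hjq.le, ← hvq]; exact hgood⟩
  have h2 : (Nat.find hex : ℤ) ≤ j - q := by omega
  have h3 : x + (Nat.find hex : ℤ) * c.L ≤ v := by
    rw [hvq]; exact add_le_add le_rfl (mul_le_mul_of_nonneg_right h2 hLZ.le)
  refine h3.trans ?_
  rw [hv, hb]
  have h4 : bigM a + (ρ + j * c.L) ≤ (bigM a + c.L + A * c.L) * n := by
    calc bigM a + (ρ + j * c.L) ≤ bigM a + (c.L + A * n * c.L) :=
          Nat.add_le_add_left (add_le_add hρ.le (Nat.mul_le_mul_right _ hj2)) _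
      _ ≤ bigM a * n + (c.L * n + A * n * c.L) := by
          refine add_le_add (Nat.le_mul_of_pos_right _ hn) (add_le_add (Nat.le_mul_of_pos_right _ hn) le_rfl)
      _ = _ := by ring
  rw [add_assoc]
  refine add_le_add le_rfl ?_
  exact_mod_cast h4

/-- The slope `α₁` exceeds `α'` by at least `2 * ε`. After time `n` this beats the allowance `ε * n`
and the loss of one through the floor. -/
theorem Settled.lt_of_floor (hs : Scales a c α' ε β K κ B N A) (hnε : 1 ≤ ε * n) {t : ℝ≥0}
    (h : (⌊c.α₁ * t⌋ : ℝ) < α' * t + ε * n) : t ≤ n := by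
  by_contra hcon
  have h1 : (n : ℝ) < t := by
    have := not_le.1 hcon
    exact_mod_cast this
  have h2 := Int.sub_one_lt_floor (c.α₁ * t)
  have h3 := mul_le_mul_of_nonneg_right hs.gap t.coe_nonneg
  have h4 := mul_lt_mul_of_pos_left h1 hs.ε_pos
  linarith

/-- A broken trial is followed by another one soon. -/
theorem Nice.exists_next (h : Nice c w f) (hs : Scales a c α' ε β K κ B N A) (hu : w.r ≤ u)
    (hn : 1 ≤ n) (hnε : 1 ≤ ε * n) (hnp : (a * bigM a + 1) * Real.exp (-(c.θ * n)) ≤ c.p / 2)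
    (hset : Settled c α' ε w u n f) (hr : ¬ Rough c β K κ B A u n f) (hbr : ∃ t, Broken c w u f t) :
    ∃ v, Next c w u v f ∧ v ≤ u + (bigM a + c.L + A * c.L) * n := by
  have hr' := hr
  simp only [Rough, not_or, not_lt] at hr'
  obtain ⟨-, hr2, hr3, -⟩ := hr'
  have hnR : (1 : ℝ) ≤ n := by exact_mod_cast hn
  have hα₁ := hs.α₁_pos
  have htop : ∀ x, tau w x f ≠ ∞ := fun x => (Reg.tau_lt_top (h.reg x) le_rfl).ne
  -- A break happens by time `n` whatever its cause: an auxiliary front not slow until `n` never is,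
  -- and settled particles cannot be too fast after `n`.
  obtain ⟨t, htn, hbt⟩ : ∃ t : ℝ≥0, t ≤ n ∧ Broken c w u f t := by
    obtain ⟨t, ht⟩ := hbr
    rcases ht with ht | ⟨l, hl1, hl2, hl3, hl4⟩ | ht
    · by_contra hcon
      exact hr3 ⟨⟨t, ht⟩, fun s hs' hslow => hcon ⟨s, hs', Or.inl hslow⟩⟩
    · refine ⟨t, Settled.lt_of_floor hs hnε ?_, Or.inr (Or.inl ⟨l, hl1, hl2, hl3, hl4⟩)⟩
      have h1 := place_add_lt hs.θ_pos (hset.old t) hl1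
      have h2 : ((⌊c.α₁ * t⌋ + u : ℤ) : ℝ) < (place w u f l + futV w u f l t : ℤ) := by exact_mod_cast hl4
      push_cast at h2
      linarith
    · refine ⟨t, Settled.lt_of_floor hs hnε ?_, Or.inr (Or.inr ht)⟩
      have h1 : ENNReal.ofReal (Real.exp (c.θ * ⌊c.α₁ * t⌋)) <
          ENNReal.ofReal (Real.exp (c.θ * (α' * t + ε * n))) := by
        refine lt_of_le_of_lt (ht.trans (ENNReal.tsum_le_tsum fun l => ?_)) (hset.old t)
        refine mul_le_mul_left ?_ _
        rw [weight, weight]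
        split_ifs with h1 h2
        · exact le_rfl
        · exact absurd (alive_mono w (by omega) h1) h2
        · exact bot_le
        · exact le_rfl
      rw [ENNReal.ofReal_lt_ofReal_iff (Real.exp_pos _), Real.exp_lt_exp] at h1
      exact lt_of_mul_lt_mul_left h1 hs.θ_pos.le
  -- By time `n` the front has advanced less than `B * n` sites: the slacks account for at most half
  -- of them, the old particles for `n`, and `2 * (β + 1) < B` leaves more than `β * n` for the line
  -- of slope `β`.
  have hspeed : tau w u f + t < tau w (u + (B * n : ℕ)) f := by
    have h1 := le_tau_of_slack (w := w) (u := u) (f := f) (β := β) (X := n) h.reg hu (by positivity)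
      (fun l hl s => by
        have h2 := place_add_lt hs.θ_pos (hset.old s) hl
        have h3 : α' * s ≤ β * s :=
          mul_le_mul_of_nonneg_right (by linarith [hs.gap, hs.ε_pos, hs.β_ge]) s.coe_nonneg
        have h4 : ε * n ≤ 1 * n := mul_le_mul_of_nonneg_right hs.ε_le (by positivity)
        linarith)
      (fun l _ => ne_top_of_le_ne_top (h.slack_ne l) (slack_anti hs.β_ge _)) (B * n)
    have h5 : β * n < β * ((tau w (u + (B * n : ℕ)) f).toReal - (tau w u f).toReal) := by
      have h6 := mul_lt_mul_of_pos_right hs.B_gt (by linarith : (0 : ℝ) < n)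
      push_cast at h1 hr2 ⊢
      linarith
    have h7 := lt_of_mul_lt_mul_left h5 (hα₁.le.trans hs.β_ge)
    refine (ENNReal.toReal_lt_toReal (ENNReal.add_ne_top.2 ⟨htop _, ENNReal.coe_ne_top⟩) (htop _)).1 ?_
    rw [ENNReal.toReal_add (htop _) ENNReal.coe_ne_top, ENNReal.coe_toReal]
    have h8 : (t : ℝ) ≤ n := by exact_mod_cast htn
    linarith
  classical
  have hex : ∃ k : ℕ, ∃ t : ℝ≥0, Broken c w u f t ∧ tau w u f + t < tau w (u + k) f :=
    ⟨B * n, t, hbt, hspeed⟩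
  have h1 := Nat.find_spec hex
  have h2 : Nat.find hex ≤ B * n := Nat.find_min' hex ⟨t, hbt, hspeed⟩
  have h3 : Nat.find hex ≠ 0 := fun h0 => by
    obtain ⟨s, -, hs'⟩ := h1
    rw [h0] at hs'
    simp only [Nat.cast_zero, add_zero] at hs'
    exact absurd le_self_add (not_le.2 hs')
  obtain ⟨k, hk⟩ := Nat.exists_eq_succ_of_ne_zero h3
  have hBN : B * n ≤ N * n := Nat.mul_le_mul_right n hs.B_le
  obtain ⟨v, hv1, hv2⟩ := h.exists_first hs hu hn hnp hset hr (x := u + k) (by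
    have : (k : ℤ) ≤ N * n := by exact_mod_cast (by omega : k ≤ N * n)
    have := bigM_pos a
    omega)
  refine ⟨v, ⟨u + k, by omega, ?_, ?_, hv1⟩, hv2⟩
  · rw [hk] at h1
    rw [add_assoc]
    exact_mod_cast h1
  · exact Nat.find_min hex (by omega)

end

/-! ### Probabilities given the past of a trial, and their iteration -/

section
variable {a : ℕ} {μ : Measure (Real₀ a)} {c : Params} {w : Config a} {u : ℤ}

/-! ### Conditioning on a trial -/

/-- The positions at the passage at `u` are those of a good block. -/
def Ready (c : Params) (w : Config a) (u : ℤ) (s : Real₀ a) : Prop :=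
  Good c w u s ∧ ∀ l ∈ alive w u, place w u s l ≤ u

theorem measurableSet_ready (c : Params) (w : Config a) (u : ℤ) : MeasurableSet {s | Ready c w u s} := by
  refine (measurableSet_good c w u).inter ?_
  have : {s : Real₀ a | ∀ l ∈ alive w u, place w u s l ≤ u} =
      ⋂ l : ℤ × Fin a, ⋂ _ : l ∈ alive w u, {s | place w u s l ≤ u} := by ext; simp
  change MeasurableSet {s : Real₀ a | ∀ l ∈ alive w u, place w u s l ≤ u}
  rw [this]
  exact MeasurableSet.iInter fun l => MeasurableSet.iInter fun _ =>
    measurableSet_le (measurable_place w u l) measurable_const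

/-- Given the past of a trial, the future paths have the law of the walks. -/
theorem measure_trial_le (hμ : IsMeshFamily μ coord) (hL : 1 ≤ c.L)
    (hreg : ∀ᵐ f ∂μ, ∀ v, f ∈ Reg w v) (k : ℕ) {C : Set (Real₀ a × Real₀ a)} (hC : UMeas C)
    {ε : ℝ≥0∞} (hε : ∀ s, Ready c w u s → μ {g | (s, g) ∈ C} ≤ ε) {X : Set (Real₀ a)}
    (hX : ∀ f, (∀ v, f ∈ Reg w v) → Trial c w k u f → f ∈ X →
      (stopAt (age w u f) f, futV w u f) ∈ C) :
    μ ({f | Trial c w k u f} ∩ X) ≤ ε * μ {f | Trial c w k u f} := by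
  have hst := isStopping_age w u (hreg.mono fun f hf => hf u)
  have hA : UMeas ({f | Trial c w k u f} ∩ {f | Ready c w u f}) :=
    (uMeas_trial c w k u).inter (UMeas.of_measurableSet (measurableSet_ready c w u))
  refine le_trans (measure_mono_ae ?_) ((hst.measure_inter_le hμ hA ?_ (measurableSet_ready c w u)
    Set.inter_subset_right hC hε).trans (mul_le_mul_right (measure_mono Set.inter_subset_left) _))
  · filter_upwards [hreg] with f hf hfX
    have h1 : Trial c w k u f := hfX.1
    exact ⟨⟨h1, h1.good, fun l hl => place_le (h1.lt hL).le (hf _) hl⟩, hX f hf h1 hfX.2⟩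
  · rintro f hf g hfg ⟨h1, h2, h3⟩
    have hag : Agree w u f g := hfg
    refine ⟨(hag.trial_iff hL hf k).2 h1, (hag.good_iff hf le_rfl).2 h2, fun l hl => ?_⟩
    rw [hag.place_eq hf le_rfl]
    exact h3 l hl

theorem stop_place (f : Real₀ a) (hf : f ∈ Reg w u) (l : ℤ × Fin a) :
    place w u (stopAt (age w u f) f) l = place w u f l :=
  Agree.place_eq (IsStopping.stop_agree (σ := age w u) f) hf le_rfl l

theorem stop_weight (f : Real₀ a) (hf : f ∈ Reg w u) (θ : ℝ) (z : ℤ) (l : ℤ × Fin a) :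
    weight θ w z u (stopAt (age w u f) f) l = weight θ w z u f l :=
  Agree.weight_eq (IsStopping.stop_agree (σ := age w u) f) hf le_rfl θ z l

theorem tau_le_futV {f : Real₀ a} (hu : w.r ≤ u) {v : ℤ} (huv : u < v) (hf : tau w u f < ∞)
    {l : ℤ × Fin a} (hl : l ∈ alive w u) :
    tau w v f ≤ tau w u f + hit (futV w u f l) (v - place w u f l) := by
  refine (tau_le w (hu.trans_lt huv) f (alive_mono w (by omega) hl)).trans ?_
  have h : hit (f l) (v - start w l) ≤ age w u f l + hit (futV w u f l) (v - place w u f l) := by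
    conv_rhs => rw [hit]
    simp only [ENNReal.add_iInf]
    refine le_iInf₂ fun t ht => ?_
    rw [← ENNReal.coe_add]
    refine hit_le ?_
    rw [futV_apply, place] at ht
    omega
  refine (add_le_add le_rfl h).trans (le_of_eq ?_)
  rw [← add_assoc, coe_age hf, add_tsub_cancel_of_le (tau_mono w f hl.1)]

/-- The particles present at the passage at `u` behave unexpectedly on the scale `n`. -/
def Unsettled (c : Params) (α' ε : ℝ) (w : Config a) (u : ℤ) (n : ℕ) (s g : Real₀ a) : Prop :=
  (∀ l ∈ alive w u, u - c.L < place w u s l → (n : ℝ≥0∞) < hit (g l) (bigM a + c.L : ℕ)) ∨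
  ∃ t : ℝ≥0, ENNReal.ofReal (Real.exp (c.θ * (α' * t + ε * n))) ≤
    ∑' l, weight c.θ w u u s l * ENNReal.ofReal (Real.exp (c.θ * g l t))

variable {α' ε : ℝ} {n : ℕ}

theorem uMeas_unsettled (c : Params) (α' ε : ℝ) (w : Config a) (u : ℤ) (n : ℕ) :
    UMeas {q : Real₀ a × Real₀ a | Unsettled c α' ε w u n q.1 q.2} := by
  refine UMeas.union (UMeas.setOf_forall fun l => UMeas.setOf_forall fun _ => ?_)
    (UMeas.exists_time_prod (C := {q | ENNReal.ofReal (Real.exp (c.θ * (α' * q.2 + ε * n))) ≤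
      ∑' l, weight c.θ w u u q.1.1 l * ENNReal.ofReal (Real.exp (c.θ * q.1.2 l q.2))}) ?_)
  · refine UMeas.of_measurableSet ?_
    have h1 : MeasurableSet {q : Real₀ a × Real₀ a | u - c.L < place w u q.1 l} :=
      measurableSet_lt measurable_const ((measurable_place w u l).comp measurable_fst)
    have h2 : MeasurableSet {q : Real₀ a × Real₀ a | (n : ℝ≥0∞) < hit (q.2 l) (bigM a + c.L : ℕ)} :=
      measurableSet_lt measurable_const ((measurable_hit_apply l _).comp measurable_snd)
    convert h1.compl.union h2 using 1
    ext q
    exact imp_iff_not_or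
  · refine measurableSet_le ?_ (Measurable.tsum fun l => ?_)
    · exact (Real.measurable_exp.comp (((measurable_snd.coe_nnreal_real.const_mul α').add_const
        _).const_mul _)).ennreal_ofReal
    · exact ((measurable_weight _ _ _ _ l).comp (measurable_fst.comp measurable_fst)).mul
        ((measurable_expInt c.θ).comp (measurable_eval_of (measurable_snd.comp measurable_fst)
          measurable_snd l))

theorem settled_of_not_unsettled {f : Real₀ a} (hu : w.r ≤ u) (hf : ∀ v, f ∈ Reg w v)
    (h : ¬ Unsettled c α' ε w u n f (futV w u f)) : Settled c α' ε w u n f := by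
  simp only [Unsettled, not_or, not_forall, not_exists, not_lt, not_le] at h
  obtain ⟨⟨l, hl, h1, h2⟩, h3⟩ := h
  refine ⟨?_, h3⟩
  have hp := place_le hu (hf _) hl
  have hM := bigM_pos a
  have htop : tau w u f < ∞ := Reg.tau_lt_top (hf u) le_rfl
  have h4 : tau w (u + bigM a) f ≤ tau w u f + n := by
    refine (tau_le_futV hu (by omega) htop hl).trans (add_le_add le_rfl (le_trans ?_ h2))
    exact hit_mono (futV w u f l).isStep (by rw [StepPath.zero]; omega) (by push_cast; omega)
  have h5 := ENNReal.toReal_mono (by simp [htop.ne]) h4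
  rwa [ENNReal.toReal_add htop.ne (ENNReal.natCast_ne_top n), ENNReal.toReal_natCast] at h5

/-- The particles behind the block weigh at most `p` in total; each of the at most `L * a` others is
not beyond the front, so it weighs at most `1`. -/
theorem Ready.tsum_weight_le (hθ : 0 ≤ c.θ) {s : Real₀ a} (hs : Ready c w u s) :
    ∑' l, weight c.θ w u u s l ≤ ENNReal.ofReal c.p + (c.L * a : ℕ) := by
  classical
  set F : Finset (ℤ × Fin a) := Finset.Ioc (u - c.L) u ×ˢ Finset.univ with hF
  have h1 : ∀ l, weight c.θ w u u s l ≤ weight c.θ w (u - c.L) u s l + if l ∈ F then 1 else 0 := by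
    intro l
    by_cases hl : l ∈ alive w u
    · by_cases hl' : l.1 ≤ u - c.L
      · refine le_add_right (le_of_eq ?_)
        rw [weight, weight, if_pos hl, if_pos ⟨hl', hl.2⟩]
      · rw [if_pos (by simp [hF]; exact ⟨by omega, hl.1⟩), weight, if_pos hl]
        refine le_add_left (ENNReal.ofReal_le_one.2 (Real.exp_le_one_iff.2 ?_))
        have : ((place w u s l - u : ℤ) : ℝ) ≤ 0 := by exact_mod_cast sub_nonpos.2 (hs.2 l hl)
        exact mul_nonpos_of_nonneg_of_nonpos hθ this
    · rw [weight, if_neg hl]; exact zero_le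
  refine (ENNReal.tsum_le_tsum h1).trans ?_
  rw [ENNReal.tsum_add]
  refine add_le_add hs.1.1 ?_
  rw [tsum_eq_sum (s := F) fun l hl => if_neg hl, Finset.sum_ite_mem, Finset.inter_self,
    Finset.sum_const, hF, Finset.card_product, Int.card_Ioc, Finset.card_univ, Fintype.card_fin]
  simp

/-- The count in a good block pays here: with `M ≤ a * L` it contains at least `2 (a + 5)` particles
within `L` of the front, all of which fail to cross the next window by time `n` with probability of
order `n ^ (-(a + 5))`. The exponential sum fails with exponentially small probability. -/
theorem IsWalkLaw.unsettled_tail (hμ : IsWalkLaw μ) (hθ : 0 < c.θ) (hα' : psi c.θ ≤ c.θ * α')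
    (hε : 0 < ε) (haL : bigM a ≤ a * c.L) : ∃ C : ℝ, 0 ≤ C ∧ ∀ (w : Config a) (u : ℤ) (s : Real₀ a),
      Ready c w u s → ∀ n : ℕ, 1 ≤ n → μ {g | Unsettled c α' ε w u n s g} ≤ ENNReal.ofReal (C / n ^ (a + 2)) := by
  obtain ⟨C, hC, h⟩ := hμ.exists_hit_tail_pow (bigM a + c.L)
  set D : ℝ := (a + 2).factorial / (c.θ * ε) ^ (a + 2) * (max c.p 0 + (c.L * a : ℕ)) with hD
  have hD0 : 0 ≤ D := by positivity
  refine ⟨C ^ (2 * (a + 5)) + D, by positivity, fun w u s hs n hn => ?_⟩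
  have hnR : (1 : ℝ) ≤ n := by exact_mod_cast hn
  rw [add_div, ENNReal.ofReal_add (by positivity) (by positivity)]
  refine (measure_union_le _ _).trans (add_le_add ?_ ?_)
  · obtain ⟨S, hS, hSl⟩ := hs.1.2
    have hcard : 2 * (a + 5) ≤ S.card := by
      have h1 : (bigM a : ℝ) ≤ a * c.L := by exact_mod_cast haL
      have h2 : (2 * (a + 5) : ℝ) ≤ S.card := by rw [bigM] at h1; push_cast at h1; linarith
      exact_mod_cast h2
    obtain ⟨S', hS', hc⟩ := Finset.exists_subset_card_eq hcard
    refine (measure_mono fun g hg l hl => ?_).trans ((h S' n hn).trans (ENNReal.ofReal_le_ofReal ?_))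
    · obtain ⟨h1, -, h3, -⟩ := hSl l (hS' hl)
      exact hg l h1 h3
    · rw [hc, div_pow, pow_mul (√(n : ℝ)), Real.sq_sqrt (by positivity)]
      exact div_le_div_of_nonneg_left (by positivity) (by positivity)
        (pow_le_pow_right₀ hnR (by omega))
  · have h1 := hμ.mesh.exceed (weight c.θ w u u s) hα' (c.θ * ε * n)
    refine (measure_mono ?_).trans (h1.trans ?_)
    · rintro g ⟨t, ht⟩
      refine ⟨t, le_trans (le_of_eq ?_) ht⟩
      ring_nf
    · have h2 : ∑' l, weight c.θ w u u s l ≤ ENNReal.ofReal (max c.p 0 + (c.L * a : ℕ)) := by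
        rw [ENNReal.ofReal_add (le_max_right _ _) (by positivity), ENNReal.ofReal_natCast]
        exact (hs.tsum_weight_le hθ.le).trans
          (add_le_add (ENNReal.ofReal_le_ofReal (le_max_left _ _)) le_rfl)
      have h3 := exp_neg_le_div_pow (mul_pos hθ hε) (a + 2) hn
      refine (mul_le_mul' (ENNReal.ofReal_le_ofReal h3) h2).trans ?_
      rw [← ENNReal.ofReal_mul (by positivity), hD]
      exact ENNReal.ofReal_le_ofReal (le_of_eq (by ring))

theorem wait_congr {f g : Real₀ a} {k : ℤ} (h : ∀ l : ℤ × Fin a, k - bigM a ≤ l.1 → g l = f l) :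
    wait k g = wait k f :=
  iInf_congr fun l => iInf_congr fun hl => by rw [h l hl.1]

theorem gain_congr {f g : Real₀ a} {α K κ : ℝ} {k : ℤ}
    (h : ∀ l : ℤ × Fin a, k - bigM a ≤ l.1 → g l = f l) : gain α K κ k g = gain α K κ k f := by
  have hM := bigM_pos a
  have h1 : excess α K (k - 1) g = excess α K (k - 1) f := Finset.sum_congr rfl fun i _ => by
    rw [lag, lag, h _ (by simp only; omega)]
  rw [gain, gain, waitR, waitR, wait_congr h, h1]

theorem slowAux_congr {f g : Real₀ a} (h : ∀ l : ℤ × Fin a, u ≤ l.1 → g l = f l) (t : ℝ≥0) :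
    SlowAux c u g t ↔ SlowAux c u f t := by
  have h1 : ∀ n, auxTime g u n = auxTime f u n := fun n => Finset.sum_congr rfl fun k _ => by
    rcases k with _ | k
    · simp [nu]
    · rw [nu_succ, nu_succ]
      exact iInf_congr fun l => iInf_congr fun hl => by rw [h l ((le_max_left _ _).trans hl.1)]
  rw [SlowAux, SlowAux, h1]

/-- The environment concerns only labels from `u` on, whose particles have age zero at the passage
at `u`. So it may be read off the restarted paths. -/
theorem rough_congr {f g : Real₀ a} {β K κ : ℝ} {B A : ℕ}
    (h : ∀ l : ℤ × Fin a, u ≤ l.1 → g l = f l) (hr : Rough c β K κ B A u n f) :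
    Rough c β K κ B A u n g := by
  have hg : ∀ k : ℤ, u + bigM a ≤ k → gain c.α₁ K κ k g = gain c.α₁ K κ k f := fun k hk =>
    gain_congr fun l hl => h l (by omega)
  rcases hr with ⟨l, h1, h2, h3⟩ | hr | hr | ⟨ρ, hρ, hr⟩ | ⟨ρ, hρ, hr⟩
  · exact Or.inl ⟨l, h1, h2, by rwa [h l h1.le]⟩
  · refine Or.inr (Or.inl (lt_of_lt_of_eq hr (Finset.sum_congr rfl fun j _ => ?_)))
    exact Finset.sum_congr rfl fun i _ => by rw [h _ (by simp)]
  · refine Or.inr (Or.inr (Or.inl ?_))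
    simpa only [slowAux_congr h] using hr
  · refine Or.inr (Or.inr (Or.inr (Or.inl ⟨ρ, hρ, lt_of_eq_of_lt ?_ hr⟩)))
    exact Finset.sum_congr rfl fun j _ => hg _ (by omega)
  · refine Or.inr (Or.inr (Or.inr (Or.inr ⟨ρ, hρ, lt_of_lt_of_eq hr ?_⟩)))
    refine Finset.sum_congr rfl fun j _ => ?_
    rw [deficit, deficit]
    refine Finset.sum_congr rfl fun k hk => ?_
    rw [Finset.sum_congr rfl fun i hi => ?_]
    rw [Finset.mem_range] at hk hi
    rw [hg]
    have : (0 : ℤ) ≤ (c.L * j : ℕ) := by positivity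
    omega

theorem Proper.ae_nice (hμ : IsWalkLaw μ) (ha : 1 ≤ a) (hθ : 0 < c.θ) (hα : 0 < c.α₁)
    (hα₁ : psi c.θ ≤ c.θ * c.α₁) (hw : Proper c.θ w) : ∀ᵐ f ∂μ, Nice c w f := by
  obtain ⟨u, hu, hpu⟩ := exists_psi_le (β := c.α₁ / 10) (by positivity)
  filter_upwards [hw.ae_reg hμ.mesh hθ, hμ.ae_wait_ne_top ha, hμ.mesh.ae_slack_ne_top hθ hα₁,
    hμ.mesh.ae_slack_neg_ne_top hu hpu] with f h1 h2 h3 h4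
  exact ⟨h1, h2, h3, h4⟩

theorem exists_scale {c : Params} (hθ : 0 < c.θ) (hp : 0 < c.p) (hε : 0 < ε) : ∃ n₀ : ℕ, ∀ n : ℕ, n₀ ≤ n →
    1 ≤ ε * n ∧ (a * bigM a + 1) * Real.exp (-(c.θ * n)) ≤ c.p / 2 := by
  have h1 : Tendsto (fun n : ℕ => ε * n) atTop atTop :=
    tendsto_natCast_atTop_atTop.const_mul_atTop hε
  have h2 : Tendsto (fun n : ℕ => (a * bigM a + 1 : ℝ) * Real.exp (-(c.θ * n))) atTop
      (𝓝 ((a * bigM a + 1 : ℝ) * 0)) :=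
    (Real.tendsto_exp_neg_atTop_nhds_zero.comp
      (tendsto_natCast_atTop_atTop.const_mul_atTop hθ)).const_mul _
  rw [mul_zero] at h2
  obtain ⟨n₀, h⟩ := eventually_atTop.1 ((h1.eventually_ge_atTop 1).and
    (h2.eventually_le_const (by positivity : (0 : ℝ) < c.p / 2)))
  exact ⟨n₀, h⟩

/-- The maximal distance between consecutive trials on the scale `n`. -/
def reach (a : ℕ) (c : Params) (A n : ℕ) : ℕ := (bigM a + c.L + A * c.L) * n

/-- After a broken trial, the next one is near. -/
theorem IsWalkLaw.gap_tail (hμ : IsWalkLaw μ) {β K κ : ℝ} {B N A : ℕ} (hs : Scales a c α' ε β K κ B N A)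
    (hp : 0 < c.p) (hα' : psi c.θ ≤ c.θ * α') (haL : bigM a ≤ a * c.L)
    (hrough : PolyBound μ (a + 2) fun u n => {g | Rough c β K κ B A u n g}) :
    ∃ C : ℝ, 0 ≤ C ∧ ∀ w : Config a, (∀ᵐ f ∂μ, Nice c w f) → ∀ (k : ℕ) (u : ℤ) (n : ℕ), 1 ≤ n →
      μ ({f | Trial c w k u f} ∩ {f | (∃ t, Broken c w u f t) ∧
        ¬ ∃ v ≤ u + reach a c A n, Next c w u v f}) ≤
          ENNReal.ofReal (C / n ^ (a + 2)) * μ {f | Trial c w k u f} := by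
  obtain ⟨C₁, hC₁, h1⟩ := hμ.unsettled_tail hs.θ_pos hα' hs.ε_pos haL
  obtain ⟨C₂, hC₂, h2⟩ := hrough
  obtain ⟨n₀, hn₀⟩ := exists_scale (a := a) hs.θ_pos hp hs.ε_pos
  refine ⟨max (C₁ + C₂) ((n₀ : ℝ) ^ (a + 2)), by positivity, fun w hw k u n hn => ?_⟩
  have hnR : (1 : ℝ) ≤ n := by exact_mod_cast hn
  -- For small `n` the constant is large enough to make the bound trivial.
  rcases lt_or_ge n n₀ with hnn | hnn
  · refine (measure_mono Set.inter_subset_left).trans ?_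
    refine le_mul_of_one_le_left zero_le ?_
    rw [← ENNReal.ofReal_one]
    refine ENNReal.ofReal_le_ofReal ?_
    rw [le_div_iff₀ (by positivity), one_mul]
    exact (pow_le_pow_left₀ (by positivity) (by exact_mod_cast hnn.le) _).trans (le_max_right _ _)
  obtain ⟨hn1, hn2⟩ := hn₀ n hnn
  set X := {f | (∃ t, Broken c w u f t) ∧ ¬ ∃ v ≤ u + reach a c A n, Next c w u v f} with hX
  -- Passing to a measurable hull keeps the probability and makes the condition admissible in the
  -- product space.
  set Q := toMeasurable μ {g : Real₀ a | Rough c β K κ B A u n g} with hQ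
  have h3 := measure_trial_le (X := X ∩ {f | Nice c w f}) (u := u) hμ.mesh hs.L_pos (hw.mono fun f hf => hf.reg) k
    (C := {q | Unsettled c α' ε w u n q.1 q.2} ∪ Prod.snd ⁻¹' Q) ((uMeas_unsettled c α' ε w u n).union
      (UMeas.of_measurableSet (measurable_snd (measurableSet_toMeasurable _ _))))
    (ε := ENNReal.ofReal (max (C₁ + C₂) ((n₀ : ℝ) ^ (a + 2)) / n ^ (a + 2))) ?_ ?_
  · refine le_trans (measure_mono_ae ?_) h3
    filter_upwards [hw] with f hf hfX
    exact ⟨hfX.1, hfX.2, hf⟩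
  · intro s hsr
    refine (measure_union_le _ _).trans ((add_le_add (h1 w u s hsr n hn)
      ((measure_toMeasurable _).trans_le (h2 u n hn))).trans ?_)
    rw [← ENNReal.ofReal_add (by positivity) (by positivity), ← add_div]
    exact ENNReal.ofReal_le_ofReal (div_le_div_of_nonneg_right (le_max_left _ _) (by positivity))
  · rintro f hf ht ⟨⟨hbr, hno⟩, hnice⟩
    by_contra hcon
    simp only [Set.mem_union, not_or, Set.mem_preimage] at hcon
    have hur := (ht.lt hs.L_pos).le
    have hset : Settled c α' ε w u n f := by
      refine settled_of_not_unsettled hur hf fun hun => hcon.1 ?_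
      simp only [Set.mem_ofPred_eq, Unsettled, stop_place f (hf u), stop_weight f (hf u)]
      exact hun
    have hr : ¬ Rough c β K κ B A u n f := fun hr => hcon.2 (subset_toMeasurable _ _
      (rough_congr (fun l hl => futV_of_ge w f hl) hr))
    obtain ⟨v, hv, hv'⟩ := Nice.exists_next hnice hs hur hn hn1 hn2 hset hr hbr
    exact hno ⟨v, by rw [reach]; push_cast; exact hv', hv⟩

end

section
variable {a : ℕ} {μ : Measure (Real₀ a)} {c : Params}

/-! ### Every trial succeeds with a probability bounded from below -/

/-- Doob's inequality for the sum of the particles behind the block: the floor loses at most one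
unit, so the level is `exp (-θ)`, and the initial sum is at most `p`. Restricting to the labels
behind the block before taking a measurable hull keeps the event independent of all the others. -/
theorem IsWalkLaw.exists_slow_back (hμ : IsWalkLaw μ) (hα₁ : psi c.θ ≤ c.θ * c.α₁) (hθ : 0 < c.θ)
    (w : Config a) (u : ℤ) (s : Real₀ a)
    (hs : ∑' l, weight c.θ w (u - c.L) u s l ≤ ENNReal.ofReal c.p) :
    ∃ H : Set (Real₀ a), MeasurableSet[labSigma {l | l.1 ≤ u - c.L}] H ∧
      (∀ g ∈ H, ∀ t, ¬ FastBack c w u s g t) ∧ 1 - ENNReal.ofReal (c.p * Real.exp c.θ) ≤ μ H := by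
  have := hμ.mesh.isProbabilityMeasure
  set T : Set (ℤ × Fin a) := {l | l.1 ≤ u - c.L} with hT
  let ρ : Real₀ a → PathSpace T := fun g l => g l
  have hρT : Measurable[labSigma T] ρ := @measurable_pi_lambda _ _ _ (labSigma T) _ _ fun l =>
    measurable_labSigma l.2
  have hρ : Measurable ρ := measurable_pi_lambda _ fun l => measurable_pi_apply _
  have hsum : ∀ (g : Real₀ a) (t : ℝ≥0), ∑' l : T, weight c.θ w (u - c.L) u s l *
      ENNReal.ofReal (Real.exp (c.θ * ρ g l t)) =
      ∑' l, weight c.θ w (u - c.L) u s l * ENNReal.ofReal (Real.exp (c.θ * g l t)) := fun g t =>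
    tsum_subtype_eq_of_support_subset (f := fun l => weight c.θ w (u - c.L) u s l *
      ENNReal.ofReal (Real.exp (c.θ * g l t))) fun l hl => by
        by_contra hcon
        refine hl ?_
        simp only [weight]
        rw [if_neg fun h => hcon h.1, zero_mul]
  set E : Set (PathSpace T) := {h | ∃ t : ℝ≥0, ENNReal.ofReal (Real.exp (c.θ * c.α₁ * t + -c.θ)) ≤
    ∑' l : T, weight c.θ w (u - c.L) u s l * ENNReal.ofReal (Real.exp (c.θ * h l t))} with hE
  have hEm : UMeas E := by
    refine UMeas.exists_time (C := {q | ENNReal.ofReal (Real.exp (c.θ * c.α₁ * q.2 + -c.θ)) ≤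
      ∑' l : T, weight c.θ w (u - c.L) u s l * ENNReal.ofReal (Real.exp (c.θ * q.1 l q.2))}) ?_
    refine measurableSet_le (Real.measurable_exp.comp
      ((measurable_snd.coe_nnreal_real.const_mul _).add_const _)).ennreal_ofReal
      (Measurable.tsum fun l => Measurable.const_mul ?_ _)
    exact (measurable_expInt c.θ).comp (Measurable.eval
      (φ := fun q : PathSpace T × ℝ≥0 => q.1 l) ((measurable_pi_apply l).comp measurable_fst) measurable_snd)
  set Q := toMeasurable (μ.map ρ) E with hQ
  have hQm : MeasurableSet Q := measurableSet_toMeasurable _ _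
  have h1 : μ (ρ ⁻¹' Q) ≤ ENNReal.ofReal (c.p * Real.exp c.θ) := by
    rw [← Measure.map_apply hρ hQm, hQ, measure_toMeasurable, Measure.map_apply₀ hρ.aemeasurable
      (hEm _ inferInstance), mul_comm, ENNReal.ofReal_mul (Real.exp_pos _).le]
    have h2 := hμ.mesh.exceed (weight c.θ w (u - c.L) u s) hα₁ (-c.θ)
    rw [neg_neg] at h2
    refine le_trans (measure_mono ?_) (h2.trans (mul_le_mul_right hs _))
    rintro g ⟨t, ht⟩
    exact ⟨t, by rwa [hsum g t] at ht⟩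
  refine ⟨(ρ ⁻¹' Q)ᶜ, (hρT hQm).compl, fun g hg t ht => hg (subset_toMeasurable _ _ ⟨t, ?_⟩), ?_⟩
  · rw [hsum g t]
    refine le_trans (ENNReal.ofReal_le_ofReal (Real.exp_le_exp.2 ?_)) ht
    have h3 := (Int.sub_one_lt_floor (c.α₁ * t)).le
    nlinarith
  · rw [prob_compl_eq_one_sub (hρ hQm)]
    exact tsub_le_tsub_left h1 _

/-- The three causes of a break are excluded by events of disjoint sets of labels: from `u` on,
strictly inside the block, and behind it. Their product is a lower bound for success that depends
neither on the past nor on `u`. -/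
theorem IsWalkLaw.exists_broken_le (hμ : IsWalkLaw μ) (ha : 1 ≤ a) (hL : 1 ≤ c.L) (hθ : 0 < c.θ)
    (hα₁ : psi c.θ ≤ c.θ * c.α₁) (hα₁0 : 0 < c.α₁) (hα₂ : 0 < c.α₂) (hα₂' : c.α₂ < (meanWait μ)⁻¹)
    (hp : c.p * Real.exp c.θ < 1) : ∃ δ : ℝ≥0∞, 0 < δ ∧ ∀ w : Config a,
      (∀ᵐ f ∂μ, ∀ v, f ∈ Reg w v) → ∀ (k : ℕ) (u : ℤ),
        μ ({f | Trial c w k u f} ∩ {f | ∃ t, Broken c w u f t}) ≤ (1 - δ) * μ {f | Trial c w k u f} := by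
  have := hμ.mesh.isProbabilityMeasure
  obtain ⟨q, hq, hqS⟩ := hμ.mesh.exists_pos_le_floor hθ hα₁ hα₁0
  choose S hS1 hS2 hS3 using hqS
  set r := 1 - ENNReal.ofReal (c.p * Real.exp c.θ) with hr
  have hr0 : 0 < r := tsub_pos_of_lt (by rwa [ENNReal.ofReal_lt_one])
  have hah := hμ.ahead_pos ha hα₂ hα₂'
  refine ⟨μ {f | Ahead c.α₂ 0 f} * q ^ (c.L * a) * r,
    ENNReal.mul_pos (ENNReal.mul_pos hah.ne' (ENNReal.pow_pos hq _).ne').ne' hr0.ne', fun w hreg k u => ?_⟩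
  refine measure_trial_le hμ.mesh hL hreg k (C := {x | ∃ t, SlowAux c u x.2 t ∨
    FastBlock c w u x.1 x.2 t ∨ FastBack c w u x.1 x.2 t}) ?_ (fun s hs => ?_) fun f hf ht hb => ?_
  · have h1 : Measurable fun x : (Real₀ a × Real₀ a) × ℝ≥0 => x.1.1 := measurable_fst.comp measurable_fst
    have h2 : Measurable fun x : (Real₀ a × Real₀ a) × ℝ≥0 => x.1.2 := measurable_snd.comp measurable_fst
    exact UMeas.exists_time_prod (C := {x | SlowAux c u x.1.2 x.2 ∨ FastBlock c w u x.1.1 x.1.2 x.2 ∨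
      FastBack c w u x.1.1 x.1.2 x.2}) ((measurableSet_slowAux c u h2 measurable_snd).union
        ((measurableSet_fastBlock c w u h1 h2 measurable_snd).union
          (measurableSet_fastBack c w u h1 h2 measurable_snd)))
  · obtain ⟨H, hH1, hH2, hH3⟩ := hμ.exists_slow_back hα₁ hθ w u s hs.1.1
    set F : Finset (ℤ × Fin a) := Finset.Ioo (u - c.L) u ×ˢ Finset.univ with hF
    set G : Set (Real₀ a) := ⋂ l ∈ F, (fun g : Real₀ a => g l) ⁻¹' S l with hG
    have hGm : MeasurableSet[labSigma {l : ℤ × Fin a | u - c.L < l.1 ∧ l.1 < u}] G := by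
      refine MeasurableSet.biInter F.countable_toSet fun l hl => ?_
      have hl' : u - c.L < l.1 ∧ l.1 < u := by simpa [hF] using hl
      exact measurable_labSigma (S := {l : ℤ × Fin a | u - c.L < l.1 ∧ l.1 < u}) hl' (hS1 l)
    have hGq : q ^ (c.L * a) ≤ μ G := by
      rw [hG, hμ.indep.measure_inter_preimage_eq_mul F fun l _ => hS1 l]
      have hq1 : q ≤ 1 := (hS3 (0, ⟨0, ha⟩)).trans prob_le_one
      have hFc : F.card ≤ c.L * a := by
        rw [hF, Finset.card_product, Int.card_Ioo, Finset.card_univ, Fintype.card_fin]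
        exact Nat.mul_le_mul_right _ (by omega)
      refine (pow_le_pow_right_of_le_one' hq1 hFc).trans ?_
      rw [← Finset.prod_const]
      exact Finset.prod_le_prod' fun l _ => hS3 l
    have hA := measurableSet_ahead (a := a) c.α₂ u
    have hAG : μ ({f | Ahead c.α₂ u f} ∩ G) = μ {f | Ahead c.α₂ u f} * μ G :=
      (Indep_iff _ _ μ).1 (hμ.indep_labSigma (Set.disjoint_left.2 fun l h1 h2 => by
        simp only [Set.mem_ofPred_eq] at h1 h2; omega)) _ _ hA hGm
    have hsub1 : {l : ℤ × Fin a | u ≤ l.1} ⊆ {l | u - c.L < l.1} := fun l hl => by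
      simp only [Set.mem_ofPred_eq] at hl ⊢; omega
    have hsub2 : {l : ℤ × Fin a | u - c.L < l.1 ∧ l.1 < u} ⊆ {l | u - c.L < l.1} := fun l hl => hl.1
    have hAGm : MeasurableSet[labSigma {l : ℤ × Fin a | u - c.L < l.1}] ({f | Ahead c.α₂ u f} ∩ G) :=
      @MeasurableSet.inter _ (labSigma {l : ℤ × Fin a | u - c.L < l.1}) _ _
        (labSigma_mono hsub1 _ hA) (labSigma_mono hsub2 _ hGm)
    have hAGH : μ ({f | Ahead c.α₂ u f} ∩ G ∩ H) = μ ({f | Ahead c.α₂ u f} ∩ G) * μ H :=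
      (Indep_iff _ _ μ).1 (hμ.indep_labSigma (Set.disjoint_left.2 fun l h1 h2 => by
        simp only [Set.mem_ofPred_eq] at h1 h2; omega)) _ _ hAGm hH1
    have hm : MeasurableSet ({f | Ahead c.α₂ u f} ∩ G ∩ H) :=
      (labSigma_le _ _ hAGm).inter (labSigma_le _ _ hH1)
    refine (measure_mono (t := ({f | Ahead c.α₂ u f} ∩ G ∩ H)ᶜ) ?_).trans ?_
    · rintro g ⟨t, ht⟩ ⟨⟨h1, h2⟩, h3⟩
      rcases ht with ht | ⟨l, h4, h5, h6, h7⟩ | ht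
      · exact (not_slowAux_iff hα₂ u g).2 h1 ⟨t, ht⟩
      · have h8 : g l ∈ S l := Set.mem_iInter₂.1 h2 l (by simp [hF, h5, h6])
        have h9 := hS2 l _ h8 t
        have h10 := hs.2 l h4
        dsimp only at h7
        omega
      · exact hH2 g h3 t ht
    · rw [prob_compl_eq_one_sub hm, hAGH, hAG, hμ.measure_ahead]
      exact tsub_le_tsub_left (mul_le_mul' (mul_le_mul' le_rfl hGq) hH3) _
  · obtain ⟨t, hb⟩ := hb
    refine ⟨t, hb.imp (slowAux_congr (fun l hl => futV_of_ge w f hl) t).2 (Or.imp ?_ ?_)⟩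
    · simp only [FastBlock, stop_place f (hf u), imp_self]
    · simp only [FastBack, stop_weight f (hf u), imp_self]

end

section
variable {a : ℕ} {μ : Measure (Real₀ a)} {c : Params} {w : Config a}

/-! ### Iteration of the trials -/

theorem First.unique {x v v' : ℤ} {f : Real₀ a} (h : First c w x v f) (h' : First c w x v' f) :
    v = v' := by
  obtain ⟨j, h1, rfl, h2, h3⟩ := h
  obtain ⟨j', h1', rfl, h2', h3'⟩ := h'
  rcases lt_trichotomy j j' with hj | rfl | hj
  · exact absurd h2 (h3' j h1 hj)
  · rfl
  · exact absurd h2' (h3 j' h1' hj)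

theorem Next.unique {u v v' : ℤ} {f : Real₀ a} (h : Next c w u v f) (h' : Next c w u v' f) :
    v = v' := by
  obtain ⟨x, -, ⟨t, h1, h2⟩, h3, h4⟩ := h
  obtain ⟨x', -, ⟨t', h1', h2'⟩, h3', h4'⟩ := h'
  rcases lt_trichotomy x x' with hx | rfl | hx
  · exact absurd ⟨t, h1, h2.trans_le (tau_mono w f (by omega))⟩ h3'
  · exact h4.unique h4'
  · exact absurd ⟨t', h1', h2'.trans_le (tau_mono w f (by omega))⟩ h3

theorem Trial.unique {k : ℕ} {v v' : ℤ} {f : Real₀ a} (h : Trial c w k v f) (h' : Trial c w k v' f) :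
    v = v' := by
  induction k generalizing v v' with
  | zero => exact First.unique h h'
  | succ k ih =>
    obtain ⟨u, h1, h2⟩ := h
    obtain ⟨u', h1', h2'⟩ := h'
    obtain rfl := ih h1 h1'
    exact h2.unique h2'

/-- The events that trial number `k` takes place at `u` are disjoint for different `u`, so
conditional bounds add up. -/
theorem measure_exists_trial_le [IsFiniteMeasure μ] {k : ℕ} {ε : ℝ≥0∞} {X : ℤ → Set (Real₀ a)}
    (h : ∀ u, μ ({f | Trial c w k u f} ∩ X u) ≤ ε * μ {f | Trial c w k u f}) :
    μ {f | ∃ u, Trial c w k u f ∧ f ∈ X u} ≤ ε * μ {f | ∃ u, Trial c w k u f} := by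
  have h1 : {f | ∃ u, Trial c w k u f} = ⋃ u, {f | Trial c w k u f} := by ext; simp
  have h2 : {f | ∃ u, Trial c w k u f ∧ f ∈ X u} = ⋃ u, ({f | Trial c w k u f} ∩ X u) := by ext; simp
  have hd : Pairwise (Function.onFun (AEDisjoint μ) fun u => {f | Trial c w k u f}) := fun u v huv =>
    (Set.disjoint_left.2 fun f hu hv => huv (Trial.unique hu hv)).aedisjoint
  rw [h1, h2, measure_iUnion₀ hd fun u => uMeas_trial c w k u μ inferInstance, ← ENNReal.tsum_mul_left]
  exact (measure_iUnion_le _).trans (ENNReal.tsum_le_tsum h)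

theorem measure_trial_pow_le [IsProbabilityMeasure μ] {q : ℝ≥0∞}
    (hq : ∀ k u, μ ({f | Trial c w k u f} ∩ {f | ∃ t, Broken c w u f t}) ≤ q * μ {f | Trial c w k u f})
    (k : ℕ) : μ {f | ∃ u, Trial c w k u f} ≤ q ^ k := by
  induction k with
  | zero => exact prob_le_one.trans_eq (pow_zero q).symm
  | succ k ih =>
    refine (measure_mono ?_).trans ((measure_exists_trial_le (hq k)).trans
      ((mul_le_mul_right ih q).trans_eq (pow_succ' q k).symm))
    rintro f ⟨v, u, h1, h2⟩
    obtain ⟨x, -, ⟨t, h3, -⟩, -⟩ := h2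
    exact ⟨u, h1, t, h3⟩

/-- The trial at `v` takes place and is never broken. -/
def Regen (c : Params) (w : Config a) (v : ℤ) (f : Real₀ a) : Prop :=
  (∃ k, Trial c w k v f) ∧ ¬ ∃ t, Broken c w v f t

/-- If there is no regeneration within reach, either a broken trial with number below `K` has no
near successor, which costs `ε` times a geometric sum, or trial number `K` takes place, which
requires `K` breaks. -/
theorem measure_not_regen_le [IsProbabilityMeasure μ] {q ε : ℝ≥0∞}
    (hq : ∀ k u, μ ({f | Trial c w k u f} ∩ {f | ∃ t, Broken c w u f t}) ≤ q * μ {f | Trial c w k u f})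
    {ρ : ℕ} (hε : ∀ k u, μ ({f | Trial c w k u f} ∩ {f | (∃ t, Broken c w u f t) ∧
      ¬ ∃ v ≤ u + ρ, Next c w u v f}) ≤ ε * μ {f | Trial c w k u f}) (b : ℤ) (K : ℕ) :
    μ {f | (∃ v ≤ b, First c w w.r v f) ∧ ¬ ∃ v ≤ b + ρ * K, Regen c w v f} ≤
      ε * (1 - q)⁻¹ + q ^ K := by
  have hsub : {f | (∃ v ≤ b, First c w w.r v f) ∧ ¬ ∃ v ≤ b + ρ * K, Regen c w v f} ⊆
      (⋃ k ∈ Finset.range K, {f | ∃ u, Trial c w k u f ∧ f ∈ {f | (∃ t, Broken c w u f t) ∧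
        ¬ ∃ v ≤ u + ρ, Next c w u v f}}) ∪ {f | ∃ u, Trial c w K u f} := by
    rintro f ⟨hfirst, hno⟩
    by_contra hcon
    rw [Set.mem_union, not_or] at hcon
    obtain ⟨h1, h2⟩ := hcon
    have h3 : ∀ k < K, ∀ u, Trial c w k u f → (∃ t, Broken c w u f t) → ∃ v ≤ u + ρ, Next c w u v f := by
      intro k hk u hu hb
      by_contra hn
      exact h1 (Set.mem_biUnion (Finset.mem_coe.2 (Finset.mem_range.2 hk)) ⟨u, hu, hb, hn⟩)
    have h4 : ∀ k ≤ K, ∃ v ≤ b + ρ * k, Trial c w k v f := by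
      intro k
      induction k with
      | zero => exact fun _ => by simpa [Trial] using hfirst
      | succ k ih =>
        intro hk
        obtain ⟨v, hv, ht⟩ := ih (by omega)
        have hb : ∃ t, Broken c w v f t := by
          by_contra hb
          refine hno ⟨v, hv.trans ?_, ⟨k, ht⟩, hb⟩
          have : (ρ : ℤ) * k ≤ ρ * K := by exact_mod_cast Nat.mul_le_mul_left _ (by omega)
          omega
        obtain ⟨v', hv', hn⟩ := h3 k hk v ht hb
        exact ⟨v', by push_cast; linarith, v, ht, hn⟩
    obtain ⟨v, -, hv⟩ := h4 K le_rfl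
    exact h2 ⟨v, hv⟩
  refine (measure_mono hsub).trans ((measure_union_le _ _).trans (add_le_add ?_ (measure_trial_pow_le hq K)))
  refine (measure_biUnion_finset_le _ _).trans ?_
  rw [← ENNReal.tsum_geometric, ← ENNReal.tsum_mul_left]
  refine (Finset.sum_le_sum fun k _ => ?_).trans (ENNReal.sum_le_tsum _)
  exact (measure_exists_trial_le (hε k)).trans (mul_le_mul_right (measure_trial_pow_le hq k) _)

/-- For a fixed bound on the first trial, let the scale and the number of trials tend to infinity
together. -/
theorem ae_exists_regen [IsProbabilityMeasure μ] {q : ℝ≥0∞} (hq1 : q < 1)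
    (hq : ∀ k u, μ ({f | Trial c w k u f} ∩ {f | ∃ t, Broken c w u f t}) ≤ q * μ {f | Trial c w k u f})
    {ρ : ℕ → ℕ} {C : ℝ} {s : ℕ} (hs : s ≠ 0) (hε : ∀ k u n, 1 ≤ n → μ ({f | Trial c w k u f} ∩
      {f | (∃ t, Broken c w u f t) ∧ ¬ ∃ v ≤ u + ρ n, Next c w u v f}) ≤
        ENNReal.ofReal (C / n ^ s) * μ {f | Trial c w k u f})
    (hfirst : ∀ᵐ f ∂μ, ∃ v, First c w w.r v f) : ∀ᵐ f ∂μ, ∃ v, Regen c w v f := by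
  have h1 : ∀ᵐ f ∂μ, ∀ b : ℤ, ¬ ((∃ v ≤ b, First c w w.r v f) ∧ ¬ ∃ v, Regen c w v f) := by
    refine ae_all_iff.2 fun b => ?_
    rw [ae_iff]
    simp only [not_not]
    have hlim : Tendsto (fun n : ℕ => ENNReal.ofReal (C / (n : ℝ) ^ s) * (1 - q)⁻¹ + q ^ n) atTop (𝓝 0) := by
      have h2 : Tendsto (fun n : ℕ => ENNReal.ofReal (C / (n : ℝ) ^ s)) atTop (𝓝 0) := by
        rw [← ENNReal.ofReal_zero]
        exact ENNReal.tendsto_ofReal (Tendsto.div_atTop tendsto_const_nhds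
          ((tendsto_pow_atTop hs).comp tendsto_natCast_atTop_atTop))
      have h3 := ENNReal.Tendsto.mul_const (b := (1 - q)⁻¹) h2
        (Or.inr (ENNReal.inv_ne_top.2 (tsub_pos_of_lt hq1).ne'))
      simpa using h3.add (ENNReal.tendsto_pow_atTop_nhds_zero_of_lt_one hq1)
    refine le_antisymm (ge_of_tendsto hlim ?_) zero_le
    filter_upwards [eventually_ge_atTop 1] with n hn
    refine (measure_mono ?_).trans (measure_not_regen_le hq (fun k u => hε k u n hn) b n)
    exact fun f hf => ⟨hf.1, fun ⟨v, _, hv⟩ => hf.2 ⟨v, hv⟩⟩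
  filter_upwards [h1, hfirst] with f h ⟨b, hb⟩
  by_contra hcon
  exact h b ⟨⟨b, le_rfl, hb⟩, hcon⟩

variable {α' ε β K κ : ℝ} {B N A : ℕ}

theorem settled_root {n : ℕ} {f : Real₀ a} (h1 : (tau w (w.r + bigM a) f).toReal ≤ n)
    (h2 : ∀ t : ℝ≥0, ∑' l, rootWeight c.θ w l * ENNReal.ofReal (Real.exp (c.θ * f l t)) <
      ENNReal.ofReal (Real.exp (c.θ * α' * t + c.θ * ε * n))) : Settled c α' ε w w.r n f := by
  refine ⟨by rw [tau_of_le w le_rfl]; simpa using h1, fun t => ?_⟩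
  rw [futV_of_le w le_rfl, show c.θ * (α' * t + ε * n) = c.θ * α' * t + c.θ * ε * n by ring]
  refine lt_of_eq_of_lt (tsum_congr fun l => ?_) (h2 t)
  rw [rootWeight, weight_root]

/-- At the root there is no good block to rely on. Instead the scale is chosen after the
realization, larger than its own random constants and such that the environment is not rough; almost
surely there are arbitrarily large such scales. -/
theorem Proper.ae_exists_first (hμ : IsWalkLaw μ) (hs : Scales a c α' ε β K κ B N A)
    (hp : 0 < c.p) (hα' : psi c.θ ≤ c.θ * α')
    (hrough : PolyBound μ (a + 2) fun u n => {g | Rough c β K κ B A u n g}) (hw : Proper c.θ w)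
    (hnice : ∀ᵐ f ∂μ, Nice c w f) : ∀ᵐ f ∂μ, ∃ v, First c w w.r v f := by
  obtain ⟨C, hC, hC'⟩ := hrough
  obtain ⟨n₀, hn₀⟩ := exists_scale (a := a) hs.θ_pos hp hs.ε_pos
  have h1 : ∀ᵐ f ∂μ, ∀ m : ℕ, ¬ ∀ n : ℕ, m ≤ n → Rough c β K κ B A w.r n f := by
    refine ae_all_iff.2 fun m => ?_
    rw [ae_iff]
    simp only [not_not]
    have hlim : Tendsto (fun n : ℕ => ENNReal.ofReal (C / (n : ℝ) ^ (a + 2))) atTop (𝓝 0) := by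
      rw [← ENNReal.ofReal_zero]
      exact ENNReal.tendsto_ofReal (Tendsto.div_atTop tendsto_const_nhds
        ((tendsto_pow_atTop (by omega)).comp tendsto_natCast_atTop_atTop))
    refine le_antisymm (ge_of_tendsto hlim ?_) zero_le
    filter_upwards [eventually_ge_atTop 1, eventually_ge_atTop m] with n hn hm
    exact (measure_mono (Set.ofPred_subset_ofPred.2 fun f hf => hf n hm)).trans (hC' w.r n hn)
  filter_upwards [h1, hnice, ae_root_bound hμ.mesh hα' hw.finite] with f hr hf ⟨n₁, hn₁⟩
  obtain ⟨n₂, hn₂⟩ := exists_nat_ge (tau w (w.r + bigM a) f).toReal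
  obtain ⟨n₃, hn₃⟩ := exists_nat_ge (n₁ / (c.θ * ε))
  obtain ⟨n, hn, hrn⟩ : ∃ n : ℕ, 1 + n₀ + n₂ + n₃ ≤ n ∧ ¬ Rough c β K κ B A w.r n f := by
    by_contra! hcon
    exact hr _ hcon
  obtain ⟨-, hn2⟩ := hn₀ n (by omega)
  have hset : Settled c α' ε w w.r n f := by
    refine settled_root (hn₂.trans (by exact_mod_cast (by omega : n₂ ≤ n))) fun t => ?_
    refine (hn₁ t).trans_le (ENNReal.ofReal_le_ofReal (Real.exp_le_exp.2 ?_))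
    have hθε := mul_pos hs.θ_pos hs.ε_pos
    rw [div_le_iff₀ hθε] at hn₃
    have : (n₃ : ℝ) ≤ n := by exact_mod_cast (by omega : n₃ ≤ n)
    nlinarith
  obtain ⟨v, hv, -⟩ := hf.exists_first hs le_rfl (by omega) hn2 hset hrn (x := w.r) (by
    have : (0 : ℤ) ≤ N * n := by positivity
    omega)
  exact ⟨v, hv⟩

theorem tau_le_of_ahead {α : ℝ} {u : ℤ} (hu : Fresh w u) {f : Real₀ a} (h : Ahead α u f) (n : ℕ) :
    tau w (u + n) f ≤ tau w u f + ENNReal.ofReal (n / α) :=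
  (tau_le_auxTime hu f n).trans (add_le_add le_rfl (h n))

/-- On the event that the auxiliary front is fast, the first good block is near the origin. -/
theorem IsWalkLaw.first_tail (hμ : IsWalkLaw μ) (hs : Scales a c α' ε β K κ B N A)
    (hp : 0 < c.p) (hα₂ : 0 < c.α₂) (hα' : psi c.θ ≤ c.θ * α')
    (hrough : PolyBound μ (a + 2) fun u n => {g | Rough c β K κ B A u n g}) (hw : Proper c.θ w)
    (hfresh : Fresh w w.r) (hnice : ∀ᵐ f ∂μ, Nice c w f) : ∃ C : ℝ, 0 ≤ C ∧ ∀ n : ℕ, 1 ≤ n →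
      μ {f | Ahead c.α₂ w.r f ∧ ¬ ∃ v ≤ w.r + reach a c A n, First c w w.r v f} ≤
        ENNReal.ofReal (C / n ^ (a + 2)) := by
  have := hμ.mesh.isProbabilityMeasure
  obtain ⟨C, hC, hC'⟩ := hrough
  obtain ⟨n₀, hn₀⟩ := exists_scale (a := a) hs.θ_pos hp hs.ε_pos
  obtain ⟨n₁, hn₁⟩ := exists_nat_ge (bigM a / c.α₂)
  set R := ∑' l, rootWeight c.θ w l with hR
  have hθε := mul_pos hs.θ_pos hs.ε_pos
  set D : ℝ := (a + 2).factorial / (c.θ * ε) ^ (a + 2) with hD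
  suffices h : ∀ n : ℕ, 1 ≤ n → n₀ + n₁ ≤ n →
      μ {f | Ahead c.α₂ w.r f ∧ ¬ ∃ v ≤ w.r + reach a c A n, First c w w.r v f} ≤
        ENNReal.ofReal ((C + D * R.toReal) / n ^ (a + 2)) by
    obtain ⟨C', h0, h'⟩ := exists_bound_of_le (ι := Unit) (s := a + 2) (n₀ := n₀ + n₁)
      (X := fun _ n => μ {f | Ahead c.α₂ w.r f ∧ ¬ ∃ v ≤ w.r + reach a c A n, First c w w.r v f})
      (fun _ _ => prob_le_one) fun _ => h
    exact ⟨C', h0, h' ()⟩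
  intro n hn hnn
  obtain ⟨-, hn2⟩ := hn₀ n (by omega)
  have h1 := hμ.mesh.exceed (rootWeight c.θ w) hα' (c.θ * ε * n)
  refine le_trans (measure_mono_ae ?_) ((measure_union_le _ _).trans ((add_le_add (hC' w.r n hn) h1).trans ?_))
  · filter_upwards [hnice] with f hf ⟨hah, hno⟩
    by_contra hcon
    obtain ⟨h2, h3⟩ := not_or.1 hcon
    simp only [Set.mem_ofPred_eq, not_exists, not_le] at h3
    refine hno ?_
    have hset : Settled c α' ε w w.r n f := by
      refine settled_root ?_ h3
      have h4 := tau_le_of_ahead hfresh hah (bigM a)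
      rw [tau_of_le w le_rfl, zero_add] at h4
      refine (ENNReal.toReal_le_of_le_ofReal (by positivity) h4).trans (hn₁.trans ?_)
      exact_mod_cast (by omega : n₁ ≤ n)
    obtain ⟨v, hv, hv'⟩ := hf.exists_first hs le_rfl hn hn2 hset h2 (x := w.r) (by
    have : (0 : ℤ) ≤ N * n := by positivity
    omega)
    exact ⟨v, by rw [reach]; push_cast; exact hv', hv⟩
  · rw [add_div, ENNReal.ofReal_add (by positivity) (by positivity)]
    refine add_le_add le_rfl ?_
    refine (mul_le_mul' (ENNReal.ofReal_le_ofReal (exp_neg_le_div_pow hθε (a + 2) hn))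
      (ENNReal.ofReal_toReal hw.finite.ne).ge).trans ?_
    rw [← ENNReal.ofReal_mul (by positivity), hD]
    exact ENNReal.ofReal_le_ofReal (le_of_eq (by ring))

/-- Take `K` of order `t ^ η` and `n` of order `t ^ (1 - η)`. Then `ρ ^ K` decays faster than any
power, and the loss in the exponent is `η * s ≤ e`. -/
theorem exists_rpow_bound {X : ℝ → ℝ≥0∞} (hX : ∀ t, X t ≤ 1) {D s : ℕ} (hD : 1 ≤ D) {C ρ : ℝ}
    (hC : 0 ≤ C) (hρ : 0 < ρ) (hρ1 : ρ < 1) (h : ∀ n K : ℕ, 1 ≤ n → ∀ t : ℝ, (D * n * (1 + K) : ℕ) ≤ t →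
      X t ≤ ENNReal.ofReal (C / n ^ s + ρ ^ K)) {e : ℝ} (he : 0 < e) :
    ∃ C' : ℝ, 0 < C' ∧ ∀ t : ℝ, 1 ≤ t → X t ≤ ENNReal.ofReal (C' * t ^ (-(s - e))) := by
  set η : ℝ := min (1 / 2) (e / (s + 1)) with hη
  have hη0 : 0 < η := by positivity
  have hη1 : η ≤ 1 / 2 := min_le_left _ _
  have hηs : η * s ≤ e := by
    have h1 : η * (s + 1) ≤ e := by
      rw [← le_div_iff₀ (by positivity)]
      exact min_le_right _ _
    nlinarith
  obtain ⟨m, hm⟩ := exists_nat_ge (s / η)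
  rw [div_le_iff₀ hη0] at hm
  set lam := -Real.log ρ with hlam
  have hlam0 : 0 < lam := by rw [hlam, neg_pos]; exact Real.log_neg hρ hρ1
  set C₁ : ℝ := C * (4 * D) ^ s with hC₁
  set C₂ : ℝ := Real.exp lam * (m.factorial / lam ^ m) with hC₂
  have hDR : (1 : ℝ) ≤ D := by exact_mod_cast hD
  refine ⟨(4 * D ^ 2) ^ s + C₁ + C₂, by positivity, fun t ht => ?_⟩
  have ht0 : 0 < t := by linarith
  have hpow : ∀ x : ℝ, t ^ (-(x : ℝ)) = 1 / t ^ x := fun x => by rw [Real.rpow_neg ht0.le, one_div]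
  rcases lt_or_ge (t ^ (1 - η)) (2 * D) with hs | hs
  · refine (hX t).trans ?_
    rw [← ENNReal.ofReal_one]
    refine ENNReal.ofReal_le_ofReal ?_
    have h1 : t ^ (1 / 2 : ℝ) ≤ 2 * D :=
      (Real.rpow_le_rpow_of_exponent_le ht (by linarith)).trans hs.le
    have h2 : t ≤ 4 * D ^ 2 := by
      have h3 : (t ^ (1 / 2 : ℝ)) ^ 2 = t := by
        rw [← Real.rpow_natCast, ← Real.rpow_mul ht0.le]; norm_num
      rw [← h3]
      calc (t ^ (1 / 2 : ℝ)) ^ 2 ≤ (2 * D : ℝ) ^ 2 := pow_le_pow_left₀ (by positivity) h1 2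
        _ = 4 * D ^ 2 := by ring
    rw [hpow, mul_one_div, le_div_iff₀ (by positivity), one_mul]
    calc t ^ ((s : ℝ) - e) ≤ t ^ (s : ℝ) := Real.rpow_le_rpow_of_exponent_le ht (by linarith)
      _ = t ^ s := Real.rpow_natCast t s
      _ ≤ (4 * D ^ 2) ^ s := pow_le_pow_left₀ ht0.le h2 s
      _ ≤ _ := by rw [add_assoc]; exact le_add_of_nonneg_right (by positivity)
  set n := ⌊t ^ (1 - η) / (2 * D)⌋₊ with hn
  set K := ⌊t ^ η⌋₊ with hK
  have hz : 1 ≤ t ^ (1 - η) / (2 * D) := by rwa [le_div_iff₀ (by positivity), one_mul]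
  have hn1 : 1 ≤ n := Nat.one_le_floor_iff _ |>.2 hz
  have hn2 : (n : ℝ) ≤ t ^ (1 - η) / (2 * D) := Nat.floor_le (by positivity)
  have hn3 : t ^ (1 - η) / (4 * D) ≤ n := by
    have h1 : t ^ (1 - η) / (2 * D) < n + 1 := Nat.lt_floor_add_one _
    have h2 : (1 : ℝ) ≤ n := by exact_mod_cast hn1
    have h3 : t ^ (1 - η) / (4 * D) = t ^ (1 - η) / (2 * D) / 2 := by ring
    linarith
  have hK1 : (K : ℝ) ≤ t ^ η := Nat.floor_le (by positivity)
  have hK2 : t ^ η < K + 1 := Nat.lt_floor_add_one _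
  have hη2 : 1 ≤ t ^ η := Real.one_le_rpow ht hη0.le
  refine (h n K hn1 t ?_).trans (ENNReal.ofReal_le_ofReal ?_)
  · push_cast
    calc (D : ℝ) * n * (1 + K) ≤ D * (t ^ (1 - η) / (2 * D)) * (2 * t ^ η) :=
          mul_le_mul (mul_le_mul_of_nonneg_left hn2 (by positivity)) (by linarith) (by positivity)
            (by positivity)
      _ = t ^ (1 - η) * t ^ η := by field_simp
      _ = t := by rw [← Real.rpow_add ht0]; simp
  · rw [add_assoc, add_mul, add_mul]
    have h0 : 0 ≤ (4 * D ^ 2 : ℝ) ^ s * t ^ (-(s - e)) := by positivity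
    have h1 : C / n ^ s ≤ C₁ * t ^ (-(s - e)) := by
      have h2 : (t ^ (1 - η) / (4 * D)) ^ s ≤ (n : ℝ) ^ s := pow_le_pow_left₀ (by positivity) hn3 s
      refine (div_le_div_of_nonneg_left hC (by positivity) h2).trans ?_
      rw [hC₁, div_pow, div_div_eq_mul_div, hpow, mul_one_div]
      refine div_le_div_of_nonneg_left (by positivity) (by positivity) ?_
      rw [← Real.rpow_natCast, ← Real.rpow_mul ht0.le]
      exact Real.rpow_le_rpow_of_exponent_le ht (by nlinarith)
    have h3 : ρ ^ K ≤ C₂ * t ^ (-(s - e)) := by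
      have h4 : ρ ^ K = Real.exp (-(lam * K)) := by
        rw [← Real.rpow_natCast, Real.rpow_def_of_pos hρ, hlam]; ring_nf
      have h5 : (lam * t ^ η) ^ m / m.factorial ≤ Real.exp (lam * t ^ η) :=
        Real.pow_div_factorial_le_exp _ (by positivity) m
      have h6 : Real.exp (-(lam * t ^ η)) ≤ m.factorial / (lam * t ^ η) ^ m := by
        rw [Real.exp_neg, ← one_div, div_le_div_iff₀ (Real.exp_pos _) (by positivity), one_mul]
        rwa [div_le_iff₀ (by positivity), mul_comm (Real.exp _)] at h5
      have h7 : Real.exp (-(lam * K)) ≤ Real.exp lam * Real.exp (-(lam * t ^ η)) := by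
        rw [← Real.exp_add]
        exact Real.exp_le_exp.2 (by nlinarith)
      rw [h4]
      refine h7.trans ?_
      rw [hC₂, mul_assoc]
      refine mul_le_mul_of_nonneg_left (h6.trans ?_) (Real.exp_pos _).le
      rw [mul_pow, ← div_div, hpow, mul_one_div]
      refine div_le_div_of_nonneg_left (by positivity) (by positivity) ?_
      rw [← Real.rpow_natCast, ← Real.rpow_mul ht0.le]
      exact Real.rpow_le_rpow_of_exponent_le ht (by nlinarith)
    linarith

end

/-! ### Back to the labelled process -/

section
variable {a : ℕ} {c : Params} {w : Config a} {f : Real₀ a}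

/-! ### The regeneration time in terms of sites -/

theorem passage_walks (w : Config a) (f : Real₀ a) (k : ℕ) :
    w.passage (walks f) k = tau w (w.r + k) f := by
  rw [tau, Config.T, show (w.r + (k : ℤ) - w.r).toNat = k by omega]

theorem front_eq {v : ℤ} {t : ℝ≥0} (hv : w.r ≤ v) (h1 : tau w v f ≤ t) (h2 : t < tau w (v + 1) f) :
    w.front (walks f) t = v := by
  have h : IsGreatest {k : ℕ | w.passage (walks f) k ≤ t} (v - w.r).toNat := by
    refine ⟨?_, fun k hk => ?_⟩
    · rw [Set.mem_ofPred_eq, passage_walks, show w.r + ((v - w.r).toNat : ℤ) = v by omega]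
      exact h1
    · rw [Set.mem_ofPred_eq, passage_walks] at hk
      by_contra hcon
      exact absurd (hk.trans_lt h2) (not_lt.2 (tau_mono w f (by omega)))
  rw [Config.front, h.csSup_eq]
  omega

variable {v : ℤ}

theorem coe_tau (hf : ∀ v, f ∈ Reg w v) (v : ℤ) : ((tau w v f).toNNReal : ℝ≥0∞) = tau w v f :=
  ENNReal.coe_toNNReal (Reg.tau_lt_top (hf v) le_rfl).ne

theorem front_tau (hf : ∀ v, f ∈ Reg w v) (hv : w.r ≤ v) :
    w.front (walks f) (tau w v f).toNNReal = v :=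
  front_eq hv (coe_tau hf v).ge ((coe_tau hf v).trans_lt (Reg.tau_lt_succ (hf (v + 1)) hv (lt_add_one v)))

theorem mem_labelsAt (hf : ∀ v, f ∈ Reg w v) {l : ℤ × Fin a} (hl : l.1 ≤ v) (t : ℝ≥0) :
    l ∈ w.labelsAt (walks f) ((tau w v f).toNNReal + t) ↔ l ∈ alive w v := by
  have h : w.T (walks f) l.1 ≤ ((tau w v f).toNNReal + t : ℝ≥0) := by
    rw [ENNReal.coe_add, coe_tau hf v]
    exact (tau_mono w f hl).trans le_self_add
  simp [Config.labelsAt, alive, -ENNReal.coe_add, h, hl]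

theorem posAt_eq (hf : ∀ v, f ∈ Reg w v) {l : ℤ × Fin a} (hl : l.1 ≤ v) (t : ℝ≥0) :
    w.posAt (walks f) l ((tau w v f).toNNReal + t) = place w v f l + futV w v f l t := by
  rw [place, futV_apply, start, age, Config.posAt]
  split_ifs with h
  · rw [tau_of_le w h, tsub_zero]
    simp only [walks]; ring
  · have h1 := tau_mono w f hl
    have h2 : (tau w v f - tau w l.1 f).toNNReal = (tau w v f).toNNReal - (tau w l.1 f).toNNReal :=
      ENNReal.toNNReal_sub (Reg.tau_lt_top (hf l.1) le_rfl).ne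
    have h3 : (tau w l.1 f).toNNReal ≤ (tau w v f).toNNReal :=
      ENNReal.toNNReal_mono (Reg.tau_lt_top (hf v) le_rfl).ne h1
    have h4 : (tau w v f).toNNReal + t - (w.T (walks f) l.1).toNNReal =
        (tau w v f).toNNReal - (tau w l.1 f).toNNReal + t := (tsub_add_eq_add_tsub h3).symm
    rw [h2, h4]
    simp only [walks]; ring

/-- The position of the front enters only through a common factor. The same factor appears in the
threshold of `W`, so the condition of `W` does not involve the motion of the front. -/
theorem expNorm_eq (hf : ∀ v, f ∈ Reg w v) (θ : ℝ) {z : ℤ} (hz : z ≤ v) (t : ℝ≥0) :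
    w.expNorm (walks f) θ z ((tau w v f).toNNReal + t) =
      (∑' l, weight θ w z v f l * ENNReal.ofReal (Real.exp (θ * futV w v f l t))) *
        ENNReal.ofReal (Real.exp (-(θ * ((w.front (walks f) ((tau w v f).toNNReal + t) - v : ℤ) : ℝ)))) := by
  set s := (tau w v f).toNNReal + t with hs
  rw [Config.expNorm]
  have h := tsum_subtype {l : ℤ × Fin a | l ∈ w.labelsAt (walks f) s ∧ l.1 ≤ z}
    (fun l => ENNReal.ofReal (Real.exp (θ * ((w.posAt (walks f) l s - w.front (walks f) s : ℤ) : ℝ))))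
  refine h.trans ?_
  rw [← ENNReal.tsum_mul_right]
  refine tsum_congr fun l => ?_
  rw [weight]
  by_cases hl : l.1 ≤ z
  · have h1 := mem_labelsAt hf (hl.trans hz) t
    by_cases h2 : l ∈ alive w v
    · rw [Set.indicator_of_mem (Set.mem_ofPred_eq ▸ ⟨h1.2 h2, hl⟩), if_pos ⟨hl, h2.2⟩, posAt_eq hf (hl.trans hz),
        ← ENNReal.ofReal_mul (Real.exp_pos _).le, ← ENNReal.ofReal_mul (by positivity), ← Real.exp_add,
        ← Real.exp_add]
      push_cast
      ring_nf
    · rw [Set.indicator_of_notMem fun h3 => h2 (h1.1 h3.1), if_neg fun h3 => h2 (alive_mono w hz h3),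
        zero_mul, zero_mul]
  · rw [Set.indicator_of_notMem fun h3 => hl h3.2, if_neg fun h3 => hl h3.1, zero_mul, zero_mul]

theorem goodBlock_iff (hf : ∀ v, f ∈ Reg w v) {x : ℤ} {j : ℕ} (hx : w.r ≤ x + j * c.L) :
    GoodBlock c w (walks f) x j ↔ Good c w (x + j * c.L) f := by
  set v := x + j * c.L with hv
  have hz : x + ((j : ℤ) - 1) * c.L = v - c.L := by rw [hv]; ring
  have h0 : (tau w v f).toNNReal = (tau w v f).toNNReal + 0 := (add_zero _).symm
  rw [GoodBlock, hz, ← hv]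
  change (tau w v f < ∞ ∧ w.expNorm (walks f) c.θ (v - c.L) (tau w v f).toNNReal ≤ _ ∧
    _ ≤ (w.blockCount (walks f) (v - c.L) v (tau w v f).toNNReal : ℝ)) ↔ _
  rw [Good, and_iff_right (Reg.tau_lt_top (hf v) le_rfl), h0, expNorm_eq hf c.θ (by omega) 0, ← h0, front_tau hf hx]
  refine and_congr (by simp) ?_
  set Q : Set (ℤ × Fin a) := {l ∈ w.labelsAt (walks f) (tau w v f).toNNReal |
    l.1 ∈ Set.Ioc (v - c.L) v ∧ w.posAt (walks f) l (tau w v f).toNNReal ∈ Set.Ioc (v - c.L) v} with hQ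
  have hfin : Q.Finite := (finite_window (v - c.L) v).subset fun l hl => ⟨hl.2.1.1.le, hl.2.1.2⟩
  have hmem : ∀ l, l ∈ Q ↔ l ∈ alive w v ∧ v - c.L < l.1 ∧ v - c.L < place w v f l ∧ place w v f l ≤ v := by
    intro l
    have key : l.1 ≤ v → (l ∈ w.labelsAt (walks f) (tau w v f).toNNReal ↔ l ∈ alive w v) ∧
        w.posAt (walks f) l (tau w v f).toNNReal = place w v f l := fun hl => by
      have h1 := mem_labelsAt hf hl 0
      have h2 := posAt_eq hf hl 0
      rw [add_zero] at h1 h2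
      exact ⟨h1, by simpa using h2⟩
    constructor
    · rintro ⟨h1, h2, h3⟩
      obtain ⟨k1, k2⟩ := key h2.2
      rw [k2] at h3
      exact ⟨k1.1 h1, h2.1, h3⟩
    · rintro ⟨h1, h2, h3⟩
      obtain ⟨k1, k2⟩ := key h1.1
      exact ⟨k1.2 h1, ⟨h2, h1.1⟩, by rw [k2]; exact h3⟩
  change _ ≤ (Q.ncard : ℝ) ↔ _
  constructor
  · intro h
    refine ⟨hfin.toFinset, by rwa [← Set.ncard_eq_toFinset_card Q hfin], fun l hl => ?_⟩
    exact (hmem l).1 (hfin.mem_toFinset.1 hl)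
  · rintro ⟨S, h1, h2⟩
    refine h1.trans ?_
    rw [Set.ncard_eq_toFinset_card Q hfin]
    exact_mod_cast Finset.card_le_card fun l hl => hfin.mem_toFinset.2 ((hmem l).2 (h2 l hl))

theorem blockTime_of_first (hf : ∀ v, f ∈ Reg w v) {x : ℤ} (hx : w.r ≤ x) (h : First c w x v f) :
    blockTime c w (walks f) x = tau w v f := by
  obtain ⟨j, h1, rfl, h2, h3⟩ := h
  have hg : ∀ i : ℕ, GoodBlock c w (walks f) x i ↔ Good c w (x + i * c.L) f := fun i =>
    goodBlock_iff hf (by have : (0 : ℤ) ≤ i * c.L := by positivity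
                         omega)
  have hj : blockIndex c w (walks f) x = j := by
    refine le_antisymm (iInf₂_le j ⟨h1, (hg j).2 h2⟩) (le_iInf₂ fun i hi => ?_)
    by_contra hcon
    exact h3 i hi.1 (by exact_mod_cast not_le.1 hcon) ((hg i).1 hi.2)
  rw [blockTime, hj, if_neg (ENat.natCast_ne_top j), ENat.toNat_natCast]
  rfl

/-- The realizations for which the description by sites is valid. -/
structure Typical (w : Config a) (f : Real₀ a) : Prop where
  reg : ∀ v, f ∈ Reg w v
  aux : ∀ u n, auxTime f u n ≠ ∞
  aux_tendsto : ∀ u, Tendsto (fun n : ℕ => (auxTime f u n).toReal) atTop atTop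

/-- At passage times each of the conditions of `U`, `V` and `W` becomes the corresponding cause of a
break, and the minimum of infima is the infimum over all causes. -/
theorem timeD_tau (hf : Typical w f) (hα : 0 ≤ c.α₂) (hv : w.r ≤ v) :
    timeD c w (walks f) (tau w v f).toNNReal = ⨅ (t : ℝ≥0) (_ : Broken c w v f t), (t : ℝ≥0∞) := by
  have hU : timeU c (walks f) v = ⨅ (t : ℝ≥0) (_ : SlowAux c v f t), (t : ℝ≥0∞) := by
    simp only [timeU, slowAux_iff hα (hf.aux v) (hf.aux_tendsto v)]
  have hV : timeV c w (walks f) (tau w v f).toNNReal =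
      ⨅ (t : ℝ≥0) (_ : FastBlock c w v f (futV w v f) t), (t : ℝ≥0∞) := by
    rw [timeV, front_tau hf.reg hv]
    refine iInf_congr fun t => iInf_congr_Prop (exists_congr fun l => ?_) fun _ => rfl
    constructor
    · rintro ⟨h1, h2, h3, h4⟩
      rw [posAt_eq hf.reg h3.le] at h4
      exact ⟨(mem_labelsAt hf.reg h3.le t).1 h1, h2, h3, h4⟩
    · rintro ⟨h1, h2, h3, h4⟩
      rw [← posAt_eq hf.reg h3.le] at h4
      exact ⟨(mem_labelsAt hf.reg h3.le t).2 h1, h2, h3, h4⟩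
  have hW : timeW c w (walks f) (tau w v f).toNNReal =
      ⨅ (t : ℝ≥0) (_ : FastBack c w v f (futV w v f) t), (t : ℝ≥0∞) := by
    rw [timeW, front_tau hf.reg hv]
    refine iInf_congr fun t => iInf_congr_Prop ?_ fun _ => rfl
    rw [expNorm_eq hf.reg c.θ (by omega), FastBack]
    set x := w.front (walks f) ((tau w v f).toNNReal + t) with hx
    rw [show c.θ * ((⌊c.α₁ * t⌋ - (x - v) : ℤ) : ℝ) = c.θ * ⌊c.α₁ * t⌋ + -(c.θ * ((x - v : ℤ) : ℝ)) by
      push_cast; ring, Real.exp_add, ENNReal.ofReal_mul (Real.exp_pos _).le]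
    exact ENNReal.mul_le_mul_iff_left (by simp [Real.exp_pos]) ENNReal.ofReal_ne_top
  rw [timeD, front_tau hf.reg hv, hU, hV, hW]
  simp only [Broken, iInf_or, iInf_inf_eq]

theorem breakTime_tau (hf : Typical w f) (hα : 0 ≤ c.α₂) (hv : w.r ≤ v) :
    breakTime c w (walks f) (tau w v f) =
      tau w v f + ⨅ (t : ℝ≥0) (_ : Broken c w v f t), (t : ℝ≥0∞) := by
  rw [breakTime, if_neg (Reg.tau_lt_top (hf.reg v) le_rfl).ne, timeD_tau hf hα hv]

theorem breakTime_eq_top_iff (hf : Typical w f) (hα : 0 ≤ c.α₂) (hv : w.r ≤ v) :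
    breakTime c w (walks f) (tau w v f) = ∞ ↔ ¬ ∃ t, Broken c w v f t := by
  rw [breakTime_tau hf hα hv, ENNReal.add_eq_top, or_iff_right (Reg.tau_lt_top (hf.reg v) le_rfl).ne]
  simp [iInf_eq_top]

/-- The site `x` in `Next` is the front at the infimum of the break times: some break occurs
strictly before the passage at `x + 1`, and none before that at `x`. -/
theorem timeS_of_trial (hf : Typical w f) (hα : 0 ≤ c.α₂) (hL : 1 ≤ c.L) {k : ℕ}
    (h : Trial c w k v f) : timeS c w (walks f) (k + 1) = tau w v f := by
  induction k generalizing v with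
  | zero => exact blockTime_of_first hf.reg le_rfl h
  | succ k ih =>
    obtain ⟨u, h1, x, hux, ⟨t, h2, h3⟩, h4, h5⟩ := h
    have hu := (h1.lt hL).le
    have hne : breakTime c w (walks f) (tau w u f) ≠ ∞ := fun he =>
      (breakTime_eq_top_iff hf hα hu).1 he ⟨t, h2⟩
    rw [timeS, ih h1, if_neg hne]
    refine (congrArg _ ?_).trans (blockTime_of_first hf.reg (hu.trans hux) h5)
    refine front_eq (hu.trans hux) ?_ ?_
    · rw [ENNReal.coe_toNNReal hne, breakTime_tau hf hα hu]
      simp only [ENNReal.add_iInf]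
      refine le_iInf₂ fun t' ht' => not_lt.1 fun hlt => h4 ⟨t', ht', hlt⟩
    · rw [ENNReal.coe_toNNReal hne, breakTime_tau hf hα hu]
      exact (add_le_add le_rfl (iInf₂_le t h2)).trans_lt h3

theorem kappa_of_regen (hf : Typical w f) (hα : 0 ≤ c.α₂) (hL : 1 ≤ c.L) (h : Regen c w v f) :
    kappa c w (walks f) = tau w v f := by
  obtain ⟨⟨k, hk⟩, hb⟩ := h
  have hS := timeS_of_trial hf hα hL hk
  have hmem : k + 1 ∈ regenIndices c w (walks f) := by
    refine ⟨by omega, ?_, ?_⟩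
    · rw [hS]
      exact Reg.tau_lt_top (hf.reg v) le_rfl
    · rw [hS]
      exact (breakTime_eq_top_iff hf hα (hk.lt hL).le).2 hb
  -- A later trial exists only because all trials before it were broken, so the index found is the
  -- least one.
  have hearlier : ∀ m k, Trial c w (k + m + 1) v f → ∃ u, Trial c w k u f ∧ ∃ t, Broken c w u f t := by
    intro m
    clear hk hb hS hmem
    induction m generalizing v with
    | zero =>
      rintro k ⟨u, h1, x, -, ⟨t, h2, -⟩, -⟩
      exact ⟨u, h1, t, h2⟩
    | succ m ih =>
      rintro k ⟨u, h1, -⟩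
      exact ih k h1
  have hmin : IsLeast (regenIndices c w (walks f)) (k + 1) := by
    refine ⟨hmem, fun i hi => ?_⟩
    by_contra hcon
    obtain ⟨h1, -, h3⟩ := hi
    obtain ⟨i, rfl⟩ : ∃ j, i = j + 1 := ⟨i - 1, by omega⟩
    obtain ⟨u, hu, hub⟩ := hearlier (k - i - 1) i (by rwa [show i + (k - i - 1) + 1 = k by omega])
    rw [timeS_of_trial hf hα hL hu, breakTime_eq_top_iff hf hα (hu.lt hL).le] at h3
    exact h3 hub
  rw [kappa, if_pos ⟨_, hmem⟩, hmin.csInf_eq, hS]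

theorem frontKappa_of_regen (hf : Typical w f) (hα : 0 ≤ c.α₂) (hL : 1 ≤ c.L) (h : Regen c w v f) :
    frontKappa c w (walks f) = v := by
  obtain ⟨⟨k, hk⟩, -⟩ := id h
  rw [frontKappa, kappa_of_regen hf hα hL h, front_tau hf.reg (hk.lt hL).le]

theorem timeU_eq_top_iff (hf : Typical w f) (hα : 0 < c.α₂) (u : ℤ) :
    timeU c (walks f) u = ∞ ↔ Ahead c.α₂ u f := by
  rw [← not_slowAux_iff hα]
  simp [timeU, iInf_eq_top, slowAux_iff hα.le (hf.aux u) (hf.aux_tendsto u)]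

end

/-! ### Choice of the scales, and the regeneration theorem -/

section
variable {a : ℕ} {μ : Measure (Real₀ a)} {c : Params}

/-! ### Choice of the scales -/

/-- By convexity `cosh θ - 1 ≤ θ sinh θ`, so `2 sinh 2θ` is an admissible slope for the exponent
`θ`. It plays the role of `α'` below `α₁`. -/
theorem psi_le_mul_sinh {θ : ℝ} (hθ : 0 ≤ θ) : psi θ ≤ θ * (2 * Real.sinh (2 * θ)) := by
  have h1 := Real.add_one_le_exp θ
  have h2 := Real.add_one_le_exp (-θ)
  have h3 : Real.exp θ * Real.exp (-θ) = 1 := by rw [← Real.exp_add]; simp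
  have h4 : Real.sinh θ ≤ Real.sinh (2 * θ) := Real.sinh_le_sinh.2 (by linarith)
  have h5 := mul_le_mul_of_nonneg_left h4 hθ
  have h6 : psi θ ≤ θ * (2 * Real.sinh θ) := by
    rw [psi, Real.cosh_eq, Real.sinh_eq]
    nlinarith [mul_le_mul_of_nonneg_left h2 (Real.exp_pos θ).le,
      mul_le_mul_of_nonneg_left h1 (Real.exp_pos (-θ)).le]
  linarith

theorem exists_small (a : ℕ) {θ K κ p : ℝ} (hθ : 0 < θ) (hκ : 0 < κ) (hp : 0 < p) : ∃ L₀ : ℕ, ∀ L : ℕ, L₀ ≤ L →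
    (L : ℝ) / 5 + K + 1 ≤ L / 2 ∧
    Real.exp (θ * K) * Real.exp (-(θ * κ * L)) * (a / (1 - Real.exp (-(θ * κ)))) ≤ p / 2 := by
  have h1 : Tendsto (fun L : ℕ => 3 / 10 * (L : ℝ)) atTop atTop :=
    tendsto_natCast_atTop_atTop.const_mul_atTop (by norm_num)
  have h2 : Tendsto (fun L : ℕ => Real.exp (θ * K) * Real.exp (-(θ * κ * L)) *
      (a / (1 - Real.exp (-(θ * κ))))) atTop (𝓝 (Real.exp (θ * K) * 0 * (a / (1 - Real.exp (-(θ * κ)))))) :=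
    ((Real.tendsto_exp_neg_atTop_nhds_zero.comp
      (tendsto_natCast_atTop_atTop.const_mul_atTop (mul_pos hθ hκ))).const_mul _).mul_const _
  rw [mul_zero, zero_mul] at h2
  obtain ⟨L₀, h⟩ := eventually_atTop.1 ((h1.eventually_ge_atTop (K + 1)).and
    (h2.eventually_le_const (by positivity : (0 : ℝ) < p / 2)))
  exact ⟨L₀, fun L hL => ⟨by linarith [(h L hL).1], (h L hL).2⟩⟩

/-- The constants are chosen in an order free of circularity: `κ` from the gap between `α₁` and the
speed, then `K` and `β`, then the threshold for `L`, and `B`, `N`, `A` independently of `L`. -/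
theorem IsWalkLaw.exists_scales (hμ : IsWalkLaw μ) (ha : 1 ≤ a) {θ α' α₁ α₂ p : ℝ} (hθ : 0 < θ)
    (hα' : psi θ ≤ θ * α') (hα'0 : 0 < α') (h1 : α' < α₁) (h12 : α₁ < α₂) (h2 : α₂ < (meanWait μ)⁻¹)
    (hp : 0 < p) : ∃ L₀ : ℕ, ∀ L : ℕ, L₀ ≤ L → ∃ (ε β K κ : ℝ) (B N A : ℕ),
      Scales a ⟨L, θ, α₁, α₂, p⟩ α' ε β K κ B N A ∧
      PolyBound μ (a + 2) fun u n => {g | Rough ⟨L, θ, α₁, α₂, p⟩ β K κ B A u n g} := by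
  have hα₁ : psi θ ≤ θ * α₁ := hα'.trans (mul_le_mul_of_nonneg_left h1.le hθ.le)
  have hα₁0 : 0 < α₁ := hα'0.trans h1
  have hm := hμ.meanWait_pos ha
  have hlt : α₁ * meanWait μ < 1 := by
    have := h12.trans h2
    rwa [← one_div, lt_div_iff₀ hm] at this
  -- So that `α₁ * meanWait μ = 1 - 4 * κ`, which leaves a mean gain of at least `2 * κ`.
  set κ := (1 - α₁ * meanWait μ) / 4 with hκ
  have hκ0 : 0 < κ := by rw [hκ]; linarith
  have hαm : 0 < α₁ * meanWait μ := mul_pos hα₁0 hm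
  obtain ⟨K, hK, hgain⟩ := hμ.exists_gain_mean ha hθ hα₁ hα₁0 hκ0 (by rw [hκ]; linarith)
  obtain ⟨β, hβ0, hβ, hβ'⟩ := hμ.mesh.exists_slackSum_le (a := a) hθ hα₁ (ε := 1 / 4) (by norm_num)
  obtain ⟨L₁, hL₁⟩ := hμ.exists_deficit_mean ha hθ hα₁ hα₁0 (lt_of_lt_of_le (by positivity) hgain)
    (η := κ / 4) (by positivity)
  obtain ⟨L₂, hL₂⟩ := exists_small a (K := K) hθ hκ0 hp
  obtain ⟨B, hB⟩ := exists_nat_gt (2 * (β + 1))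
  obtain ⟨N, hN⟩ := exists_nat_ge ((2 + α₁) / κ)
  obtain ⟨A, hA⟩ := exists_nat_ge (((B + N : ℕ) + 1 : ℝ) / (κ / 2))
  rw [div_le_iff₀' (by positivity)] at hN hA
  have hB1 : 1 ≤ B := by
    have : (0 : ℝ) < B := by linarith
    exact_mod_cast this
  have hA1 : 1 ≤ A := by
    have h3 : 0 < κ / 2 * A := lt_of_lt_of_le (by positivity) hA
    have : (0 : ℝ) < A := pos_of_mul_pos_right h3 (by positivity)
    exact_mod_cast this
  refine ⟨1 + L₁ + L₂, fun L hL => ⟨min 1 ((α₁ - α') / 2), β, K, κ, B, B + N, A, ?_, ?_⟩⟩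
  · have hε := min_le_right 1 ((α₁ - α') / 2)
    refine ⟨⟨hθ, hα₁0, hκ0, by rw [hκ]; linarith, hK, by simp only; omega, (hL₂ L (by omega)).1,
      (hL₂ L (by omega)).2⟩, lt_min one_pos (by linarith), min_le_left _ _, by simp only; linarith, hβ, hB,
      by omega, ?_, hA⟩
    push_cast
    have : 0 ≤ κ * B := by positivity
    linarith
  · exact hμ.rough_tail ha (by simp only; omega) hθ hα₁ hα₁0 (hα₁0.trans h12) h2
      (hα₁.trans (mul_le_mul_of_nonneg_left hβ hθ.le)) hβ' hB1 hA1 hκ0 hgain (hL₁ L (by omega))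

/-! ### The regeneration time of the process on the space of paths -/

theorem aDeltaZero_proper (ha : 1 ≤ a) (θ : ℝ) : Proper θ (Config.aDeltaZero a) := by
  refine ⟨?_, (0, ⟨0, ha⟩), rfl, rfl⟩
  rw [tsum_eq_sum (s := {(0 : ℤ)} ×ˢ (Finset.univ : Finset (Fin a))) fun l hl =>
    rootWeight_of_notMem θ fun h =>
      hl (Finset.mem_product.2 ⟨Finset.mem_singleton.2 h, Finset.mem_univ _⟩)]
  refine ENNReal.sum_lt_top.2 fun l hl => ?_
  have hl' : l ∈ (Config.aDeltaZero a).labels := Finset.mem_singleton.1 (Finset.mem_product.1 hl).1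
  rw [rootWeight_of_mem θ hl']
  exact ENNReal.ofReal_lt_top

theorem aDeltaZero_fresh (a : ℕ) : Fresh (Config.aDeltaZero a) 0 := by
  refine ⟨le_rfl, fun l hl => ⟨?_, ?_⟩⟩
  · rcases hl.eq_or_lt with h | h
    · exact Or.inl h.symm
    · exact Or.inr h
  · rw [start]
    split_ifs with h
    · exact le_antisymm hl h
    · rfl

/-- The regeneration theorem on the space of paths. -/
theorem IsWalkLaw.regeneration (hμ : IsWalkLaw μ) (ha : 1 ≤ a) {θ α' α₁ α₂ p : ℝ} (hθ : 0 < θ)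
    (hα' : psi θ ≤ θ * α') (hα'0 : 0 < α') (h1 : α' < α₁) (h12 : α₁ < α₂) (h2 : α₂ < (meanWait μ)⁻¹)
    (hp : 0 < p) (hpθ : p * Real.exp θ < 1) : ∃ L₀ : ℕ, ∀ L : ℕ, L₀ ≤ L → 1 ≤ L → bigM a ≤ a * L →
      (∀ w : Config a, Proper θ w → ∀ᵐ f ∂μ, ∃ v, Regen ⟨L, θ, α₁, α₂, p⟩ w v f) ∧
      ∀ b e : ℝ, 0 < b → 0 < e → ∃ C : ℝ, 0 < C ∧ ∀ t : ℝ, 1 ≤ t →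
        μ {f | Ahead α₂ 0 f ∧ ¬ ∃ v : ℤ, (v : ℝ) ≤ b * t ∧
          Regen ⟨L, θ, α₁, α₂, p⟩ (Config.aDeltaZero a) v f} ≤
            ENNReal.ofReal (C * t ^ (-(((a + 2 : ℕ) : ℝ) - e))) := by
  have := hμ.mesh.isProbabilityMeasure
  have hα₁ : psi θ ≤ θ * α₁ := hα'.trans (mul_le_mul_of_nonneg_left h1.le hθ.le)
  have hα₁0 : 0 < α₁ := hα'0.trans h1
  have hα₂0 : 0 < α₂ := hα₁0.trans h12
  obtain ⟨L₀, h⟩ := hμ.exists_scales ha hθ hα' hα'0 h1 h12 h2 hp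
  refine ⟨L₀, fun L hL hL1 haL => ?_⟩
  obtain ⟨ε, β, K, κ, B, N, A, hs, hrough⟩ := h L hL
  set c : Params := ⟨L, θ, α₁, α₂, p⟩ with hc
  obtain ⟨δ, hδ, hbr⟩ := hμ.exists_broken_le (c := c) ha hL1 hθ hα₁ hα₁0 hα₂0 h2 hpθ
  obtain ⟨C₁, hC₁, hgap⟩ := hμ.gap_tail hs hp hα' haL hrough
  have hq1 : 1 - δ < 1 := ENNReal.sub_lt_self ENNReal.one_ne_top one_ne_zero hδ.ne'
  have hnice : ∀ w : Config a, Proper θ w → ∀ᵐ f ∂μ, Nice c w f := fun w hw =>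
    Proper.ae_nice hμ ha hθ hα₁0 hα₁ hw
  refine ⟨fun w hw => ?_, fun b e hb he => ?_⟩
  · have hn := hnice w hw
    exact ae_exists_regen hq1 (hbr w (hn.mono fun f hf => hf.reg)) (by omega : a + 2 ≠ 0)
      (fun k u n => hgap w hn k u n) (hw.ae_exists_first hμ hs hp hα' hrough hn)
  · set w := Config.aDeltaZero a with hw
    have hwp : Proper θ w := aDeltaZero_proper ha θ
    have hn := hnice w hwp
    obtain ⟨C₂, hC₂, hfirst⟩ := hμ.first_tail hs hp hα₂0 hα' hrough hwp (aDeltaZero_fresh a) hn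
    set R := bigM a + L + A * L with hR
    -- A reach of `R * n` sites, repeated `1 + k` times, stays below `b * t` as soon as `D * n * (1
    -- + k) ≤ t`.
    obtain ⟨D, hD⟩ := exists_nat_ge (R / b)
    rw [div_le_iff₀ hb] at hD
    have hD1 : 1 ≤ D := by
      have hR0 : (0 : ℝ) < R := by exact_mod_cast (by omega : 0 < R)
      have : (0 : ℝ) < D := pos_of_mul_pos_left (hR0.trans_le hD) hb.le
      exact_mod_cast this
    set G := ((1 - (1 - δ))⁻¹).toReal with hG
    -- The maximum with `1 / 2` keeps the ratio positive, so that its logarithm can be taken later.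
    set ρ := max (1 - δ).toReal (1 / 2) with hρ
    have hρ1 : ρ < 1 := max_lt (by
      have := (ENNReal.toReal_lt_toReal hq1.ne_top ENNReal.one_ne_top).2 hq1
      simpa using this) (by norm_num)
    refine exists_rpow_bound (fun t => prob_le_one) hD1 (C := C₂ + C₁ * G) (ρ := ρ) (by positivity)
      (by positivity) hρ1 (fun n k hn1 t ht => ?_) he
    have hreach : ((reach a c A n * (1 + k) : ℕ) : ℝ) ≤ b * t := by
      have h3 : ((reach a c A n * (1 + k) : ℕ) : ℝ) = R * (n * (1 + k)) := by
        rw [reach]; push_cast [hR, hc]; ring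
      rw [h3]
      push_cast at ht
      calc (R : ℝ) * (n * (1 + k)) ≤ D * b * (n * (1 + k)) :=
            mul_le_mul_of_nonneg_right hD (by positivity)
        _ = b * (D * n * (1 + k)) := by ring
        _ ≤ _ := mul_le_mul_of_nonneg_left ht hb.le
    have h3 := measure_not_regen_le (hbr w (hn.mono fun f hf => hf.reg))
      (fun k u => hgap w hn k u n hn1) (w.r + reach a c A n) k
    refine (measure_mono ?_).trans ((measure_union_le _ _).trans ((add_le_add (hfirst n hn1) h3).trans ?_))
    · rintro f ⟨hah, hno⟩
      by_cases hf : ∃ v ≤ w.r + reach a c A n, First c w w.r v f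
      · refine Or.inr ⟨hf, fun ⟨v, hv, hv'⟩ => hno ⟨v, le_trans ?_ hreach, hv'⟩⟩
        have hv2 : v ≤ (reach a c A n * (1 + k) : ℕ) := by
          have hr : w.r = 0 := rfl
          rw [hr] at hv
          push_cast
          linarith
        exact_mod_cast hv2
      · exact Or.inl ⟨hah, hf⟩
    · have hGe : (1 - (1 - δ))⁻¹ = ENNReal.ofReal G :=
        (ENNReal.ofReal_toReal (ENNReal.inv_ne_top.2 (tsub_pos_of_lt hq1).ne')).symm
      have hqe : 1 - δ ≤ ENNReal.ofReal ρ := by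
        rw [← ENNReal.ofReal_toReal hq1.ne_top]
        exact ENNReal.ofReal_le_ofReal (le_max_left _ _)
      rw [hGe, ← ENNReal.ofReal_mul (by positivity), add_div, add_assoc,
        ENNReal.ofReal_add (by positivity) (by positivity), ENNReal.ofReal_add (by positivity) (by positivity)]
      refine add_le_add le_rfl (add_le_add (ENNReal.ofReal_le_ofReal (le_of_eq (by ring))) ?_)
      rw [ENNReal.ofReal_pow (by positivity)]
      exact pow_le_pow_left' hqe k

theorem Proper.ae_typical (hμ : IsWalkLaw μ) (ha : 1 ≤ a) {θ : ℝ} (hθ : 0 < θ) {w : Config a}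
    (hw : Proper θ w) : ∀ᵐ f ∂μ, Typical w f := by
  filter_upwards [hw.ae_reg hμ.mesh hθ, hμ.ae_auxTime_ne_top ha, hμ.ae_auxTime_tendsto ha] with f h1 h2 h3
  exact ⟨h1, h2, fun u => tendsto_auxTime_atTop (hμ.meanWait_pos ha) (h3 u)⟩

/-! ### Moments -/

/-- The layer-cake formula: `t * t ^ (-s)` is integrable at infinity because `2 < s`. -/
theorem memLp_two_of_tail {Ω : Type*} [MeasurableSpace Ω] {P : Measure Ω} [IsProbabilityMeasure P]
    {X : Ω → ℝ} (hX : AEMeasurable X P) (h0 : 0 ≤ᵐ[P] X) {C s : ℝ} (hs : 2 < s)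
    (h : ∀ t : ℝ, 1 ≤ t → P {ω | t < X ω} ≤ ENNReal.ofReal (C * t ^ (-s))) : MemLp X 2 P := by
  rw [memLp_two_iff_integrable_sq hX.aestronglyMeasurable]
  refine ⟨(hX.pow_const 2).aestronglyMeasurable, ?_⟩
  rw [hasFiniteIntegral_iff_ofReal (Eventually.of_forall fun ω => sq_nonneg (X ω))]
  have h1 := lintegral_rpow_eq_lintegral_meas_lt_mul P h0 hX (p := 2) two_pos
  simp only [Real.rpow_two] at h1
  rw [h1]
  refine ENNReal.mul_lt_top ENNReal.ofReal_lt_top ?_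
  rw [← Set.Ioc_union_Ioi_eq_Ioi zero_le_one, lintegral_union measurableSet_Ioi
    (Set.Ioc_disjoint_Ioi le_rfl)]
  refine ENNReal.add_lt_top.2 ⟨?_, ?_⟩
  · refine lt_of_le_of_lt (setLIntegral_mono measurable_const (g := fun _ => 1) fun t ht => ?_) (by simp)
    refine mul_le_one' prob_le_one ?_
    rw [ENNReal.ofReal_le_one]
    exact Real.rpow_le_one ht.1.le ht.2 (by norm_num)
  · have hi : IntegrableOn (fun t : ℝ => C * t ^ (1 - s)) (Set.Ioi 1) :=
      (integrableOn_Ioi_rpow_of_lt (by linarith) one_pos).const_mul C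
    refine lt_of_le_of_lt (setLIntegral_mono' measurableSet_Ioi fun t ht => ?_) hi.lintegral_lt_top
    have ht0 : (0 : ℝ) < t := one_pos.trans ht
    refine (mul_le_mul' (h t (le_of_lt ht)) le_rfl).trans (le_of_eq ?_)
    rw [← ENNReal.ofReal_mul' (by positivity), mul_assoc, ← Real.rpow_add ht0]
    norm_num
    ring_nf

/-- Almost surely there is a regeneration site, and on the countably many universally measurable
events that select it the variable is a measurable function of the paths. Nothing needs to be known
about the infima that define `κ`. -/
theorem aemeasurable_of_regen [IsFiniteMeasure μ] {E : Type*} [MeasurableSpace E]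
    [MeasurableSpace.CountablyGenerated E] {w : Config a} {X : Real₀ a → E} {x : ℤ → Real₀ a → E}
    (hx : ∀ v, Measurable (x v)) (h : ∀ᵐ f ∂μ, ∃ v, Regen c w v f)
    (h' : ∀ᵐ f ∂μ, ∀ v, Regen c w v f → X f = x v f) : AEMeasurable X μ := by
  refine NullMeasurable.aemeasurable fun S hS => ?_
  have h1 : ∀ v, UMeas {f | Regen c w v f} := fun v =>
    UMeas.setOf_and (UMeas.setOf_exists fun k => uMeas_trial c w k v) (UMeas.setOf_not (uMeas_broken c w v))
  have h2 : NullMeasurableSet (⋃ v, {f | Regen c w v f} ∩ x v ⁻¹' S) μ :=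
    UMeas.iUnion (fun v => (h1 v).inter (UMeas.of_measurableSet (hx v hS))) μ inferInstance
  refine h2.congr ?_
  filter_upwards [h, h'] with f ⟨v, hv⟩ h3
  refine propext ⟨fun h4 => ?_, fun h4 => ?_⟩
  · obtain ⟨v', h5, h6⟩ := Set.mem_iUnion.1 h4
    have h6' : x v' f ∈ S := h6
    rwa [← h3 v' h5] at h6'
  · refine Set.mem_iUnion.2 ⟨v, hv, ?_⟩
    have h4' : X f ∈ S := h4
    rwa [h3 v hv] at h4'

/-- The moments and the tail of the regeneration time. -/
theorem IsWalkLaw.kappa_moments (hμ : IsWalkLaw μ) (ha : 1 ≤ a) (hθ : 0 < c.θ) (hL : 1 ≤ c.L)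
    (hα : 0 < c.α₂) (hpos : 0 < μ {f | Ahead c.α₂ 0 f})
    (hreg : ∀ᵐ f ∂μ, ∃ v, Regen c (Config.aDeltaZero a) v f)
    (htail : ∀ b e : ℝ, 0 < b → 0 < e → ∃ C : ℝ, 0 < C ∧ ∀ t : ℝ, 1 ≤ t →
      μ {f | Ahead c.α₂ 0 f ∧ ¬ ∃ v : ℤ, (v : ℝ) ≤ b * t ∧ Regen c (Config.aDeltaZero a) v f} ≤
        ENNReal.ofReal (C * t ^ (-(((a + 2 : ℕ) : ℝ) - e)))) :
    MemLp (fun f => (kappa c (Config.aDeltaZero a) (walks f)).toReal) 2 (μ[|{f | Ahead c.α₂ 0 f}]) ∧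
    MemLp (fun f => (frontKappa c (Config.aDeltaZero a) (walks f) : ℝ)) 2 (μ[|{f | Ahead c.α₂ 0 f}]) ∧
    ∀ e : ℝ, 0 < e → ∃ C : ℝ, 0 < C ∧ ∀ t : ℝ, 1 ≤ t → (μ[|{f | Ahead c.α₂ 0 f}])
      {f | ENNReal.ofReal t < kappa c (Config.aDeltaZero a) (walks f)} ≤
        ENNReal.ofReal (C * t ^ (-(((a + 2 : ℕ) : ℝ) - e))) := by
  have := hμ.mesh.isProbabilityMeasure
  set w := Config.aDeltaZero a with hw
  set E : Set (Real₀ a) := {f | Ahead c.α₂ 0 f} with hE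
  have hEm : MeasurableSet E := labSigma_le _ _ (measurableSet_ahead c.α₂ 0)
  have hprob : IsProbabilityMeasure μ[|E] := cond_isProbabilityMeasure hpos.ne'
  have htyp : ∀ᵐ f ∂μ, Typical w f := (aDeltaZero_proper ha c.θ).ae_typical hμ ha hθ
  have hac : μ[|E] ≪ μ := cond_absolutelyContinuous
  have hκ : ∀ᵐ f ∂μ, ∀ v, Regen c w v f → kappa c w (walks f) = tau w v f ∧
      frontKappa c w (walks f) = v ∧ 0 < v := by
    filter_upwards [htyp] with f hf v hv
    obtain ⟨⟨k, hk⟩, -⟩ := id hv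
    exact ⟨kappa_of_regen hf hα.le hL hv, frontKappa_of_regen hf hα.le hL hv, hk.lt hL⟩
  -- On `U = ∞` the passage at `v` happens by time `v / c.α₂`. This converts tails and moments of
  -- the regeneration site into those of the time.
  have htau : ∀ f ∈ E, ∀ v : ℤ, 0 < v → tau w v f ≤ ENNReal.ofReal (v / c.α₂) := by
    intro f hf v hv
    lift v to ℕ using hv.le
    have h1 := tau_le_of_ahead (aDeltaZero_fresh a) hf v
    rwa [← hw, tau_of_le w (show (0 : ℤ) ≤ w.r from le_rfl), zero_add, zero_add] at h1
  have htail' : ∀ b e : ℝ, 0 < b → 0 < e → ∃ C : ℝ, 0 < C ∧ ∀ t : ℝ, 1 ≤ t → ∀ A : Set (Real₀ a),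
      (∀ᵐ f ∂μ, f ∈ E → f ∈ A → ¬ ∃ v : ℤ, (v : ℝ) ≤ b * t ∧ Regen c w v f) →
        (μ[|E]) A ≤ ENNReal.ofReal (C * t ^ (-(((a + 2 : ℕ) : ℝ) - e))) := by
    intro b e hb he
    obtain ⟨C, hC, h⟩ := htail b e hb he
    have hE0 : (μ E)⁻¹ ≠ ∞ := ENNReal.inv_ne_top.2 hpos.ne'
    have hE1 : 0 < (μ E)⁻¹.toReal :=
      ENNReal.toReal_pos (ENNReal.inv_ne_zero.2 (measure_ne_top _ _)) hE0
    refine ⟨(μ E)⁻¹.toReal * C, by positivity, fun t ht A hA => ?_⟩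
    rw [cond_apply hEm, mul_assoc, ENNReal.ofReal_mul hE1.le, ENNReal.ofReal_toReal hE0]
    refine mul_le_mul_right (le_trans (measure_mono_ae ?_) (h t ht)) _
    filter_upwards [hA] with f hf h1
    exact ⟨h1.1, hf h1.1 h1.2⟩
  have hfront : MemLp (fun f => (frontKappa c w (walks f) : ℝ)) 2 (μ[|E]) := by
    -- With `e = 1 / 2` the exponent is `a + 3 / 2`, which exceeds `2` because `1 ≤ a`.
    obtain ⟨C, hC, h⟩ := htail' 1 (1 / 2) one_pos (by norm_num)
    refine memLp_two_of_tail ?_ ?_ (C := C) (s := ((a + 2 : ℕ) : ℝ) - 1 / 2) ?_ fun t ht => h t ht _ ?_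
    · refine AEMeasurable.mono_ac ?_ hac
      refine aemeasurable_of_regen (x := fun v _ => (v : ℝ)) (fun v => measurable_const) hreg ?_
      filter_upwards [hκ] with f hf v hv
      rw [(hf v hv).2.1]
    · filter_upwards [hac.ae_le hκ, hac.ae_le hreg] with f hf ⟨v, hv⟩
      obtain ⟨-, h1, h2⟩ := hf v hv
      have h3 : (0 : ℝ) ≤ v := by exact_mod_cast h2.le
      simpa only [h1, Pi.zero_apply] using h3
    · have : (1 : ℝ) ≤ a := by exact_mod_cast ha
      push_cast
      linarith
    · filter_upwards [hκ] with f hf _ hlt ⟨v, hv1, hv2⟩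
      rw [(hf v hv2).2.1] at hlt
      linarith
  refine ⟨?_, hfront, fun e he => ?_⟩
  · refine MemLp.of_le_mul (c := 1 / c.α₂) hfront ?_ ?_
    · refine AEMeasurable.aestronglyMeasurable (AEMeasurable.mono_ac ?_ hac)
      refine aemeasurable_of_regen (x := fun v f => (tau w v f).toReal)
        (fun v => (measurable_tau w v).ennreal_toReal) hreg ?_
      filter_upwards [hκ] with f hf v hv
      rw [(hf v hv).1]
    · filter_upwards [hac.ae_le hκ, hac.ae_le hreg, ae_cond_mem hEm] with f hf ⟨v, hv⟩ hfE
      obtain ⟨h1, h2, h3⟩ := hf v hv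
      have hv0 : (0 : ℝ) < v := by exact_mod_cast h3
      rw [h1, h2, Real.norm_of_nonneg ENNReal.toReal_nonneg, Real.norm_of_nonneg hv0.le]
      refine (ENNReal.toReal_le_of_le_ofReal (by positivity) (htau f hfE v h3)).trans (le_of_eq ?_)
      ring
  · obtain ⟨C, hC, h⟩ := htail' c.α₂ e hα he
    refine ⟨C, hC, fun t ht => h t ht _ ?_⟩
    filter_upwards [hκ] with f hf hfE hlt ⟨v, hv1, hv2⟩
    obtain ⟨h1, -, h3⟩ := hf v hv2
    rw [h1] at hlt
    refine absurd (htau f hfE v h3) (not_le.2 (lt_of_le_of_lt (ENNReal.ofReal_le_ofReal ?_) hlt))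
    rw [div_le_iff₀ hα]
    linarith

/-! ### The law of the driving walks -/

variable {Ω : Type*} [MeasurableSpace Ω] {P : Measure Ω} [IsProbabilityMeasure P]
  {Y : ℤ × Fin a → ℝ≥0 → Ω → ℤ}

/-- The centered walks as a random element of the space of paths. -/
def IsWalkFamily.paths (hY : IsWalkFamily P Y) : Ω → Real₀ a :=
  ofFamily (cent Y) hY.isMeshFamily.step hY.isMeshFamily.zero

theorem IsWalkFamily.measurable_paths (hY : IsWalkFamily P Y) : Measurable hY.paths :=
  measurable_pathSpace hY.isMeshFamily.measurable

theorem IsWalkFamily.sample_eq (hY : IsWalkFamily P Y) (ω : Ω) : sample Y ω = walks (hY.paths ω) := by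
  funext l t
  change Y l t ω = l.1 + (Y l t ω - l.1)
  ring

theorem IsWalkFamily.isWalkLaw (hY : IsWalkFamily P Y) : IsWalkLaw (P.map hY.paths) := by
  refine ⟨hY.isMeshFamily.map, ?_⟩
  have hm := hY.measurable_paths
  have h1 : iIndepFun (fun l ω => hY.paths ω l) P := by
    have h2 : ∀ l, MeasurableSpace.comap (fun ω => hY.paths ω l) inferInstance ≤
        MeasurableSpace.comap (fun ω t => Y l t ω) MeasurableSpace.pi := by
      intro l
      rw [← measurable_iff_comap_le]
      refine measurable_stepPath fun t => ?_
      have h3 : Measurable[MeasurableSpace.comap (fun ω t => Y l t ω) MeasurableSpace.pi] fun ω => Y l t ω :=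
        (measurable_pi_apply t).comp (comap_measurable (fun ω t => Y l t ω))
      exact h3.sub_const l.1
    exact iIndep_of_iIndep_of_le hY.indep h2
  rw [iIndepFun_iff_measure_inter_preimage_eq_mul] at h1 ⊢
  intro S s hs
  rw [Measure.map_apply hm (Finset.measurableSet_biInter _ fun l hl => (measurable_pi_apply l) (hs l hl))]
  refine Eq.trans ?_ ((h1 S hs).trans (Finset.prod_congr rfl fun l hl => ?_))
  · congr 1
    ext ω; simp
  · rw [Measure.map_apply hm ((measurable_pi_apply l) (hs l hl))]
    rfl

end

end Combustion

end

/-! ### The main theorem -/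

open Combustion

theorem mainTheorem4 {Ω : Type*} [MeasurableSpace Ω] (P : Measure Ω) [IsProbabilityMeasure P]
    (a : ℕ) (ha : 1 ≤ a) (Y : ℤ × Fin a → ℝ≥0 → Ω → ℤ) (hY : Combustion.IsWalkFamily P Y) :
    ∃ α : ℝ, 0 < α ∧
      (∀ r : ℤ, ∀ᵐ ω ∂P, Tendsto
        (fun t : ℝ≥0 => (Combustion.auxFront (Combustion.sample Y ω) r t : ℝ) / t) atTop (𝓝 α)) ∧
      ∀ θ α₁ α₂ p : ℝ, 0 < 2 * Real.sinh (2 * θ) → 2 * Real.sinh (2 * θ) < α₁ → α₁ < α₂ → α₂ < α →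
        0 < p * Real.exp θ → p * Real.exp θ < 1 →
        ∃ L₀ : ℕ, ∀ L : ℕ, L₀ ≤ L → Combustion.bigM a ≤ a * L →
          ((a : ℝ) - 1) * Real.exp (-(L * θ)) < p →
          (∀ w : Combustion.Config a, w.Admissible θ → (∃ l ∈ w.labels, w.pos l = w.r) →
            ∀ᵐ ω ∂P, Combustion.kappa ⟨L, θ, α₁, α₂, p⟩ w (Combustion.sample Y ω) < ∞) ∧
          0 < P (Combustion.eventU ⟨L, θ, α₁, α₂, p⟩ Y) ∧
          MemLp (fun ω => (Combustion.kappa ⟨L, θ, α₁, α₂, p⟩ (Combustion.Config.aDeltaZero a)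
            (Combustion.sample Y ω)).toReal) 2 (P[|Combustion.eventU ⟨L, θ, α₁, α₂, p⟩ Y]) ∧
          MemLp (fun ω => (Combustion.frontKappa ⟨L, θ, α₁, α₂, p⟩ (Combustion.Config.aDeltaZero a)
            (Combustion.sample Y ω) : ℝ)) 2 (P[|Combustion.eventU ⟨L, θ, α₁, α₂, p⟩ Y]) ∧
          ∀ ε : ℝ, 0 < ε → ∃ C : ℝ, 0 < C ∧ ∀ t : ℝ, 1 ≤ t →
            P[|Combustion.eventU ⟨L, θ, α₁, α₂, p⟩ Y]
              {ω | ENNReal.ofReal t < Combustion.kappa ⟨L, θ, α₁, α₂, p⟩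
                (Combustion.Config.aDeltaZero a) (Combustion.sample Y ω)} ≤
              ENNReal.ofReal (C * t ^ (-((Combustion.bigM a : ℝ) / 4 - 3 - ε))) := by
  set φ := hY.paths with hφ
  have hm : Measurable φ := hY.measurable_paths
  have hμ := hY.isWalkLaw
  set μ := P.map φ with hμd
  have hprob := hμ.mesh.isProbabilityMeasure
  have hmean := hμ.meanWait_pos ha
  have hae : ∀ {q : Real₀ a → Prop}, (∀ᵐ f ∂μ, q f) → ∀ᵐ ω ∂P, q (φ ω) := fun h =>
    ae_of_ae_map hm.aemeasurable h
  refine ⟨(meanWait μ)⁻¹, inv_pos.2 hmean, fun r => ?_, ?_⟩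
  · filter_upwards [hae (hμ.ae_auxTime_ne_top ha), hae (hμ.ae_auxTime_tendsto ha)] with ω h1 h2
    rw [hY.sample_eq]
    exact tendsto_auxFront hmean (h1 r) (h2 r)
  intro θ α₁ α₂ p h0 h1 h12 h2 hp hpθ
  have hθ : 0 < θ := by
    have : 0 < Real.sinh (2 * θ) := by linarith
    rw [Real.sinh_pos_iff] at this
    linarith
  have hp0 : 0 < p := pos_of_mul_pos_left hp (Real.exp_pos θ).le
  have hα₂ : 0 < α₂ := h0.trans (h1.trans h12)
  obtain ⟨L₀, hreg⟩ := hμ.regeneration ha hθ (psi_le_mul_sinh hθ.le) h0 h1 h12 h2 hp0 hpθ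
  -- The added one guarantees blocks of positive length.
  refine ⟨L₀ + 1, fun L hL haL _ => ?_⟩
  obtain ⟨h3, h4⟩ := hreg L (by omega) (by omega) haL
  set c : Params := ⟨L, θ, α₁, α₂, p⟩ with hc
  have hL1 : 1 ≤ c.L := by rw [hc]; dsimp only; omega
  have hpos := hμ.ahead_pos ha hα₂ h2
  have hzero := aDeltaZero_proper ha θ
  obtain ⟨h5, h6, h7⟩ := hμ.kappa_moments (c := c) ha hθ hL1 hα₂ hpos (h3 _ hzero) h4
  set E : Set (Real₀ a) := {f | Ahead α₂ 0 f} with hE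
  have hEm : MeasurableSet E := labSigma_le _ _ (measurableSet_ahead α₂ 0)
  -- `eventU` is an intersection over uncountably many times; almost surely it coincides with a
  -- measurable event, so both condition in the same way.
  have hU : eventU c Y =ᵐ[P] φ ⁻¹' E := by
    filter_upwards [hae (hzero.ae_typical hμ ha hθ)] with ω hω
    refine propext ?_
    change timeU c (sample Y ω) 0 = ∞ ↔ Ahead α₂ 0 (φ ω)
    rw [hY.sample_eq]
    exact timeU_eq_top_iff hω hα₂ 0
  have hPU : P (eventU c Y) = μ E := by rw [measure_congr hU, hμd, Measure.map_apply hm hEm]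
  have hcond : (P[|eventU c Y]).map φ = μ[|E] := by
    rw [ProbabilityTheory.cond, ProbabilityTheory.cond, Measure.map_smul, hPU,
      Measure.restrict_congr_set hU, hμd, Measure.restrict_map hm hEm]
  have hsample : ∀ ω, sample Y ω = walks (φ ω) := hY.sample_eq
  simp only [hsample]
  refine ⟨fun w hw hfront => ?_, hPU ▸ hpos, ?_, ?_, fun ε hε => ?_⟩
  · have hwp : Proper θ w := ⟨hw.tsum_rootWeight, hfront⟩
    filter_upwards [hae (h3 w hwp), hae (hwp.ae_typical hμ ha hθ)] with ω ⟨v, hv⟩ hω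
    rw [kappa_of_regen hω hα₂.le hL1 hv]
    exact Reg.tau_lt_top (hω.reg v) le_rfl
  · rw [← hcond] at h5
    exact h5.comp_of_map hm.aemeasurable
  · rw [← hcond] at h6
    exact h6.comp_of_map hm.aemeasurable
  · obtain ⟨C, hC, h⟩ := h7 ε hε
    refine ⟨C, hC, fun t ht => ?_⟩
    have h8 := h t ht
    rw [← hcond] at h8
    -- The set of late regenerations need not be measurable; the inequality for images of measures
    -- holds without that. The exponents agree because `M / 4 - 3 = a + 2`.
    refine (Measure.le_map_apply hm.aemeasurable _).trans (h8.trans_eq ?_)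
    congr 4
    rw [bigM]
    push_cast
    ring
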